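/- **Setting.** Let $\mathfrak g=\bigoplus_{n\in\mathbb Z}\mathfrak g_n$ be a $\mathbb Z$-graded complex Lie algebra with $\dim\mathfrak g_n<\infty$ for all $n$, and put $\mathfrak g_+=\bigoplus_{n\ge 0}\mathfrak g_n$, $\mathfrak g_-=\bigoplus_{n<0}\mathfrak g_n$. Let $\gamma:\mathfrak g\to\mathbb C$ be a semi-infinite $1$-cochain, i.e. a linear map with $$\gamma([x,y])=\operatorname{tr}\big((\operatorname{ad}x)_{+-}(\operatorname{ad}y)_{-+}-(\operatorname{ad}y)_{+-}(\operatorname{ad}x)_{-+}\big)\qquad(x,y\in\mathfrak g),$$ where $(\operatorname{ad}x)_{\pm\mp}$ is the composition $\mathfrak g_\mp\xrightarrow{\operatorname{ad}x}\mathfrak g\to\mathfrak g_\pm$ (the second map being the projection), and assume $\gamma(\mathfrak g_n)=0$ for $n\neq 0$. Let $U,U_\pm$ be the enveloping algebras of $\mathfrak g,\mathfrak g_\pm$ with their induced gradings, and let $U_\pm^*$ be the graded duals. **The semi-regular bimodule.** Let $(x_i)$ be a basis of $\mathfrak g$ of homogeneous elements, $[x_i,x_j]=\sum_k c_{ij}^kx_k$.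 Let $\Lambda$ be the irreducible module over the Clifford algebra with generators $\psi_i,\psi_i^*$ and relations $\{\psi_i,\psi_j^*\}=\delta_{ij}$, $\{\psi_i,\psi_j\}=\{\psi_i^*,\psi_j^*\}=0$, generated by a vector $\mathbf 1$ with $\psi_i\mathbf 1=0$ if $\deg x_i<0$ and $\psi_i^*\mathbf 1=0$ if $\deg x_i\ge 0$ (semi-infinite forms for the opposite semi-infinite structure, in which $\mathfrak g_\pm$ is replaced by $\mathfrak g_\mp$ and $\gamma$ by $-\gamma$). It is graded by $\deg\mathbf 1=0$, $\deg\psi_i^*=1$, $\deg\psi_i=-1$. Let $U^*=U_+^*\otimes U_-^*$, embedded in $\operatorname{Hom}_{\mathbb C}(U,\mathbb C)$ by $(f_+\otimes f_-)(u_-u_+)=f_+(u_+)f_-(u_-)$. For $f\in\operatorname{Hom}_{\mathbb C}(U,\mathbb C)$, $X\in\mathfrak g$, put $(Xf)(u)=f(uX)$ and $(fX)(u)=f(Xu)$. Let $\mathfrak g$ act on $U^*\otimes U$ diagonally, $X(f\otimes u)=Xf\otimes u+f\otimes Xu$, and consider $$d=\sum_i x_i\otimes\psi_i^*-\tfrac12\sum_{i,j,k}c_{ij}^k:\!\psi_i^*(:\!\psi_j^*\psi_k\!:)\!:-\sum_i\gamma(x_i)\psi_i^*$$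 (normal ordering with respect to $\mathbf 1$) on the graded completion of $U^*\otimes U\otimes\Lambda$ in the direction of $U_-^*$ and of the $\psi_i^*$ with $x_i\in\mathfrak g_-$. That is, writing $\Lambda\cong\Lambda(\mathfrak g_-)^*\otimes\Lambda(\mathfrak g_+)$, the cochains are the finite sums of linear maps $U_-\otimes\Lambda^q(\mathfrak g_-)\to U_+^*\otimes U\otimes\Lambda^p(\mathfrak g_+)$ that are homogeneous for the $\mathbb Z$-gradings induced from $\mathfrak g$; such a map has cohomological degree $q-p$. (Without the completion the sum over the basis of $\mathfrak g_-$ in $d$ does not converge.) The semi-regular bimodule is $$S_{\mathfrak g}=H^{\frac\infty2+0}(\mathfrak g,U^*\otimes U),$$ the cohomology in degree $0$, with the left and right actions of $\mathfrak g$ induced by $X(f\otimes u)=-(fX)\otimes u$ and $(f\otimes u)X=f\otimes uX$. **The category.** Let $\tilde{\mathcal O}^{\mathfrak g}$ be the category of $\mathbb Z$-graded $\mathfrak g$-modules $M=\bigoplus_nM_n$ with $\dim M_n<\infty$ on which $\bigoplus_{j>0}\mathfrak g_j$ acts locally nilpotently (for every $m\in M$ there is $N$ such that $y_1\cdots y_r\,m=0$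 for all homogeneous $y_1,\dots,y_r$ of positive degrees with $\sum_a\deg y_a\ge N$) and $\mathfrak g_0$ acts locally finitely. **Proposition.** Let $M\in\tilde{\mathcal O}^{\mathfrak g}$. For $X\in\mathfrak g$, $s\in S_{\mathfrak g}$, $m\in M$ put $$\pi_1(X)(s\otimes m)=-(sX)\otimes m+s\otimes Xm,\qquad \pi_2(X)(s\otimes m)=(Xs)\otimes m,$$ $$\pi_1'(X)(s\otimes m)=-(sX)\otimes m,\qquad \pi_2'(X)(s\otimes m)=(Xs)\otimes m+s\otimes Xm.$$ Then the two $U$-bimodule structures $(\pi_1,\pi_2)$ and $(\pi_1',\pi_2')$ on $S_{\mathfrak g}\otimes_{\mathbb C}M$ are equivalent: there is a linear automorphism $\Phi$ of $S_{\mathfrak g}\otimes_{\mathbb C}M$ such that $\Phi\circ\pi_i'(X)=\pi_i(X)\circ\Phi$ for $i=1,2$ and all $X\in\mathfrak g$. -/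

import Mathlib

open scoped TensorProduct

set_option linter.unusedSectionVars false

noncomputable section

namespace SemiInfinite

universe u v w

/-! ## Semi-infinite structures -/

section Structure

variable {𝔤 : Type u} [LieRing 𝔤] [LieAlgebra ℂ 𝔤]

/-- For a `ℤ`-graded space `V = ⨁ Vₙ` and a predicate `p` on degrees, the projection of `V` onto
`⨁_{p n} Vₙ` along `⨁_{¬ p n} Vₙ`. -/
def degreeProj {V : Type u} [AddCommGroup V] [Module ℂ V] {gr : ℤ → Submodule ℂ V}
    (h : DirectSum.IsInternal gr) (p : ℤ → Prop) [DecidablePred p] : V →ₗ[ℂ] V :=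
  (DirectSum.coeLinearMap gr) ∘ₗ
    (DFinsupp.filterLinearMap ℂ (fun n => gr n) p) ∘ₗ
    (LinearEquiv.ofBijective (DirectSum.coeLinearMap gr) h).symm.toLinearMap

/-- The trace of an endomorphism of finite rank of a (possibly infinite-dimensional) space: the
trace of its restriction to its image. -/
def finiteRankTrace {V : Type u} [AddCommGroup V] [Module ℂ V] (T : V →ₗ[ℂ] V) : ℂ :=
  LinearMap.trace ℂ (LinearMap.range T) (T.rangeRestrict ∘ₗ (LinearMap.range T).subtype)

/-- The operator `(ad x)₊₋ (ad y)₋₊ - (ad y)₊₋ (ad x)₋₊` on `𝔤₊ = ⨁_{n ≥ 0} 𝔤ₙ`, extended by zero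
to `𝔤₋ = ⨁_{n < 0} 𝔤ₙ`. -/
def mixedOperator {gr : ℤ → Submodule ℂ 𝔤} (h : DirectSum.IsInternal gr) (x y : 𝔤) :
    𝔤 →ₗ[ℂ] 𝔤 :=
  let P := degreeProj h (fun n => 0 ≤ n)
  let Q := degreeProj h (fun n => n < 0)
  let A : 𝔤 → (𝔤 →ₗ[ℂ] 𝔤) := fun z => LieAlgebra.ad ℂ 𝔤 z
  P ∘ₗ A x ∘ₗ Q ∘ₗ A y ∘ₗ P - P ∘ₗ A y ∘ₗ Q ∘ₗ A x ∘ₗ P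

variable (𝔤) in
/-- A semi-infinite structure on a complex Lie algebra `𝔤`: a `ℤ`-grading with finite-dimensional
components, and a semi-infinite `1`-cochain `γ`. -/
structure SemiInfiniteStructure where
  gr : ℤ → Submodule ℂ 𝔤
  isInternal : DirectSum.IsInternal gr
  lie_mem : ∀ {i j : ℤ} {x y : 𝔤}, x ∈ gr i → y ∈ gr j → ⁅x, y⁆ ∈ gr (i + j)
  finiteDimensional : ∀ n, FiniteDimensional ℂ (gr n)
  γ : 𝔤 →ₗ[ℂ] ℂ
  γ_lie : ∀ x y : 𝔤, γ ⁅x, y⁆ = finiteRankTrace (mixedOperator isInternal x y)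

/-- The category `Õ`: the graded `𝔤`-modules `M = ⨁ Mₙ` with finite-dimensional components on which
`⨁_{j>0} 𝔤ⱼ` acts locally nilpotently (every vector is killed by all products of homogeneous
elements of positive degrees whose total degree is large) and `𝔤₀` acts locally finitely. -/
structure IsCategoryO (s : SemiInfiniteStructure 𝔤) {M : Type w} [AddCommGroup M] [Module ℂ M]
    [LieRingModule 𝔤 M] [LieModule ℂ 𝔤 M] (grM : ℤ → Submodule ℂ M) : Prop where
  isInternal : DirectSum.IsInternal grM
  lie_mem : ∀ {i n : ℤ} {x : 𝔤} {m : M}, x ∈ s.gr i → m ∈ grM n → ⁅x, m⁆ ∈ grM (i + n)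
  finiteDimensional : ∀ n, FiniteDimensional ℂ (grM n)
  locally_nilpotent : ∀ m : M, ∃ N : ℤ, ∀ l : List (ℤ × 𝔤),
    (∀ p ∈ l, 0 < p.1 ∧ p.2 ∈ s.gr p.1) → N ≤ (l.map Prod.fst).sum →
      l.foldr (fun p m' => ⁅p.2, m'⁆) m = 0
  locally_finite : ∀ m : M, ∃ W : Submodule ℂ M, FiniteDimensional ℂ W ∧ m ∈ W ∧
    ∀ x ∈ s.gr 0, ∀ m' ∈ W, ⁅x, m'⁆ ∈ W

/-- A basis `(xᵢ)` of `𝔤` consisting of homogeneous elements. -/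
structure HomogeneousBasis (s : SemiInfiniteStructure 𝔤) (ι : Type v) where
  basis : Module.Basis ι ℂ 𝔤
  deg : ι → ℤ
  mem : ∀ i, basis i ∈ s.gr (deg i)

namespace HomogeneousBasis

variable {s : SemiInfiniteStructure 𝔤} {ι : Type v}

/-- The structure constants: `[xᵢ, xⱼ] = ∑ₖ cᵢⱼᵏ xₖ`. -/
def sc (b : HomogeneousBasis s ι) (i j k : ι) : ℂ :=
  b.basis.repr ⁅b.basis i, b.basis j⁆ k

theorem coord_eq_zero (b : HomogeneousBasis s ι) {n : ℤ} {x : 𝔤} (hx : x ∈ s.gr n) {k : ι}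
    (hk : b.deg k ≠ n) : b.basis.repr x k = 0 := by
  classical
  -- group the expansion of `x` by degree
  let f : ι →₀ ℂ := b.basis.repr x
  have hsum : ∀ g : ι →₀ ℂ, ∀ m : ℤ, (∀ i ∈ g.support, b.deg i = m) →
      Finsupp.linearCombination ℂ b.basis g ∈ s.gr m := by
    intro g m hg
    rw [Finsupp.linearCombination_apply, Finsupp.sum]
    refine Submodule.sum_mem _ fun i hi => Submodule.smul_mem _ _ ?_
    rw [← hg i hi]; exact b.mem i
  let P : Submodule ℂ 𝔤 := ⨆ (j) (_ : j ≠ n), s.gr j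
  have h1 : Finsupp.linearCombination ℂ b.basis (f.filter fun i => b.deg i = n) ∈ s.gr n :=
    hsum _ _ fun i hi => by
      by_contra h; exact (Finsupp.mem_support_iff.1 hi) (Finsupp.filter_apply_neg _ _ h)
  have h2 : Finsupp.linearCombination ℂ b.basis (f.filter fun i => ¬ b.deg i = n) ∈ P := by
    rw [Finsupp.linearCombination_apply, Finsupp.sum]
    refine Submodule.sum_mem _ fun i hi => Submodule.smul_mem _ _ ?_
    have : b.deg i ≠ n := by
      intro h
      exact (Finsupp.mem_support_iff.1 hi) (Finsupp.filter_apply_neg _ _ (by simpa using h))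
    exact Submodule.mem_iSup_of_mem _ (Submodule.mem_iSup_of_mem this (b.mem i))
  have h3 : Finsupp.linearCombination ℂ b.basis (f.filter fun i => b.deg i = n) +
      Finsupp.linearCombination ℂ b.basis (f.filter fun i => ¬ b.deg i = n) = x := by
    rw [← map_add, Finsupp.filter_add_filter_not]
    exact b.basis.linearCombination_repr x
  have h4 : Finsupp.linearCombination ℂ b.basis (f.filter fun i => ¬ b.deg i = n) = 0 := by
    refine Submodule.disjoint_def.1 (s.isInternal.submodule_iSupIndep n) _ ?_ h2
    have := Submodule.sub_mem _ hx h1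
    rwa [← h3, add_sub_cancel_left] at this
  have h5 : f.filter (fun i => ¬ b.deg i = n) = 0 := by
    have := congrArg b.basis.repr h4
    simpa using this
  have := DFunLike.congr_fun h5 k
  rwa [Finsupp.filter_apply_pos (fun i => ¬ b.deg i = n) f hk] at this

theorem sc_ne_zero (b : HomogeneousBasis s ι) {i j k : ι} (h : b.sc i j k ≠ 0) :
    b.deg k = b.deg i + b.deg j := by
  by_contra hk
  exact h (b.coord_eq_zero (s.lie_mem (b.mem i) (b.mem j)) hk)

theorem finite_sc (b : HomogeneousBasis s ι) (i j : ι) : {k | b.sc i j k ≠ 0}.Finite := by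
  refine (Finset.finite_toSet (b.basis.repr ⁅b.basis i, b.basis j⁆).support).subset ?_
  intro k hk
  simpa [sc] using hk

theorem finite_deg (b : HomogeneousBasis s ι) (n : ℤ) : {i | b.deg i = n}.Finite := by
  have := s.finiteDimensional n
  let f : {i | b.deg i = n} → s.gr n := fun i => ⟨b.basis i, by
    have := b.mem i; rw [i.2] at this; exact this⟩
  have hf : LinearIndependent ℂ f := by
    refine LinearIndependent.of_comp (s.gr n).subtype ?_
    exact b.basis.linearIndependent.comp (fun i : {i | b.deg i = n} => (i : ι))
      Subtype.val_injective
  have := hf.finite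
  exact Set.toFinite _

theorem finite_deg_Icc (b : HomogeneousBasis s ι) (m n : ℤ) :
    {i | m ≤ b.deg i ∧ b.deg i ≤ n}.Finite := by
  have : {i | m ≤ b.deg i ∧ b.deg i ≤ n} = ⋃ k ∈ Set.Icc m n, {i | b.deg i = k} := by
    ext i; simp
  rw [this]
  exact (Set.finite_Icc m n).biUnion fun k _ => b.finite_deg k

end HomogeneousBasis

end Structure

/-! ## The space of semi-infinite forms

Let `pos` be the set of indices of the basis vectors of the "positive" half.  The semi-infinite
forms have the basis `e_K`, `K` a finite set of indices, where `e_K` is the ordered product of the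
creation operators `ψᵢ*` (`i ∈ K`, `pos i`) and `ψᵢ` (`i ∈ K`, `¬ pos i`) applied to the vacuum,
which is killed by `ψᵢ` for `pos i` and by `ψᵢ*` for `¬ pos i`.  A function `c : Finset ι → V`
stands for the (possibly infinite) sum `∑_K c(K) ⊗ e_K`. -/

section Clifford

variable {ι : Type v} [LinearOrder ι] {V : Type w} [AddCommGroup V] [Module ℂ V]

/-- The sign `(-1)^{#{k ∈ K, k < i}}`. -/
def sgn (i : ι) (K : Finset ι) : ℂ := (-1) ^ (K.filter (· < i)).card

/-- The operator `e_K ↦ ± e_{K ∪ {i}}` if `i ∉ K`, and `e_K ↦ 0` if `i ∈ K`. -/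
def creation (i : ι) : (Finset ι → V) →ₗ[ℂ] (Finset ι → V) where
  toFun c K := if i ∈ K then sgn i K • c (K.erase i) else 0
  map_add' c c' := by ext K; by_cases h : i ∈ K <;> simp [h]
  map_smul' a c := by ext K; by_cases h : i ∈ K <;> simp [h, smul_comm a]

/-- The operator `e_K ↦ ± e_{K ∖ {i}}` if `i ∈ K`, and `e_K ↦ 0` if `i ∉ K`. -/
def annihilation (i : ι) : (Finset ι → V) →ₗ[ℂ] (Finset ι → V) where
  toFun c K := if i ∈ K then 0 else sgn i K • c (insert i K)
  map_add' c c' := by ext K; by_cases h : i ∈ K <;> simp [h]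
  map_smul' a c := by ext K; by_cases h : i ∈ K <;> simp [h, smul_comm a]

variable (pos : ι → Prop) [DecidablePred pos]

/-- The Clifford generator `ψᵢ`. -/
def psi (i : ι) : (Finset ι → V) →ₗ[ℂ] (Finset ι → V) :=
  if pos i then annihilation i else creation i

/-- The Clifford generator `ψᵢ*`. -/
def psiStar (i : ι) : (Finset ι → V) →ₗ[ℂ] (Finset ι → V) :=
  if pos i then creation i else annihilation i

/-- The normally ordered product `:ψⱼ*ψₖ:`. -/
def normalQuadratic (j k : ι) : (Finset ι → V) →ₗ[ℂ] (Finset ι → V) :=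
  if pos j then psiStar pos j ∘ₗ psi pos k else -(psi pos k ∘ₗ psiStar pos j)

/-- The normally ordered product `:ψᵢ*(:ψⱼ*ψₖ:):`. -/
def normalCubic (i j k : ι) : (Finset ι → V) →ₗ[ℂ] (Finset ι → V) :=
  if pos i then psiStar pos i ∘ₗ normalQuadratic pos j k
  else normalQuadratic pos j k ∘ₗ psiStar pos i

/-- The part of `K` consisting of the indices of the created `ψᵢ*`. -/
def starPart (K : Finset ι) : Finset ι := K.filter fun i => pos i

/-- The part of `K` consisting of the indices of the created `ψᵢ`. -/
def psiPart (K : Finset ι) : Finset ι := K.filter fun i => ¬ pos i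

end Clifford

/-! ## The enveloping algebra -/

section Enveloping

variable {𝔤 : Type u} [LieRing 𝔤] [LieAlgebra ℂ 𝔤]

/-- The canonical map `𝔤 → U(𝔤)`. -/
abbrev toU (x : 𝔤) : UniversalEnvelopingAlgebra ℂ 𝔤 := UniversalEnvelopingAlgebra.ι ℂ x

/-- The degree `n` component of `U(𝔤)`, spanned by the products of homogeneous elements of total
degree `n`. -/
def grU (s : SemiInfiniteStructure 𝔤) (n : ℤ) : Submodule ℂ (UniversalEnvelopingAlgebra ℂ 𝔤) :=
  Submodule.span ℂ {u | ∃ l : List (ℤ × 𝔤), (∀ p ∈ l, p.2 ∈ s.gr p.1) ∧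
    (l.map Prod.fst).sum = n ∧ (l.map fun p => toU p.2).prod = u}

/-- `U₊`, the subalgebra of `U(𝔤)` generated by `𝔤₊ = ⨁_{n ≥ 0} 𝔤ₙ`. -/
def Uplus (s : SemiInfiniteStructure 𝔤) : Subalgebra ℂ (UniversalEnvelopingAlgebra ℂ 𝔤) :=
  Algebra.adjoin ℂ {u | ∃ n : ℤ, 0 ≤ n ∧ ∃ x ∈ s.gr n, toU x = u}

theorem toU_mul_mem (s : SemiInfiniteStructure 𝔤) {i n : ℤ} {x : 𝔤} (hx : x ∈ s.gr i)
    {y : UniversalEnvelopingAlgebra ℂ 𝔤} (hy : y ∈ grU s n) : toU x * y ∈ grU s (i + n) := by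
  induction hy using Submodule.span_induction with
  | mem y hy =>
    obtain ⟨l, h1, h2, rfl⟩ := hy
    refine Submodule.subset_span ⟨(i, x) :: l, ?_, by simp [h2], by simp⟩
    intro p hp
    rcases List.mem_cons.1 hp with rfl | hp
    · exact hx
    · exact h1 p hp
  | zero => simp
  | add y z _ _ h1 h2 => rw [mul_add]; exact add_mem h1 h2
  | smul a y _ h => rw [mul_smul_comm]; exact Submodule.smul_mem _ _ h

theorem mul_toU_mem (s : SemiInfiniteStructure 𝔤) {i n : ℤ} {x : 𝔤} (hx : x ∈ s.gr i)
    {y : UniversalEnvelopingAlgebra ℂ 𝔤} (hy : y ∈ grU s n) : y * toU x ∈ grU s (n + i) := by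
  induction hy using Submodule.span_induction with
  | mem y hy =>
    obtain ⟨l, h1, h2, rfl⟩ := hy
    refine Submodule.subset_span ⟨l ++ [(i, x)], ?_, by simp [h2], by simp⟩
    intro p hp
    rcases List.mem_append.1 hp with hp | hp
    · exact h1 p hp
    · simp only [List.mem_singleton] at hp; subst hp; exact hx
  | zero => simp
  | add y z _ _ h1 h2 => rw [add_mul]; exact add_mem h1 h2
  | smul a y _ h => rw [smul_mul_assoc]; exact Submodule.smul_mem _ _ h

end Enveloping

/-! ## The semi-regular bimodule -/

section Semiregular

variable {𝔤 : Type u} [LieRing 𝔤] [LieAlgebra ℂ 𝔤] {s : SemiInfiniteStructure 𝔤}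
  {ι : Type v} [LinearOrder ι]

/-- The positive half of the opposite semi-infinite structure is `𝔤₋`: its basis vectors are the
`xᵢ` with `deg xᵢ < 0`. -/
abbrev HomogeneousBasis.opp (b : HomogeneousBasis s ι) : ι → Prop := fun i => b.deg i < 0

variable (𝔤 ι) in
/-- Formal sums `∑_K c(K) ⊗ e_K` with `c(K) ∈ End(U)`.  Here `f ⊗ u ∈ U* ⊗ U` is identified with
the endomorphism `v ↦ f(v) u` of `U`. -/
abbrev FormalCochain : Type (max u v) :=
  Finset ι → Module.End ℂ (UniversalEnvelopingAlgebra ℂ 𝔤)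

instance : AddCommGroup (FormalCochain 𝔤 ι) := Pi.addCommGroup

/-- The formal sums lying in the completion `𝓗om(U₋ ⊗ Λ(𝔤₋), U₊* ⊗ U ⊗ Λ(𝔤₊))` of
`U* ⊗ U ⊗ Λ`, up to the conditions on degrees: for every `v ∈ U` and every fixed part `I` of `K`
lying in `𝔤₋`, the function `u ↦ ∑_{K ⊇ I} c(K)(v u) ⊗ e_{K ∖ I}` of `u ∈ U₊` belongs to
`U₊* ⊗ U ⊗ Λ(𝔤₊)`, where `U₊*` is the graded dual.  (No finiteness is imposed in the direction of
`U₋* ⊗ Λ(𝔤₋)*`: the term `∑ᵢ f ⊗ xᵢ u ⊗ ψᵢ*` of the differential, summed over a basis of `𝔤₋`, is an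
infinite sum which only makes sense in this completion.) -/
def tame (b : HomogeneousBasis s ι) : Submodule ℂ (FormalCochain 𝔤 ι) where
  carrier := {c |
    (∀ I v, {K | starPart b.opp K = I ∧ ∃ u ∈ Uplus s, c K (v * u) ≠ 0}.Finite) ∧
    (∀ K v, FiniteDimensional ℂ
      ((Subalgebra.toSubmodule (Uplus s)).map (c K ∘ₗ LinearMap.mulLeft ℂ v))) ∧
    (∀ K v, ∃ D : ℤ, ∀ n, D < n → ∀ u ∈ Uplus s, u ∈ grU s n → c K (v * u) = 0)}
  zero_mem' := by
    refine ⟨fun I v => ?_, fun K v => ?_, fun K v => ⟨0, by simp⟩⟩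
    · simp
    · have : (0 : FormalCochain 𝔤 ι) K ∘ₗ LinearMap.mulLeft ℂ v = 0 := by simp
      rw [this, Submodule.map_zero]
      infer_instance
  add_mem' := by
    rintro c c' ⟨h1, h2, h3⟩ ⟨h1', h2', h3'⟩
    refine ⟨fun I v => ?_, fun K v => ?_, fun K v => ?_⟩
    · refine ((h1 I v).union (h1' I v)).subset ?_
      rintro K ⟨hK, u, hu, hne⟩
      by_cases h : c K (v * u) = 0
      · refine Or.inr ⟨hK, u, hu, fun h' => hne ?_⟩
        simp [h, h']
      · exact Or.inl ⟨hK, u, hu, h⟩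
    · have := h2 K v
      have := h2' K v
      have hle : (Subalgebra.toSubmodule (Uplus s)).map
          ((c + c') K ∘ₗ LinearMap.mulLeft ℂ v) ≤
          (Subalgebra.toSubmodule (Uplus s)).map (c K ∘ₗ LinearMap.mulLeft ℂ v) ⊔
          (Subalgebra.toSubmodule (Uplus s)).map (c' K ∘ₗ LinearMap.mulLeft ℂ v) := by
        rintro _ ⟨u, hu, rfl⟩
        exact Submodule.add_mem_sup ⟨u, hu, rfl⟩ ⟨u, hu, rfl⟩
      exact Submodule.finiteDimensional_of_le hle
    · obtain ⟨D, hD⟩ := h3 K v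
      obtain ⟨D', hD'⟩ := h3' K v
      refine ⟨max D D', fun n hn u hu hu' => ?_⟩
      have e1 := hD n (lt_of_le_of_lt (le_max_left _ _) hn) u hu hu'
      have e2 := hD' n (lt_of_le_of_lt (le_max_right _ _) hn) u hu hu'
      simp [e1, e2]
  smul_mem' := by
    rintro a c ⟨h1, h2, h3⟩
    refine ⟨fun I v => ?_, fun K v => ?_, fun K v => ?_⟩
    · refine (h1 I v).subset ?_
      rintro K ⟨hK, u, hu, hne⟩
      refine ⟨hK, u, hu, fun h => hne ?_⟩
      simp [h]
    · have := h2 K v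
      have hle : (Subalgebra.toSubmodule (Uplus s)).map
          ((a • c) K ∘ₗ LinearMap.mulLeft ℂ v) ≤
          (Subalgebra.toSubmodule (Uplus s)).map (c K ∘ₗ LinearMap.mulLeft ℂ v) := by
        rintro _ ⟨u, hu, rfl⟩
        exact Submodule.smul_mem _ a ⟨u, hu, rfl⟩
      exact Submodule.finiteDimensional_of_le hle
    · obtain ⟨D, hD⟩ := h3 K v
      refine ⟨D, fun n hn u hu hu' => ?_⟩
      simp [hD n hn u hu hu']

/-- The formal sums that are homogeneous of internal degree `n` and involve only the `e_K` which
are products of `q` operators `ψ*` and `q - m` operators `ψ` (so have cohomological degree `m`). -/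
def homogeneous (b : HomogeneousBasis s ι) (m n : ℤ) (q : ℕ) :
    Submodule ℂ (FormalCochain 𝔤 ι) where
  carrier := {c | ∀ K,
    (¬ ((starPart b.opp K).card = q ∧ (q : ℤ) - (psiPart b.opp K).card = m) → c K = 0) ∧
    ∀ k, ∀ v ∈ grU s k, c K v ∈
      grU s (n + k + ∑ i ∈ starPart b.opp K, b.deg i - ∑ i ∈ psiPart b.opp K, b.deg i)}
  zero_mem' := fun K => ⟨fun _ => rfl, fun k v _ => by simp⟩
  add_mem' := fun {c c'} h h' K => ⟨fun hK => by simp [(h K).1 hK, (h' K).1 hK],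
    fun k v hv => Submodule.add_mem _ ((h K).2 k v hv) ((h' K).2 k v hv)⟩
  smul_mem' := fun a c h K => ⟨fun hK => by simp [(h K).1 hK],
    fun k v hv => Submodule.smul_mem _ a ((h K).2 k v hv)⟩

/-- The space of cochains of degree `m` of the (completed) semi-infinite complex with coefficients
in `U* ⊗ U` for the opposite semi-infinite structure. -/
def cochains (b : HomogeneousBasis s ι) (m : ℤ) : Submodule ℂ (FormalCochain 𝔤 ι) :=
  ⨆ (n : ℤ) (q : ℕ), tame b ⊓ homogeneous b m n q

/-- The diagonal left action of `x ∈ 𝔤`, `x (f ⊗ u) = x f ⊗ u + f ⊗ x u` with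
`(x f)(v) = f(v x)`. -/
def diagAct (x : 𝔤) (φ : Module.End ℂ (UniversalEnvelopingAlgebra ℂ 𝔤)) :
    Module.End ℂ (UniversalEnvelopingAlgebra ℂ 𝔤) :=
  φ ∘ₗ LinearMap.mulRight ℂ (toU x) + LinearMap.mulLeft ℂ (toU x) ∘ₗ φ

/-- The value at `v ∈ U` of the coefficient of `e_K` in `d c`, where
`d = ∑ᵢ xᵢ ⊗ ψᵢ* - ½ ∑ᵢⱼₖ cᵢⱼᵏ :ψᵢ*(:ψⱼ*ψₖ:): + ∑ᵢ γ'(xᵢ) ψᵢ*` is the differential for the opposite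
semi-infinite structure, with `γ' = -γ`.  All three sums are finite on cochains. -/
def dCoeff (b : HomogeneousBasis s ι) (c : FormalCochain 𝔤 ι) (K : Finset ι)
    (v : UniversalEnvelopingAlgebra ℂ 𝔤) : UniversalEnvelopingAlgebra ℂ 𝔤 :=
  ∑ᶠ i, diagAct (b.basis i) (psiStar b.opp i c K) v
    - (1 / 2 : ℂ) • ∑ᶠ t : ι × ι × ι,
        b.sc t.1 t.2.1 t.2.2 • normalCubic b.opp t.1 t.2.1 t.2.2 c K v
    + ∑ᶠ i, (-s.γ) (b.basis i) • psiStar b.opp i c K v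

theorem toU_mem_Uplus (b : HomogeneousBasis s ι) {i : ι} (hi : ¬ b.opp i) :
    toU (b.basis i) ∈ Uplus s :=
  Algebra.subset_adjoin ⟨b.deg i, not_lt.1 hi, _, b.mem i, rfl⟩

theorem creation_ne {c : FormalCochain 𝔤 ι} {i : ι} {K : Finset ι}
    {v : UniversalEnvelopingAlgebra ℂ 𝔤} (h : creation i c K v ≠ 0) :
    i ∈ K ∧ c (K.erase i) v ≠ 0 := by
  by_cases hi : i ∈ K
  · refine ⟨hi, fun h' => h ?_⟩
    simp [creation, hi, h']
  · exact absurd (by simp [creation, hi]) h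

theorem annihilation_ne {c : FormalCochain 𝔤 ι} {i : ι} {K : Finset ι}
    {v : UniversalEnvelopingAlgebra ℂ 𝔤} (h : annihilation i c K v ≠ 0) :
    c (insert i K) v ≠ 0 := by
  intro h'
  refine h ?_
  by_cases hi : i ∈ K <;> simp [annihilation, hi, h']

/-- The indices occurring in the `e_K` with nonzero coefficient. -/
def reach (b : HomogeneousBasis s ι) (c : FormalCochain 𝔤 ι) (L : Finset ι)
    (v : UniversalEnvelopingAlgebra ℂ 𝔤) : Set ι :=
  {i | ∃ K, starPart b.opp K = starPart b.opp L ∧ i ∈ K ∧ ∃ u ∈ Uplus s, c K (v * u) ≠ 0}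

theorem finite_reach (b : HomogeneousBasis s ι) {c : FormalCochain 𝔤 ι} (hc : c ∈ tame b)
    (L : Finset ι) (v : UniversalEnvelopingAlgebra ℂ 𝔤) : (reach b c L v).Finite := by
  refine ((hc.1 (starPart b.opp L) v).biUnion
    (t := fun K : Finset ι => (K : Set ι)) fun K _ => K.finite_toSet).subset ?_
  rintro i ⟨K, hK, hi, h⟩
  exact Set.mem_biUnion (show K ∈ {K | _} from ⟨hK, h⟩) hi

theorem starPart_insert (b : HomogeneousBasis s ι) {i : ι} (hi : ¬ b.opp i) (K : Finset ι) :
    starPart b.opp (insert i K) = starPart b.opp K := by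
  simp [starPart, Finset.filter_insert, not_lt.1 hi]

theorem psiStar_mem (b : HomogeneousBasis s ι) {c : FormalCochain 𝔤 ι} {i : ι} {K : Finset ι}
    {v u : UniversalEnvelopingAlgebra ℂ 𝔤} (hu : ¬ b.opp i → u ∈ Uplus s)
    (h : psiStar b.opp i c K (v * u) ≠ 0) : i ∈ (K : Set ι) ∪ reach b c K v := by
  by_cases hi : b.opp i
  · rw [psiStar, if_pos hi] at h
    exact Or.inl (creation_ne h).1
  · rw [psiStar, if_neg hi] at h
    exact Or.inr ⟨_, starPart_insert b hi K, Finset.mem_insert_self _ _, u, hu hi,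
      annihilation_ne h⟩

theorem psiStar_mem' (b : HomogeneousBasis s ι) {c : FormalCochain 𝔤 ι} {i : ι} {K : Finset ι}
    {v : UniversalEnvelopingAlgebra ℂ 𝔤} (h : psiStar b.opp i c K v ≠ 0) :
    i ∈ (K : Set ι) ∪ reach b c K v :=
  psiStar_mem b (u := 1) (fun _ => one_mem _) (by simpa using h)

theorem finite_linear (b : HomogeneousBasis s ι) {c : FormalCochain 𝔤 ι} (hc : c ∈ tame b)
    (K : Finset ι) (v : UniversalEnvelopingAlgebra ℂ 𝔤) :
    (Function.support fun i => diagAct (b.basis i) (psiStar b.opp i c K) v).Finite := by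
  refine (K.finite_toSet.union (finite_reach b hc K v)).subset fun i hi => ?_
  by_cases h : psiStar b.opp i c K v = 0
  · refine psiStar_mem b (u := toU (b.basis i)) (toU_mem_Uplus b) fun h' => hi ?_
    simp [diagAct, h, h', -UniversalEnvelopingAlgebra.ι_apply]
  · exact psiStar_mem' b h

theorem finite_gamma (b : HomogeneousBasis s ι) {c : FormalCochain 𝔤 ι} (hc : c ∈ tame b)
    (K : Finset ι) (v : UniversalEnvelopingAlgebra ℂ 𝔤) :
    (Function.support fun i => (-s.γ) (b.basis i) • psiStar b.opp i c K v).Finite := by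
  refine (K.finite_toSet.union (finite_reach b hc K v)).subset fun i hi => ?_
  refine psiStar_mem' b fun h => hi ?_
  simp [h]

theorem mixed_mem (b : HomogeneousBasis s ι) {c : FormalCochain 𝔤 ι} {i j k : ι} {K : Finset ι}
    {v : UniversalEnvelopingAlgebra ℂ 𝔤} (hi : b.opp i) (hj : ¬ b.opp j)
    (hd : b.deg k = b.deg i + b.deg j)
    (h : psiStar b.opp i (psi b.opp k (psiStar b.opp j c)) K v ≠ 0) :
    i ∈ K ∧ (b.deg j ≤ -b.deg i ∨ ∃ L ⊆ K, j ∈ reach b c L v) := by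
  rw [psiStar, if_pos hi] at h
  obtain ⟨hiK, h⟩ := creation_ne h
  refine ⟨hiK, ?_⟩
  by_cases hk : b.opp k
  · left
    have : b.deg k < 0 := hk
    linarith
  · right
    rw [psi, if_neg hk] at h
    obtain ⟨-, h⟩ := creation_ne h
    rw [psiStar, if_neg hj] at h
    refine ⟨(K.erase i).erase k, (Finset.erase_subset _ _).trans (Finset.erase_subset _ _), _,
      starPart_insert b hj _, Finset.mem_insert_self _ _, 1, one_mem _, ?_⟩
    simpa using annihilation_ne h

theorem finite_cubic (b : HomogeneousBasis s ι) {c : FormalCochain 𝔤 ι} (hc : c ∈ tame b)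
    (K : Finset ι) (v : UniversalEnvelopingAlgebra ℂ 𝔤) :
    (Function.support fun t : ι × ι × ι =>
      b.sc t.1 t.2.1 t.2.2 • normalCubic b.opp t.1 t.2.1 t.2.2 c K v).Finite := by
  let X : Set ι := (K : Set ι) ∪ (⋃ l ∈ K, {j | 0 ≤ b.deg j ∧ b.deg j ≤ -b.deg l}) ∪
    ⋃ L ∈ K.powerset, reach b c L v
  have hX : X.Finite := by
    refine (K.finite_toSet.union ?_).union ?_
    · exact K.finite_toSet.biUnion fun l _ => b.finite_deg_Icc _ _
    · exact (K.powerset.finite_toSet).biUnion fun L _ => finite_reach b hc L v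
  have hK : ∀ {i}, i ∈ K → i ∈ X := fun hi => Or.inl (Or.inl hi)
  have hR : ∀ {i L}, L ⊆ K → i ∈ reach b c L v → i ∈ X := fun hL hi =>
    Or.inr (Set.mem_biUnion (Finset.mem_coe.2 (Finset.mem_powerset.2 hL)) hi)
  have hD : ∀ {i l}, l ∈ K → 0 ≤ b.deg i → b.deg i ≤ -b.deg l → i ∈ X := fun hl h1 h2 =>
    Or.inl (Or.inr (Set.mem_biUnion (Finset.mem_coe.2 hl) ⟨h1, h2⟩))
  refine (hX.biUnion (t := fun i => ⋃ j ∈ X, (fun k => (i, j, k)) '' {k | b.sc i j k ≠ 0})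
    fun i _ => hX.biUnion fun j _ => (b.finite_sc i j).image _).subset ?_
  rintro ⟨i, j, k⟩ ht
  have hsc : b.sc i j k ≠ 0 := fun h => ht (by simp [h])
  have hne : normalCubic b.opp i j k c K v ≠ 0 := fun h => ht (by simp [h])
  have hd := b.sc_ne_zero hsc
  suffices h : i ∈ X ∧ j ∈ X from
    Set.mem_biUnion h.1 (Set.mem_biUnion h.2 ⟨k, hsc, rfl⟩)
  by_cases hi : b.opp i <;> by_cases hj : b.opp j
  · rw [normalCubic, if_pos hi, normalQuadratic, if_pos hj] at hne
    simp only [LinearMap.comp_apply] at hne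
    rw [psiStar, if_pos hi, psiStar, if_pos hj] at hne
    obtain ⟨h1, hne⟩ := creation_ne hne
    exact ⟨hK h1, hK (Finset.mem_of_mem_erase (creation_ne hne).1)⟩
  · rw [normalCubic, if_pos hi, normalQuadratic, if_neg hj] at hne
    have hne' : psiStar b.opp i (psi b.opp k (psiStar b.opp j c)) K v ≠ 0 := fun h => hne (by
      simp [h])
    obtain ⟨h1, h2⟩ := mixed_mem b hi hj hd hne'
    refine ⟨hK h1, ?_⟩
    rcases h2 with h2 | ⟨L, hL, h2⟩
    · exact hD h1 (not_lt.1 hj) h2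
    · exact hR hL h2
  · rw [normalCubic, if_neg hi, normalQuadratic, if_pos hj] at hne
    obtain ⟨h1, h2⟩ := mixed_mem b hj hi (hd.trans (add_comm _ _)) hne
    refine ⟨?_, hK h1⟩
    rcases h2 with h2 | ⟨L, hL, h2⟩
    · exact hD h1 (not_lt.1 hi) h2
    · exact hR hL h2
  · rw [normalCubic, if_neg hi, normalQuadratic, if_neg hj] at hne
    have hne' : psi b.opp k (psiStar b.opp j (psiStar b.opp i c)) K v ≠ 0 := fun h => hne (by
      simp [h])
    have hk : ¬ b.opp k := by
      have h1 : 0 ≤ b.deg i := not_lt.1 hi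
      have h2 : 0 ≤ b.deg j := not_lt.1 hj
      exact not_lt.2 (by linarith)
    rw [psi, if_neg hk] at hne'
    have h1 := (creation_ne hne').2
    rw [psiStar, if_neg hj] at h1
    have h2 := annihilation_ne h1
    rw [psiStar, if_neg hi] at h2
    have h3 := annihilation_ne h2
    have hs : starPart b.opp (insert i (insert j (K.erase k))) =
        starPart b.opp (K.erase k) := by
      rw [starPart_insert b hi, starPart_insert b hj]
    refine ⟨hR (Finset.erase_subset k K) ⟨_, hs, by simp, 1, one_mem _, by simpa using h3⟩,
      hR (Finset.erase_subset k K) ⟨_, hs, by simp, 1, one_mem _, by simpa using h3⟩⟩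

theorem cochains_le_tame (b : HomogeneousBasis s ι) (m : ℤ) : cochains b m ≤ tame b :=
  iSup_le fun _ => iSup_le fun _ => inf_le_left

theorem dCoeff_add (b : HomogeneousBasis s ι) {c c' : FormalCochain 𝔤 ι} (hc : c ∈ tame b)
    (hc' : c' ∈ tame b) (K : Finset ι) (v : UniversalEnvelopingAlgebra ℂ 𝔤) :
    dCoeff b (c + c') K v = dCoeff b c K v + dCoeff b c' K v := by
  have e1 := finsum_add_distrib (finite_linear b hc K v) (finite_linear b hc' K v)
  have e2 := finsum_add_distrib (finite_cubic b hc K v) (finite_cubic b hc' K v)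
  have e3 := finsum_add_distrib (finite_gamma b hc K v) (finite_gamma b hc' K v)
  have f1 : ∀ i, diagAct (b.basis i) (psiStar b.opp i (c + c') K) v =
      diagAct (b.basis i) (psiStar b.opp i c K) v +
      diagAct (b.basis i) (psiStar b.opp i c' K) v := by
    intro i; simp [diagAct, mul_add]; abel
  have f2 : ∀ t : ι × ι × ι, b.sc t.1 t.2.1 t.2.2 •
      normalCubic b.opp t.1 t.2.1 t.2.2 (c + c') K v =
      b.sc t.1 t.2.1 t.2.2 • normalCubic b.opp t.1 t.2.1 t.2.2 c K v +
      b.sc t.1 t.2.1 t.2.2 • normalCubic b.opp t.1 t.2.1 t.2.2 c' K v := by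
    intro t; simp
  have f3 : ∀ i, (-s.γ) (b.basis i) • psiStar b.opp i (c + c') K v =
      (-s.γ) (b.basis i) • psiStar b.opp i c K v +
      (-s.γ) (b.basis i) • psiStar b.opp i c' K v := by
    intro i; rw [map_add, Pi.add_apply, LinearMap.add_apply, smul_add]
  simp only [dCoeff, f1, f2, f3, e1, e2, e3, smul_add]
  abel

/-- The endomorphism `c(K) ↦ g ∘ c(K) ∘ r` of the space of formal sums. -/
def transform (r g : UniversalEnvelopingAlgebra ℂ 𝔤 →ₗ[ℂ] UniversalEnvelopingAlgebra ℂ 𝔤) :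
    FormalCochain 𝔤 ι →ₗ[ℂ] FormalCochain 𝔤 ι where
  toFun c K := g ∘ₗ c K ∘ₗ r
  map_add' c c' := by ext K v; simp
  map_smul' a c := by ext K v; simp

theorem dCoeff_transform (b : HomogeneousBasis s ι) {c : FormalCochain 𝔤 ι} (hc : c ∈ tame b)
    (r g : UniversalEnvelopingAlgebra ℂ 𝔤 →ₗ[ℂ] UniversalEnvelopingAlgebra ℂ 𝔤)
    (hr : ∀ v w, r (v * w) = r v * w) (hg : ∀ v w, g (v * w) = v * g w)
    (K : Finset ι) (v : UniversalEnvelopingAlgebra ℂ 𝔤) :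
    dCoeff b (transform r g c) K v = g (dCoeff b c K (r v)) := by
  change dCoeff b (fun L => g ∘ₗ c L ∘ₗ r) K v = g (dCoeff b c K (r v))
  have key : ∀ (i : ι) (c : FormalCochain 𝔤 ι),
      creation i (fun L => g ∘ₗ c L ∘ₗ r) = fun L => g ∘ₗ (creation i c L) ∘ₗ r := by
    intro i c; ext L v; by_cases h : i ∈ L <;> simp [creation, h]
  have key' : ∀ (i : ι) (c : FormalCochain 𝔤 ι),
      annihilation i (fun L => g ∘ₗ c L ∘ₗ r) = fun L => g ∘ₗ (annihilation i c L) ∘ₗ r := by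
    intro i c; ext L v; by_cases h : i ∈ L <;> simp [annihilation, h]
  have k1 : ∀ (i : ι) (c : FormalCochain 𝔤 ι),
      psiStar b.opp i (fun L => g ∘ₗ c L ∘ₗ r) =
        fun L => g ∘ₗ (psiStar b.opp i c L) ∘ₗ r := by
    intro i c; unfold psiStar; split_ifs
    · exact key i c
    · exact key' i c
  have k2 : ∀ (i : ι) (c : FormalCochain 𝔤 ι),
      psi b.opp i (fun L => g ∘ₗ c L ∘ₗ r) = fun L => g ∘ₗ (psi b.opp i c L) ∘ₗ r := by
    intro i c; unfold psi; split_ifs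
    · exact key' i c
    · exact key i c
  have k3 : ∀ (i j : ι) (c : FormalCochain 𝔤 ι),
      normalQuadratic b.opp i j (fun L => g ∘ₗ c L ∘ₗ r) =
        fun L => g ∘ₗ (normalQuadratic b.opp i j c L) ∘ₗ r := by
    intro i j c; unfold normalQuadratic; split_ifs
    · simp only [LinearMap.comp_apply, k1, k2]
    · ext L v; simp [k1, k2]
  have k4 : ∀ (i j k : ι) (c : FormalCochain 𝔤 ι),
      normalCubic b.opp i j k (fun L => g ∘ₗ c L ∘ₗ r) =
        fun L => g ∘ₗ (normalCubic b.opp i j k c L) ∘ₗ r := by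
    intro i j k c; unfold normalCubic; split_ifs <;> simp only [LinearMap.comp_apply, k1, k3]
  have hfin : ∀ {α : Type v} (f : α → UniversalEnvelopingAlgebra ℂ 𝔤),
      (Function.support f).Finite → g (∑ᶠ i, f i) = ∑ᶠ i, g (f i) := fun f hf =>
    AddMonoidHom.map_finsum g.toAddMonoidHom hf
  simp only [dCoeff, map_add, map_sub, map_smul]
  rw [hfin _ (finite_linear b hc K (r v)), hfin _ (finite_cubic b hc K (r v)),
    hfin _ (finite_gamma b hc K (r v))]
  simp only [k1, k4, diagAct, map_smul, LinearMap.comp_apply, LinearMap.add_apply, map_add,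
    LinearMap.mulRight_apply, LinearMap.mulLeft_apply, hr, hg]

theorem transform_tame (b : HomogeneousBasis s ι) {c : FormalCochain 𝔤 ι} (hc : c ∈ tame b)
    (r g : UniversalEnvelopingAlgebra ℂ 𝔤 →ₗ[ℂ] UniversalEnvelopingAlgebra ℂ 𝔤)
    (hr : ∀ v w, r (v * w) = r v * w) : transform r g c ∈ tame b := by
  obtain ⟨h1, h2, h3⟩ := hc
  refine ⟨fun I v => ?_, fun K v => ?_, fun K v => ?_⟩
  · refine (h1 I (r v)).subset ?_
    rintro K ⟨hK, u, hu, hne⟩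
    refine ⟨hK, u, hu, fun h => hne ?_⟩
    simp [transform, hr, h]
  · have := h2 K (r v)
    have e : transform r g c K ∘ₗ LinearMap.mulLeft ℂ v =
        g ∘ₗ (c K ∘ₗ LinearMap.mulLeft ℂ (r v)) := by
      ext u; simp [transform, hr]
    rw [e, Submodule.map_comp]
    infer_instance
  · obtain ⟨D, hD⟩ := h3 K (r v)
    refine ⟨D, fun n hn u hu hu' => ?_⟩
    simp [transform, hr, hD n hn u hu hu']

theorem transform_homogeneous (b : HomogeneousBasis s ι) {m n : ℤ} {q : ℕ}
    {c : FormalCochain 𝔤 ι} (hc : c ∈ homogeneous b m n q)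
    (r g : UniversalEnvelopingAlgebra ℂ 𝔤 →ₗ[ℂ] UniversalEnvelopingAlgebra ℂ 𝔤) {i j : ℤ}
    (hr : ∀ k, ∀ v ∈ grU s k, r v ∈ grU s (i + k))
    (hg : ∀ k, ∀ v ∈ grU s k, g v ∈ grU s (k + j)) :
    transform r g c ∈ homogeneous b m (n + (i + j)) q := by
  intro K
  refine ⟨fun h => ?_, fun k v hv => ?_⟩
  · have := (hc K).1 h
    ext v
    simp [transform, this]
  · have := hg _ _ ((hc K).2 _ _ (hr k v hv))
    have e : n + (i + k) + ∑ i ∈ starPart b.opp K, b.deg i - ∑ i ∈ psiPart b.opp K, b.deg i + j =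
        n + (i + j) + k + ∑ i ∈ starPart b.opp K, b.deg i - ∑ i ∈ psiPart b.opp K, b.deg i := by
      ring
    rwa [e] at this

theorem transform_cochains (b : HomogeneousBasis s ι) {m : ℤ}
    (r g : UniversalEnvelopingAlgebra ℂ 𝔤 →ₗ[ℂ] UniversalEnvelopingAlgebra ℂ 𝔤) {i j : ℤ}
    (hm : ∀ v w, r (v * w) = r v * w)
    (hr : ∀ k, ∀ v ∈ grU s k, r v ∈ grU s (i + k))
    (hg : ∀ k, ∀ v ∈ grU s k, g v ∈ grU s (k + j)) :
    ∀ c ∈ cochains b m, transform r g c ∈ cochains b m := by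
  suffices h : cochains b m ≤ (cochains b m).comap (transform r g) from fun c hc => h hc
  refine iSup_le fun n => iSup_le fun q => fun c hc => ?_
  exact Submodule.mem_iSup_of_mem (n + (i + j)) (Submodule.mem_iSup_of_mem q
    ⟨transform_tame b hc.1 r g hm, transform_homogeneous b hc.2 r g hr hg⟩)

/-- The action `x (f ⊗ u) = -(f x) ⊗ u` on coefficients, where `(f x)(v) = f(x v)`. -/
def leftFormal (x : 𝔤) : FormalCochain 𝔤 ι →ₗ[ℂ] FormalCochain 𝔤 ι :=
  transform (LinearMap.mulLeft ℂ (toU x)) (-LinearMap.id)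

/-- The action `(f ⊗ u) x = f ⊗ u x` on coefficients. -/
def rightFormal (x : 𝔤) : FormalCochain 𝔤 ι →ₗ[ℂ] FormalCochain 𝔤 ι :=
  transform LinearMap.id (LinearMap.mulRight ℂ (toU x))

/-- A property of `x ∈ 𝔤` that is linear in `x` holds if it holds for homogeneous `x`. -/
theorem forall_of_homogeneous (P : Submodule ℂ 𝔤) (h : ∀ i, s.gr i ≤ P) (x : 𝔤) : x ∈ P := by
  have : (⊤ : Submodule ℂ 𝔤) ≤ P := by
    rw [← s.isInternal.submodule_iSup_eq_top]
    exact iSup_le h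
  exact this trivial

theorem leftFormal_cochains (b : HomogeneousBasis s ι) {m : ℤ} (x : 𝔤) :
    ∀ c ∈ cochains b m, leftFormal x c ∈ cochains b m := by
  let P : Submodule ℂ 𝔤 :=
    { carrier := {x | ∀ c ∈ cochains b m, leftFormal x c ∈ cochains b m}
      zero_mem' := fun c _ => by
        have : leftFormal (0 : 𝔤) c = 0 := by
          ext K v
          simp [leftFormal, transform]
        rw [this]; exact zero_mem _
      add_mem' := fun {x y} hx hy c hc => by
        have : leftFormal (x + y) c = leftFormal x c + leftFormal y c := by
          ext K v
          simp [leftFormal, transform, add_mul, add_comm]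
        rw [this]; exact add_mem (hx c hc) (hy c hc)
      smul_mem' := fun a x hx c hc => by
        have : leftFormal (a • x) c = a • leftFormal x c := by
          ext K v
          simp [leftFormal, transform]
        rw [this]; exact Submodule.smul_mem _ _ (hx c hc) }
  refine forall_of_homogeneous (s := s) P (fun i x hx => ?_) x
  refine transform_cochains b _ _ (i := i) (j := 0) (fun v w => ?_) (fun k v hv => ?_)
    (fun k v hv => ?_)
  · simp [mul_assoc]
  · exact toU_mul_mem s hx hv
  · simpa using hv

theorem rightFormal_cochains (b : HomogeneousBasis s ι) {m : ℤ} (x : 𝔤) :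
    ∀ c ∈ cochains b m, rightFormal x c ∈ cochains b m := by
  let P : Submodule ℂ 𝔤 :=
    { carrier := {x | ∀ c ∈ cochains b m, rightFormal x c ∈ cochains b m}
      zero_mem' := fun c _ => by
        have : rightFormal (0 : 𝔤) c = 0 := by
          ext K v
          simp [rightFormal, transform]
        rw [this]; exact zero_mem _
      add_mem' := fun {x y} hx hy c hc => by
        have : rightFormal (x + y) c = rightFormal x c + rightFormal y c := by
          ext K v
          simp [rightFormal, transform, mul_add]
        rw [this]; exact add_mem (hx c hc) (hy c hc)
      smul_mem' := fun a x hx c hc => by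
        have : rightFormal (a • x) c = a • rightFormal x c := by
          ext K v
          simp [rightFormal, transform]
        rw [this]; exact Submodule.smul_mem _ _ (hx c hc) }
  refine forall_of_homogeneous (s := s) P (fun i x hx => ?_) x
  refine transform_cochains b _ _ (i := 0) (j := i) (fun v w => ?_) (fun k v hv => ?_)
    (fun k v hv => ?_)
  · simp
  · simpa using hv
  · exact mul_toU_mem s hx hv

theorem dCoeff_leftFormal (b : HomogeneousBasis s ι) {c : FormalCochain 𝔤 ι} (hc : c ∈ tame b)
    (x : 𝔤) (K : Finset ι) (v : UniversalEnvelopingAlgebra ℂ 𝔤) :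
    dCoeff b (leftFormal x c) K v = -dCoeff b c K (toU x * v) :=
  dCoeff_transform b hc _ _ (fun v w => by simp [mul_assoc]) (fun v w => by simp) K v

theorem dCoeff_rightFormal (b : HomogeneousBasis s ι) {c : FormalCochain 𝔤 ι} (hc : c ∈ tame b)
    (x : 𝔤) (K : Finset ι) (v : UniversalEnvelopingAlgebra ℂ 𝔤) :
    dCoeff b (rightFormal x c) K v = dCoeff b c K v * toU x :=
  dCoeff_transform b hc _ _ (fun v w => by simp) (fun v w => by simp [mul_assoc]) K v

theorem dCoeff_smul (b : HomogeneousBasis s ι) {c : FormalCochain 𝔤 ι} (hc : c ∈ tame b)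
    (a : ℂ) (K : Finset ι) (v : UniversalEnvelopingAlgebra ℂ 𝔤) :
    dCoeff b (a • c) K v = a • dCoeff b c K v := by
  have h := dCoeff_transform b hc LinearMap.id (a • LinearMap.id) (fun v w => by simp)
    (fun v w => by simp) K v
  have e : transform LinearMap.id (a • LinearMap.id) c = a • c := by
    ext K v; simp [transform]
  rw [e] at h
  simpa using h

theorem dCoeff_zero (b : HomogeneousBasis s ι) (K : Finset ι)
    (v : UniversalEnvelopingAlgebra ℂ 𝔤) : dCoeff b 0 K v = 0 := by
  simpa using dCoeff_smul b (zero_mem (tame b)) 0 K v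

/-- The cocycles of degree `m`. -/
def cocycles (b : HomogeneousBasis s ι) (m : ℤ) : Submodule ℂ (FormalCochain 𝔤 ι) where
  carrier := {c | c ∈ cochains b m ∧ ∀ K v, dCoeff b c K v = 0}
  zero_mem' := ⟨zero_mem _, dCoeff_zero b⟩
  add_mem' := fun {c c'} h h' => ⟨add_mem h.1 h'.1, fun K v => by
    rw [dCoeff_add b (cochains_le_tame b m h.1) (cochains_le_tame b m h'.1), h.2, h'.2, add_zero]⟩
  smul_mem' := fun a c h => ⟨Submodule.smul_mem _ a h.1, fun K v => by
    rw [dCoeff_smul b (cochains_le_tame b m h.1), h.2, smul_zero]⟩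

/-- The coboundaries of degree `m`. -/
def coboundaries (b : HomogeneousBasis s ι) (m : ℤ) : Submodule ℂ (FormalCochain 𝔤 ι) where
  carrier := {c | ∃ a ∈ cochains b (m - 1), ∀ K v, c K v = dCoeff b a K v}
  zero_mem' := ⟨0, zero_mem _, fun K v => (dCoeff_zero b K v).symm⟩
  add_mem' := by
    rintro c c' ⟨a, ha, h⟩ ⟨a', ha', h'⟩
    refine ⟨a + a', add_mem ha ha', fun K v => ?_⟩
    rw [dCoeff_add b (cochains_le_tame b _ ha) (cochains_le_tame b _ ha'), ← h, ← h']
    rfl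
  smul_mem' := by
    rintro z c ⟨a, ha, h⟩
    refine ⟨z • a, Submodule.smul_mem _ z ha, fun K v => ?_⟩
    rw [dCoeff_smul b (cochains_le_tame b _ ha), ← h]
    rfl

/-- The coboundaries of degree `m`, as a subspace of the cocycles. -/
def coboundariesIn (b : HomogeneousBasis s ι) (m : ℤ) : Submodule ℂ (cocycles b m) :=
  (coboundaries b m).comap (cocycles b m).subtype

/-- The semi-infinite cohomology `H^{∞/2 + m}(𝔤, U* ⊗ U)` for the opposite semi-infinite
structure. -/
abbrev Cohomology (b : HomogeneousBasis s ι) (m : ℤ) : Type (max u v) :=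
  cocycles b m ⧸ coboundariesIn b m

/-- The semi-regular bimodule `S_𝔤 = H^{∞/2 + 0}(𝔤, U* ⊗ U)`. -/
abbrev SemiRegular (b : HomogeneousBasis s ι) : Type (max u v) := Cohomology b 0

theorem leftFormal_cocycles (b : HomogeneousBasis s ι) {m : ℤ} (x : 𝔤) :
    ∀ c ∈ cocycles b m, leftFormal x c ∈ cocycles b m := fun c hc =>
  ⟨leftFormal_cochains b x c hc.1, fun K v => by
    rw [dCoeff_leftFormal b (cochains_le_tame b m hc.1), hc.2, neg_zero]⟩

theorem rightFormal_cocycles (b : HomogeneousBasis s ι) {m : ℤ} (x : 𝔤) :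
    ∀ c ∈ cocycles b m, rightFormal x c ∈ cocycles b m := fun c hc =>
  ⟨rightFormal_cochains b x c hc.1, fun K v => by
    rw [dCoeff_rightFormal b (cochains_le_tame b m hc.1), hc.2, zero_mul]⟩

/-- The left action `t ↦ x t` of `x ∈ 𝔤` on `S_𝔤`, induced by `x (f ⊗ u) = -(f x) ⊗ u`. -/
def leftAct (b : HomogeneousBasis s ι) (x : 𝔤) : Module.End ℂ (SemiRegular b) :=
  (coboundariesIn b 0).mapQ (coboundariesIn b 0)
    ((leftFormal x).restrict (leftFormal_cocycles b x)) (by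
      rintro ⟨c, hc⟩ ⟨a, ha, h⟩
      refine ⟨leftFormal x a, leftFormal_cochains b x a ha, fun K v => ?_⟩
      rw [dCoeff_leftFormal b (cochains_le_tame b _ ha), ← h]
      simp [leftFormal, transform])

/-- The right action `t ↦ t x` of `x ∈ 𝔤` on `S_𝔤`, induced by `(f ⊗ u) x = f ⊗ u x`. -/
def rightAct (b : HomogeneousBasis s ι) (x : 𝔤) : Module.End ℂ (SemiRegular b) :=
  (coboundariesIn b 0).mapQ (coboundariesIn b 0)
    ((rightFormal x).restrict (rightFormal_cocycles b x)) (by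
      rintro ⟨c, hc⟩ ⟨a, ha, h⟩
      refine ⟨rightFormal x a, rightFormal_cochains b x a ha, fun K v => ?_⟩
      rw [dCoeff_rightFormal b (cochains_le_tame b _ ha), ← h]
      simp [rightFormal, transform])

end Semiregular

/-! ## The four actions on `S_𝔤 ⊗ M` -/

section Actions

variable {𝔤 : Type u} [LieRing 𝔤] [LieAlgebra ℂ 𝔤] {s : SemiInfiniteStructure 𝔤}
  {ι : Type v} [LinearOrder ι] (b : HomogeneousBasis s ι)
  (M : Type w) [AddCommGroup M] [Module ℂ M] [LieRingModule 𝔤 M] [LieModule ℂ 𝔤 M]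

/-- `π₁(x)(t ⊗ m) = -(t x) ⊗ m + t ⊗ x m`. -/
def pi₁ (x : 𝔤) : Module.End ℂ (SemiRegular b ⊗[ℂ] M) :=
  -(rightAct b x).rTensor M + (LieModule.toEnd ℂ 𝔤 M x).lTensor (SemiRegular b)

/-- `π₂(x)(t ⊗ m) = (x t) ⊗ m`. -/
def pi₂ (x : 𝔤) : Module.End ℂ (SemiRegular b ⊗[ℂ] M) :=
  (leftAct b x).rTensor M

/-- `π₁'(x)(t ⊗ m) = -(t x) ⊗ m`. -/
def pi₁' (x : 𝔤) : Module.End ℂ (SemiRegular b ⊗[ℂ] M) :=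
  -(rightAct b x).rTensor M

/-- `π₂'(x)(t ⊗ m) = (x t) ⊗ m + t ⊗ x m`. -/
def pi₂' (x : 𝔤) : Module.End ℂ (SemiRegular b ⊗[ℂ] M) :=
  (leftAct b x).rTensor M + (LieModule.toEnd ℂ 𝔤 M x).lTensor (SemiRegular b)

end Actions

end SemiInfinite

/-!
The idea is to replace `S_𝔤 ⊗ M`, where `S_𝔤` is the semi-regular bimodule, by the cohomology of a
complex with coefficients in `U* ⊗ (U ⊗ M)`, and to write down an automorphism of that complex.

A cochain with coefficients in `U* ⊗ Y`, for a `U`-module `Y`, is a formal sum `∑_K c(K) ⊗ e_K`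
with `c(K) ∈ Hom(U, Y)`, subject to a finiteness condition on each `v U₊`; such formal sums are
called tame (`Tame`). An element `x` acts on `Hom(U, Y)` by `ρ_x F = F(· x) + x F(·)`, and the
differential `dd` is built from `ρ`, `γ` and the operators `ψᵢ`, `ψᵢ*` as an infinite sum which is
locally finite. Cartan's formula `dd_ps` gives the action `L_x` on cochains. That `L` is a
representation (`Lop_lie`) is the defining property of `γ`, and `dd² = 0` follows (`dd_dd`). All
these identities are checked by commuting both sides with the `ψᵢ` (`eq_zero_of_comm_ps`). When `Y`
is `U`, the complex is the one which defines `S_𝔤` (`dCoeff_eq`, `semiRegularEquiv`).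

For `Y = U ⊗ M` there is a natural map from `S_𝔤 ⊗ M` to the cohomology. It is injective, as one
sees by taking coordinates in `M`. For the surjectivity, a cocycle has to be approximated by
finitely many of its coordinates. By the Poincaré–Birkhoff–Witt theorem, `U` is a free left
`U₊`-module on the ordered monomials in a basis of `𝔤₋`, and the complex has the Koszul homotopy
`h = ∑ ∂_a ⊗ ψ_a`, where `a` runs through that basis and `∂_a` is the partial derivative on ordered
monomials. The operator `d h + h d` multiplies the leading term of a cochain by its total degree in
`U₋* ⊗ Λ(𝔤₋)*` (`laplace_apply`). So a homogeneous cocycle whose component over `∅ ⊆ 𝔤₋` vanishes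
on `U₊` is a coboundary (`exists_primitive`). By tameness, this component takes values in a
finite-dimensional subspace of `U ⊗ M`, hence only involves finitely many coordinates in `M`
(`exists_sum_em`).

On `Hom(U, U ⊗ M)` the automorphism is the composition of two Hopf-algebraic maps. With `S` the
antipode and Sweedler's notation for the coproduct, the first one is the twist
`F ↦ (v ↦ ∑ S(v₁) F(v₂))`, where `U` acts on the factor `M`; it turns `ρ_x` into `ρ_x` plus
the action of `x` on `M`.
The second one is the composition with the shear `u ⊗ m ↦ ∑ u₁ ⊗ S(u₂) m`, which turns the diagonal
action of `x` on `U ⊗ M` into left multiplication on `U`. Together they commute with `ρ_x` and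
therefore with the differential (`isCoeffMap_exchange`), while they carry `π₁'` and `π₂'` into `π₁`
and `π₂` (`exchange_rgt`, `exchange_lam`). The twist has to preserve tameness (`twist_bdd`). This
holds because every finite-dimensional subspace of a module in the category lies in a
finite-dimensional subspace with a finite filtration on which elements of `𝔤₊` of degree `d` act
with degree `d` (`locFilt_mTL`).
-/

attribute [-simp] UniversalEnvelopingAlgebra.ι_apply

section

attribute [local instance 100] LieRing.ofAssociativeRing LieAlgebra.toModule

/-! ### The Poincaré–Birkhoff–Witt theorem: linear independence -/

namespace PBW

open Finsupp

variable {κ R L : Type*} [LinearOrder κ] [CommRing R] [LieRing L] [LieAlgebra R L]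
  (B : Module.Basis κ R L)

/-- One step of the recursion for the action of `x_i` on the ordered monomial with letters `l`:
`z_i z_j z_T` is rewritten as `z_j z_i z_T + [x_i, x_j] z_T` when `j < i`, where `A` is the action
on shorter monomials. -/
def stepFun (A : κ → Module.End R (Multiset κ →₀ R)) (i : κ) : List κ → (Multiset κ →₀ R)
  | [] => single {i} 1
  | j :: T => if i ≤ j then single (i ::ₘ j ::ₘ (T : Multiset κ)) 1 else
      single (i ::ₘ j ::ₘ (T : Multiset κ)) 1
        + A j (A i (single (T : Multiset κ) 1) - single (i ::ₘ (T : Multiset κ)) 1)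
        + B.constr R A ⁅B i, B j⁆ (single (T : Multiset κ) 1)

/-- The action of the basis vectors on monomials of length at most `n` (with irrelevant values on
longer ones). -/
def preAct : ℕ → κ → Module.End R (Multiset κ →₀ R)
  | 0, i => linearCombination R fun S => single (i ::ₘ S) 1
  | n + 1, i => linearCombination R fun S => stepFun B (preAct n) i (S.sort (· ≤ ·))

/-- The action of the basis vectors of `L` on the space with basis the monomials. -/
def basisAct (i : κ) : Module.End R (Multiset κ →₀ R) :=
  linearCombination R fun S => preAct B (Multiset.card S) i (single S 1)

/-- The action of `L` on the space with basis the monomials. -/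
def act : L →ₗ[R] Module.End R (Multiset κ →₀ R) := B.constr R (basisAct B)

variable (κ R) in
/-- The span of the monomials of length at most `n`. -/
def lengthLE (n : ℕ) : Submodule R (Multiset κ →₀ R) :=
  Submodule.span R {w | ∃ S : Multiset κ, Multiset.card S ≤ n ∧ w = single S 1}

variable {B}

theorem single_mem_lengthLE {S : Multiset κ} {n : ℕ} (h : Multiset.card S ≤ n) :
    single S (1 : R) ∈ lengthLE κ R n := Submodule.subset_span ⟨S, h, rfl⟩

theorem lengthLE_mono {m n : ℕ} (h : m ≤ n) : lengthLE κ R m ≤ lengthLE κ R n :=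
  Submodule.span_mono fun _ ⟨S, hS, e⟩ => ⟨S, hS.trans h, e⟩

theorem exists_cons_of_ne_zero {S : Multiset κ} (h : S ≠ 0) :
    ∃ j T, S = j ::ₘ T ∧ (∀ k ∈ T, j ≤ k) := by
  rcases e : S.sort (· ≤ ·) with _ | ⟨j, T⟩
  · exact absurd (by rw [← Multiset.sort_eq S (· ≤ ·), e]; rfl) h
  · refine ⟨j, T, by rw [← Multiset.sort_eq S (· ≤ ·), e]; rfl, ?_⟩
    have := Multiset.pairwise_sort S (· ≤ ·)
    rw [e] at this
    exact fun k hk => (List.pairwise_cons.1 this).1 k hk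

theorem sort_cons_of_le {j : κ} {T : Multiset κ} (h : ∀ k ∈ T, j ≤ k) :
    (j ::ₘ T).sort (· ≤ ·) = j :: T.sort (· ≤ ·) := Multiset.sort_cons _ _ _ h

theorem preAct_succ_of_le {n : ℕ} {i : κ} {S : Multiset κ} (h : ∀ k ∈ S, i ≤ k) :
    preAct B (n + 1) i (single S 1) = single (i ::ₘ S) 1 := by
  rw [preAct, linearCombination_single, one_smul]
  by_cases h0 : S = 0
  · subst h0; simp [stepFun]
  · obtain ⟨j, T, rfl, hT⟩ := exists_cons_of_ne_zero h0
    rw [sort_cons_of_le hT, stepFun, if_pos (h j (Multiset.mem_cons_self _ _))]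
    simp

theorem preAct_of_le {n : ℕ} {i : κ} {S : Multiset κ} (h : ∀ k ∈ S, i ≤ k) :
    preAct B n i (single S 1) = single (i ::ₘ S) 1 := by
  cases n with
  | zero => simp [preAct]
  | succ n => exact preAct_succ_of_le h

theorem preAct_succ_of_lt {n : ℕ} {i j : κ} {T : Multiset κ} (hT : ∀ k ∈ T, j ≤ k) (h : j < i) :
    preAct B (n + 1) i (single (j ::ₘ T) 1) = single (i ::ₘ j ::ₘ T) 1
        + preAct B n j (preAct B n i (single T 1) - single (i ::ₘ T) 1)
        + B.constr R (preAct B n) ⁅B i, B j⁆ (single T 1) := by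
  rw [preAct, linearCombination_single, one_smul, sort_cons_of_le hT, stepFun,
    if_neg (not_le.2 h)]
  simp

theorem constr_apply_mem {A : κ → Module.End R (Multiset κ →₀ R)} {p : Submodule R (Multiset κ →₀ R)}
    {w} (h : ∀ k, A k w ∈ p) (x : L) : B.constr R A x w ∈ p := by
  rw [Module.Basis.constr_apply, Finsupp.sum, LinearMap.sum_apply]
  exact Submodule.sum_mem _ fun k _ => Submodule.smul_mem _ _ (h k)

theorem map_lengthLE {A : Module.End R (Multiset κ →₀ R)} {m n : ℕ}
    (h : ∀ S, Multiset.card S ≤ m → A (single S 1) ∈ lengthLE κ R n) {w}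
    (hw : w ∈ lengthLE κ R m) : A w ∈ lengthLE κ R n := by
  have : lengthLE κ R m ≤ (lengthLE κ R n).comap A := by
    refine Submodule.span_le.2 ?_
    rintro _ ⟨S, hS, rfl⟩
    exact h S hS
  exact this hw

theorem eq_on_lengthLE {A A' : Module.End R (Multiset κ →₀ R)} {m : ℕ}
    (h : ∀ S, Multiset.card S ≤ m → A (single S 1) = A' (single S 1)) {w}
    (hw : w ∈ lengthLE κ R m) : A w = A' w := by
  have : lengthLE κ R m ≤ LinearMap.eqLocus A A' := by
    refine Submodule.span_le.2 ?_
    rintro _ ⟨S, hS, rfl⟩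
    exact h S hS
  exact this hw

/-- Up to monomials of at most the same length, `x_i` inserts the letter `i`; and the depth of the
recursion does not matter as soon as it is at least the length of the monomial. -/
theorem preAct_spec (n : ℕ) : ∀ S : Multiset κ, Multiset.card S ≤ n → ∀ i,
    preAct B n i (single S 1) - single (i ::ₘ S) 1 ∈ lengthLE κ R (Multiset.card S) ∧
    preAct B (n + 1) i (single S 1) = preAct B n i (single S 1) := by
  induction n with
  | zero =>
    intro S hS i
    obtain rfl : S = 0 := by simpa using hS
    rw [preAct_succ_of_le (by simp), preAct_of_le (by simp)]
    simp
  | succ n ih =>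
    intro S hS i
    by_cases hi : ∀ k ∈ S, i ≤ k
    · rw [preAct_succ_of_le hi, preAct_of_le hi]; simp
    have h0 : S ≠ 0 := by rintro rfl; simp at hi
    obtain ⟨j, T, rfl, hT⟩ := exists_cons_of_ne_zero h0
    have hji : j < i := by
      by_contra h
      refine hi fun k hk => ?_
      rcases Multiset.mem_cons.1 hk with rfl | hk
      · exact not_lt.1 h
      · exact (not_lt.1 h).trans (hT k hk)
    rw [Multiset.card_cons] at hS ⊢
    have hT' : Multiset.card T ≤ n := by omega
    have key : ∀ (S : Multiset κ), Multiset.card S ≤ Multiset.card T → ∀ k,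
        preAct B n k (single S 1) ∈ lengthLE κ R (Multiset.card T + 1) := by
      intro S hS k
      rw [← sub_add_cancel (preAct B n k (single S 1)) (single (k ::ₘ S) 1)]
      refine add_mem (lengthLE_mono (by omega) (ih S (by omega) k).1) ?_
      exact single_mem_lengthLE (by simp; omega)
    have key2 : ∀ k, ∀ w ∈ lengthLE κ R (Multiset.card T),
        preAct B (n + 1) k w = preAct B n k w := fun k w hw =>
      eq_on_lengthLE (fun S hS => (ih S (hS.trans hT') k).2) hw
    constructor
    · rw [preAct_succ_of_lt hT hji, add_assoc, add_sub_cancel_left]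
      refine add_mem ?_ ?_
      · exact map_lengthLE (fun S hS => key S hS j) (ih T hT' i).1
      · exact constr_apply_mem (fun k => key T le_rfl k) _
    · rw [preAct_succ_of_lt hT hji, preAct_succ_of_lt hT hji, (ih T hT' i).2,
        key2 j _ (ih T hT' i).1]
      congr 1
      simp only [Module.Basis.constr_apply, Finsupp.sum, LinearMap.sum_apply, LinearMap.smul_apply,
        (ih T hT' _).2]

theorem preAct_eq_basisAct {n : ℕ} {S : Multiset κ} (h : Multiset.card S ≤ n) (i : κ) :
    preAct B n i (single S 1) = basisAct B i (single S 1) := by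
  rw [basisAct, linearCombination_single, one_smul]
  induction n, h using Nat.le_induction with
  | base => rfl
  | succ n hn ih => rw [(preAct_spec n S hn i).2, ih]

theorem act_basis (i : κ) : act B (B i) = basisAct B i := by simp [act]

theorem act_basis_of_le {i : κ} {S : Multiset κ} (h : ∀ k ∈ S, i ≤ k) :
    act B (B i) (single S 1) = single (i ::ₘ S) 1 := by
  rw [act_basis, ← preAct_eq_basisAct le_rfl, preAct_of_le h]

theorem act_basis_sub_mem (i : κ) (S : Multiset κ) :
    act B (B i) (single S 1) - single (i ::ₘ S) 1 ∈ lengthLE κ R (Multiset.card S) := by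
  rw [act_basis, ← preAct_eq_basisAct le_rfl]
  exact (preAct_spec _ S le_rfl i).1

/-- If `j` is the smallest letter of a monomial and `j < i`, the action of `x_i` is the one
prescribed by `x_i x_j = x_j x_i + [x_i, x_j]`. -/
theorem act_basis_of_lt {i j : κ} {T : Multiset κ} (hT : ∀ k ∈ T, j ≤ k) (h : j < i) :
    act B (B i) (single (j ::ₘ T) 1) =
      act B (B j) (act B (B i) (single T 1)) + act B ⁅B i, B j⁆ (single T 1) := by
  have e1 : act B ⁅B i, B j⁆ (single T 1) =
      B.constr R (preAct B (Multiset.card T)) ⁅B i, B j⁆ (single T 1) := by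
    simp only [act, Module.Basis.constr_apply, Finsupp.sum, LinearMap.sum_apply,
      LinearMap.smul_apply, preAct_eq_basisAct le_rfl]
  have e2 : preAct B (Multiset.card T) j
      (preAct B (Multiset.card T) i (single T 1) - single (i ::ₘ T) 1) =
      act B (B j) (act B (B i) (single T 1) - single (i ::ₘ T) 1) := by
    rw [act_basis, act_basis, ← preAct_eq_basisAct le_rfl i]
    exact eq_on_lengthLE (fun S hS => preAct_eq_basisAct hS j) (preAct_spec _ T le_rfl i).1
  rw [act_basis i, ← preAct_eq_basisAct (n := Multiset.card T + 1) (S := j ::ₘ T) (by simp),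
    preAct_succ_of_lt hT h, e2, ← e1, map_sub,
    act_basis_of_le (i := j) (S := i ::ₘ T) fun k hk => ?_, Multiset.cons_swap j i, act_basis i]
  · abel
  · rcases Multiset.mem_cons.1 hk with rfl | hk
    · exact h.le
    · exact hT k hk

/-- The defect of `act` from being a homomorphism of Lie algebras, on a vector `w`. -/
def defect (B : Module.Basis κ R L) (w : Multiset κ →₀ R) : L →ₗ[R] L →ₗ[R] (Multiset κ →₀ R) :=
  LinearMap.mk₂ R (fun x y => act B x (act B y w) - act B y (act B x w) - act B ⁅x, y⁆ w)
    (fun x x' y => by simp; abel) (fun a x y => by simp [smul_sub])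
    (fun x y y' => by simp; abel) (fun a x y => by simp [smul_sub])

theorem defect_apply (w : Multiset κ →₀ R) (x y : L) :
    defect B w x y = act B x (act B y w) - act B y (act B x w) - act B ⁅x, y⁆ w := rfl

theorem defect_swap (w : Multiset κ →₀ R) (x y : L) : defect B w y x = - defect B w x y := by
  rw [defect_apply, defect_apply, ← lie_skew x y]
  simp only [map_neg, LinearMap.neg_apply]
  abel

theorem defect_linear {n : ℕ} (h : ∀ S : Multiset κ, Multiset.card S ≤ n →
      defect B (single S 1) = 0) {w} (hw : w ∈ lengthLE κ R n) : defect B w = 0 := by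
  induction hw using Submodule.span_induction with
  | mem w hw => obtain ⟨S, hS, rfl⟩ := hw; exact h S hS
  | zero => ext x y; simp [defect_apply]
  | add w w' _ _ h1 h2 =>
    have : defect B (w + w') = defect B w + defect B w' := by
      refine LinearMap.ext₂ fun x y => ?_
      simp only [defect_apply, LinearMap.add_apply, map_add]
      abel
    rw [this, h1, h2, add_zero]
  | smul a w _ h1 =>
    have : defect B (a • w) = a • defect B w := by
      refine LinearMap.ext₂ fun x y => ?_
      simp [defect_apply, smul_sub]
    rw [this, h1, smul_zero]

/-- The inductive step in the proof that `act` is a representation. If `j` is not larger than the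
letters of `S`, the relation holds by the construction of the action. Otherwise the smallest letter
`k` of `S` is less than both `i` and `j`, and the relation follows from those for the pairs
`(i, k)` and `(j, k)` by the Jacobi identity. -/
theorem defect_eq_zero_of_lt {S : Multiset κ}
    (ih : ∀ T : Multiset κ, Multiset.card T < Multiset.card S → defect B (single T 1) = 0)
    {i j : κ} (hji : j < i) : defect B (single S 1) (B i) (B j) = 0 := by
  by_cases hj : ∀ k ∈ S, j ≤ k
  · rw [defect_apply, act_basis_of_le hj, act_basis_of_lt hj hji]
    abel
  have h0 : S ≠ 0 := by rintro rfl; simp at hj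
  obtain ⟨k, T, rfl, hT⟩ := exists_cons_of_ne_zero h0
  have hkj : k < j := by
    by_contra h
    refine hj fun l hl => ?_
    rcases Multiset.mem_cons.1 hl with rfl | hl
    · exact not_lt.1 h
    · exact (not_lt.1 h).trans (hT l hl)
  have hki := hkj.trans hji
  have ihT : ∀ x y, act B x (act B y (single T 1)) =
      act B y (act B x (single T 1)) + act B ⁅x, y⁆ (single T 1) := by
    intro x y
    have := LinearMap.congr_fun₂ (ih T (by simp)) x y
    rw [defect_apply] at this
    exact eq_add_of_sub_eq' (by simpa [sub_eq_zero] using this)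
  have e : single (k ::ₘ T) (1 : R) = act B (B k) (single T 1) := (act_basis_of_le hT).symm
  -- the relation for `(p, k)` on `x_q z_T`, which is `z_{qT}` up to terms covered by induction
  have key : ∀ p q : κ, k < p → k < q → act B (B p) (act B (B k) (act B (B q) (single T 1))) =
      act B (B k) (act B (B p) (act B (B q) (single T 1))) +
      act B ⁅B p, B k⁆ (act B (B q) (single T 1)) := by
    intro p q hp hq
    obtain ⟨w, hw, e⟩ : ∃ w ∈ lengthLE κ R (Multiset.card T),
        act B (B q) (single T 1) = single (q ::ₘ T) 1 + w :=
      ⟨_, act_basis_sub_mem q T, by abel⟩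
    have hkq : ∀ l ∈ q ::ₘ T, k ≤ l := by
      intro l hl
      rcases Multiset.mem_cons.1 hl with rfl | hl
      · exact hq.le
      · exact hT l hl
    have e2 := LinearMap.congr_fun₂
      (defect_linear (fun S hS => ih S (by simpa [Nat.lt_succ_iff] using hS)) hw) (B p) (B k)
    rw [defect_apply] at e2
    have e3 : act B (B p) (act B (B k) w) =
        act B (B k) (act B (B p) w) + act B ⁅B p, B k⁆ w :=
      eq_add_of_sub_eq' (by simpa [sub_eq_zero] using e2)
    rw [e, map_add, map_add, act_basis_of_le hkq, act_basis_of_lt hkq hp, e3]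
    simp only [map_add]
    abel
  rw [defect_apply, e, ihT (B j) (B k), ihT (B i) (B k)]
  simp only [map_add]
  rw [key i j hki hkj, key j i hkj hki, ihT (B i) ⁅B j, B k⁆, ihT (B j) ⁅B i, B k⁆,
    ihT (B i) (B j), ihT ⁅B i, B j⁆ (B k), lie_lie (B i) (B j) (B k)]
  simp only [map_add, map_sub, LinearMap.sub_apply]
  abel

theorem defect_eq_zero (S : Multiset κ) : defect B (single S (1 : R)) = 0 := by
  induction h : Multiset.card S using Nat.strong_induction_on generalizing S with
  | _ n ih =>
    subst h
    refine B.ext fun i => B.ext fun j => ?_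
    rcases lt_trichotomy i j with h | rfl | h
    · rw [defect_swap, defect_eq_zero_of_lt (fun T hT => ih _ hT T rfl) h]; simp
    · simp [defect_apply]
    · rw [defect_eq_zero_of_lt (fun T hT => ih _ hT T rfl) h]; simp

variable (B) in
/-- The action of `L` on the space with basis the monomials, as a homomorphism of Lie algebras. -/
def actHom : L →ₗ⁅R⁆ Module.End R (Multiset κ →₀ R) :=
  { act B with
    map_lie' := fun {x y} => by
      refine Finsupp.lhom_ext' fun S => LinearMap.ext_ring ?_
      have := LinearMap.congr_fun₂ (defect_eq_zero (B := B) S) x y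
      rw [defect_apply, LinearMap.zero_apply, LinearMap.zero_apply, sub_eq_zero] at this
      exact this.symm }

local notation "U" => UniversalEnvelopingAlgebra R L

variable (B) in
/-- The ordered monomial in the enveloping algebra with letters `x_i`, `i ∈ S`. -/
def mon (S : Multiset κ) : U :=
  ((S.sort (· ≤ ·)).map fun i => UniversalEnvelopingAlgebra.ι R (B i)).prod

theorem mon_cons {j : κ} {T : Multiset κ} (h : ∀ k ∈ T, j ≤ k) :
    mon B (j ::ₘ T) = UniversalEnvelopingAlgebra.ι R (B j) * mon B T := by
  rw [mon, sort_cons_of_le h, List.map_cons, List.prod_cons, mon]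

@[simp] theorem mon_zero : mon B (0 : Multiset κ) = 1 := by simp [mon]

variable (B) in
/-- The linear map from the enveloping algebra sending ordered monomials to the basis vectors. -/
def symbol : U →ₗ[R] (Multiset κ →₀ R) :=
  (LinearMap.applyₗ (single (0 : Multiset κ) (1 : R))) ∘ₗ
    (UniversalEnvelopingAlgebra.lift R (actHom B)).toLinearMap

theorem symbol_mon (S : Multiset κ) : symbol B (mon B S) = single S 1 := by
  induction h : Multiset.card S generalizing S with
  | zero => obtain rfl := Multiset.card_eq_zero.1 h; simp [symbol]
  | succ n ih =>
    obtain ⟨j, T, rfl, hT⟩ := exists_cons_of_ne_zero (S := S) (by rintro rfl; simp at h)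
    have e := ih T (by simpa using h)
    simp only [symbol, LinearMap.comp_apply, LinearMap.applyₗ_apply_apply,
      AlgHom.toLinearMap_apply] at e ⊢
    rw [mon_cons hT, map_mul, UniversalEnvelopingAlgebra.lift_ι_apply, Module.End.mul_apply, e]
    exact act_basis_of_le hT

theorem linearIndependent_mon : LinearIndependent R (mon B) := by
  refine LinearIndependent.of_comp (symbol B) ?_
  have : symbol B ∘ mon B = fun S => single S (1 : R) := funext symbol_mon
  rw [this]
  exact Finsupp.linearIndependent_single_one R _

/-! ### Spanning by ordered monomials -/

/-- The product in the enveloping algebra of the basis vectors with indices in `l`. -/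
def word (B : Module.Basis κ R L) (l : List κ) : U :=
  (l.map fun i => UniversalEnvelopingAlgebra.ι R (B i)).prod

@[simp] theorem word_nil : word B [] = 1 := rfl

@[simp] theorem word_cons (i : κ) (l : List κ) :
    word B (i :: l) = UniversalEnvelopingAlgebra.ι R (B i) * word B l := rfl

@[simp] theorem word_append (l l' : List κ) : word B (l ++ l') = word B l * word B l' := by
  simp [word]

theorem exists_word_eq_mon (S : Multiset κ) :
    ∃ l : List κ, (l : Multiset κ) = S ∧ word B l = mon B S :=
  ⟨S.sort (· ≤ ·), Multiset.sort_eq _ _, rfl⟩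

variable (B) in
/-- The span of the products of at most `n` basis vectors with indices in `p` and of total
weight `d`. -/
def wordSpan (p : Set κ) (wt : κ → ℤ) (n : ℕ) (d : ℤ) : Submodule R U :=
  Submodule.span R {u | ∃ l : List κ, (∀ i ∈ l, i ∈ p) ∧ l.length ≤ n ∧ (l.map wt).sum = d ∧
    word B l = u}

theorem word_mem_wordSpan {p : Set κ} {wt : κ → ℤ} {n : ℕ} {l : List κ}
    (h1 : ∀ i ∈ l, i ∈ p) (h2 : l.length ≤ n) :
    word B l ∈ wordSpan B p wt n (l.map wt).sum := Submodule.subset_span ⟨l, h1, h2, rfl, rfl⟩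

theorem wordSpan_mono {p : Set κ} {wt : κ → ℤ} {m n : ℕ} (h : m ≤ n) (d : ℤ) :
    wordSpan B p wt m d ≤ wordSpan B p wt n d :=
  Submodule.span_mono fun _ ⟨l, h1, h2, h3, h4⟩ => ⟨l, h1, h2.trans h, h3, h4⟩

theorem mul_mem_wordSpan {p : Set κ} {wt : κ → ℤ} {m n : ℕ} {d e : ℤ} {u v : U}
    (hu : u ∈ wordSpan B p wt m d) (hv : v ∈ wordSpan B p wt n e) :
    u * v ∈ wordSpan B p wt (m + n) (d + e) := by
  have := Submodule.mul_mem_mul hu hv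
  rw [wordSpan, wordSpan, Submodule.span_mul_span] at this
  refine Submodule.span_mono ?_ this
  rintro _ ⟨_, ⟨l, h1, h2, h3, rfl⟩, _, ⟨l', h1', h2', h3', rfl⟩, rfl⟩
  refine ⟨l ++ l', ?_, by simp; omega, by simp [h3, h3'], by simp⟩
  intro i hi
  rcases List.mem_append.1 hi with h | h
  exacts [h1 i h, h1' i h]

/-- A set of indices and a weight function compatible with the bracket. -/
structure Compatible (B : Module.Basis κ R L) (p : Set κ) (wt : κ → ℤ) : Prop where
  mem : ∀ {i j k}, i ∈ p → j ∈ p → B.repr ⁅B i, B j⁆ k ≠ 0 → k ∈ p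
  wt : ∀ {i j k}, B.repr ⁅B i, B j⁆ k ≠ 0 → wt k = wt i + wt j

variable {p : Set κ} {wt : κ → ℤ}

theorem Compatible.lie_mem (h : Compatible B p wt) {i j : κ} (hi : i ∈ p) (hj : j ∈ p) :
    UniversalEnvelopingAlgebra.ι R ⁅B i, B j⁆ ∈ wordSpan B p wt 1 (wt i + wt j) := by
  rw [← B.linearCombination_repr ⁅B i, B j⁆, Finsupp.linearCombination_apply, Finsupp.sum, map_sum]
  refine Submodule.sum_mem _ fun k hk => ?_
  rw [map_smul]
  refine Submodule.smul_mem _ _ ?_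
  have hk' := Finsupp.mem_support_iff.1 hk
  have := word_mem_wordSpan (B := B) (p := p) (wt := wt) (n := 1) (l := [k])
    (by simpa using h.mem hi hj hk') le_rfl
  simpa [h.wt hk'] using this

/-- Permuting the letters of a word only changes it by shorter words. -/
theorem Compatible.perm (h : Compatible B p wt) {l l' : List κ} (hp : l.Perm l') :
    (∀ i ∈ l, i ∈ p) →
    word B l - word B l' ∈ wordSpan B p wt (l.length - 1) (l.map wt).sum := by
  induction hp with
  | nil => intro; simp
  | @cons a l l' hl ih =>
    intro hm
    have hm' : ∀ i ∈ l, i ∈ p := fun i hi => hm i (List.mem_cons_of_mem _ hi)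
    rcases Nat.eq_zero_or_pos l.length with h0 | h0
    · obtain rfl := List.length_eq_zero_iff.1 h0
      obtain rfl := hl.nil_eq
      simp
    have := mul_mem_wordSpan (word_mem_wordSpan (B := B) (p := p) (wt := wt) (n := 1) (l := [a])
      (by simpa using hm a (by simp)) le_rfl) (ih hm')
    rw [mul_sub, show 1 + (l.length - 1) = (a :: l).length - 1 by simp; omega] at this
    simpa using this
  | swap x y l =>
    intro hm
    have hx : x ∈ p := hm x (by simp)
    have hy : y ∈ p := hm y (by simp)
    have hl : ∀ i ∈ l, i ∈ p := fun i hi => hm i (by simp [hi])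
    have := mul_mem_wordSpan (h.lie_mem hy hx) (word_mem_wordSpan (wt := wt) hl le_rfl)
    rw [LieHom.map_lie, LieRing.of_associative_ring_bracket, sub_mul] at this
    simp only [word_cons, List.map_cons, List.sum_cons, List.length_cons, ← mul_assoc, ← add_assoc]
    rwa [add_comm 1] at this
  | @trans l₁ l₂ l₃ h₁ h₂ ih1 ih2 =>
    intro hm
    have e2 := ih2 fun i hi => hm i (h₁.mem_iff.2 hi)
    rw [← h₁.length_eq, ← (h₁.map wt).sum_eq] at e2
    simpa using add_mem (ih1 hm) e2

variable (B) in
/-- The span of the ordered monomials with at most `n` letters in `p` and of total weight `d`. -/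
def monSpan (p : Set κ) (wt : κ → ℤ) (n : ℕ) (d : ℤ) : Submodule R U :=
  Submodule.span R {u | ∃ S : Multiset κ, (∀ i ∈ S, i ∈ p) ∧ Multiset.card S ≤ n ∧
    (S.map wt).sum = d ∧ mon B S = u}

/-- Modulo shorter words, a word depends only on its multiset of letters. -/
theorem Compatible.word_sub_mon (h : Compatible B p wt) {l : List κ} (hl : ∀ i ∈ l, i ∈ p) :
    word B l - mon B (l : Multiset κ) ∈ wordSpan B p wt (l.length - 1) (l.map wt).sum := by
  refine h.perm ?_ hl
  rw [← Multiset.coe_eq_coe, Multiset.sort_eq]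

theorem mon_mem_wordSpan {S : Multiset κ} {n : ℕ} {d : ℤ} (h1 : ∀ i ∈ S, i ∈ p)
    (h2 : Multiset.card S ≤ n) (h3 : (S.map wt).sum = d) : mon B S ∈ wordSpan B p wt n d := by
  refine Submodule.subset_span ⟨S.sort (· ≤ ·), by simpa using h1, by simpa using h2, ?_, rfl⟩
  rw [← h3, ← Multiset.sum_coe, ← Multiset.map_coe, Multiset.sort_eq]

/-- Words can be straightened into ordered monomials without leaving the set of letters `p`,
changing the weight or increasing the length. -/
theorem Compatible.wordSpan_eq (h : Compatible B p wt) (n : ℕ) (d : ℤ) :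
    wordSpan B p wt n d = monSpan B p wt n d := by
  apply le_antisymm
  · induction n with
    | zero =>
      refine Submodule.span_le.2 ?_
      rintro _ ⟨l, h1, h2, h3, rfl⟩
      obtain rfl : l = [] := by simpa using h2
      exact Submodule.subset_span ⟨0, by simp, by simp, by simpa using h3, by simp⟩
    | succ n ih =>
      refine Submodule.span_le.2 ?_
      rintro _ ⟨l, h1, h2, rfl, rfl⟩
      rw [← sub_add_cancel (word B l) (mon B (l : Multiset κ))]
      refine add_mem ?_ (Submodule.subset_span ⟨l, by simpa using h1, by simpa using h2, by simp,
        rfl⟩)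
      have h4 := ih (wordSpan_mono (by omega) _ (h.word_sub_mon h1))
      refine Submodule.span_mono ?_ h4
      rintro _ ⟨S, g1, g2, g3, g4⟩
      exact ⟨S, g1, by omega, g3, g4⟩
  · refine Submodule.span_le.2 ?_
    rintro _ ⟨S, h1, h2, h3, rfl⟩
    exact mon_mem_wordSpan h1 h2 h3

theorem span_mon_eq_top : ⊤ ≤ Submodule.span R (Set.range (mon B)) := by
  have h : Compatible B (Set.univ) (fun _ => 0) := ⟨fun _ _ _ => trivial, fun _ => by simp⟩
  have hw : ∀ l : List κ, word B l ∈ Submodule.span R (Set.range (mon B)) := by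
    intro l
    have := word_mem_wordSpan (B := B) (p := Set.univ) (wt := fun _ => 0) (l := l)
      (fun _ _ => trivial) le_rfl
    rw [h.wordSpan_eq] at this
    refine Submodule.span_mono ?_ this
    rintro _ ⟨S, _, _, _, rfl⟩
    exact ⟨S, rfl⟩
  -- the span of all words is a subalgebra containing `L`, hence everything
  let A : Subalgebra R U := Subalgebra.mk
    { carrier := Submodule.span R (Set.range (word B))
      mul_mem' := fun {x y} hx hy => by
        have := Submodule.mul_mem_mul hx hy
        rw [Submodule.span_mul_span] at this
        refine Submodule.span_mono ?_ this
        rintro _ ⟨_, ⟨l, rfl⟩, _, ⟨l', rfl⟩, rfl⟩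
        exact ⟨l ++ l', by simp⟩
      one_mem' := Submodule.subset_span ⟨[], rfl⟩
      add_mem' := fun h h' => add_mem h h'
      zero_mem' := zero_mem _ } (fun r => by
        have : algebraMap R U r = r • word B [] := by simp [Algebra.algebraMap_eq_smul_one]
        rw [this]
        exact Submodule.smul_mem _ _ (Submodule.subset_span ⟨[], rfl⟩))
  have hA : ∀ x : L, UniversalEnvelopingAlgebra.ι R x ∈ A := by
    intro x
    change UniversalEnvelopingAlgebra.ι R x ∈ Submodule.span R (Set.range (word B))
    rw [← B.linearCombination_repr x, Finsupp.linearCombination_apply, Finsupp.sum, map_sum]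
    refine Submodule.sum_mem _ fun k _ => ?_
    rw [map_smul]
    exact Submodule.smul_mem _ _ (Submodule.subset_span ⟨[k], by
      simp⟩)
  -- the lift of `L → A`, followed by the inclusion of `A`, is the identity
  have hall : ∀ u : U, u ∈ A := by
    let f : L →ₗ⁅R⁆ A :=
      { toFun := fun x => ⟨UniversalEnvelopingAlgebra.ι R x, hA x⟩
        map_add' := fun x y => Subtype.ext (map_add _ x y)
        map_smul' := fun r x => Subtype.ext (map_smul _ r x)
        map_lie' := fun {x y} => Subtype.ext (LieHom.map_lie _ x y) }
    have : A.val.comp (UniversalEnvelopingAlgebra.lift R f) = AlgHom.id R U := by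
      refine UniversalEnvelopingAlgebra.hom_ext R ?_
      ext x
      change ((UniversalEnvelopingAlgebra.lift R f (UniversalEnvelopingAlgebra.ι R x) : A) : U) = _
      rw [UniversalEnvelopingAlgebra.lift_ι_apply]
      rfl
    intro u
    have e := DFunLike.congr_fun this u
    rw [AlgHom.id_apply] at e
    rw [← e]
    exact (UniversalEnvelopingAlgebra.lift R f u).2
  rintro u -
  have : u ∈ Submodule.span R (Set.range (word B)) := hall u
  refine (Submodule.span_le.2 ?_) this
  rintro _ ⟨l, rfl⟩
  exact hw l

variable (B) in
/-- The Poincaré–Birkhoff–Witt basis of the enveloping algebra. -/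
def basis : Module.Basis (Multiset κ) R U :=
  Module.Basis.mk linearIndependent_mon (span_mon_eq_top (B := B))

@[simp] theorem basis_apply (S : Multiset κ) : basis B S = mon B S := by simp [basis]

end PBW

namespace SemiInfinite

universe u v w w'

/-! ### Ordered monomials adapted to the splitting into non-negative and negative parts -/

section Monomials

variable {𝔤 : Type u} [LieRing 𝔤] [LieAlgebra ℂ 𝔤] {s : SemiInfiniteStructure 𝔤}
  {ι : Type v} [LinearOrder ι]

local notation "U" => UniversalEnvelopingAlgebra ℂ 𝔤

/-- The order on the indices of a homogeneous basis in which the indices of degree `≥ 0` come before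
those of degree `< 0`. -/
@[reducible] def keyOrder (b : HomogeneousBasis s ι) : LinearOrder ι :=
  LinearOrder.lift' (fun i : ι => (toLex (decide (b.deg i < 0), i) : Bool ×ₗ ι)) (by
    intro i j h
    exact (Prod.mk.inj (toLex.injective h)).2)

variable (b : HomogeneousBasis s ι)

theorem keyOrder_le {i j : ι} (hi : ¬ b.deg i < 0) (hj : b.deg j < 0) : (keyOrder b).le i j := by
  change (toLex (decide (b.deg i < 0), i) : Bool ×ₗ ι) ≤ toLex (decide (b.deg j < 0), j)
  rw [Prod.Lex.toLex_le_toLex]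
  left
  simp [hi, hj]

/-- The product in `U(𝔤)` of a list of basis vectors. -/
def wrd (l : List ι) : U := (l.map fun i => toU (b.basis i)).prod

/-- The ordered monomial in `U(𝔤)` (letters of degree `≥ 0` first). -/
def omon (S : Multiset ι) : U := @PBW.mon ι ℂ 𝔤 (keyOrder b) _ _ _ b.basis S

/-- The Poincaré–Birkhoff–Witt basis of `U(𝔤)` formed by the ordered monomials. -/
def pbw : Module.Basis (Multiset ι) ℂ U := @PBW.basis ι ℂ 𝔤 (keyOrder b) _ _ _ b.basis

@[simp] theorem pbw_apply (S : Multiset ι) : pbw b S = omon b S :=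
  @PBW.basis_apply ι ℂ 𝔤 (keyOrder b) _ _ _ b.basis S

@[simp] theorem wrd_nil : wrd b [] = 1 := rfl

@[simp] theorem wrd_cons (i : ι) (l : List ι) :
    wrd b (i :: l) = toU (b.basis i) * wrd b l := rfl

@[simp] theorem wrd_append (l l' : List ι) : wrd b (l ++ l') = wrd b l * wrd b l' := by
  simp [wrd]

@[simp] theorem omon_zero : omon b 0 = 1 :=
  @PBW.mon_zero ι ℂ 𝔤 (keyOrder b) _ _ _ b.basis

/-- The span of the products of basis vectors with indices in `p` and of total degree `d`. -/
def wrdSpan (p : Set ι) (d : ℤ) : Submodule ℂ U :=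
  Submodule.span ℂ {u | ∃ l : List ι, (∀ i ∈ l, i ∈ p) ∧ (l.map b.deg).sum = d ∧ wrd b l = u}

variable {b}

theorem wrd_mem {p : Set ι} {l : List ι} (h : ∀ i ∈ l, i ∈ p) :
    wrd b l ∈ wrdSpan b p (l.map b.deg).sum := Submodule.subset_span ⟨l, h, rfl, rfl⟩

theorem one_mem_wrdSpan (p : Set ι) : (1 : U) ∈ wrdSpan b p 0 :=
  Submodule.subset_span ⟨[], by simp, by simp, rfl⟩

theorem mul_mem_wrdSpan {p : Set ι} {d e : ℤ} {u v : U}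
    (hu : u ∈ wrdSpan b p d) (hv : v ∈ wrdSpan b p e) : u * v ∈ wrdSpan b p (d + e) := by
  have := Submodule.mul_mem_mul hu hv
  rw [wrdSpan, wrdSpan, Submodule.span_mul_span] at this
  refine Submodule.span_mono ?_ this
  rintro _ ⟨_, ⟨l, h1, h3, rfl⟩, _, ⟨l', h1', h3', rfl⟩, rfl⟩
  refine ⟨l ++ l', ?_, by simp [h3, h3'], by simp⟩
  intro i hi
  rcases List.mem_append.1 hi with h | h
  exacts [h1 i h, h1' i h]

theorem toU_basis_mem {p : Set ι} {i : ι} (hi : i ∈ p) :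
    toU (b.basis i) ∈ wrdSpan b p (b.deg i) :=
  Submodule.subset_span ⟨[i], by simpa using hi, by simp, by simp⟩

theorem toU_eq_sum (x : 𝔤) :
    toU x = ∑ k ∈ (b.basis.repr x).support, b.basis.repr x k • toU (b.basis k) := by
  conv_lhs => rw [← b.basis.linearCombination_repr x, Finsupp.linearCombination_apply,
    Finsupp.sum, toU, map_sum]
  simp only [map_smul]

theorem toU_mem_of {n : ℤ} {x : 𝔤} (hx : x ∈ s.gr n) {p : Submodule ℂ U}
    (h : ∀ k, b.deg k = n → toU (b.basis k) ∈ p) : toU x ∈ p := by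
  rw [toU_eq_sum (b := b)]
  refine Submodule.sum_mem _ fun k hk => Submodule.smul_mem _ _ (h k ?_)
  by_contra hne
  exact Finsupp.mem_support_iff.1 hk (b.coord_eq_zero hx hne)

theorem wrdSpan_univ (n : ℤ) : wrdSpan b Set.univ n = grU s n := by
  apply le_antisymm
  · refine Submodule.span_le.2 ?_
    rintro _ ⟨l, -, rfl, rfl⟩
    refine Submodule.subset_span ⟨l.map fun i => (b.deg i, b.basis i), ?_, ?_, ?_⟩
    · intro p hp
      obtain ⟨i, -, rfl⟩ := List.mem_map.1 hp
      exact b.mem i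
    · simp [List.map_map, Function.comp_def]
    · simp [List.map_map, Function.comp_def, wrd]
  · refine Submodule.span_le.2 ?_
    rintro _ ⟨l, h, rfl, rfl⟩
    induction l with
    | nil => exact one_mem_wrdSpan _
    | cons p l ih =>
      simp only [List.map_cons, List.sum_cons, List.prod_cons]
      refine mul_mem_wrdSpan ?_ (ih fun q hq => h q (List.mem_cons_of_mem _ hq))
      refine toU_mem_of (b := b) (h p List.mem_cons_self) fun k hk => ?_
      rw [← hk]
      exact toU_basis_mem (Set.mem_univ k)

variable (b) in
/-- The set of indices of degree `≥ 0`. -/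
def nonneg : Set ι := {i | ¬ b.deg i < 0}

variable (b) in
/-- The set of indices of degree `< 0`. -/
def neg : Set ι := {i | b.deg i < 0}

theorem repr_ne_zero {i j k : ι} (h : b.basis.repr ⁅b.basis i, b.basis j⁆ k ≠ 0) :
    b.deg k = b.deg i + b.deg j := b.sc_ne_zero h

theorem compatible_univ : PBW.Compatible b.basis Set.univ b.deg :=
  ⟨fun _ _ _ => trivial, fun h => repr_ne_zero h⟩

theorem compatible_nonneg : PBW.Compatible b.basis (nonneg b) b.deg :=
  ⟨fun {i j k} hi hj h => by
    have e : b.deg k = b.deg i + b.deg j := repr_ne_zero h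
    have hi' : ¬ b.deg i < 0 := hi
    have hj' : ¬ b.deg j < 0 := hj
    change ¬ b.deg k < 0
    omega, fun h => repr_ne_zero h⟩

theorem compatible_neg : PBW.Compatible b.basis (neg b) b.deg :=
  ⟨fun {i j k} hi hj h => by
    have e : b.deg k = b.deg i + b.deg j := repr_ne_zero h
    have hi' : b.deg i < 0 := hi
    have hj' : b.deg j < 0 := hj
    change b.deg k < 0
    omega, fun h => repr_ne_zero h⟩

theorem wrdSpan_eq_monSpan {p : Set ι} (hp : PBW.Compatible b.basis p b.deg) (d : ℤ) :
    wrdSpan b p d = Submodule.span ℂ {u | ∃ S : Multiset ι, (∀ i ∈ S, i ∈ p) ∧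
      (S.map b.deg).sum = d ∧ omon b S = u} := by
  apply le_antisymm
  · refine Submodule.span_le.2 ?_
    rintro _ ⟨l, h1, h2, rfl⟩
    have : wrd b l ∈ PBW.wordSpan b.basis p b.deg l.length d :=
      Submodule.subset_span ⟨l, h1, le_rfl, h2, rfl⟩
    rw [@PBW.Compatible.wordSpan_eq ι ℂ 𝔤 (keyOrder b) _ _ _ b.basis p b.deg hp] at this
    refine Submodule.span_mono ?_ this
    rintro _ ⟨S, h1, _, h3, h4⟩
    exact ⟨S, h1, h3, h4⟩
  · refine Submodule.span_le.2 ?_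
    rintro _ ⟨S, h1, rfl, rfl⟩
    have : omon b S ∈ PBW.wordSpan b.basis p b.deg (Multiset.card S) (S.map b.deg).sum :=
      @PBW.mon_mem_wordSpan ι ℂ 𝔤 (keyOrder b) _ _ _ b.basis p b.deg S _ _ h1 le_rfl rfl
    refine Submodule.span_mono ?_ this
    rintro _ ⟨l, h1, _, h3, h4⟩
    exact ⟨l, h1, h3, h4⟩

variable (b) in
/-- The degree `n` component of `U₊`. -/
abbrev UP (n : ℤ) : Submodule ℂ U := wrdSpan b (nonneg b) n

theorem UP_le_Uplus (n : ℤ) : UP b n ≤ Subalgebra.toSubmodule (Uplus s) := by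
  refine Submodule.span_le.2 ?_
  rintro _ ⟨l, h, -, rfl⟩
  induction l with
  | nil => exact one_mem (Uplus s)
  | cons i l ih =>
    exact mul_mem (S := Subalgebra ℂ U) (toU_mem_Uplus b (h i List.mem_cons_self))
      (ih fun q hq => h q (List.mem_cons_of_mem _ hq))

theorem UP_le_grU (n : ℤ) : UP b n ≤ grU s n := by
  rw [← wrdSpan_univ (b := b)]
  refine Submodule.span_mono ?_
  rintro _ ⟨l, -, h⟩
  exact ⟨l, fun _ _ => trivial, h⟩

/-- `U₊` is the span of all products of basis vectors of degree `≥ 0`. -/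
theorem Uplus_eq : Subalgebra.toSubmodule (Uplus s) =
    Submodule.span ℂ {u | ∃ l : List ι, (∀ i ∈ l, i ∈ nonneg b) ∧ wrd b l = u} := by
  apply le_antisymm
  · let A : Subalgebra ℂ U := Subalgebra.mk
      { carrier := Submodule.span ℂ {u | ∃ l : List ι, (∀ i ∈ l, i ∈ nonneg b) ∧ wrd b l = u}
        mul_mem' := fun {x y} hx hy => by
          have := Submodule.mul_mem_mul hx hy
          rw [Submodule.span_mul_span] at this
          refine Submodule.span_mono ?_ this
          rintro _ ⟨_, ⟨l, h, rfl⟩, _, ⟨l', h', rfl⟩, rfl⟩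
          refine ⟨l ++ l', fun i hi => ?_, by simp⟩
          rcases List.mem_append.1 hi with g | g
          exacts [h i g, h' i g]
        one_mem' := Submodule.subset_span ⟨[], by simp, rfl⟩
        add_mem' := fun h h' => add_mem h h'
        zero_mem' := zero_mem _ } (fun r => by
          rw [Algebra.algebraMap_eq_smul_one]
          exact Submodule.smul_mem _ _ (Submodule.subset_span ⟨[], by simp, rfl⟩))
    have : Uplus s ≤ A := by
      refine Algebra.adjoin_le ?_
      rintro _ ⟨n, hn, x, hx, rfl⟩
      refine toU_mem_of (b := b) hx (p := Subalgebra.toSubmodule A) fun k hk => ?_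
      exact Submodule.subset_span ⟨[k], by simp [nonneg]; omega, by simp⟩
    exact this
  · refine Submodule.span_le.2 ?_
    rintro _ ⟨l, h, rfl⟩
    exact UP_le_Uplus _ (wrd_mem h)

/-- A property of elements of `U₊` that is linear holds if it holds for homogeneous elements. -/
theorem Uplus_le {p : Submodule ℂ U} (h : ∀ n, UP b n ≤ p) {u : U} (hu : u ∈ Uplus s) : u ∈ p := by
  have hu' : u ∈ Subalgebra.toSubmodule (Uplus s) := hu
  rw [Uplus_eq (b := b)] at hu'
  refine Submodule.span_le.2 ?_ hu'
  rintro _ ⟨l, hl, rfl⟩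
  exact h _ (wrd_mem hl)

/-- The Poincaré–Birkhoff–Witt theorem for `U₊`. -/
theorem Uplus_eq_omon : Subalgebra.toSubmodule (Uplus s) =
    Submodule.span ℂ (omon b '' {S | ∀ i ∈ S, i ∈ nonneg b}) := by
  apply le_antisymm
  · intro u hu
    refine Uplus_le (b := b) (fun n => ?_) hu
    rw [UP, wrdSpan_eq_monSpan compatible_nonneg]
    refine Submodule.span_mono ?_
    rintro _ ⟨S, h, -, rfl⟩
    exact ⟨S, h, rfl⟩
  · refine Submodule.span_le.2 ?_
    rintro _ ⟨S, h, rfl⟩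
    refine UP_le_Uplus (b := b) (S.map b.deg).sum ?_
    rw [UP, wrdSpan_eq_monSpan compatible_nonneg]
    exact Submodule.subset_span ⟨S, h, rfl, rfl⟩

theorem grU_eq_omon (n : ℤ) : grU s n =
    Submodule.span ℂ (omon b '' {S | (S.map b.deg).sum = n}) := by
  rw [← wrdSpan_univ (b := b), wrdSpan_eq_monSpan compatible_univ]
  congr 1
  ext u
  constructor
  · rintro ⟨S, -, h, rfl⟩; exact ⟨S, h, rfl⟩
  · rintro ⟨S, h, rfl⟩; exact ⟨S, fun _ _ => trivial, h, rfl⟩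

theorem mem_span_omon {X : Set (Multiset ι)} {u : U} :
    u ∈ Submodule.span ℂ (omon b '' X) ↔ ∀ S ∈ ((pbw b).repr u).support, S ∈ X := by
  have : omon b '' X = pbw b '' X := by simp
  rw [this, Module.Basis.mem_span_image]
  rfl

theorem mem_UP_iff {n : ℤ} {u : U} : u ∈ UP b n ↔ u ∈ Uplus s ∧ u ∈ grU s n := by
  constructor
  · exact fun h => ⟨UP_le_Uplus n h, UP_le_grU n h⟩
  · rintro ⟨h1, h2⟩
    have h1' : u ∈ Subalgebra.toSubmodule (Uplus s) := h1
    rw [Uplus_eq_omon (b := b), mem_span_omon] at h1'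
    rw [grU_eq_omon (b := b), mem_span_omon] at h2
    rw [UP, wrdSpan_eq_monSpan compatible_nonneg]
    have : u ∈ Submodule.span ℂ (omon b '' {S | (∀ i ∈ S, i ∈ nonneg b) ∧
        (S.map b.deg).sum = n}) := mem_span_omon.2 fun S hS => ⟨h1' S hS, h2 S hS⟩
    refine Submodule.span_mono ?_ this
    rintro _ ⟨S, ⟨h, h'⟩, rfl⟩
    exact ⟨S, h, h', rfl⟩

theorem UP_neg {n : ℤ} (hn : n < 0) {u : U} (hu : u ∈ UP b n) : u = 0 := by
  have : UP b n ≤ ⊥ := by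
    refine Submodule.span_le.2 ?_
    rintro _ ⟨l, h, h', rfl⟩
    have : 0 ≤ (l.map b.deg).sum := List.sum_nonneg fun d hd => by
      obtain ⟨i, hi, rfl⟩ := List.mem_map.1 hd
      exact not_lt.1 (h i hi)
    omega
  simpa using this hu

/-! ### Moving `U₊` past elements of `U` -/

variable (b) in
/-- The degree `n` part of `∑ U₊ w`, the sum over the pairs `(w, d)` in `W`, where `w` is given
degree `-d`. -/
def RC (W : Set (U × ℤ)) (n : ℤ) : Submodule ℂ U :=
  Submodule.span ℂ {z | ∃ p ∈ W, ∃ u ∈ UP b (n + p.2), u * p.1 = z}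

variable (b) in
/-- The degree `n` part of `∑ w U₊`, the sum over the pairs `(w, d)` in `W`, where `w` is given
degree `-d`. -/
def LC (W : Set (U × ℤ)) (n : ℤ) : Submodule ℂ U :=
  Submodule.span ℂ {z | ∃ p ∈ W, ∃ u ∈ UP b (n + p.2), p.1 * u = z}

theorem RC_mono {W W' : Set (U × ℤ)} (h : W ⊆ W') (n : ℤ) : RC b W n ≤ RC b W' n :=
  Submodule.span_mono fun _ ⟨p, hp, hu⟩ => ⟨p, h hp, hu⟩

theorem LC_mono {W W' : Set (U × ℤ)} (h : W ⊆ W') (n : ℤ) : LC b W n ≤ LC b W' n :=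
  Submodule.span_mono fun _ ⟨p, hp, hu⟩ => ⟨p, h hp, hu⟩

/-- The pairs needed to move the basis vector `x_a`, of negative degree, past `U₊`. -/
def lowPairs (b : HomogeneousBasis s ι) (d : ℤ) : Set (U × ℤ) :=
  insert (1, d) ((fun k => (toU (b.basis k), d - b.deg k)) '' {k | d ≤ b.deg k ∧ b.deg k ≤ -1})

theorem finite_lowPairs (d : ℤ) : (lowPairs b d).Finite :=
  ((b.finite_deg_Icc _ _).image _).insert _

theorem lie_basis_mul_mem {a i : ι} {p : Submodule ℂ U} {w : U}
    (h : ∀ k, b.deg k = b.deg a + b.deg i → toU (b.basis k) * w ∈ p) :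
    toU ⁅b.basis a, b.basis i⁆ * w ∈ p :=
  toU_mem_of (b := b) (s.lie_mem (b.mem a) (b.mem i)) (p := p.comap (LinearMap.mulRight ℂ w)) h

theorem mul_lie_basis_mem {a i : ι} {p : Submodule ℂ U} {w : U}
    (h : ∀ k, b.deg k = b.deg a + b.deg i → w * toU (b.basis k) ∈ p) :
    w * toU ⁅b.basis a, b.basis i⁆ ∈ p :=
  toU_mem_of (b := b) (s.lie_mem (b.mem a) (b.mem i)) (p := p.comap (LinearMap.mulLeft ℂ w)) h

theorem toU_mul_toU (x y : 𝔤) : toU x * toU y = toU y * toU x + toU ⁅x, y⁆ := by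
  rw [toU, toU, toU, LieHom.map_lie, LieRing.of_associative_ring_bracket]; abel

/-- Moving a basis vector `x_a` of negative degree to the right past an element of `U₊` leaves, on
the right, only `1` and the finitely many basis vectors of degrees between `deg x_a` and `-1`. -/
theorem basis_mul_wrd_mem (l : List ι) (hl : ∀ i ∈ l, i ∈ nonneg b) :
    ∀ a ∈ neg b, toU (b.basis a) * wrd b l ∈ RC b (lowPairs b (b.deg a)) (l.map b.deg).sum := by
  induction l with
  | nil =>
    intro a ha
    have ha' : b.deg a < 0 := ha
    refine Submodule.subset_span ⟨(toU (b.basis a), b.deg a - b.deg a), Or.inr ⟨a, ⟨le_rfl, ?_⟩, rfl⟩,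
      1, ?_, by simp⟩
    · omega
    · simpa using one_mem_wrdSpan (b := b) (nonneg b)
  | cons i l ih =>
    intro a ha
    have hi : i ∈ nonneg b := hl i List.mem_cons_self
    have hl' : ∀ j ∈ l, j ∈ nonneg b := fun j hj => hl j (List.mem_cons_of_mem _ hj)
    rw [wrd_cons, ← mul_assoc, toU_mul_toU, add_mul, mul_assoc, List.map_cons, List.sum_cons]
    refine add_mem ?_ (lie_basis_mul_mem fun k hk => ?_)
    · have : RC b (lowPairs b (b.deg a)) (l.map b.deg).sum ≤
          (RC b (lowPairs b (b.deg a)) (b.deg i + (l.map b.deg).sum)).comap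
            (LinearMap.mulLeft ℂ (toU (b.basis i))) := by
        refine Submodule.span_le.2 ?_
        rintro _ ⟨p, hp, u, hu, rfl⟩
        refine Submodule.subset_span ⟨p, hp, toU (b.basis i) * u, ?_, by simp [mul_assoc]⟩
        rw [add_assoc]
        exact mul_mem_wrdSpan (toU_basis_mem hi) hu
      exact this (ih hl' a ha)
    · by_cases hkn : b.deg k < 0
      · refine Submodule.span_mono ?_ (ih hl' k hkn)
        rintro _ ⟨p, hp, u, hu, rfl⟩
        have hi' : ¬ b.deg i < 0 := hi
        rcases hp with rfl | ⟨c, ⟨hc1, hc2⟩, rfl⟩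
        · refine ⟨(1, b.deg a), Or.inl rfl, u, ?_, rfl⟩
          convert hu using 2; dsimp only; omega
        · refine ⟨(toU (b.basis c), b.deg a - b.deg c), Or.inr ⟨c, ⟨by omega, hc2⟩, rfl⟩, u, ?_, rfl⟩
          convert hu using 2; dsimp only; omega
      · refine Submodule.subset_span ⟨(1, b.deg a), Or.inl rfl, toU (b.basis k) * wrd b l, ?_,
          by simp⟩
        have := mul_mem_wrdSpan (toU_basis_mem (b := b) (p := nonneg b) (i := k) hkn) (wrd_mem hl')
        convert this using 2; dsimp only; omega

/-- Moving a basis vector `x_a` of negative degree to the left past an element of `U₊` leaves, on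
the left, only `1` and the finitely many basis vectors of degrees between `deg x_a` and `-1`. -/
theorem wrd_mul_basis_mem (l : List ι) (hl : ∀ i ∈ l, i ∈ nonneg b) :
    ∀ a ∈ neg b, wrd b l * toU (b.basis a) ∈ LC b (lowPairs b (b.deg a)) (l.map b.deg).sum := by
  induction l using List.reverseRecOn with
  | nil =>
    intro a ha
    have ha' : b.deg a < 0 := ha
    refine Submodule.subset_span ⟨(toU (b.basis a), b.deg a - b.deg a), Or.inr ⟨a, ⟨le_rfl, ?_⟩, rfl⟩,
      1, ?_, by simp⟩
    · omega
    · simpa using one_mem_wrdSpan (b := b) (nonneg b)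
  | append_singleton l i ih =>
    intro a ha
    have hi : i ∈ nonneg b := hl i (by simp)
    have hl' : ∀ j ∈ l, j ∈ nonneg b := fun j hj => hl j (by simp [hj])
    rw [wrd_append, wrd_cons, wrd_nil, mul_one, mul_assoc, toU_mul_toU, mul_add, ← mul_assoc,
      List.map_append, List.sum_append, List.map_singleton, List.sum_singleton]
    refine add_mem ?_ (mul_lie_basis_mem fun k hk => ?_)
    · have : LC b (lowPairs b (b.deg a)) (l.map b.deg).sum ≤
          (LC b (lowPairs b (b.deg a)) ((l.map b.deg).sum + b.deg i)).comap
            (LinearMap.mulRight ℂ (toU (b.basis i))) := by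
        refine Submodule.span_le.2 ?_
        rintro _ ⟨p, hp, u, hu, rfl⟩
        refine Submodule.subset_span ⟨p, hp, u * toU (b.basis i), ?_, by simp [mul_assoc]⟩
        rw [add_right_comm]
        exact mul_mem_wrdSpan hu (toU_basis_mem hi)
      exact this (ih hl' a ha)
    · by_cases hkn : b.deg k < 0
      · refine Submodule.span_mono ?_ (ih hl' k hkn)
        rintro _ ⟨p, hp, u, hu, rfl⟩
        have hi' : ¬ b.deg i < 0 := hi
        rcases hp with rfl | ⟨c, ⟨hc1, hc2⟩, rfl⟩
        · refine ⟨(1, b.deg a), Or.inl rfl, u, ?_, rfl⟩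
          convert hu using 2; dsimp only; omega
        · refine ⟨(toU (b.basis c), b.deg a - b.deg c), Or.inr ⟨c, ⟨by omega, hc2⟩, rfl⟩, u, ?_, rfl⟩
          convert hu using 2; dsimp only; omega
      · refine Submodule.subset_span ⟨(1, b.deg a), Or.inl rfl, wrd b l * toU (b.basis k), ?_,
          by simp⟩
        have := mul_mem_wrdSpan (wrd_mem hl') (toU_basis_mem (b := b) (p := nonneg b) (i := k) hkn)
        convert this using 2; dsimp only; omega

/-- A subspace which contains `1` and is closed under left multiplication by basis vectors is all of
`U`. -/
theorem mem_of_left_closed {F : Submodule ℂ U} (h1 : (1 : U) ∈ F)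
    (h : ∀ i, ∀ v ∈ F, toU (b.basis i) * v ∈ F) (v : U) : v ∈ F := by
  have hw : ∀ l : List ι, wrd b l ∈ F := by
    intro l
    induction l with
    | nil => exact h1
    | cons i l ih => exact h i _ ih
  have : v ∈ Submodule.span ℂ (Set.range (pbw b)) := (pbw b).span_eq ▸ Submodule.mem_top
  refine Submodule.span_le.2 ?_ this
  rintro _ ⟨S, rfl⟩
  rw [pbw_apply]
  exact hw _

/-- A subspace which contains `1` and is closed under right multiplication by basis vectors is all
of `U`. -/
theorem mem_of_right_closed {F : Submodule ℂ U} (h1 : (1 : U) ∈ F)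
    (h : ∀ i, ∀ v ∈ F, v * toU (b.basis i) ∈ F) (v : U) : v ∈ F := by
  have hw : ∀ l : List ι, wrd b l ∈ F := by
    intro l
    induction l using List.reverseRecOn with
    | nil => exact h1
    | append_singleton l i ih => simpa using h i _ ih
  have : v ∈ Submodule.span ℂ (Set.range (pbw b)) := (pbw b).span_eq ▸ Submodule.mem_top
  refine Submodule.span_le.2 ?_ this
  rintro _ ⟨S, rfl⟩
  rw [pbw_apply]
  exact hw _

variable (b) in
/-- `v U₊ ⊆ ∑ U₊ w`, a finite sum. -/
theorem exists_mul_mem_RC (v : U) :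
    ∃ W : Set (U × ℤ), W.Finite ∧ ∀ n, ∀ u ∈ UP b n, v * u ∈ RC b W n := by
  let F : Submodule ℂ U :=
    { carrier := {v | ∃ W : Set (U × ℤ), W.Finite ∧ ∀ n, ∀ u ∈ UP b n, v * u ∈ RC b W n}
      zero_mem' := ⟨∅, Set.finite_empty, by simp⟩
      add_mem' := by
        rintro v v' ⟨W, hW, h⟩ ⟨W', hW', h'⟩
        refine ⟨W ∪ W', hW.union hW', fun n u hu => ?_⟩
        rw [add_mul]
        exact add_mem (RC_mono Set.subset_union_left _ (h n u hu))
          (RC_mono Set.subset_union_right _ (h' n u hu))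
      smul_mem' := by
        rintro a v ⟨W, hW, h⟩
        refine ⟨W, hW, fun n u hu => ?_⟩
        rw [smul_mul_assoc]
        exact Submodule.smul_mem _ _ (h n u hu) }
  refine mem_of_left_closed (b := b) (F := F) ?_ ?_ v
  · exact ⟨{(1, 0)}, Set.finite_singleton _, fun n u hu =>
      Submodule.subset_span ⟨(1, 0), rfl, u, by simpa using hu, by simp⟩⟩
  · rintro i v ⟨W, hW, h⟩
    by_cases hi : b.deg i < 0
    · refine ⟨Set.image2 (fun p q : U × ℤ => (p.1 * q.1, p.2 + q.2)) (lowPairs b (b.deg i)) W,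
        (finite_lowPairs _).image2 _ hW, fun n u hu => ?_⟩
      have key : RC b W n ≤ (RC b (Set.image2 (fun p q : U × ℤ => (p.1 * q.1, p.2 + q.2))
          (lowPairs b (b.deg i)) W) n).comap (LinearMap.mulLeft ℂ (toU (b.basis i))) := by
        refine Submodule.span_le.2 ?_
        rintro _ ⟨q, hq, z, hz, rfl⟩
        have h2 : UP b (n + q.2) ≤ (RC b (Set.image2 (fun p q : U × ℤ => (p.1 * q.1, p.2 + q.2))
          (lowPairs b (b.deg i)) W) n).comap (LinearMap.mulRight ℂ q.1 ∘ₗ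
            LinearMap.mulLeft ℂ (toU (b.basis i))) := by
          refine Submodule.span_le.2 ?_
          rintro _ ⟨l, hl, hs, rfl⟩
          have h3 : RC b (lowPairs b (b.deg i)) (l.map b.deg).sum ≤
              (RC b (Set.image2 (fun p q : U × ℤ => (p.1 * q.1, p.2 + q.2))
                (lowPairs b (b.deg i)) W) n).comap (LinearMap.mulRight ℂ q.1) := by
            refine Submodule.span_le.2 ?_
            rintro _ ⟨p, hp, z, hz, rfl⟩
            refine Submodule.subset_span ⟨_, ⟨p, hp, q, hq, rfl⟩, z, ?_, by simp [mul_assoc]⟩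
            convert hz using 2
            dsimp only
            omega
          exact h3 (basis_mul_wrd_mem l hl i hi)
        have := h2 hz
        simpa [mul_assoc] using this
      have := key (h n u hu)
      simpa [mul_assoc] using this
    · refine ⟨(fun q : U × ℤ => (q.1, b.deg i + q.2)) '' W, hW.image _, fun n u hu => ?_⟩
      have key : RC b W n ≤ (RC b ((fun q : U × ℤ => (q.1, b.deg i + q.2)) '' W) n).comap
          (LinearMap.mulLeft ℂ (toU (b.basis i))) := by
        refine Submodule.span_le.2 ?_
        rintro _ ⟨q, hq, z, hz, rfl⟩
        refine Submodule.subset_span ⟨_, ⟨q, hq, rfl⟩, toU (b.basis i) * z, ?_, by simp [mul_assoc]⟩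
        have := mul_mem_wrdSpan (toU_basis_mem (b := b) (p := nonneg b) (i := i) hi) hz
        convert this using 2
        dsimp only
        omega
      have := key (h n u hu)
      simpa [mul_assoc] using this

variable (b) in
/-- `U₊ w ⊆ ∑ v U₊`, a finite sum. -/
theorem exists_mul_mem_LC (w : U) :
    ∃ W : Set (U × ℤ), W.Finite ∧ ∀ n, ∀ u ∈ UP b n, u * w ∈ LC b W n := by
  let F : Submodule ℂ U :=
    { carrier := {v | ∃ W : Set (U × ℤ), W.Finite ∧ ∀ n, ∀ u ∈ UP b n, u * v ∈ LC b W n}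
      zero_mem' := ⟨∅, Set.finite_empty, by simp⟩
      add_mem' := by
        rintro v v' ⟨W, hW, h⟩ ⟨W', hW', h'⟩
        refine ⟨W ∪ W', hW.union hW', fun n u hu => ?_⟩
        rw [mul_add]
        exact add_mem (LC_mono Set.subset_union_left _ (h n u hu))
          (LC_mono Set.subset_union_right _ (h' n u hu))
      smul_mem' := by
        rintro a v ⟨W, hW, h⟩
        refine ⟨W, hW, fun n u hu => ?_⟩
        rw [mul_smul_comm]
        exact Submodule.smul_mem _ _ (h n u hu) }
  refine mem_of_right_closed (b := b) (F := F) ?_ ?_ w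
  · exact ⟨{(1, 0)}, Set.finite_singleton _, fun n u hu =>
      Submodule.subset_span ⟨(1, 0), rfl, u, by simpa using hu, by simp⟩⟩
  · rintro i v ⟨W, hW, h⟩
    by_cases hi : b.deg i < 0
    · refine ⟨Set.image2 (fun p q : U × ℤ => (q.1 * p.1, p.2 + q.2)) (lowPairs b (b.deg i)) W,
        (finite_lowPairs _).image2 _ hW, fun n u hu => ?_⟩
      have key : LC b W n ≤ (LC b (Set.image2 (fun p q : U × ℤ => (q.1 * p.1, p.2 + q.2))
          (lowPairs b (b.deg i)) W) n).comap (LinearMap.mulRight ℂ (toU (b.basis i))) := by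
        refine Submodule.span_le.2 ?_
        rintro _ ⟨q, hq, z, hz, rfl⟩
        have h2 : UP b (n + q.2) ≤ (LC b (Set.image2 (fun p q : U × ℤ => (q.1 * p.1, p.2 + q.2))
          (lowPairs b (b.deg i)) W) n).comap (LinearMap.mulLeft ℂ q.1 ∘ₗ
            LinearMap.mulRight ℂ (toU (b.basis i))) := by
          refine Submodule.span_le.2 ?_
          rintro _ ⟨l, hl, hs, rfl⟩
          have h3 : LC b (lowPairs b (b.deg i)) (l.map b.deg).sum ≤
              (LC b (Set.image2 (fun p q : U × ℤ => (q.1 * p.1, p.2 + q.2))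
                (lowPairs b (b.deg i)) W) n).comap (LinearMap.mulLeft ℂ q.1) := by
            refine Submodule.span_le.2 ?_
            rintro _ ⟨p, hp, z, hz, rfl⟩
            refine Submodule.subset_span ⟨_, ⟨p, hp, q, hq, rfl⟩, z, ?_, by simp [mul_assoc]⟩
            convert hz using 2
            dsimp only
            omega
          exact h3 (wrd_mul_basis_mem l hl i hi)
        have := h2 hz
        simpa [mul_assoc] using this
      have := key (h n u hu)
      simpa [mul_assoc] using this
    · refine ⟨(fun q : U × ℤ => (q.1, b.deg i + q.2)) '' W, hW.image _, fun n u hu => ?_⟩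
      have key : LC b W n ≤ (LC b ((fun q : U × ℤ => (q.1, b.deg i + q.2)) '' W) n).comap
          (LinearMap.mulRight ℂ (toU (b.basis i))) := by
        refine Submodule.span_le.2 ?_
        rintro _ ⟨q, hq, z, hz, rfl⟩
        refine Submodule.subset_span ⟨_, ⟨q, hq, rfl⟩, z * toU (b.basis i), ?_, by simp [mul_assoc]⟩
        have := mul_mem_wrdSpan hz (toU_basis_mem (b := b) (p := nonneg b) (i := i) hi)
        convert this using 2
        dsimp only
        omega
      have := key (h n u hu)
      simpa [mul_assoc] using this

end Monomials

/-! ### The partial derivatives along the negative letters -/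

section Derivatives

variable {𝔤 : Type u} [LieRing 𝔤] [LieAlgebra ℂ 𝔤] {s : SemiInfiniteStructure 𝔤}
  {ι : Type v} [LinearOrder ι] {b : HomogeneousBasis s ι}

local notation "U" => UniversalEnvelopingAlgebra ℂ 𝔤

theorem omon_add (R S : Multiset ι) (hR : ∀ i ∈ R, i ∈ nonneg b) (hS : ∀ i ∈ S, i ∈ neg b) :
    omon b (R + S) = omon b R * omon b S := by
  induction h : Multiset.card R generalizing R with
  | zero => obtain rfl := Multiset.card_eq_zero.1 h; simp
  | succ n ih =>
    obtain ⟨j, T, rfl, hT⟩ := @PBW.exists_cons_of_ne_zero ι (keyOrder b) R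
      (by rintro rfl; simp at h)
    have hj : j ∈ nonneg b := hR j (Multiset.mem_cons_self _ _)
    have e1 : omon b (j ::ₘ T) = toU (b.basis j) * omon b T :=
      @PBW.mon_cons ι ℂ 𝔤 (keyOrder b) _ _ _ b.basis j T hT
    have e2 : omon b (j ::ₘ (T + S)) = toU (b.basis j) * omon b (T + S) :=
      @PBW.mon_cons ι ℂ 𝔤 (keyOrder b) _ _ _ b.basis j (T + S) fun k hk => by
        rcases Multiset.mem_add.1 hk with hk | hk
        · exact hT k hk
        · exact keyOrder_le b hj (hS k hk)
    rw [Multiset.cons_add, e2, e1, mul_assoc,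
      ih T (fun i hi => hR i (Multiset.mem_cons_of_mem hi)) (by simpa using h)]

/-- Every ordered monomial is the product of one in `U₊` and one in `U₋`. -/
theorem omon_split (T : Multiset ι) : ∃ R S : Multiset ι, (∀ i ∈ R, i ∈ nonneg b) ∧
    (∀ i ∈ S, i ∈ neg b) ∧ T = R + S ∧ omon b T = omon b R * omon b S := by
  have h1 : ∀ i ∈ T.filter (fun i => ¬ b.deg i < 0), i ∈ nonneg b :=
    fun i hi => (Multiset.mem_filter.1 hi).2
  have h2 : ∀ i ∈ T.filter (fun i => b.deg i < 0), i ∈ neg b :=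
    fun i hi => (Multiset.mem_filter.1 hi).2
  refine ⟨_, _, h1, h2, ?_, ?_⟩
  · rw [add_comm, Multiset.filter_add_not]
  · rw [← omon_add _ _ h1 h2, add_comm, Multiset.filter_add_not]

theorem omon_mem_Uplus {R : Multiset ι} (hR : ∀ i ∈ R, i ∈ nonneg b) : omon b R ∈ Uplus s := by
  have : omon b R ∈ Subalgebra.toSubmodule (Uplus s) := by
    rw [Uplus_eq_omon (b := b)]
    exact Submodule.subset_span ⟨R, hR, rfl⟩
  exact this

/-- A subspace which contains all `z y_S`, with `z ∈ U₊` and `y_S` a negative ordered monomial, is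
all of `U`. -/
theorem mem_of_triangular {F : Submodule ℂ U}
    (h : ∀ z ∈ Uplus s, ∀ S : Multiset ι, (∀ i ∈ S, i ∈ neg b) → z * omon b S ∈ F) (v : U) :
    v ∈ F := by
  have : v ∈ Submodule.span ℂ (Set.range (pbw b)) := (pbw b).span_eq ▸ Submodule.mem_top
  refine Submodule.span_le.2 ?_ this
  rintro _ ⟨T, rfl⟩
  obtain ⟨R, S, hR, hS, -, e⟩ := omon_split (b := b) T
  rw [pbw_apply, e]
  exact h _ (omon_mem_Uplus hR) S hS

variable (b) in
/-- The left `U₊`-linear endomorphism of `U` which is the partial derivative with respect to `x_a`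
on the ordered monomials. -/
def pd (a : ι) : U →ₗ[ℂ] U :=
  (pbw b).constr ℂ fun T => (T.count a : ℂ) • omon b (T.erase a)

theorem pd_omon (a : ι) (T : Multiset ι) :
    pd b a (omon b T) = (T.count a : ℂ) • omon b (T.erase a) := by
  rw [← pbw_apply, pd, Module.Basis.constr_basis]

theorem pd_mul_omon {a : ι} (ha : a ∈ neg b) {z : U} (hz : z ∈ Uplus s) {S : Multiset ι}
    (hS : ∀ i ∈ S, i ∈ neg b) :
    pd b a (z * omon b S) = (S.count a : ℂ) • (z * omon b (S.erase a)) := by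
  have hz' : z ∈ Subalgebra.toSubmodule (Uplus s) := hz
  rw [Uplus_eq_omon (b := b)] at hz'
  have : Submodule.span ℂ (omon b '' {S | ∀ i ∈ S, i ∈ nonneg b}) ≤
      LinearMap.eqLocus (pd b a ∘ₗ LinearMap.mulRight ℂ (omon b S))
        ((S.count a : ℂ) • LinearMap.mulRight ℂ (omon b (S.erase a))) := by
    refine Submodule.span_le.2 ?_
    rintro _ ⟨R, hR, rfl⟩
    have haR : a ∉ R := fun h => hR a h ha
    change pd b a (omon b R * omon b S) = (S.count a : ℂ) • (omon b R * omon b (S.erase a))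
    rw [← omon_add R S hR hS, pd_omon, Multiset.erase_add_right_neg _ haR, Multiset.count_add,
      Multiset.count_eq_zero_of_notMem haR, zero_add,
      omon_add R _ hR fun i hi => hS i (Multiset.mem_of_mem_erase hi)]
  exact this hz'

/-- The partial derivatives along negative letters are left `U₊`-linear. -/
theorem pd_mul {a : ι} (ha : a ∈ neg b) {z : U} (hz : z ∈ Uplus s) (w : U) :
    pd b a (z * w) = z * pd b a w := by
  refine mem_of_triangular (b := b) (F := LinearMap.eqLocus (pd b a ∘ₗ LinearMap.mulLeft ℂ z)
    (LinearMap.mulLeft ℂ z ∘ₗ pd b a)) (fun z' hz' S hS => ?_) w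
  change pd b a (z * (z' * omon b S)) = z * pd b a (z' * omon b S)
  rw [← mul_assoc, pd_mul_omon ha (mul_mem hz hz') hS, pd_mul_omon ha hz' hS, mul_smul_comm,
    mul_assoc]

theorem pd_grU (a : ι) {n : ℤ} {v : U} (hv : v ∈ grU s n) : pd b a v ∈ grU s (n - b.deg a) := by
  rw [grU_eq_omon (b := b)] at hv
  have : Submodule.span ℂ (omon b '' {S | (S.map b.deg).sum = n}) ≤
      (grU s (n - b.deg a)).comap (pd b a) := by
    refine Submodule.span_le.2 ?_
    rintro _ ⟨T, rfl, rfl⟩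
    change pd b a (omon b T) ∈ grU s ((T.map b.deg).sum - b.deg a)
    rw [pd_omon]
    by_cases h : a ∈ T
    · refine Submodule.smul_mem _ _ ?_
      rw [grU_eq_omon (b := b)]
      refine Submodule.subset_span ⟨_, ?_, rfl⟩
      change ((T.erase a).map b.deg).sum = (T.map b.deg).sum - b.deg a
      conv_rhs => rw [← Multiset.cons_erase h]
      simp
    · simp [Multiset.count_eq_zero_of_notMem h]
  exact this hv

variable (b) in
/-- The span of the ordered monomials with at most `m` negative letters. -/
def Fil (m : ℤ) : Submodule ℂ U :=
  Submodule.span ℂ (omon b '' {T | (Multiset.card (T.filter fun i => b.deg i < 0) : ℤ) ≤ m})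

theorem Fil_mono {m n : ℤ} (h : m ≤ n) : Fil b m ≤ Fil b n :=
  Submodule.span_mono (Set.image_mono fun _ hT => le_trans hT h)

theorem Fil_neg {m : ℤ} (h : m < 0) {v : U} (hv : v ∈ Fil b m) : v = 0 := by
  have : {T : Multiset ι | (Multiset.card (T.filter fun i => b.deg i < 0) : ℤ) ≤ m} = ∅ := by
    ext T; simp; omega
  rw [Fil, this] at hv
  simpa using hv

theorem exists_mem_Fil (v : U) : ∃ m : ℕ, v ∈ Fil b m := by
  let F : Submodule ℂ U :=
    { carrier := {v | ∃ m : ℕ, v ∈ Fil b m}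
      zero_mem' := ⟨0, zero_mem _⟩
      add_mem' := by
        rintro v v' ⟨m, h⟩ ⟨m', h'⟩
        exact ⟨max m m', add_mem (Fil_mono (by simp) h) (Fil_mono (by simp) h')⟩
      smul_mem' := fun a v ⟨m, h⟩ => ⟨m, Submodule.smul_mem _ a h⟩ }
  have : v ∈ Submodule.span ℂ (Set.range (pbw b)) := (pbw b).span_eq ▸ Submodule.mem_top
  refine Submodule.span_le (p := F) |>.2 ?_ this
  rintro _ ⟨T, rfl⟩
  rw [pbw_apply]
  exact ⟨Multiset.card (T.filter fun i => b.deg i < 0), Submodule.subset_span ⟨T, by simp, rfl⟩⟩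

theorem filter_add_of_nonneg {R S : Multiset ι} (hR : ∀ i ∈ R, i ∈ nonneg b)
    (hS : ∀ i ∈ S, i ∈ neg b) : (R + S).filter (fun i => b.deg i < 0) = S := by
  have h1 : R.filter (fun i => b.deg i < 0) = 0 := Multiset.filter_eq_nil.2 fun i hi => hR i hi
  have h2 : S.filter (fun i => b.deg i < 0) = S := Multiset.filter_eq_self.2 fun i hi => hS i hi
  rw [Multiset.filter_add, h1, h2, zero_add]

theorem mul_omon_mem_Fil {z : U} (hz : z ∈ Uplus s) {S : Multiset ι} (hS : ∀ i ∈ S, i ∈ neg b)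
    {m : ℤ} (hm : (Multiset.card S : ℤ) ≤ m) : z * omon b S ∈ Fil b m := by
  have hz' : z ∈ Subalgebra.toSubmodule (Uplus s) := hz
  rw [Uplus_eq_omon (b := b)] at hz'
  have : Submodule.span ℂ (omon b '' {S | ∀ i ∈ S, i ∈ nonneg b}) ≤
      (Fil b m).comap (LinearMap.mulRight ℂ (omon b S)) := by
    refine Submodule.span_le.2 ?_
    rintro _ ⟨R, hR, rfl⟩
    change omon b R * omon b S ∈ Fil b m
    rw [← omon_add R S hR hS]
    refine Submodule.subset_span ⟨_, ?_, rfl⟩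
    rw [Set.mem_ofPred_eq, filter_add_of_nonneg hR hS]
    exact hm
  exact this hz'

/-- `Fil m` is spanned by the `z y_S`, with `z ∈ U₊` and `y_S` a negative ordered monomial of
length at most `m`. -/
theorem Fil_le {m : ℤ} {F : Submodule ℂ U}
    (h : ∀ z ∈ Uplus s, ∀ S : Multiset ι, (∀ i ∈ S, i ∈ neg b) → (Multiset.card S : ℤ) ≤ m →
      z * omon b S ∈ F) : Fil b m ≤ F := by
  refine Submodule.span_le.2 ?_
  rintro _ ⟨T, hT, rfl⟩
  obtain ⟨R, S, hR, hS, rfl, e⟩ := omon_split (b := b) T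
  rw [Set.mem_ofPred_eq, filter_add_of_nonneg hR hS] at hT
  rw [e]
  exact h _ (omon_mem_Uplus hR) S hS hT

theorem pd_mem_Fil {a : ι} (ha : a ∈ neg b) {m : ℤ} {v : U} (hv : v ∈ Fil b m) :
    pd b a v ∈ Fil b (m - 1) :=
  Fil_le (F := (Fil b (m - 1)).comap (pd b a)) (fun z hz S hS hm => by
    change pd b a (z * omon b S) ∈ Fil b (m - 1)
    rw [pd_mul_omon ha hz hS]
    by_cases h : a ∈ S
    · refine Submodule.smul_mem _ _ (mul_omon_mem_Fil hz
        (fun i hi => hS i (Multiset.mem_of_mem_erase hi)) ?_)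
      rw [← Multiset.cons_erase h, Multiset.card_cons] at hm
      push_cast at hm
      linarith
    · simp [Multiset.count_eq_zero_of_notMem h]) hv

/-- Modulo shorter monomials, multiplying a negative ordered monomial by a negative letter on the
right inserts the letter. -/
theorem omon_mul_sub_mem {a : ι} (ha : a ∈ neg b) {S : Multiset ι} (hS : ∀ i ∈ S, i ∈ neg b)
    {z : U} (hz : z ∈ Uplus s) :
    z * omon b S * toU (b.basis a) - z * omon b (a ::ₘ S) ∈ Fil b (Multiset.card S) := by
  obtain ⟨l, hl, hlw⟩ := @PBW.exists_word_eq_mon ι ℂ 𝔤 (keyOrder b) _ _ _ b.basis S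
  have hlS : ∀ i ∈ l, i ∈ neg b := fun i hi => hS i (by rw [← hl]; exact hi)
  have hlen : l.length = Multiset.card S := by rw [← hl, Multiset.coe_card]
  have hw : ∀ i ∈ l ++ [a], i ∈ neg b := by
    intro i hi
    rcases List.mem_append.1 hi with h | h
    · exact hlS i h
    · rw [List.mem_singleton.1 h]; exact ha
  have e1 : ((l ++ [a] : List ι) : Multiset ι) = a ::ₘ S := by
    rw [← Multiset.coe_add, hl, add_comm]; rfl
  have key := @PBW.Compatible.word_sub_mon ι ℂ 𝔤 (keyOrder b) _ _ _ b.basis _ _ compatible_neg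
    (l ++ [a]) hw
  rw [@PBW.Compatible.wordSpan_eq ι ℂ 𝔤 (keyOrder b) _ _ _ b.basis _ _ compatible_neg, e1,
    show (l ++ [a]).length - 1 = Multiset.card S by simp [hlen]] at key
  have e2 : PBW.word b.basis (l ++ [a]) = omon b S * toU (b.basis a) := by
    rw [PBW.word_append, PBW.word_cons, PBW.word_nil, mul_one, hlw]
    rfl
  rw [e2] at key
  have h3 : z * (omon b S * toU (b.basis a) - omon b (a ::ₘ S)) ∈ Fil b (Multiset.card S) := by
    refine Submodule.span_le (p := (Fil b (Multiset.card S)).comap (LinearMap.mulLeft ℂ z)) |>.2 ?_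
      key
    rintro _ ⟨S', h1, h2, -, rfl⟩
    exact mul_omon_mem_Fil (b := b) hz h1 (by exact_mod_cast h2)
  rwa [mul_sub, ← mul_assoc] at h3

theorem mul_toU_mem_Fil {a : ι} (ha : a ∈ neg b) {m : ℤ} {v : U} (hv : v ∈ Fil b m) :
    v * toU (b.basis a) ∈ Fil b (m + 1) :=
  Fil_le (F := (Fil b (m + 1)).comap (LinearMap.mulRight ℂ (toU (b.basis a))))
    (fun z hz S hS hm => by
      change z * omon b S * toU (b.basis a) ∈ Fil b (m + 1)
      rw [← sub_add_cancel (z * omon b S * toU (b.basis a)) (z * omon b (a ::ₘ S))]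
      refine add_mem (Fil_mono (by linarith) (omon_mul_sub_mem ha hS hz))
        (mul_omon_mem_Fil hz (fun i hi => ?_) (by simpa using hm))
      rcases Multiset.mem_cons.1 hi with rfl | hi
      exacts [ha, hS i hi]) hv

/-- Modulo shorter monomials, the partial derivatives and the right multiplications by letters
satisfy the relations of the Weyl algebra. -/
theorem pd_comm {a c : ι} (ha : a ∈ neg b) (hc : c ∈ neg b) {m : ℤ} {v : U} (hv : v ∈ Fil b m) :
    pd b c (v * toU (b.basis a)) - pd b c v * toU (b.basis a) - (if c = a then v else 0)
      ∈ Fil b (m - 1) := by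
  have h := Fil_le (b := b) (m := m) (F := (Fil b (m - 1)).comap
    (pd b c ∘ₗ LinearMap.mulRight ℂ (toU (b.basis a)) -
    LinearMap.mulRight ℂ (toU (b.basis a)) ∘ₗ pd b c - if c = a then LinearMap.id else 0))
    (fun z hz S hS hm => ?_) hv
  swap
  · have haS : ∀ i ∈ a ::ₘ S, i ∈ neg b := by
      intro i hi
      rcases Multiset.mem_cons.1 hi with rfl | hi
      exacts [ha, hS i hi]
    have hcS : ∀ i ∈ S.erase c, i ∈ neg b := fun i hi => hS i (Multiset.mem_of_mem_erase hi)
    have r1 := pd_mem_Fil hc (Fil_mono hm (omon_mul_sub_mem ha hS hz))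
    rw [map_sub, pd_mul_omon hc hz haS] at r1
    have r2 : (S.count c : ℂ) • (z * omon b (S.erase c) * toU (b.basis a) -
        z * omon b (a ::ₘ S.erase c)) ∈ Fil b (m - 1) := by
      by_cases h : c ∈ S
      · refine Submodule.smul_mem _ _ (Fil_mono ?_ (omon_mul_sub_mem ha hcS hz))
        rw [← Multiset.cons_erase h, Multiset.card_cons] at hm
        push_cast at hm
        linarith
      · simp [Multiset.count_eq_zero_of_notMem h]
    have r3 : ((a ::ₘ S).count c : ℂ) • (z * omon b ((a ::ₘ S).erase c)) -
        (S.count c : ℂ) • (z * omon b (a ::ₘ S.erase c)) =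
        if c = a then z * omon b S else 0 := by
      by_cases h : c = a
      · subst h
        rw [if_pos rfl, Multiset.erase_cons_head, Multiset.count_cons_self]
        by_cases h : c ∈ S
        · rw [Multiset.cons_erase h, ← sub_smul]; simp
        · simp [Multiset.count_eq_zero_of_notMem h]
      · rw [if_neg h, Multiset.erase_cons_tail _ (Ne.symm h), Multiset.count_cons_of_ne h, sub_self]
    have := sub_mem r1 r2
    change pd b c (z * omon b S * toU (b.basis a)) - pd b c (z * omon b S) * toU (b.basis a) -
      (if c = a then LinearMap.id else 0 : U →ₗ[ℂ] U) (z * omon b S) ∈ Fil b (m - 1)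
    rw [pd_mul_omon hc hz hS]
    convert this using 1
    rw [smul_mul_assoc, smul_sub]
    have e : (if c = a then LinearMap.id else 0 : U →ₗ[ℂ] U) (z * omon b S) =
        ((a ::ₘ S).count c : ℂ) • (z * omon b ((a ::ₘ S).erase c)) -
        (S.count c : ℂ) • (z * omon b (a ::ₘ S.erase c)) := by
      rw [r3]; split_ifs <;> simp
    rw [e]
    abel
  · have e : (if c = a then LinearMap.id else 0 : U →ₗ[ℂ] U) v = if c = a then v else 0 := by
      split_ifs <;> simp
    rw [← e]
    exact h

/-- Euler's formula, modulo shorter monomials. -/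
theorem euler_mem {m : ℤ} {v : U} (hv : v ∈ Fil b m) :
    ∃ A : Finset ι, ∀ A' : Finset ι, A ⊆ A' →
      ∑ a ∈ A'.filter (fun i => b.deg i < 0), pd b a v * toU (b.basis a) - (m : ℂ) • v
        ∈ Fil b (m - 1) := by
  let F : Submodule ℂ U :=
    { carrier := {v | ∃ A : Finset ι, ∀ A' : Finset ι, A ⊆ A' →
        ∑ a ∈ A'.filter (fun i => b.deg i < 0), pd b a v * toU (b.basis a) - (m : ℂ) • v
          ∈ Fil b (m - 1)}
      zero_mem' := ⟨∅, by simp⟩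
      add_mem' := by
        rintro v v' ⟨A, h⟩ ⟨A', h'⟩
        refine ⟨A ∪ A', fun B hB => ?_⟩
        have := add_mem (h B (Finset.union_subset_left hB)) (h' B (Finset.union_subset_right hB))
        convert this using 1
        simp only [map_add, add_mul, Finset.sum_add_distrib, smul_add]
        abel
      smul_mem' := by
        rintro a v ⟨A, h⟩
        refine ⟨A, fun B hB => ?_⟩
        have := Submodule.smul_mem _ a (h B hB)
        convert this using 1
        simp only [map_smul, smul_mul_assoc, smul_sub, Finset.smul_sum, smul_comm a] }
  refine Fil_le (F := F) (fun z hz S hS hm => ⟨S.toFinset, fun A' hA => ?_⟩) hv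
  have hS' : ∀ a, ∀ i ∈ S.erase a, i ∈ neg b := fun a i hi => hS i (Multiset.mem_of_mem_erase hi)
  have h1 : ∀ a ∈ A'.filter (fun i => b.deg i < 0),
      pd b a (z * omon b S) * toU (b.basis a) - (S.count a : ℂ) • (z * omon b S)
        ∈ Fil b (m - 1) := by
    intro a ha
    have ha' : a ∈ neg b := (Finset.mem_filter.1 ha).2
    rw [pd_mul_omon ha' hz hS]
    by_cases h : a ∈ S
    · have := omon_mul_sub_mem ha' (hS' a) hz
      rw [Multiset.cons_erase h] at this
      rw [smul_mul_assoc, ← smul_sub]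
      refine Submodule.smul_mem _ _ (Fil_mono ?_ this)
      rw [← Multiset.cons_erase h, Multiset.card_cons] at hm
      push_cast at hm
      linarith
    · simp [Multiset.count_eq_zero_of_notMem h]
  have h2 := Submodule.sum_mem _ h1
  rw [Finset.sum_sub_distrib, ← Finset.sum_smul] at h2
  have h3 : ∑ a ∈ A'.filter (fun i => b.deg i < 0), (S.count a : ℂ) = Multiset.card S := by
    rw [← Nat.cast_sum, Multiset.sum_count_eq_card]
    intro a ha
    exact Finset.mem_filter.2 ⟨hA (Multiset.mem_toFinset.2 ha), hS a ha⟩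
  rw [h3] at h2
  have h4 : ((Multiset.card S : ℂ) - (m : ℂ)) • (z * omon b S) ∈ Fil b (m - 1) := by
    rcases hm.lt_or_eq with hlt | heq
    · exact Submodule.smul_mem _ _ (mul_omon_mem_Fil hz hS (by linarith))
    · rw [← heq]; simp
  have := add_mem h2 h4
  convert this using 1
  rw [sub_smul]
  abel

/-- All but finitely many of the partial derivatives vanish on `U₊ v`. This makes the homotopy
locally finite. -/
theorem exists_pd_eq_zero (v : U) : ∃ A : Finset ι, ∀ z ∈ Uplus s, ∀ a ∈ neg b, a ∉ A →
    pd b a (z * v) = 0 := by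
  let F : Submodule ℂ U :=
    { carrier := {v | ∃ A : Finset ι, ∀ z ∈ Uplus s, ∀ a ∈ neg b, a ∉ A → pd b a (z * v) = 0}
      zero_mem' := ⟨∅, by simp⟩
      add_mem' := by
        rintro v v' ⟨A, h⟩ ⟨A', h'⟩
        refine ⟨A ∪ A', fun z hz a ha haA => ?_⟩
        rw [Finset.mem_union, not_or] at haA
        rw [mul_add, map_add, h z hz a ha haA.1, h' z hz a ha haA.2, add_zero]
      smul_mem' := by
        rintro r v ⟨A, h⟩
        refine ⟨A, fun z hz a ha haA => ?_⟩
        rw [mul_smul_comm, map_smul, h z hz a ha haA, smul_zero] }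
  refine mem_of_triangular (b := b) (F := F) (fun z hz S hS => ⟨S.toFinset, ?_⟩) v
  intro z' hz' a ha haS
  rw [← mul_assoc, pd_mul_omon ha (mul_mem hz' hz) hS,
    Multiset.count_eq_zero_of_notMem (by simpa using haS)]
  simp

end Derivatives

end SemiInfinite

end

namespace SemiInfinite

universe u v w w'

/-! ### Tame formal sums with general coefficients, and locally finite sums of operators -/

/-- Formal sums `∑_K c(K) ⊗ e_K` with `c(K) ∈ Hom(U, Y)`. -/
abbrev Formal (𝔤 : Type u) [LieRing 𝔤] [LieAlgebra ℂ 𝔤] (ι : Type v) (Y : Type w)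
    [AddCommGroup Y] [Module ℂ Y] : Type (max u v w) :=
  Finset ι → (UniversalEnvelopingAlgebra ℂ 𝔤 →ₗ[ℂ] Y)

section Tame

variable {𝔤 : Type u} [LieRing 𝔤] [LieAlgebra ℂ 𝔤] {s : SemiInfiniteStructure 𝔤}
  {ι : Type v} [LinearOrder ι] (b : HomogeneousBasis s ι)
  {Y Y' Y'' : Type*} [AddCommGroup Y] [Module ℂ Y] [AddCommGroup Y'] [Module ℂ Y']
  [AddCommGroup Y''] [Module ℂ Y'']

local notation "U" => UniversalEnvelopingAlgebra ℂ 𝔤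

/-- The formal sums whose part over `I ⊆ 𝔤₋` vanishes on `v U₊`. -/
def zeroAt (I : Finset ι) (v : U) : Submodule ℂ (Formal 𝔤 ι Y) where
  carrier := {c | ∀ K, starPart b.opp K = I → ∀ u ∈ Uplus s, c K (v * u) = 0}
  zero_mem' := by intro K _ u _; rfl
  add_mem' := by
    intro c c' h h' K hK u hu
    change c K (v * u) + c' K (v * u) = 0
    rw [h K hK u hu, h' K hK u hu, add_zero]
  smul_mem' := by
    intro a c h K hK u hu
    change a • c K (v * u) = 0
    rw [h K hK u hu, smul_zero]

/-- The formal sums whose part over `I ⊆ 𝔤₋`, restricted to `v U₊`, lies in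
`U₊* ⊗ Y ⊗ Λ(𝔤₊)`. -/
def niceAt (I : Finset ι) (v : U) : Submodule ℂ (Formal 𝔤 ι Y) where
  carrier := {c | ∃ (𝒦 : Finset (Finset ι)) (W : Submodule ℂ Y) (D : ℤ), FiniteDimensional ℂ W ∧
    ∀ K, starPart b.opp K = I → ∀ n, ∀ u ∈ UP b n,
      c K (v * u) ∈ W ∧ (c K (v * u) ≠ 0 → K ∈ 𝒦 ∧ n ≤ D)}
  zero_mem' := ⟨∅, ⊥, 0, inferInstance, fun K _ n u _ => by simp⟩
  add_mem' := by
    rintro c c' ⟨𝒦, W, D, hW, h⟩ ⟨𝒦', W', D', hW', h'⟩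
    refine ⟨𝒦 ∪ 𝒦', W ⊔ W', max D D', inferInstance, fun K hK n u hu => ⟨?_, fun hne => ?_⟩⟩
    · exact Submodule.add_mem_sup (h K hK n u hu).1 (h' K hK n u hu).1
    · by_cases h0 : c K (v * u) = 0
      · have h1 : c' K (v * u) ≠ 0 := fun h1 => hne (by
          change c K (v * u) + c' K (v * u) = 0
          rw [h0, h1, add_zero])
        have := (h' K hK n u hu).2 h1
        exact ⟨Finset.mem_union_right _ this.1, this.2.trans (le_max_right _ _)⟩
      · have := (h K hK n u hu).2 h0
        exact ⟨Finset.mem_union_left _ this.1, this.2.trans (le_max_left _ _)⟩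
  smul_mem' := by
    rintro a c ⟨𝒦, W, D, hW, h⟩
    refine ⟨𝒦, W, D, hW, fun K hK n u hu => ⟨?_, fun hne => ?_⟩⟩
    · exact Submodule.smul_mem _ a (h K hK n u hu).1
    · refine (h K hK n u hu).2 fun h0 => hne ?_
      change a • c K (v * u) = 0
      rw [h0, smul_zero]

variable {b}

theorem zeroAt_le_niceAt (I : Finset ι) (v : U) :
    (zeroAt b I v : Submodule ℂ (Formal 𝔤 ι Y)) ≤ niceAt b I v := fun _ h =>
  ⟨∅, ⊥, 0, inferInstance, fun K hK n u hu => by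
    have := h K hK u (UP_le_Uplus n hu)
    simp [this]⟩

theorem mem_zeroAt_of {I : Finset ι} {v : U} {c : Formal 𝔤 ι Y}
    (h : ∀ K, starPart b.opp K = I → ∀ n, ∀ u ∈ UP b n, c K (v * u) = 0) : c ∈ zeroAt b I v := by
  intro K hK u hu
  refine Uplus_le (b := b) (p := LinearMap.ker (c K ∘ₗ LinearMap.mulLeft ℂ v)) (fun n u hu => ?_) hu
  simpa using h K hK n u hu

theorem eq_zero_of_zeroAt {c : Formal 𝔤 ι Y} {K : Finset ι} {v : U}
    (h : c ∈ zeroAt b (starPart b.opp K) v) : c K v = 0 := by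
  simpa using h K rfl 1 (one_mem _)

variable (b Y) in
/-- The formal sums with coefficients in `Hom(U, Y)` which lie in the completed complex, up to the
conditions on degrees. -/
def tameY : Submodule ℂ (Formal 𝔤 ι Y) := ⨅ (I) (v), niceAt b I v

theorem mem_tameY {c : Formal 𝔤 ι Y} : c ∈ tameY b Y ↔ ∀ I v, c ∈ niceAt b I v := by
  simp [tameY, Submodule.mem_iInf]

/-- For coefficients in `U`, tameness is the finiteness condition in the definition of the cochains
with coefficients in `U* ⊗ U`. Over a fixed `I ⊆ 𝔤₋` only finitely many `K` matter, so that the bounds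
can be chosen uniformly in `K`. -/
theorem mem_tame_iff {c : FormalCochain 𝔤 ι} : c ∈ tame b ↔ c ∈ tameY b U := by
  rw [mem_tameY]
  constructor
  · rintro ⟨h1, h2, h3⟩ I v
    let W : Submodule ℂ U := ⨆ K : (h1 I v).toFinset,
      (Subalgebra.toSubmodule (Uplus s)).map (c (K : Finset ι) ∘ₗ LinearMap.mulLeft ℂ v)
    have : ∀ K, FiniteDimensional ℂ
      ((Subalgebra.toSubmodule (Uplus s)).map (c K ∘ₗ LinearMap.mulLeft ℂ v)) := fun K => h2 K v
    choose D hD using fun K => h3 K v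
    obtain ⟨M, hM⟩ := ((h1 I v).toFinset.image D).exists_le
    refine ⟨(h1 I v).toFinset, W, M, inferInstance, fun K hK n u hu => ?_⟩
    by_cases h0 : c K (v * u) = 0
    · exact ⟨by rw [h0]; exact zero_mem _, fun h => absurd h0 h⟩
    have hu' := UP_le_Uplus n hu
    have hmem : K ∈ (h1 I v).toFinset := by simpa using ⟨hK, u, hu', h0⟩
    refine ⟨Submodule.mem_iSup_of_mem ⟨K, hmem⟩ ⟨u, hu', rfl⟩, fun _ => ⟨hmem, ?_⟩⟩
    by_contra hn
    have hDM : D K ≤ M := hM _ (Finset.mem_image_of_mem _ hmem)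
    exact h0 (hD K n (by linarith) u hu' (UP_le_grU n hu))
  · intro h
    have key : ∀ K v, ∃ (𝒦 : Finset (Finset ι)) (W : Submodule ℂ U) (D : ℤ),
        FiniteDimensional ℂ W ∧ ∀ n, ∀ u ∈ UP b n,
      c K (v * u) ∈ W ∧ (c K (v * u) ≠ 0 → K ∈ 𝒦 ∧ n ≤ D) := fun K v => by
      obtain ⟨𝒦, W, D, hW, h⟩ := h (starPart b.opp K) v
      exact ⟨𝒦, W, D, hW, h K rfl⟩
    refine ⟨fun I v => ?_, fun K v => ?_, fun K v => ?_⟩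
    · obtain ⟨𝒦, W, D, hW, h⟩ := h I v
      refine 𝒦.finite_toSet.subset ?_
      rintro K ⟨hK, u, hu, hne⟩
      by_contra hK'
      refine hne (Uplus_le (b := b) (p := LinearMap.ker (c K ∘ₗ LinearMap.mulLeft ℂ v))
        (fun n u hu => ?_) hu)
      by_contra h0
      exact hK' ((h K hK n u hu).2 (by simpa using h0)).1
    · obtain ⟨𝒦, W, D, hW, h⟩ := key K v
      refine Submodule.finiteDimensional_of_le (S₂ := W) (Submodule.map_le_iff_le_comap.2
        fun u hu => ?_)
      exact Uplus_le (b := b) (p := W.comap (c K ∘ₗ LinearMap.mulLeft ℂ v))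
        (fun n u hu => (h n u hu).1) hu
    · obtain ⟨𝒦, W, D, hW, h⟩ := key K v
      refine ⟨D, fun n hn u hu hu' => ?_⟩
      by_contra h0
      exact absurd ((h n u (mem_UP_iff.2 ⟨hu, hu'⟩)).2 h0).2 (not_le.2 hn)

variable (b Y) in
/-- The space of tame formal sums. -/
structure Tame where
  val : Formal 𝔤 ι Y
  mem : val ∈ tameY b Y

namespace Tame

theorem val_injective : Function.Injective (Tame.val : Tame b Y → Formal 𝔤 ι Y) := by
  rintro ⟨c, hc⟩ ⟨c', hc'⟩ rfl
  rfl

instance : Zero (Tame b Y) := ⟨⟨0, zero_mem _⟩⟩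

instance : Add (Tame b Y) := ⟨fun c c' => ⟨c.1 + c'.1, add_mem c.2 c'.2⟩⟩

instance : Neg (Tame b Y) := ⟨fun c => ⟨-c.1, neg_mem c.2⟩⟩

instance : Sub (Tame b Y) := ⟨fun c c' => ⟨c.1 - c'.1, sub_mem c.2 c'.2⟩⟩

instance {R : Type*} [SMul R ℂ] [SMul R (Formal 𝔤 ι Y)] [IsScalarTower R ℂ (Formal 𝔤 ι Y)] :
    SMul R (Tame b Y) := ⟨fun a c => ⟨a • c.1, Submodule.smul_of_tower_mem _ a c.2⟩⟩

instance : AddCommGroup (Tame b Y) :=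
  val_injective.addCommGroup Tame.val rfl (fun _ _ => rfl) (fun _ => rfl) (fun _ _ => rfl)
    (fun _ _ => rfl) (fun _ _ => rfl)

/-- The underlying formal sum, as a linear function. -/
def valHom : Tame b Y →+ Formal 𝔤 ι Y where
  toFun := Tame.val
  map_zero' := rfl
  map_add' _ _ := rfl

instance : Module ℂ (Tame b Y) :=
  val_injective.module ℂ valHom fun _ _ => rfl

@[simp] theorem val_zero : (0 : Tame b Y).1 = 0 := rfl

@[simp] theorem val_add (c c' : Tame b Y) : (c + c').1 = c.1 + c'.1 := rfl

@[simp] theorem val_sub (c c' : Tame b Y) : (c - c').1 = c.1 - c'.1 := rfl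

@[simp] theorem val_neg (c : Tame b Y) : (-c).1 = -c.1 := rfl

@[simp] theorem val_smul (a : ℂ) (c : Tame b Y) : (a • c).1 = a • c.1 := rfl

@[simp] theorem val_sum {κ : Type*} (A : Finset κ) (c : κ → Tame b Y) :
    (∑ k ∈ A, c k).1 = ∑ k ∈ A, (c k).1 :=
  map_sum valHom c A

end Tame

theorem Tame.ext' {c c' : Tame b Y} (h : ∀ K v, c.1 K v = c'.1 K v) : c = c' :=
  Tame.val_injective (funext fun K => LinearMap.ext fun v => h K v)

variable (b) in
/-- An operator on formal sums which preserves tameness because the part of `T c` over `I`,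
restricted to `v U₊`, only depends on finitely many such parts of `c`. -/
def Bdd (T : Formal 𝔤 ι Y →ₗ[ℂ] Formal 𝔤 ι Y') : Prop :=
  ∀ I v, ∃ σ : Finset (Finset ι × U),
    (∀ c, (∀ p ∈ σ, c ∈ niceAt b p.1 p.2) → T c ∈ niceAt b I v) ∧
    (∀ c, (∀ p ∈ σ, c ∈ zeroAt b p.1 p.2) → T c ∈ zeroAt b I v)

/-- The operator on tame formal sums induced by a bounded operator. -/
def Bdd.lift {T : Formal 𝔤 ι Y →ₗ[ℂ] Formal 𝔤 ι Y'} (hT : Bdd b T) :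
    Tame b Y →ₗ[ℂ] Tame b Y' where
  toFun c := ⟨T c.1, mem_tameY.2 fun I v => by
    obtain ⟨σ, h, -⟩ := hT I v
    exact h c.1 fun p _ => mem_tameY.1 c.2 _ _⟩
  map_add' c c' := Tame.val_injective (T.map_add c.1 c'.1)
  map_smul' a c := Tame.val_injective (T.map_smul a c.1)

/-- Equicontinuity of a family of operators for the linear topology given by the `zeroAt`. -/
def EC {κ : Type*} (T : κ → Tame b Y →ₗ[ℂ] Tame b Y') : Prop :=
  ∀ I v, ∃ σ : Finset (Finset ι × U), ∀ k c, (∀ p ∈ σ, c.1 ∈ zeroAt b p.1 p.2) →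
    (T k c).1 ∈ zeroAt b I v

/-- Continuity of an operator for the linear topology given by the `zeroAt`. -/
def Cont (T : Tame b Y →ₗ[ℂ] Tame b Y') : Prop :=
  ∀ I v, ∃ σ : Finset (Finset ι × U), ∀ c, (∀ p ∈ σ, c.1 ∈ zeroAt b p.1 p.2) →
    (T c).1 ∈ zeroAt b I v

theorem Bdd.cont {T : Formal 𝔤 ι Y →ₗ[ℂ] Formal 𝔤 ι Y'} (hT : Bdd b T) : Cont hT.lift := by
  intro I v
  obtain ⟨σ, -, h⟩ := hT I v
  exact ⟨σ, fun c hc => h c.1 hc⟩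

theorem EC.cont {κ : Type*} {T : κ → Tame b Y →ₗ[ℂ] Tame b Y'} (h : EC T) (k : κ) :
    Cont (T k) := by
  intro I v
  obtain ⟨σ, h⟩ := h I v
  exact ⟨σ, h k⟩

theorem Cont.ec {κ : Type*} {T : Tame b Y →ₗ[ℂ] Tame b Y'} (h : Cont T) :
    EC fun _ : κ => T := by
  intro I v
  obtain ⟨σ, h⟩ := h I v
  exact ⟨σ, fun _ => h⟩

theorem EC.add {κ : Type*} {T T' : κ → Tame b Y →ₗ[ℂ] Tame b Y'} (h : EC T) (h' : EC T') :
    EC fun k => T k + T' k := by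
  classical
  intro I v
  obtain ⟨σ, h⟩ := h I v
  obtain ⟨σ', h'⟩ := h' I v
  exact ⟨σ ∪ σ', fun k c hc => add_mem (h k c fun p hp => hc p (Finset.mem_union_left _ hp))
    (h' k c fun p hp => hc p (Finset.mem_union_right _ hp))⟩

theorem EC.smul {κ : Type*} {T : κ → Tame b Y →ₗ[ℂ] Tame b Y'} (h : EC T) (a : κ → ℂ) :
    EC fun k => a k • T k := by
  intro I v
  obtain ⟨σ, h⟩ := h I v
  exact ⟨σ, fun k c hc => Submodule.smul_mem _ _ (h k c hc)⟩

theorem EC.comp {κ : Type*} {T : κ → Tame b Y →ₗ[ℂ] Tame b Y'}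
    {T' : κ → Tame b Y' →ₗ[ℂ] Tame b Y''} (h' : EC T') (h : EC T) :
    EC fun k => T' k ∘ₗ T k := by
  classical
  intro I v
  obtain ⟨σ', h'⟩ := h' I v
  choose σ h using h
  refine ⟨σ'.biUnion fun p => σ p.1 p.2, fun k c hc => h' k _ fun p hp => h p.1 p.2 k c
    fun q hq => hc q (Finset.mem_biUnion.2 ⟨p, hp, hq⟩)⟩

theorem Cont.add {T T' : Tame b Y →ₗ[ℂ] Tame b Y'} (h : Cont T) (h' : Cont T') :
    Cont (T + T') := (h.ec.add h'.ec).cont ()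

theorem Cont.smul {T : Tame b Y →ₗ[ℂ] Tame b Y'} (h : Cont T) (a : ℂ) :
    Cont (a • T) := (h.ec.smul fun _ => a).cont ()

theorem Cont.neg {T : Tame b Y →ₗ[ℂ] Tame b Y'} (h : Cont T) : Cont (-T) := by
  simpa using h.smul (-1)

theorem Cont.sub {T T' : Tame b Y →ₗ[ℂ] Tame b Y'} (h : Cont T) (h' : Cont T') :
    Cont (T - T') := by
  rw [sub_eq_add_neg]; exact h.add h'.neg

theorem Cont.comp {T : Tame b Y →ₗ[ℂ] Tame b Y'} {T' : Tame b Y' →ₗ[ℂ] Tame b Y''}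
    (h' : Cont T') (h : Cont T) : Cont (T' ∘ₗ T) := (h'.ec.comp h.ec).cont ()

theorem Cont.mul {T T' : Module.End ℂ (Tame b Y)} (h' : Cont T') (h : Cont T) :
    Cont (T' * T) := h'.comp h

theorem Cont.zero : Cont (0 : Tame b Y →ₗ[ℂ] Tame b Y') := fun _ _ =>
  ⟨∅, fun _ _ => zero_mem _⟩

theorem Cont.one : Cont (1 : Module.End ℂ (Tame b Y)) := fun I v =>
  ⟨{(I, v)}, fun _ h => h (I, v) (Finset.mem_singleton_self _)⟩

/-- A family of operators all but finitely many of which contribute to each part of `T c`. -/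
def LF {κ : Type*} (T : κ → Tame b Y →ₗ[ℂ] Tame b Y') : Prop :=
  ∀ c I v, {k | (T k c).1 ∉ zeroAt b I v}.Finite

theorem LF.finite_support {κ : Type*} {T : κ → Tame b Y →ₗ[ℂ] Tame b Y'} (h : LF T)
    (c : Tame b Y) (K : Finset ι) (v : U) :
    (Function.support fun k => (T k c).1 K v).Finite :=
  (h c (starPart b.opp K) v).subset fun _ hk hz => hk (eq_zero_of_zeroAt hz)

/-- If `e` agrees with a tame formal sum on each `v U₊` over each `I`, then `e` is tame. -/
theorem mem_tameY_of_local {e : Formal 𝔤 ι Y}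
    (h : ∀ I v, ∃ c ∈ tameY b Y, e - c ∈ zeroAt b I v) : e ∈ tameY b Y := by
  rw [mem_tameY]
  intro I v
  obtain ⟨c, hc, h⟩ := h I v
  have := add_mem (zeroAt_le_niceAt I v h) (mem_tameY.1 hc I v)
  rwa [sub_add_cancel] at this

/-- The sum of a locally finite family, as a formal sum. -/
def LF.formal {κ : Type*} {T : κ → Tame b Y →ₗ[ℂ] Tame b Y'} (h : LF T) (c : Tame b Y) :
    Formal 𝔤 ι Y' := fun K =>
  { toFun := fun v => ∑ᶠ k, (T k c).1 K v
    map_add' := fun v w => by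
      rw [← finsum_add_distrib (h.finite_support c K v) (h.finite_support c K w)]
      simp
    map_smul' := fun a v => by
      rw [RingHom.id_apply, smul_finsum' _ (h.finite_support c K v)]
      simp }

theorem LF.formal_eq {κ : Type*} {T : κ → Tame b Y →ₗ[ℂ] Tame b Y'} (h : LF T) (c : Tame b Y)
    {I : Finset ι} {v : U} {A : Finset κ} (hA : ∀ k, k ∉ A → (T k c).1 ∈ zeroAt b I v) :
    h.formal c - (∑ k ∈ A, T k c : Tame b Y').1 ∈ zeroAt b I v := by
  intro K hK u hu
  change (∑ᶠ k, (T k c).1 K (v * u)) - (∑ k ∈ A, T k c : Tame b Y').1 K (v * u) = 0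
  rw [finsum_eq_sum_of_support_subset (s := A)]
  · simp
  · intro k hk
    by_contra hkA
    exact hk (hA k hkA K hK u hu)

/-- The sum of a locally finite family of operators. -/
def locSum {κ : Type*} (T : κ → Tame b Y →ₗ[ℂ] Tame b Y') (h : LF T) :
    Tame b Y →ₗ[ℂ] Tame b Y' where
  toFun c := ⟨h.formal c, mem_tameY_of_local fun I v =>
    ⟨_, (∑ k ∈ (h c I v).toFinset, T k c).2, h.formal_eq c fun k hk => by simpa using hk⟩⟩
  map_add' c c' := Tame.ext' fun K v => by
    change ∑ᶠ k, (T k (c + c')).1 K v = ∑ᶠ k, (T k c).1 K v + ∑ᶠ k, (T k c').1 K v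
    rw [← finsum_add_distrib (h.finite_support c K v) (h.finite_support c' K v)]
    simp
  map_smul' a c := Tame.ext' fun K v => by
    change ∑ᶠ k, (T k (a • c)).1 K v = a • ∑ᶠ k, (T k c).1 K v
    rw [smul_finsum' _ (h.finite_support c K v)]
    simp

section locSum

variable {κ : Type*} {T T' : κ → Tame b Y →ₗ[ℂ] Tame b Y'}

theorem locSum_apply (h : LF T) (c : Tame b Y) (K : Finset ι) (v : U) :
    (locSum T h c).1 K v = ∑ᶠ k, (T k c).1 K v := rfl

theorem locSum_sub_mem (h : LF T) (c : Tame b Y)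
    {I : Finset ι} {v : U} {A : Finset κ} (hA : ∀ k, k ∉ A → (T k c).1 ∈ zeroAt b I v) :
    (locSum T h c - ∑ k ∈ A, T k c).1 ∈ zeroAt b I v := h.formal_eq c hA

theorem locSum_mem_zeroAt (h : LF T) {c : Tame b Y} {I : Finset ι} {v : U}
    (hA : ∀ k, (T k c).1 ∈ zeroAt b I v) : (locSum T h c).1 ∈ zeroAt b I v := by
  simpa using locSum_sub_mem h c (A := ∅) fun k _ => hA k

theorem EC.cont_locSum (hT : EC T) (h : LF T) : Cont (locSum T h) := by
  intro I v
  obtain ⟨σ, hσ⟩ := hT I v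
  exact ⟨σ, fun c hc => locSum_mem_zeroAt h fun k => hσ k c hc⟩

theorem LF.add (h : LF T) (h' : LF T') : LF fun k => T k + T' k := fun c I v =>
  ((h c I v).union (h' c I v)).subset fun k hk => by
    by_contra hn
    rw [Set.mem_union, not_or] at hn
    simp only [Set.mem_ofPred_eq, not_not] at hn
    exact hk (add_mem hn.1 hn.2)

theorem LF.smul (h : LF T) (a : κ → ℂ) : LF fun k => a k • T k := fun c I v =>
  (h c I v).subset fun _ hk hn => hk (Submodule.smul_mem _ _ hn)

theorem LF.comp_right (h : LF T) (R : Tame b Y'' →ₗ[ℂ] Tame b Y) : LF fun k => T k ∘ₗ R :=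
  fun c I v => h (R c) I v

theorem LF.comp_left (h : LF T) {R : Tame b Y' →ₗ[ℂ] Tame b Y''} (hR : Cont R) :
    LF fun k => R ∘ₗ T k := fun c I v => by
  obtain ⟨σ, hσ⟩ := hR I v
  refine (σ.finite_toSet.biUnion fun p _ => h c p.1 p.2).subset fun k hk => ?_
  by_contra hn
  simp only [Set.mem_iUnion, not_exists, Set.mem_ofPred_eq, not_not] at hn
  exact hk (hσ _ fun p hp => hn p hp)

theorem locSum_comp (h : LF T) (R : Tame b Y'' →ₗ[ℂ] Tame b Y) :
    locSum T h ∘ₗ R = locSum (fun k => T k ∘ₗ R) (h.comp_right R) := rfl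

theorem comp_locSum (h : LF T) {R : Tame b Y' →ₗ[ℂ] Tame b Y''} (hR : Cont R) :
    R ∘ₗ locSum T h = locSum (fun k => R ∘ₗ T k) (h.comp_left hR) := by
  classical
  refine LinearMap.ext fun c => Tame.ext' fun K v => ?_
  obtain ⟨σ, hσ⟩ := hR (starPart b.opp K) v
  let A : Finset κ := σ.biUnion fun p => (h c p.1 p.2).toFinset
  have hA : ∀ k, k ∉ A → ∀ p ∈ σ, (T k c).1 ∈ zeroAt b p.1 p.2 := by
    intro k hk p hp
    by_contra hn
    exact hk (Finset.mem_biUnion.2 ⟨p, hp, by simpa using hn⟩)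
  have h1 := eq_zero_of_zeroAt (hσ (locSum T h c - ∑ k ∈ A, T k c)
    fun p hp => locSum_sub_mem h c fun k hk => hA k hk p hp)
  have h2 := eq_zero_of_zeroAt (locSum_sub_mem (h.comp_left hR) c (A := A)
    (I := starPart b.opp K) (v := v) fun k hk => hσ _ (hA k hk))
  rw [map_sub, map_sum] at h1
  change (R (locSum T h c)).1 K v - (∑ k ∈ A, R (T k c)).1 K v = 0 at h1
  change (locSum (fun k => R ∘ₗ T k) (h.comp_left hR) c).1 K v -
    (∑ k ∈ A, R (T k c)).1 K v = 0 at h2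
  exact (sub_eq_zero.1 h1).trans (sub_eq_zero.1 h2).symm

theorem locSum_add (h : LF T) (h' : LF T') :
    locSum (fun k => T k + T' k) (h.add h') = locSum T h + locSum T' h' := by
  refine LinearMap.ext fun c => Tame.ext' fun K v => ?_
  exact finsum_add_distrib (h.finite_support c K v) (h'.finite_support c K v)

theorem locSum_smul (h : LF T) (a : ℂ) :
    locSum (fun k => a • T k) (h.smul fun _ => a) = a • locSum T h := by
  refine LinearMap.ext fun c => Tame.ext' fun K v => ?_
  exact (smul_finsum' a (h.finite_support c K v)).symm

theorem locSum_single (h : LF T) (k : κ) (hk : ∀ j, j ≠ k → T j = 0) : locSum T h = T k := by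
  refine LinearMap.ext fun c => Tame.ext' fun K v => ?_
  rw [locSum_apply]
  exact finsum_eq_single _ k fun j hj => by rw [hk j hj]; rfl

/-- A condition on the individual values of a formal sum passes to locally finite sums. -/
theorem locSum_pointwise (h : LF T) {c : Tame b Y} {K : Finset ι} {v : U} {S : Submodule ℂ Y'}
    (hS : ∀ k, (T k c).1 K v ∈ S) : (locSum T h c).1 K v ∈ S := by
  rw [locSum_apply]
  exact finsum_induction (· ∈ S) (zero_mem _) (fun _ _ => add_mem) hS

end locSum

end Tame

/-! ### Canonical anticommutation relations -/

section CAR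

variable {ι : Type v} [LinearOrder ι] {V : Type w} [AddCommGroup V] [Module ℂ V]

theorem sgn_insert {i j : ι} {K : Finset ι} (hj : j ∉ K) :
    sgn i (insert j K) = (if j < i then -1 else 1) * sgn i K := by
  unfold sgn
  rw [Finset.filter_insert]
  split_ifs with h
  · rw [Finset.card_insert_of_notMem (by simp [hj]), pow_succ']
  · rw [one_mul]

theorem sgn_insert_self (i : ι) (K : Finset ι) : sgn i (insert i K) = sgn i K := by
  unfold sgn
  rw [Finset.filter_insert, if_neg (lt_irrefl i)]

theorem sgn_erase {i j : ι} {K : Finset ι} (hj : j ∈ K) :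
    sgn i (K.erase j) = (if j < i then -1 else 1) * sgn i K := by
  conv_rhs => rw [← Finset.insert_erase hj, sgn_insert (Finset.notMem_erase j K)]
  split_ifs <;> simp

theorem sgn_mul_self (i : ι) (K : Finset ι) : sgn i K * sgn i K = 1 := by
  unfold sgn
  rw [← mul_pow]; simp

theorem sign_swap {i j : ι} (h : i ≠ j) :
    (if i < j then (-1 : ℂ) else 1) = -(if j < i then -1 else 1) := by
  rcases lt_or_gt_of_ne h with h | h
  · rw [if_pos h, if_neg h.not_gt]
  · rw [if_pos h, if_neg h.not_gt, neg_neg]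

theorem creation_creation (i j : ι) (c : Finset ι → V) :
    creation i (creation j c) + creation j (creation i c) = 0 := by
  funext K
  change (if i ∈ K then sgn i K • (if j ∈ K.erase i then sgn j (K.erase i) •
      c ((K.erase i).erase j) else 0) else 0) +
    (if j ∈ K then sgn j K • (if i ∈ K.erase j then sgn i (K.erase j) •
      c ((K.erase j).erase i) else 0) else 0) = 0
  by_cases hij : i = j
  · subst hij; simp
  by_cases hi : i ∈ K <;> by_cases hj : j ∈ K <;> simp [hi, hj, hij, Ne.symm hij]
  rw [sgn_erase hi, sgn_erase hj, Finset.erase_right_comm, smul_smul, smul_smul, ← add_smul,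
    sign_swap hij]
  have : sgn i K * (-(if j < i then (-1 : ℂ) else 1) * sgn j K) +
      sgn j K * ((if j < i then -1 else 1) * sgn i K) = 0 := by ring
  rw [this, zero_smul]

theorem annihilation_annihilation (i j : ι) (c : Finset ι → V) :
    annihilation i (annihilation j c) + annihilation j (annihilation i c) = 0 := by
  funext K
  change (if i ∈ K then 0 else sgn i K • (if j ∈ insert i K then 0 else sgn j (insert i K) •
      c (insert j (insert i K)))) +
    (if j ∈ K then 0 else sgn j K • (if i ∈ insert j K then 0 else sgn i (insert j K) •
      c (insert i (insert j K)))) = 0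
  by_cases hij : i = j
  · subst hij; simp
  by_cases hi : i ∈ K <;> by_cases hj : j ∈ K <;> simp [hi, hj, hij, Ne.symm hij]
  rw [sgn_insert hi, sgn_insert hj, Finset.insert_comm, smul_smul, smul_smul, ← add_smul,
    sign_swap hij]
  have : sgn i K * (-(if j < i then (-1 : ℂ) else 1) * sgn j K) +
      sgn j K * ((if j < i then -1 else 1) * sgn i K) = 0 := by ring
  rw [this, zero_smul]

theorem annihilation_creation (i j : ι) (c : Finset ι → V) :
    annihilation i (creation j c) + creation j (annihilation i c) =
      if i = j then c else 0 := by
  funext K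
  change (if i ∈ K then 0 else sgn i K • (if j ∈ insert i K then sgn j (insert i K) •
      c ((insert i K).erase j) else 0)) +
    (if j ∈ K then sgn j K • (if i ∈ K.erase j then 0 else sgn i (K.erase j) •
      c (insert i (K.erase j))) else 0) = (if i = j then c else 0) K
  by_cases hij : i = j
  · subst hij
    by_cases hi : i ∈ K
    · simp only [hi, if_true, zero_add, Finset.notMem_erase, if_false]
      rw [sgn_erase hi, if_neg (lt_irrefl i), one_mul, smul_smul, sgn_mul_self, one_smul,
        Finset.insert_erase hi]
    · simp only [hi, if_false, if_true, Finset.mem_insert_self, add_zero]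
      rw [sgn_insert_self, smul_smul, sgn_mul_self, one_smul, Finset.erase_insert hi]
  · rw [if_neg hij]
    change _ = (0 : V)
    by_cases hi : i ∈ K <;> by_cases hj : j ∈ K <;> simp [hi, hj, hij, Ne.symm hij]
    rw [sgn_insert hi, sgn_erase hj, Finset.erase_insert_of_ne hij, smul_smul, smul_smul,
      ← add_smul, sign_swap hij]
    have : sgn i K * (-(if j < i then (-1 : ℂ) else 1) * sgn j K) +
        sgn j K * ((if j < i then -1 else 1) * sgn i K) = 0 := by ring
    rw [this, zero_smul]

end CAR

/-! ### The basic operators on tame formal sums -/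

section Operators

variable {𝔤 : Type u} [LieRing 𝔤] [LieAlgebra ℂ 𝔤] {s : SemiInfiniteStructure 𝔤}
  {ι : Type v} [LinearOrder ι] {b : HomogeneousBasis s ι}
  {Y Y' Y'' : Type*} [AddCommGroup Y] [Module ℂ Y] [AddCommGroup Y'] [Module ℂ Y']
  [AddCommGroup Y''] [Module ℂ Y'']

local notation "U" => UniversalEnvelopingAlgebra ℂ 𝔤

theorem starPart_erase (i : ι) (K : Finset ι) :
    starPart b.opp (K.erase i) = (starPart b.opp K).erase i := by
  ext j; simp [starPart, and_assoc]

theorem starPart_insert_eq (i : ι) (K : Finset ι) :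
    starPart b.opp (insert i K) =
      if b.opp i then insert i (starPart b.opp K) else starPart b.opp K := by
  unfold starPart
  rw [Finset.filter_insert]

theorem mem_starPart {i : ι} {K : Finset ι} : i ∈ starPart b.opp K ↔ i ∈ K ∧ b.deg i < 0 := by
  simp [starPart]

theorem creation_zeroAt {i : ι} {I : Finset ι} {v : U} {c : Formal 𝔤 ι Y}
    (h : c ∈ zeroAt b (I.erase i) v) : creation i c ∈ zeroAt b I v := by
  intro K hK u hu
  change (if i ∈ K then sgn i K • c (K.erase i) else 0) (v * u) = 0
  split_ifs
  · change sgn i K • c (K.erase i) (v * u) = 0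
    rw [h _ (by rw [starPart_erase, hK]) u hu, smul_zero]
  · rfl

theorem annihilation_zeroAt {i : ι} {I : Finset ι} {v : U} {c : Formal 𝔤 ι Y}
    (h : c ∈ zeroAt b (if b.opp i then insert i I else I) v) :
    annihilation i c ∈ zeroAt b I v := by
  intro K hK u hu
  change (if i ∈ K then 0 else sgn i K • c (insert i K)) (v * u) = 0
  split_ifs
  · rfl
  · change sgn i K • c (insert i K) (v * u) = 0
    rw [h _ (by rw [starPart_insert_eq, hK]) u hu, smul_zero]

variable (b) in
theorem creation_bdd (i : ι) : Bdd b (creation i : Formal 𝔤 ι Y →ₗ[ℂ] _) := by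
  intro I v
  refine ⟨{(I.erase i, v)}, fun c hc => ?_, fun c hc => ?_⟩
  · obtain ⟨𝒦, W, D, hW, h⟩ := hc _ (Finset.mem_singleton_self _)
    refine ⟨𝒦.image (insert i), W, D, hW, fun K hK n u hu => ?_⟩
    change (if i ∈ K then sgn i K • c (K.erase i) else 0) (v * u) ∈ W ∧
      ((if i ∈ K then sgn i K • c (K.erase i) else 0) (v * u) ≠ 0 → _)
    split_ifs with hi
    · have := h (K.erase i) (by rw [starPart_erase, hK]) n u hu
      refine ⟨Submodule.smul_mem _ _ this.1, fun hne => ?_⟩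
      have := this.2 fun h0 => hne (by
        change sgn i K • c (K.erase i) (v * u) = 0
        rw [h0, smul_zero])
      exact ⟨Finset.mem_image.2 ⟨_, this.1, Finset.insert_erase hi⟩, this.2⟩
    · exact ⟨zero_mem _, fun h => absurd rfl h⟩
  · exact creation_zeroAt (hc _ (Finset.mem_singleton_self _))

variable (b) in
theorem annihilation_bdd (i : ι) : Bdd b (annihilation i : Formal 𝔤 ι Y →ₗ[ℂ] _) := by
  intro I v
  refine ⟨{(if b.opp i then insert i I else I, v)}, fun c hc => ?_, fun c hc => ?_⟩
  · obtain ⟨𝒦, W, D, hW, h⟩ := hc _ (Finset.mem_singleton_self _)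
    refine ⟨𝒦.image (fun K => K.erase i), W, D, hW, fun K hK n u hu => ?_⟩
    change (if i ∈ K then 0 else sgn i K • c (insert i K)) (v * u) ∈ W ∧
      ((if i ∈ K then 0 else sgn i K • c (insert i K)) (v * u) ≠ 0 → _)
    split_ifs with hi
    · exact ⟨zero_mem _, fun h => absurd rfl h⟩
    · have := h (insert i K) (by rw [starPart_insert_eq, hK]) n u hu
      refine ⟨Submodule.smul_mem _ _ this.1, fun hne => ?_⟩
      have := this.2 fun h0 => hne (by
        change sgn i K • c (insert i K) (v * u) = 0
        rw [h0, smul_zero])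
      exact ⟨Finset.mem_image.2 ⟨_, this.1, Finset.erase_insert hi⟩, this.2⟩
  · exact annihilation_zeroAt (hc _ (Finset.mem_singleton_self _))

variable (b Y) in
/-- The operator `creation i` on tame formal sums. -/
def cr (i : ι) : Module.End ℂ (Tame b Y) := (creation_bdd b i).lift

variable (b Y) in
/-- The operator `annihilation i` on tame formal sums. -/
def an (i : ι) : Module.End ℂ (Tame b Y) := (annihilation_bdd b i).lift

theorem cr_apply (i : ι) (c : Tame b Y) (K : Finset ι) (v : U) :
    (cr b Y i c).1 K v = if i ∈ K then sgn i K • c.1 (K.erase i) v else 0 := by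
  change (if i ∈ K then sgn i K • c.1 (K.erase i) else 0) v = _
  split_ifs <;> rfl

theorem an_apply (i : ι) (c : Tame b Y) (K : Finset ι) (v : U) :
    (an b Y i c).1 K v = if i ∈ K then 0 else sgn i K • c.1 (insert i K) v := by
  change (if i ∈ K then 0 else sgn i K • c.1 (insert i K)) v = _
  split_ifs <;> rfl

theorem cr_cr (i j : ι) : cr b Y i * cr b Y j + cr b Y j * cr b Y i = 0 :=
  LinearMap.ext fun c => Tame.val_injective (creation_creation i j c.1)

theorem an_an (i j : ι) : an b Y i * an b Y j + an b Y j * an b Y i = 0 :=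
  LinearMap.ext fun c => Tame.val_injective (annihilation_annihilation i j c.1)

theorem an_cr (i j : ι) : an b Y i * cr b Y j + cr b Y j * an b Y i = if i = j then 1 else 0 := by
  refine LinearMap.ext fun c => Tame.val_injective ((annihilation_creation i j c.1).trans ?_)
  split_ifs <;> rfl

theorem cr_an (i j : ι) : cr b Y i * an b Y j + an b Y j * cr b Y i = if i = j then 1 else 0 := by
  rw [add_comm, an_cr]
  simp only [eq_comm]

theorem cont_cr (i : ι) : Cont (cr b Y i) := (creation_bdd b i).cont

theorem cont_an (i : ι) : Cont (an b Y i) := (annihilation_bdd b i).cont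

/-! ### Operators acting on the coefficients -/

/-- Composition of the coefficients with a linear map on the right. -/
def preFormal (r : U →ₗ[ℂ] U) : Formal 𝔤 ι Y →ₗ[ℂ] Formal 𝔤 ι Y where
  toFun c K := c K ∘ₗ r
  map_add' _ _ := rfl
  map_smul' _ _ := rfl

/-- Composition of the coefficients with a linear map on the left. -/
def postFormal (g : Y →ₗ[ℂ] Y') : Formal 𝔤 ι Y →ₗ[ℂ] Formal 𝔤 ι Y' where
  toFun c K := g ∘ₗ c K
  map_add' _ _ := by funext K; exact LinearMap.comp_add _ _ _
  map_smul' _ _ := by funext K; exact LinearMap.comp_smul _ _ _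

variable (b) in
/-- The linear maps `r` such that `r(v u)`, for `u ∈ U₊`, is a combination of finitely many
elements `v' u'`, with `u' ∈ U₊` of degree bounded below in terms of that of `u`. -/
def Adm (r : U →ₗ[ℂ] U) : Prop :=
  ∀ v, ∃ W : Set (U × ℤ), W.Finite ∧ ∀ n, ∀ u ∈ UP b n, r (v * u) ∈ LC b W n

theorem apply_mem_of_LC {W : Set (U × ℤ)} {n : ℤ} {x : U} (hx : x ∈ LC b W n) {φ : U →ₗ[ℂ] Y}
    {S : Submodule ℂ Y} (h : ∀ p ∈ W, ∀ u ∈ UP b (n + p.2), φ (p.1 * u) ∈ S) : φ x ∈ S := by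
  have : LC b W n ≤ S.comap φ := Submodule.span_le.2 (by
    rintro _ ⟨p, hp, u, hu, rfl⟩
    exact h p hp u hu)
  exact this hx

theorem preFormal_zeroAt {r : U →ₗ[ℂ] U} {v : U} {W : Set (U × ℤ)}
    (hW : ∀ n, ∀ u ∈ UP b n, r (v * u) ∈ LC b W n) {I : Finset ι} {c : Formal 𝔤 ι Y}
    (hc : ∀ p ∈ W, c ∈ zeroAt b I p.1) : preFormal r c ∈ zeroAt b I v := by
  refine mem_zeroAt_of fun K hK n u hu => ?_
  refine (Submodule.mem_bot ℂ).1 (apply_mem_of_LC (hW n u hu) (φ := c K) fun p hp u' hu' => ?_)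
  exact (Submodule.mem_bot ℂ).2 (hc p hp K hK u' (UP_le_Uplus _ hu'))

theorem Adm.bdd {r : U →ₗ[ℂ] U} (hr : Adm b r) :
    Bdd b (preFormal r : Formal 𝔤 ι Y →ₗ[ℂ] _) := by
  classical
  intro I v
  obtain ⟨W, hW, h⟩ := hr v
  refine ⟨hW.toFinset.image fun p => (I, p.1), fun c hc => ?_, fun c hc => ?_⟩
  · have hc' : ∀ p : hW.toFinset, c ∈ niceAt b I p.1.1 := fun p =>
      hc (I, p.1.1) (Finset.mem_image.2 ⟨p, p.2, rfl⟩)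
    choose 𝒦 S D hS hc' using hc'
    obtain ⟨M, hM⟩ := (Finset.univ.image fun p : hW.toFinset => D p - p.1.2).exists_le
    refine ⟨Finset.univ.biUnion 𝒦, ⨆ p, S p, M, inferInstance, fun K hK n u hu => ⟨?_, ?_⟩⟩
    · refine apply_mem_of_LC (h n u hu) (φ := c K) fun p hp u' hu' => ?_
      exact Submodule.mem_iSup_of_mem ⟨p, by simpa using hp⟩
        (hc' ⟨p, by simpa using hp⟩ K hK _ u' hu').1
    · intro hne
      by_contra hcon
      refine hne ((Submodule.mem_bot ℂ).1
        (apply_mem_of_LC (h n u hu) (φ := c K) fun p hp u' hu' => (Submodule.mem_bot ℂ).2 ?_))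
      by_contra h0
      have hp' : p ∈ hW.toFinset := by simpa using hp
      have := (hc' ⟨p, hp'⟩ K hK _ u' hu').2 h0
      refine hcon ⟨Finset.mem_biUnion.2 ⟨_, Finset.mem_univ _, this.1⟩, ?_⟩
      have := hM _ (Finset.mem_image.2 ⟨⟨p, hp'⟩, Finset.mem_univ _, rfl⟩)
      have h2 := (hc' ⟨p, hp'⟩ K hK _ u' hu').2 h0
      linarith [h2.2]
  · refine preFormal_zeroAt h fun p hp => ?_
    exact hc (I, p.1) (Finset.mem_image.2 ⟨p, by simpa using hp, rfl⟩)

theorem postFormal_zeroAt (g : Y →ₗ[ℂ] Y') {v : U} {I : Finset ι} {c : Formal 𝔤 ι Y}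
    (hc : c ∈ zeroAt b I v) : postFormal g c ∈ zeroAt b I v := by
  intro K hK u hu
  change g (c K (v * u)) = 0
  rw [hc K hK u hu, map_zero]

theorem postFormal_niceAt (g : Y →ₗ[ℂ] Y') {v : U} {I : Finset ι} {c : Formal 𝔤 ι Y}
    (hc : c ∈ niceAt b I v) : postFormal g c ∈ niceAt b I v := by
  obtain ⟨𝒦, W, D, hW, h⟩ := hc
  refine ⟨𝒦, W.map g, D, inferInstance, fun K hK n u hu => ⟨?_, fun hne => ?_⟩⟩
  · exact Submodule.mem_map_of_mem (h K hK n u hu).1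
  · exact (h K hK n u hu).2 fun h0 => hne (by
      change g (c K (v * u)) = 0
      rw [h0, map_zero])

variable (b) in
theorem post_bdd (g : Y →ₗ[ℂ] Y') : Bdd b (postFormal g : Formal 𝔤 ι Y →ₗ[ℂ] _) := fun I v =>
  ⟨{(I, v)}, fun _ hc => postFormal_niceAt g (hc _ (Finset.mem_singleton_self _)),
    fun _ hc => postFormal_zeroAt g (hc _ (Finset.mem_singleton_self _))⟩

variable (Y) in
/-- Composition of the coefficients of a tame formal sum with an admissible map on the right. -/
def pre {r : U →ₗ[ℂ] U} (hr : Adm b r) : Module.End ℂ (Tame b Y) := hr.bdd.lift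

variable (b) in
/-- Composition of the coefficients of a tame formal sum with a linear map on the left. -/
def post (g : Y →ₗ[ℂ] Y') : Tame b Y →ₗ[ℂ] Tame b Y' := (post_bdd b g).lift

theorem pre_apply {r : U →ₗ[ℂ] U} (hr : Adm b r) (c : Tame b Y) (K : Finset ι) (v : U) :
    (pre Y hr c).1 K v = c.1 K (r v) := rfl

theorem post_apply (g : Y →ₗ[ℂ] Y') (c : Tame b Y) (K : Finset ι) (v : U) :
    (post b g c).1 K v = g (c.1 K v) := rfl

theorem cont_pre {r : U →ₗ[ℂ] U} (hr : Adm b r) : Cont (pre Y hr) := hr.bdd.cont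

theorem cont_post (g : Y →ₗ[ℂ] Y') : Cont (post b g) := (post_bdd b g).cont

theorem mul_mem_LC (v : U) {W : Set (U × ℤ)} {n : ℤ} {x : U} (hx : x ∈ LC b W n) :
    v * x ∈ LC b ((fun p : U × ℤ => (v * p.1, p.2)) '' W) n := by
  have : LC b W n ≤ (LC b ((fun p : U × ℤ => (v * p.1, p.2)) '' W) n).comap
      (LinearMap.mulLeft ℂ v) := Submodule.span_le.2 (by
    rintro _ ⟨p, hp, u, hu, rfl⟩
    refine Submodule.subset_span ⟨(v * p.1, p.2), ⟨p, hp, rfl⟩, u, hu, ?_⟩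
    simp [mul_assoc])
  exact this hx

variable (b) in
/-- Right multiplication by `w` is admissible because `w` can be moved to the left past `U₊`. -/
theorem adm_mulRight (w : U) : Adm b (LinearMap.mulRight ℂ w) := by
  intro v
  obtain ⟨W, hW, h⟩ := exists_mul_mem_LC b w
  refine ⟨_, hW.image (fun p : U × ℤ => (v * p.1, p.2)), fun n u hu => ?_⟩
  rw [LinearMap.mulRight_apply, mul_assoc]
  exact mul_mem_LC v (h n u hu)

theorem mem_LC_singleton {v u : U} {n d : ℤ} (hu : u ∈ UP b (n + d)) :
    v * u ∈ LC b {(v, d)} n := Submodule.subset_span ⟨(v, d), rfl, u, hu, rfl⟩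

variable (b) in
theorem adm_mulLeft (w : U) : Adm b (LinearMap.mulLeft ℂ w) := by
  intro v
  refine ⟨{(w * v, 0)}, Set.finite_singleton _, fun n u hu => ?_⟩
  rw [LinearMap.mulLeft_apply, ← mul_assoc]
  exact mem_LC_singleton (by simpa using hu)

end Operators

/-! ### The operators `ψ_x` and the spin action -/

section Spin

variable {𝔤 : Type u} [LieRing 𝔤] [LieAlgebra ℂ 𝔤] {s : SemiInfiniteStructure 𝔤}
  {ι : Type v} [LinearOrder ι] {b : HomogeneousBasis s ι}
  {Y : Type w} [AddCommGroup Y] [Module ℂ Y]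

local notation "U" => UniversalEnvelopingAlgebra ℂ 𝔤

section locSum

variable {κ κ' : Type*} {T T' T'' : κ → Module.End ℂ (Tame b Y)}

theorem LF.mul_left (h : LF T) {R : Module.End ℂ (Tame b Y)} (hR : Cont R) :
    LF fun k => R * T k := h.comp_left hR

theorem LF.mul_right (h : LF T) (R : Module.End ℂ (Tame b Y)) : LF fun k => T k * R :=
  h.comp_right R

theorem mul_locSum (h : LF T) {R : Module.End ℂ (Tame b Y)} (hR : Cont R) :
    R * locSum T h = locSum (fun k => R * T k) (h.mul_left hR) := comp_locSum h hR

theorem locSum_mul (h : LF T) (R : Module.End ℂ (Tame b Y)) :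
    locSum T h * R = locSum (fun k => T k * R) (h.mul_right R) := locSum_comp h R

theorem locSum_eq (h : LF T) (h' : LF T') (e : ∀ k, T k = T' k) : locSum T h = locSum T' h' := by
  obtain rfl : T = T' := funext e
  rfl

theorem locSum_eq_add (h : LF T) (h' : LF T') (h'' : LF T'') (e : ∀ k, T'' k = T k + T' k) :
    locSum T'' h'' = locSum T h + locSum T' h' := by
  rw [← locSum_add]
  exact locSum_eq _ _ e

theorem locSum_eq_smul (a : ℂ) (h : LF T) (h' : LF T') (e : ∀ k, T' k = a • T k) :
    locSum T' h' = a • locSum T h := by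
  rw [← locSum_smul]
  exact locSum_eq _ _ e

theorem lf_of_eq_zero (k : κ) (h : ∀ j, j ≠ k → T j = 0) : LF T := fun c I v =>
  (Set.finite_singleton k).subset fun j hj => by
    by_contra hn
    exact hj (by rw [h j hn]; exact zero_mem _)

theorem LF.congr (h : LF T) (e : ∀ k, T' k = T k) : LF T' := by
  obtain rfl : T' = T := funext e
  exact h

theorem EC.congr (h : EC T) (e : ∀ k, T' k = T k) : EC T' := by
  obtain rfl : T' = T := funext e
  exact h

theorem EC.mul (h : EC T) (h' : EC T') : EC fun k => T k * T' k := h.comp h'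

theorem LF.ec_mul (h : LF T) {S : κ → Module.End ℂ (Tame b Y)} (hS : EC S) :
    LF fun k => S k * T k := fun c I v => by
  obtain ⟨σ, hσ⟩ := hS I v
  refine (σ.finite_toSet.biUnion fun p _ => h c p.1 p.2).subset fun k hk => ?_
  by_contra hn
  simp only [Set.mem_iUnion, not_exists, Set.mem_ofPred_eq, not_not] at hn
  exact hk (hσ _ _ fun p hp => hn p hp)

theorem EC.locSum {S : κ → κ' → Module.End ℂ (Tame b Y)}
    (hS : EC fun k : κ × κ' => S k.1 k.2) (h : ∀ k, LF (S k)) :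
    EC fun k => SemiInfinite.locSum (S k) (h k) := by
  intro I v
  obtain ⟨σ, hσ⟩ := hS I v
  exact ⟨σ, fun k c hc => locSum_mem_zeroAt (h k) fun j => hσ (k, j) c hc⟩

end locSum

variable (b Y) in
/-- The operator `ψᵢ` on tame formal sums. -/
def ps (i : ι) : Module.End ℂ (Tame b Y) := if b.deg i < 0 then an b Y i else cr b Y i

variable (b Y) in
/-- The operator `ψᵢ*` for `xᵢ ∈ 𝔤₊`, and zero for `xᵢ ∈ 𝔤₋`. -/
def anP (i : ι) : Module.End ℂ (Tame b Y) := if b.deg i < 0 then 0 else an b Y i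

variable (b Y) in
/-- The operator `ψᵢ*` for `xᵢ ∈ 𝔤₋`, and zero for `xᵢ ∈ 𝔤₊`. -/
def crN (i : ι) : Module.End ℂ (Tame b Y) := if b.deg i < 0 then cr b Y i else 0

variable (b) in
/-- The coordinate along `xᵢ` for `xᵢ ∈ 𝔤₊`, and zero for `xᵢ ∈ 𝔤₋`. -/
def coefP (i : ι) : 𝔤 →ₗ[ℂ] ℂ := if b.deg i < 0 then 0 else b.basis.coord i

variable (b) in
/-- The coordinate along `xᵢ` for `xᵢ ∈ 𝔤₋`, and zero for `xᵢ ∈ 𝔤₊`. -/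
def coefN (i : ι) : 𝔤 →ₗ[ℂ] ℂ := if b.deg i < 0 then b.basis.coord i else 0

variable (b Y) in
/-- The operator `ψ_x`. -/
def psi' : 𝔤 →ₗ[ℂ] Module.End ℂ (Tame b Y) := b.basis.constr ℂ (ps b Y)

theorem psi'_basis (i : ι) : psi' b Y (b.basis i) = ps b Y i := b.basis.constr_basis ℂ _ i

theorem psi'_eq_sum (x : 𝔤) :
    psi' b Y x = ∑ k ∈ (b.basis.repr x).support, b.basis.repr x k • ps b Y k := by
  rw [psi', Module.Basis.constr_apply]
  rfl

theorem ps_ps (i j : ι) : ps b Y i * ps b Y j + ps b Y j * ps b Y i = 0 := by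
  unfold ps
  split_ifs with h1 h2 h2
  · exact an_an i j
  · rw [an_cr, if_neg (by rintro rfl; exact h2 h1)]
  · rw [cr_an, if_neg (by rintro rfl; exact h1 h2)]
  · exact cr_cr i j

theorem anP_ps (i j : ι) : anP b Y i * ps b Y j + ps b Y j * anP b Y i =
    if i = j ∧ ¬ b.deg j < 0 then 1 else 0 := by
  unfold anP ps
  split_ifs with h1 h2 h3 h3 h2 h3 h3
  · exact absurd h1 (h3.1 ▸ h3.2)
  · simp
  · exact absurd h1 (h3.1 ▸ h3.2)
  · simp
  · exact absurd h2 h3.2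
  · exact an_an i j
  · rw [an_cr, if_pos h3.1]
  · rw [an_cr, if_neg fun h => h3 ⟨h, h2⟩]

theorem crN_ps (i j : ι) : crN b Y i * ps b Y j + ps b Y j * crN b Y i =
    if i = j ∧ b.deg j < 0 then 1 else 0 := by
  unfold crN ps
  split_ifs with h1 h2 h3 h3 h2 h3 h3
  · rw [cr_an, if_pos h3.1]
  · rw [cr_an, if_neg fun h => h3 ⟨h, h2⟩]
  · exact absurd h3.2 h2
  · exact cr_cr i j
  · exact absurd (h3.1 ▸ h2) h1
  · simp
  · exact absurd h3.2 h2
  · simp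

theorem anP_crN (i j : ι) : anP b Y i * crN b Y j + crN b Y j * anP b Y i = 0 := by
  unfold anP crN
  split_ifs with h1 h2 h2
  · simp
  · simp
  · rw [an_cr, if_neg (by rintro rfl; exact h1 h2)]
  · simp

theorem psi'_ps (x : 𝔤) (j : ι) : psi' b Y x * ps b Y j + ps b Y j * psi' b Y x = 0 := by
  have : (LinearMap.mulRight ℂ (ps b Y j) + LinearMap.mulLeft ℂ (ps b Y j)) ∘ₗ psi' b Y = 0 :=
    b.basis.ext fun i => by
      simp only [LinearMap.comp_apply, psi'_basis, LinearMap.add_apply, LinearMap.mulRight_apply,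
        LinearMap.mulLeft_apply, ps_ps, LinearMap.zero_apply]
  simpa using LinearMap.congr_fun this x

theorem anP_psi' (i : ι) (x : 𝔤) :
    anP b Y i * psi' b Y x + psi' b Y x * anP b Y i = coefP b i x • 1 := by
  have : (LinearMap.mulLeft ℂ (anP b Y i) + LinearMap.mulRight ℂ (anP b Y i)) ∘ₗ psi' b Y =
      (coefP b i).smulRight (1 : Module.End ℂ (Tame b Y)) :=
    b.basis.ext fun j => by
      simp only [LinearMap.comp_apply, psi'_basis, LinearMap.add_apply, LinearMap.mulRight_apply,
        LinearMap.mulLeft_apply, anP_ps, LinearMap.smulRight_apply, coefP]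
      by_cases hi : b.deg i < 0
      · rw [if_pos hi, if_neg (by rintro ⟨rfl, h⟩; exact h hi)]; simp
      · rw [if_neg hi]
        by_cases hij : i = j
        · subst hij; simp [hi]
        · simp [hij]
  simpa using LinearMap.congr_fun this x

theorem crN_psi' (i : ι) (x : 𝔤) :
    crN b Y i * psi' b Y x + psi' b Y x * crN b Y i = coefN b i x • 1 := by
  have : (LinearMap.mulLeft ℂ (crN b Y i) + LinearMap.mulRight ℂ (crN b Y i)) ∘ₗ psi' b Y =
      (coefN b i).smulRight (1 : Module.End ℂ (Tame b Y)) :=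
    b.basis.ext fun j => by
      simp only [LinearMap.comp_apply, psi'_basis, LinearMap.add_apply, LinearMap.mulRight_apply,
        LinearMap.mulLeft_apply, crN_ps, LinearMap.smulRight_apply, coefN]
      by_cases hi : b.deg i < 0
      · rw [if_pos hi]
        by_cases hij : i = j
        · subst hij; simp [hi]
        · simp [hij]
      · rw [if_neg hi, if_neg (by rintro ⟨rfl, h⟩; exact hi h)]; simp
  simpa using LinearMap.congr_fun this x

/-! ### Local finiteness -/

theorem cont_ps (i : ι) : Cont (ps b Y i) := by
  unfold ps; split_ifs
  · exact cont_an i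
  · exact cont_cr i

theorem ec_anP : EC (anP b Y) := fun I v => ⟨{(I, v)}, fun i c hc => by
  unfold anP
  split_ifs with h
  · exact zero_mem _
  · refine annihilation_zeroAt ?_
    rw [if_neg h]
    exact hc _ (Finset.mem_singleton_self _)⟩

theorem lf_anP : LF (anP b Y) := by
  intro c I v
  obtain ⟨𝒦, W, D, -, h⟩ := mem_tameY.1 c.2 I v
  refine (𝒦.finite_toSet.biUnion (t := fun K : Finset ι => (K : Set ι))
    fun K _ => K.finite_toSet).subset fun j hj => ?_
  by_contra hn
  refine hj ?_
  unfold anP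
  split_ifs with hd
  · exact zero_mem _
  refine mem_zeroAt_of fun K hK n u hu => ?_
  rw [an_apply]
  split_ifs with hjK
  · rfl
  by_contra h0
  have := ((h (insert j K) (by rw [starPart_insert_eq, if_neg hd, hK]) n u hu).2
    fun h1 => h0 (by rw [h1, smul_zero])).1
  exact hn (Set.mem_biUnion this (Finset.mem_insert_self j K))

theorem crN_zeroAt {i : ι} {I : Finset ι} (hi : i ∉ I) (v : U) (c : Tame b Y) :
    (crN b Y i c).1 ∈ zeroAt b I v := by
  unfold crN
  split_ifs with hd
  · intro K hK u hu
    rw [cr_apply, if_neg]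
    rintro hiK
    exact hi (hK ▸ mem_starPart.2 ⟨hiK, hd⟩)
  · exact zero_mem _

theorem cont_crN (i : ι) : Cont (crN b Y i) := by
  unfold crN; split_ifs
  · exact cont_cr i
  · exact Cont.zero

theorem lf_crN (R : ι → Module.End ℂ (Tame b Y)) : LF fun a => crN b Y a * R a := fun c I v =>
  I.finite_toSet.subset fun a ha => by
    by_contra hn
    exact ha (crN_zeroAt (by simpa using hn) v (R a c))

theorem ec_crN {R : ι → Module.End ℂ (Tame b Y)} (hR : ∀ a, Cont (R a)) :
    EC fun a => crN b Y a * R a := by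
  classical
  intro I v
  choose σ hσ using fun a => (cont_crN a).mul (hR a) I v
  refine ⟨I.biUnion σ, fun a c hc => ?_⟩
  by_cases ha : a ∈ I
  · exact hσ a c fun p hp => hc p (Finset.mem_biUnion.2 ⟨a, ha, hp⟩)
  · exact crN_zeroAt ha v (R a c)

theorem lf_anP_of {S : ι → Module.End ℂ (Tame b Y)}
    (hS : EC fun i => if b.deg i < 0 then 0 else S i) : LF fun i => S i * anP b Y i := by
  refine (lf_anP.ec_mul hS).congr fun i => ?_
  by_cases h : b.deg i < 0
  · simp [anP, h]
  · simp [h]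

theorem ec_anP_of {S : ι → Module.End ℂ (Tame b Y)}
    (hS : EC fun i => if b.deg i < 0 then 0 else S i) : EC fun i => S i * anP b Y i := by
  refine (hS.mul ec_anP).congr fun i => ?_
  by_cases h : b.deg i < 0
  · simp [anP, h]
  · simp [h]

theorem ec_psi' {κ : Type*} {z : κ → 𝔤} (A : Finset ι)
    (h : ∀ j, ∀ k, b.deg k < 0 → k ∉ A → b.basis.repr (z j) k = 0) :
    EC fun j => psi' b Y (z j) := by
  classical
  intro I v
  refine ⟨insert (I, v) (A.image fun k => (insert k I, v)), fun j c hc => ?_⟩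
  have h0 := hc _ (Finset.mem_insert_self _ _)
  change (psi' b Y (z j) c).1 ∈ zeroAt b I v
  rw [psi'_eq_sum, LinearMap.sum_apply, Tame.val_sum]
  refine Submodule.sum_mem _ fun k _ => ?_
  by_cases hk : b.deg k < 0
  · by_cases hkA : k ∈ A
    · refine Submodule.smul_mem _ _ ?_
      unfold ps
      rw [if_pos hk]
      refine annihilation_zeroAt ?_
      rw [if_pos hk]
      exact hc _ (Finset.mem_insert_of_mem (Finset.mem_image_of_mem _ hkA))
    · rw [h j k hk hkA, zero_smul]
      exact zero_mem _
  · refine Submodule.smul_mem _ _ ?_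
    unfold ps
    rw [if_neg hk]
    intro K hK u hu
    rw [cr_apply]
    split_ifs with hkK
    · rw [h0 _ (by rw [starPart_erase, hK, Finset.erase_eq_of_notMem]
                   rw [← hK, mem_starPart]; exact fun h => hk h.2) u hu, smul_zero]
    · rfl

theorem cont_psi' (x : 𝔤) : Cont (psi' b Y x) :=
  (ec_psi' (κ := Unit) (z := fun _ => x) (b.basis.repr x).support fun _ k _ hk => by
    simpa using hk).cont ()

variable (b) in
/-- For fixed `x`, the components in `𝔤₋` of the vectors `[x, xⱼ]`, for `xⱼ ∈ 𝔤₊`, only involve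
finitely many of the basis vectors. -/
theorem exists_lie_support (x : 𝔤) : ∃ A : Finset ι, ∀ j, ¬ b.deg j < 0 → ∀ k, b.deg k < 0 →
    k ∉ A → b.basis.repr ⁅x, b.basis j⁆ k = 0 := by
  classical
  let P : Submodule ℂ 𝔤 :=
    { carrier := {x | ∃ A : Finset ι, ∀ j, ¬ b.deg j < 0 → ∀ k, b.deg k < 0 →
        k ∉ A → b.basis.repr ⁅x, b.basis j⁆ k = 0}
      zero_mem' := ⟨∅, by simp⟩
      add_mem' := by
        rintro x y ⟨A, h⟩ ⟨A', h'⟩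
        refine ⟨A ∪ A', fun j hj k hk hkA => ?_⟩
        rw [Finset.mem_union, not_or] at hkA
        rw [add_lie, map_add, Finsupp.add_apply, h j hj k hk hkA.1, h' j hj k hk hkA.2, add_zero]
      smul_mem' := by
        rintro a x ⟨A, h⟩
        refine ⟨A, fun j hj k hk hkA => ?_⟩
        rw [smul_lie, map_smul, Finsupp.smul_apply, h j hj k hk hkA, smul_zero] }
  refine forall_of_homogeneous (s := s) P (fun n x hx => ?_) x
  refine ⟨(b.finite_deg_Icc n (-1)).toFinset, fun j hj k hk hkA => ?_⟩
  refine b.coord_eq_zero (s.lie_mem hx (b.mem j)) fun h => hkA ?_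
  simp only [Set.Finite.mem_toFinset, Set.mem_ofPred_eq]
  omega

theorem repr_lie_eq_zero {i j k : ι} (hi : ¬ b.deg i < 0) (hj : ¬ b.deg j < 0)
    (hk : b.deg k < 0) : b.basis.repr ⁅b.basis i, b.basis j⁆ k = 0 :=
  b.coord_eq_zero (s.lie_mem (b.mem i) (b.mem j)) (by omega)

theorem repr_lie_eq_zero' {i j k : ι} (hi : b.deg i < 0) (hj : b.deg j < 0)
    (hk : ¬ b.deg k < 0) : b.basis.repr ⁅b.basis i, b.basis j⁆ k = 0 :=
  b.coord_eq_zero (s.lie_mem (b.mem i) (b.mem j)) (by omega)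

theorem ec_Q (x : 𝔤) :
    EC fun j => if b.deg j < 0 then 0 else psi' b Y ⁅x, b.basis j⁆ := by
  obtain ⟨A, hA⟩ := exists_lie_support b x
  refine (ec_psi' (Y := Y) (z := fun j => if b.deg j < 0 then 0 else ⁅x, b.basis j⁆) A
    fun j k hk hkA => ?_).congr fun j => ?_
  · split_ifs with h
    · simp
    · exact hA j h k hk hkA
  · split_ifs <;> simp

theorem lf_Q (x : 𝔤) : LF fun j => psi' b Y ⁅x, b.basis j⁆ * anP b Y j := lf_anP_of (ec_Q x)

variable (b Y) in
/-- The operator `∑_{xⱼ ∈ 𝔤₊} ψ_{[x, xⱼ]} ψⱼ*`. -/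
def Qop : 𝔤 →ₗ[ℂ] Module.End ℂ (Tame b Y) where
  toFun x := locSum (fun j => psi' b Y ⁅x, b.basis j⁆ * anP b Y j) (lf_Q x)
  map_add' x y := locSum_eq_add _ _ _ fun j => by rw [add_lie, map_add, add_mul]
  map_smul' _ x := locSum_eq_smul _ _ _ fun j => by
    rw [smul_lie, map_smul, smul_mul_assoc]; rfl

variable (b Y) in
/-- The operator `-∑_{xₐ ∈ 𝔤₋} ψₐ* ψ_{[x, xₐ]}`. -/
def Kop : 𝔤 →ₗ[ℂ] Module.End ℂ (Tame b Y) where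
  toFun x := locSum (fun a => crN b Y a * -psi' b Y ⁅x, b.basis a⁆) (lf_crN _)
  map_add' x y := locSum_eq_add _ _ _ fun j => by rw [add_lie, map_add, neg_add, mul_add]
  map_smul' _ x := locSum_eq_smul _ _ _ fun j => by
    rw [smul_lie, map_smul, ← smul_neg, mul_smul_comm]; rfl

theorem Qop_eq (x : 𝔤) :
    Qop b Y x = locSum (fun j => psi' b Y ⁅x, b.basis j⁆ * anP b Y j) (lf_Q x) := rfl

theorem Kop_eq (x : 𝔤) :
    Kop b Y x = locSum (fun a => crN b Y a * -psi' b Y ⁅x, b.basis a⁆) (lf_crN _) := rfl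

theorem cont_Qop (x : 𝔤) : Cont (Qop b Y x) := (ec_anP_of (ec_Q x)).cont_locSum _

theorem cont_Kop (x : 𝔤) : Cont (Kop b Y x) :=
  (ec_crN fun _ => (cont_psi' _).neg).cont_locSum _

theorem ec_Qop : EC fun i => if b.deg i < 0 then 0 else Qop b Y (b.basis i) := by
  have h : EC fun k : ι × ι => (if b.deg k.1 < 0 then 0 else if b.deg k.2 < 0 then 0 else
      psi' b Y ⁅b.basis k.1, b.basis k.2⁆ : Module.End ℂ (Tame b Y)) := by
    refine (ec_psi' (Y := Y) (z := fun k : ι × ι => if b.deg k.1 < 0 then 0 else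
      if b.deg k.2 < 0 then 0 else ⁅b.basis k.1, b.basis k.2⁆) ∅ fun j k hk _ => ?_).congr
      fun j => ?_
    · split_ifs with h1 h2
      · simp
      · simp
      · exact repr_lie_eq_zero h1 h2 hk
    · split_ifs <;> simp
  have h2 : EC fun k : ι × ι => (if b.deg k.1 < 0 then 0 else
      psi' b Y ⁅b.basis k.1, b.basis k.2⁆ * anP b Y k.2 : Module.End ℂ (Tame b Y)) := by
    have h3 : EC fun k : ι × ι => anP b Y k.2 := fun I v => by
      obtain ⟨σ, hσ⟩ := ec_anP (b := b) (Y := Y) I v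
      exact ⟨σ, fun k => hσ k.2⟩
    refine (h.mul h3).congr fun k => ?_
    by_cases h2 : b.deg k.2 < 0
    · simp [anP, h2]
    · simp [h2]
  have h4 : ∀ i, LF fun j => (if b.deg i < 0 then 0 else
      psi' b Y ⁅b.basis i, b.basis j⁆ * anP b Y j : Module.End ℂ (Tame b Y)) := fun i => by
    by_cases hi : b.deg i < 0
    · simp only [hi, if_true]
      exact fun c I v => by simp
    · simp only [hi, if_false]
      exact lf_Q _
  refine (EC.locSum h2 h4).congr fun i => ?_
  refine LinearMap.ext fun c => Tame.ext' fun K v => ?_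
  rw [locSum_apply]
  by_cases hi : b.deg i < 0
  · simp [hi]
  · simp only [hi, if_false]
    rfl

/-! ### The commutators of the spin action with the operators `ψ` -/

theorem Qop_ps (x : 𝔤) (k : ι) : Qop b Y x * ps b Y k - ps b Y k * Qop b Y x =
    if b.deg k < 0 then 0 else psi' b Y ⁅x, b.basis k⁆ := by
  rw [sub_eq_iff_eq_add, Qop_eq, locSum_mul, mul_locSum _ (cont_ps k)]
  have e : ∀ j, psi' b Y ⁅x, b.basis j⁆ * anP b Y j * ps b Y k =
      (if j = k ∧ ¬ b.deg k < 0 then psi' b Y ⁅x, b.basis k⁆ else 0) +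
      ps b Y k * (psi' b Y ⁅x, b.basis j⁆ * anP b Y j) := by
    intro j
    have h1 := anP_ps (b := b) (Y := Y) j k
    have h2 := psi'_ps (b := b) (Y := Y) ⁅x, b.basis j⁆ k
    rw [← eq_sub_iff_add_eq] at h1
    rw [← eq_neg_iff_add_eq_zero, ← neg_eq_iff_eq_neg] at h2
    rw [mul_assoc, h1, mul_sub, ← mul_assoc, ← mul_assoc, ← h2, neg_mul]
    split_ifs with h
    · rw [h.1, mul_one]; abel
    · rw [mul_zero]; abel
  have hlf : LF fun j => (if j = k ∧ ¬ b.deg k < 0 then psi' b Y ⁅x, b.basis k⁆ else 0 :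
      Module.End ℂ (Tame b Y)) := lf_of_eq_zero k fun j hj => if_neg fun h => hj h.1
  rw [locSum_eq_add hlf (LF.mul_left (lf_Q x) (cont_ps k)) _ e, locSum_single hlf k fun j hj => by rw [if_neg fun h => hj h.1]]
  congr 1
  by_cases hk : b.deg k < 0 <;> simp [hk]

theorem Kop_ps (x : 𝔤) (k : ι) : Kop b Y x * ps b Y k - ps b Y k * Kop b Y x =
    if b.deg k < 0 then psi' b Y ⁅x, b.basis k⁆ else 0 := by
  rw [sub_eq_iff_eq_add, Kop_eq, locSum_mul, mul_locSum _ (cont_ps k)]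
  have e : ∀ j, crN b Y j * -psi' b Y ⁅x, b.basis j⁆ * ps b Y k =
      (if j = k ∧ b.deg k < 0 then psi' b Y ⁅x, b.basis k⁆ else 0) +
      ps b Y k * (crN b Y j * -psi' b Y ⁅x, b.basis j⁆) := by
    intro j
    have h1 := crN_ps (b := b) (Y := Y) j k
    have h2 := psi'_ps (b := b) (Y := Y) ⁅x, b.basis j⁆ k
    rw [← eq_sub_iff_add_eq] at h1
    rw [← eq_neg_iff_add_eq_zero] at h2
    rw [mul_assoc, neg_mul, h2, neg_neg, ← mul_assoc, h1, sub_mul, mul_neg, mul_neg, ← mul_assoc]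
    split_ifs with h
    · rw [h.1, one_mul]; abel
    · rw [zero_mul]; abel
  have hlf : LF fun j => (if j = k ∧ b.deg k < 0 then psi' b Y ⁅x, b.basis k⁆ else 0 :
      Module.End ℂ (Tame b Y)) := lf_of_eq_zero k fun j hj => if_neg fun h => hj h.1
  rw [locSum_eq_add hlf (LF.mul_left (lf_crN _) (cont_ps k)) _ e, locSum_single hlf k fun j hj => by rw [if_neg fun h => hj h.1]]
  congr 1
  by_cases hk : b.deg k < 0 <;> simp [hk]

end Spin

/-! ### The diagonal action and the differential -/

section Differential

variable {𝔤 : Type u} [LieRing 𝔤] [LieAlgebra ℂ 𝔤] {s : SemiInfiniteStructure 𝔤}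
  {ι : Type v} [LinearOrder ι] {b : HomogeneousBasis s ι}
  {Y : Type w} [AddCommGroup Y] [Module ℂ Y]
  [Module (UniversalEnvelopingAlgebra ℂ 𝔤) Y] [IsScalarTower ℂ (UniversalEnvelopingAlgebra ℂ 𝔤) Y]

local notation "U" => UniversalEnvelopingAlgebra ℂ 𝔤

theorem toU_add (x y : 𝔤) : (toU (x + y) : U) = toU x + toU y := by rw [toU, map_add]

theorem toU_smul (a : ℂ) (x : 𝔤) : (toU (a • x) : U) = a • toU x := by rw [toU, map_smul]

variable (b Y) in
/-- The diagonal action of `x` on the coefficients, `φ ↦ φ(· x) + x φ(·)`. -/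
def rho : 𝔤 →ₗ[ℂ] Module.End ℂ (Tame b Y) where
  toFun x := pre Y (adm_mulRight b (toU x)) + post b (Algebra.lsmul ℂ ℂ Y (toU x))
  map_add' x y := LinearMap.ext fun c => Tame.ext' fun K v => by
    change c.1 K (v * toU (x + y)) + toU (x + y) • c.1 K v =
      (c.1 K (v * toU x) + toU x • c.1 K v) + (c.1 K (v * toU y) + toU y • c.1 K v)
    rw [toU_add, mul_add, map_add, add_smul]
    abel
  map_smul' a x := LinearMap.ext fun c => Tame.ext' fun K v => by
    change c.1 K (v * toU (a • x)) + toU (a • x) • c.1 K v =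
      a • (c.1 K (v * toU x) + toU x • c.1 K v)
    rw [toU_smul, mul_smul_comm, map_smul, smul_assoc, smul_add]

theorem rho_apply (x : 𝔤) (c : Tame b Y) (K : Finset ι) (v : U) :
    (rho b Y x c).1 K v = c.1 K (v * toU x) + toU x • c.1 K v := rfl

theorem cont_rho (x : 𝔤) : Cont (rho b Y x) := (cont_pre _).add (cont_post _)

theorem rho_an (x : 𝔤) (i : ι) : rho b Y x * an b Y i = an b Y i * rho b Y x :=
  LinearMap.ext fun c => Tame.ext' fun K v => by
    change (rho b Y x (an b Y i c)).1 K v = (an b Y i (rho b Y x c)).1 K v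
    simp only [rho_apply, an_apply]
    split_ifs
    · simp
    · rw [smul_add, smul_comm (toU x)]

theorem rho_cr (x : 𝔤) (i : ι) : rho b Y x * cr b Y i = cr b Y i * rho b Y x :=
  LinearMap.ext fun c => Tame.ext' fun K v => by
    change (rho b Y x (cr b Y i c)).1 K v = (cr b Y i (rho b Y x c)).1 K v
    simp only [rho_apply, cr_apply]
    split_ifs
    · rw [smul_add, smul_comm (toU x)]
    · simp

theorem rho_ps (x : 𝔤) (i : ι) : rho b Y x * ps b Y i = ps b Y i * rho b Y x := by
  unfold ps; split_ifs
  · exact rho_an x i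
  · exact rho_cr x i

theorem rho_anP (x : 𝔤) (i : ι) : rho b Y x * anP b Y i = anP b Y i * rho b Y x := by
  unfold anP; split_ifs
  · simp
  · exact rho_an x i

theorem rho_crN (x : 𝔤) (i : ι) : rho b Y x * crN b Y i = crN b Y i * rho b Y x := by
  unfold crN; split_ifs
  · exact rho_cr x i
  · simp

theorem toU_lie (x y : 𝔤) : toU ⁅x, y⁆ = toU x * toU y - toU y * toU x := by
  rw [toU_mul_toU x y]; abel

theorem rho_lie (x y : 𝔤) :
    rho b Y ⁅x, y⁆ = rho b Y x * rho b Y y - rho b Y y * rho b Y x :=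
  LinearMap.ext fun c => Tame.ext' fun K v => by
    change (rho b Y ⁅x, y⁆ c).1 K v =
      (rho b Y x (rho b Y y c)).1 K v - (rho b Y y (rho b Y x c)).1 K v
    simp only [rho_apply, toU_lie, mul_sub, sub_smul, map_sub, smul_add, mul_smul, mul_assoc]
    abel

theorem ec_rho : EC fun i => if b.deg i < 0 then 0 else rho b Y (b.basis i) := fun I v =>
  ⟨{(I, v)}, fun i c hc => by
    have hc := hc _ (Finset.mem_singleton_self _)
    by_cases h : b.deg i < 0
    · simp only [h, if_true]
      exact zero_mem _
    · simp only [h, if_false]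
      refine add_mem (preFormal_zeroAt (W := {(v, b.deg i)}) (fun n u hu => ?_) ?_)
        (postFormal_zeroAt _ hc)
      · rw [LinearMap.mulRight_apply, mul_assoc]
        exact mem_LC_singleton (mul_mem_wrdSpan hu (toU_basis_mem h))
      · rintro p rfl
        exact hc⟩

variable (b Y) in
/-- The twist `ρ_x - γ(x)` of the diagonal action. -/
def rhog : 𝔤 →ₗ[ℂ] Module.End ℂ (Tame b Y) := rho b Y - s.γ.smulRight 1

theorem rhog_apply (x : 𝔤) : rhog b Y x = rho b Y x - s.γ x • 1 := rfl

theorem cont_rhog (x : 𝔤) : Cont (rhog b Y x) := (cont_rho x).sub (Cont.one.smul _)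

theorem rhog_comm {x : 𝔤} {R : Module.End ℂ (Tame b Y)} (h : rho b Y x * R = R * rho b Y x) :
    rhog b Y x * R = R * rhog b Y x := by
  rw [rhog_apply, sub_mul, mul_sub, h, smul_one_mul, mul_smul_one]

variable (b Y) in
/-- The action `L_x` of `x` on semi-infinite forms. -/
def Lop : 𝔤 →ₗ[ℂ] Module.End ℂ (Tame b Y) := rhog b Y + Qop b Y + Kop b Y

theorem Lop_apply (x : 𝔤) : Lop b Y x = rhog b Y x + Qop b Y x + Kop b Y x := rfl

theorem cont_Lop (x : 𝔤) : Cont (Lop b Y x) := ((cont_rhog x).add (cont_Qop x)).add (cont_Kop x)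

theorem Lop_ps (x : 𝔤) (k : ι) :
    Lop b Y x * ps b Y k - ps b Y k * Lop b Y x = psi' b Y ⁅x, b.basis k⁆ := by
  have h1 := rhog_comm (rho_ps (b := b) (Y := Y) x k)
  have h2 := Qop_ps (b := b) (Y := Y) x k
  have h3 := Kop_ps (b := b) (Y := Y) x k
  have : Lop b Y x * ps b Y k - ps b Y k * Lop b Y x =
      (rhog b Y x * ps b Y k - ps b Y k * rhog b Y x) +
      (Qop b Y x * ps b Y k - ps b Y k * Qop b Y x) +
      (Kop b Y x * ps b Y k - ps b Y k * Kop b Y x) := by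
    rw [Lop_apply]; noncomm_ring
  rw [this, h1, h2, h3]
  split_ifs <;> simp

theorem Lop_psi' (x y : 𝔤) :
    Lop b Y x * psi' b Y y - psi' b Y y * Lop b Y x = psi' b Y ⁅x, y⁆ := by
  have : (LinearMap.mulLeft ℂ (Lop b Y x) - LinearMap.mulRight ℂ (Lop b Y x)) ∘ₗ psi' b Y =
      psi' b Y ∘ₗ (LieAlgebra.ad ℂ 𝔤 x) :=
    b.basis.ext fun k => by
      simp only [LinearMap.comp_apply, psi'_basis, LinearMap.sub_apply, LinearMap.mulRight_apply,
        LinearMap.mulLeft_apply, Lop_ps, LieAlgebra.ad_apply]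
  simpa using LinearMap.congr_fun this y

variable (b Y) in
/-- The coefficient of `ψₐ*` in the part of the differential creating a `ψₐ*` with `xₐ ∈ 𝔤₋`. -/
def Aop (x : 𝔤) : Module.End ℂ (Tame b Y) :=
  rhog b Y x + (1 / 2 : ℂ) • Kop b Y x + Qop b Y x

variable (b Y) in
/-- The coefficient of `ψᵢ*` in the part of the differential annihilating an `xᵢ ∈ 𝔤₊`. -/
def Bop (x : 𝔤) : Module.End ℂ (Tame b Y) := rhog b Y x + (1 / 2 : ℂ) • Qop b Y x

theorem cont_Aop (x : 𝔤) : Cont (Aop b Y x) :=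
  ((cont_rhog x).add ((cont_Kop x).smul _)).add (cont_Qop x)

theorem ec_one {κ : Type*} (a : κ → ℂ) : EC fun k => a k • (1 : Module.End ℂ (Tame b Y)) :=
  (Cont.one.ec).smul a

theorem ec_Bop : EC fun i => if b.deg i < 0 then 0 else Bop b Y (b.basis i) := by
  refine ((ec_rho.add (ec_one fun i => if b.deg i < 0 then 0 else -s.γ (b.basis i))).add
    (ec_Qop.smul fun _ => 1 / 2)).congr fun i => ?_
  split_ifs
  · simp
  · rw [Bop, rhog_apply]
    congr 1
    rw [neg_smul, sub_eq_add_neg]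

variable (b Y) in
/-- The part of the differential which creates some `ψₐ*` with `xₐ ∈ 𝔤₋`. -/
def dCr : Module.End ℂ (Tame b Y) :=
  locSum (fun a => crN b Y a * Aop b Y (b.basis a)) (lf_crN _)

variable (b Y) in
/-- The part of the differential which does not create a `ψₐ*` with `xₐ ∈ 𝔤₋`. -/
def dAn : Module.End ℂ (Tame b Y) :=
  locSum (fun i => Bop b Y (b.basis i) * anP b Y i) (lf_anP_of ec_Bop)

variable (b Y) in
/-- The semi-infinite differential, written as `∑ᵢ ψᵢ* (ρᵢ - γ(xᵢ) + …)` with the `ψᵢ*` moved to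
the left for `xᵢ ∈ 𝔤₋` and to the right for `xᵢ ∈ 𝔤₊`. The two equal cubic
sums in which exactly one of the first two indices lies in `𝔤₋` are both part of `dCr`, so that
`Qop` enters `Aop` with the coefficient `1`. -/
def dd : Module.End ℂ (Tame b Y) := dCr b Y + dAn b Y

theorem cont_dCr : Cont (dCr b Y) := (ec_crN fun _ => cont_Aop _).cont_locSum _

theorem cont_dAn : Cont (dAn b Y) := (ec_anP_of ec_Bop).cont_locSum _

theorem cont_dd : Cont (dd b Y) := cont_dCr.add cont_dAn

theorem Aop_ps (x : 𝔤) (k : ι) : Aop b Y x * ps b Y k - ps b Y k * Aop b Y x =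
    (if b.deg k < 0 then (1 / 2 : ℂ) else 1) • psi' b Y ⁅x, b.basis k⁆ := by
  have h1 := rhog_comm (rho_ps (b := b) (Y := Y) x k)
  have h2 := Qop_ps (b := b) (Y := Y) x k
  have h3 := Kop_ps (b := b) (Y := Y) x k
  have : Aop b Y x * ps b Y k - ps b Y k * Aop b Y x =
      (rhog b Y x * ps b Y k - ps b Y k * rhog b Y x) +
      (Qop b Y x * ps b Y k - ps b Y k * Qop b Y x) +
      (1 / 2 : ℂ) • (Kop b Y x * ps b Y k - ps b Y k * Kop b Y x) := by
    rw [Aop, add_mul, add_mul, mul_add, mul_add, smul_mul_assoc, mul_smul_comm, smul_sub]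
    abel
  rw [this, h1, h2, h3]
  split_ifs <;> simp

theorem Bop_ps (x : 𝔤) (k : ι) : Bop b Y x * ps b Y k - ps b Y k * Bop b Y x =
    (if b.deg k < 0 then 0 else (1 / 2 : ℂ)) • psi' b Y ⁅x, b.basis k⁆ := by
  have h1 := rhog_comm (rho_ps (b := b) (Y := Y) x k)
  have h2 := Qop_ps (b := b) (Y := Y) x k
  have : Bop b Y x * ps b Y k - ps b Y k * Bop b Y x =
      (rhog b Y x * ps b Y k - ps b Y k * rhog b Y x) +
      (1 / 2 : ℂ) • (Qop b Y x * ps b Y k - ps b Y k * Qop b Y x) := by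
    rw [Bop, add_mul, mul_add, smul_mul_assoc, mul_smul_comm, smul_sub]
    abel
  rw [this, h1, h2]
  split_ifs <;> simp

theorem dCr_ps (k : ι) : dCr b Y * ps b Y k + ps b Y k * dCr b Y =
    (if b.deg k < 0 then (1 / 2 : ℂ) else 1) • Kop b Y (b.basis k) +
    if b.deg k < 0 then Aop b Y (b.basis k) else 0 := by
  have hlf : LF fun a => (if a = k ∧ b.deg k < 0 then Aop b Y (b.basis k) else 0 :
      Module.End ℂ (Tame b Y)) := lf_of_eq_zero k fun j hj => if_neg fun h => hj h.1
  have h0 : (if b.deg k < 0 then Aop b Y (b.basis k) else 0) = locSum _ hlf := by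
    rw [locSum_single hlf k fun j hj => if_neg fun h => hj h.1]
    simp
  rw [h0, Kop_eq, ← locSum_smul, dCr, locSum_mul, mul_locSum _ (cont_ps k), ← locSum_add,
    ← locSum_add]
  refine locSum_eq _ _ fun a => ?_
  have h1 := crN_ps (b := b) (Y := Y) a k
  have h2 := Aop_ps (b := b) (Y := Y) (b.basis a) k
  have h3 : crN b Y a * Aop b Y (b.basis a) * ps b Y k +
      ps b Y k * (crN b Y a * Aop b Y (b.basis a)) =
      (crN b Y a * ps b Y k + ps b Y k * crN b Y a) * Aop b Y (b.basis a) +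
      crN b Y a * (Aop b Y (b.basis a) * ps b Y k - ps b Y k * Aop b Y (b.basis a)) := by
    noncomm_ring
  rw [h3, h1, h2, ← lie_skew (b.basis k), map_neg, neg_neg, mul_smul_comm, add_comm]
  congr 1
  split_ifs with h
  · rw [h.1, one_mul]
  · rw [zero_mul]

theorem dAn_ps (k : ι) : dAn b Y * ps b Y k + ps b Y k * dAn b Y =
    if b.deg k < 0 then 0 else Bop b Y (b.basis k) + (1 / 2 : ℂ) • Qop b Y (b.basis k) := by
  have hlf : LF fun a => (if a = k ∧ ¬ b.deg k < 0 then Bop b Y (b.basis k) else 0 :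
      Module.End ℂ (Tame b Y)) := lf_of_eq_zero k fun j hj => if_neg fun h => hj h.1
  have h0 : (if b.deg k < 0 then 0 else Bop b Y (b.basis k)) = locSum _ hlf := by
    rw [locSum_single hlf k fun j hj => if_neg fun h => hj h.1]
    by_cases h : b.deg k < 0 <;> simp [h]
  have e : (if b.deg k < 0 then 0 else
      Bop b Y (b.basis k) + (1 / 2 : ℂ) • Qop b Y (b.basis k)) =
      (if b.deg k < 0 then 0 else (1 / 2 : ℂ)) • Qop b Y (b.basis k) +
      (if b.deg k < 0 then 0 else Bop b Y (b.basis k)) := by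
    split_ifs
    · simp
    · rw [add_comm]
  rw [e, h0, Qop_eq, ← locSum_smul, dAn, locSum_mul, mul_locSum _ (cont_ps k), ← locSum_add,
    ← locSum_add]
  refine locSum_eq _ _ fun a => ?_
  have h1 := anP_ps (b := b) (Y := Y) a k
  have h2 := Bop_ps (b := b) (Y := Y) (b.basis a) k
  have h3 : Bop b Y (b.basis a) * anP b Y a * ps b Y k +
      ps b Y k * (Bop b Y (b.basis a) * anP b Y a) =
      Bop b Y (b.basis a) * (anP b Y a * ps b Y k + ps b Y k * anP b Y a) -
      (Bop b Y (b.basis a) * ps b Y k - ps b Y k * Bop b Y (b.basis a)) * anP b Y a := by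
    noncomm_ring
  rw [h3, h1, h2, ← lie_skew (b.basis k), map_neg, neg_mul, smul_neg,
    smul_mul_assoc, sub_eq_neg_add]
  congr 1
  split_ifs with h
  · rw [h.1, mul_one]
  · rw [mul_zero]

/-- Cartan's formula `d ψ_x + ψ_x d = L_x`, on basis vectors. -/
theorem dd_ps (k : ι) : dd b Y * ps b Y k + ps b Y k * dd b Y = Lop b Y (b.basis k) := by
  have : dd b Y * ps b Y k + ps b Y k * dd b Y =
      (dCr b Y * ps b Y k + ps b Y k * dCr b Y) + (dAn b Y * ps b Y k + ps b Y k * dAn b Y) := by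
    rw [dd]; noncomm_ring
  rw [this, dCr_ps, dAn_ps, Lop_apply]
  split_ifs
  · rw [Aop]
    module
  · rw [Bop]
    module

theorem dd_psi' (x : 𝔤) : dd b Y * psi' b Y x + psi' b Y x * dd b Y = Lop b Y x := by
  have : (LinearMap.mulLeft ℂ (dd b Y) + LinearMap.mulRight ℂ (dd b Y)) ∘ₗ psi' b Y =
      Lop b Y :=
    b.basis.ext fun k => by
      simp only [LinearMap.comp_apply, psi'_basis, LinearMap.add_apply, LinearMap.mulRight_apply,
        LinearMap.mulLeft_apply, dd_ps]
  simpa using LinearMap.congr_fun this x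

end Differential

/-! ### The trace in coordinates -/

section Trace

variable {𝔤 : Type u} [LieRing 𝔤] [LieAlgebra ℂ 𝔤] {s : SemiInfiniteStructure 𝔤}
  {ι : Type v} [LinearOrder ι] {b : HomogeneousBasis s ι}

theorem degreeProj_of_mem {V : Type u} [AddCommGroup V] [Module ℂ V] {gr : ℤ → Submodule ℂ V}
    (h : DirectSum.IsInternal gr) (p : ℤ → Prop) [DecidablePred p] {n : ℤ} {x : V}
    (hx : x ∈ gr n) : degreeProj h p x = if p n then x else 0 := by
  have h1 : (LinearEquiv.ofBijective (DirectSum.coeLinearMap gr) h).symm x =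
      DirectSum.lof ℂ ℤ (fun i => gr i) n ⟨x, hx⟩ := by
    rw [LinearEquiv.symm_apply_eq]
    exact (DirectSum.coeLinearMap_lof gr n ⟨x, hx⟩).symm
  change DirectSum.coeLinearMap gr (DFinsupp.filterLinearMap ℂ (fun n => gr n) p
    ((LinearEquiv.ofBijective (DirectSum.coeLinearMap gr) h).symm x)) = _
  rw [h1]
  change DirectSum.coeLinearMap gr (DFinsupp.filter p (DFinsupp.single n ⟨x, hx⟩)) = _
  rw [DFinsupp.filter_single]
  split_ifs with hp
  · exact DirectSum.coeLinearMap_lof gr n ⟨x, hx⟩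
  · exact map_zero _

variable (s) in
/-- The projection onto `𝔤₋`. -/
def qN : 𝔤 →ₗ[ℂ] 𝔤 := degreeProj s.isInternal (fun n => n < 0)

variable (s) in
/-- The projection onto `𝔤₊`. -/
def qP : 𝔤 →ₗ[ℂ] 𝔤 := degreeProj s.isInternal (fun n => 0 ≤ n)

theorem qN_basis (i : ι) : qN s (b.basis i) = if b.deg i < 0 then b.basis i else 0 :=
  degreeProj_of_mem _ _ (b.mem i)

theorem qP_basis (i : ι) : qP s (b.basis i) = if b.deg i < 0 then 0 else b.basis i := by
  rw [qP, degreeProj_of_mem _ _ (b.mem i)]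
  by_cases h : b.deg i < 0
  · rw [if_pos h, if_neg (by omega)]
  · rw [if_neg h, if_pos (by omega)]

theorem repr_qN (x : 𝔤) (k : ι) : b.basis.repr (qN s x) k = coefN b k x := by
  have : b.basis.coord k ∘ₗ qN s = coefN b k := b.basis.ext fun i => by
    rw [LinearMap.comp_apply, qN_basis, coefN]
    by_cases hik : i = k
    · subst hik; split_ifs <;> simp
    · split_ifs <;> simp [hik]
  exact LinearMap.congr_fun this x

theorem repr_qP (x : 𝔤) (k : ι) : b.basis.repr (qP s x) k = coefP b k x := by
  have : b.basis.coord k ∘ₗ qP s = coefP b k := b.basis.ext fun i => by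
    rw [LinearMap.comp_apply, qP_basis, coefP]
    by_cases hik : i = k
    · subst hik; split_ifs <;> simp
    · split_ifs <;> simp [hik]
  exact LinearMap.congr_fun this x

/-- The trace of an operator of finite rank, computed in a basis. -/
theorem finiteRankTrace_eq_sum {T : 𝔤 →ₗ[ℂ] 𝔤} {A : Finset ι}
    (hA : ∀ z, ∀ k, k ∉ A → b.basis.repr (T z) k = 0) :
    finiteRankTrace T = ∑ i ∈ A, b.basis.repr (T (b.basis i)) i := by
  classical
  let W : Submodule ℂ 𝔤 := Submodule.span ℂ (Set.range fun i : A => b.basis i)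
  have hli : LinearIndependent ℂ fun i : A => b.basis i :=
    b.basis.linearIndependent.comp _ Subtype.val_injective
  let B : Module.Basis A ℂ W := Module.Basis.span hli
  have hB : ∀ i, (B i : 𝔤) = b.basis i := fun i => by rw [Module.Basis.span_apply]
  have hfd : FiniteDimensional ℂ W := Module.Finite.of_basis B
  have hTW : ∀ z, T z ∈ W := by
    intro z
    rw [← b.basis.linearCombination_repr (T z), Finsupp.linearCombination_apply, Finsupp.sum]
    refine Submodule.sum_mem _ fun k hk => Submodule.smul_mem _ _ ?_
    by_cases hkA : k ∈ A
    · exact Submodule.subset_span ⟨⟨k, hkA⟩, rfl⟩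
    · exact absurd (hA z k hkA) (Finsupp.mem_support_iff.1 hk)
  have hrange : LinearMap.range T ≤ W := by
    rintro _ ⟨z, rfl⟩; exact hTW z
  let f : W →ₗ[ℂ] W := T.restrict fun z _ => hTW z
  let p : Submodule ℂ W := (LinearMap.range T).comap W.subtype
  have hp : ∀ x, f x ∈ p := fun x => ⟨(x : 𝔤), rfl⟩
  -- the traces of `T` on its range and on the larger coordinate subspace `W` agree
  have h1 := LinearMap.trace_restrict_eq_of_forall_mem p f hp
  let e : p ≃ₗ[ℂ] LinearMap.range T := Submodule.comapSubtypeEquivOfLe hrange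
  have h2 : T.rangeRestrict ∘ₗ (LinearMap.range T).subtype =
      e.conj (f.restrict fun x _ => hp x) := by
    refine LinearMap.ext fun x => Subtype.ext ?_
    rfl
  rw [finiteRankTrace, h2, LinearMap.trace_conj', h1, LinearMap.trace_eq_matrix_trace ℂ B,
    Matrix.trace, ← Finset.sum_coe_sort A]
  refine Finset.sum_congr rfl fun i _ => ?_
  rw [Matrix.diag_apply, LinearMap.toMatrix_apply]
  have h3 : b.basis.repr ((f (B i) : W) : 𝔤) i = B.repr (f (B i)) i := by
    conv_lhs => rw [← B.sum_repr (f (B i))]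
    rw [Submodule.coe_sum, map_sum, Finsupp.finsetSum_apply, Finset.sum_eq_single i]
    · simp [hB]
    · intro j _ hj
      rw [Submodule.coe_smul, hB, map_smul, Finsupp.smul_apply, Module.Basis.repr_self,
        Finsupp.single_apply, if_neg fun h => hj (Subtype.ext h), smul_zero]
    · intro h; exact absurd (Finset.mem_univ i) h
  rw [← h3]
  change b.basis.repr (T (B i)) i = _
  rw [hB]

variable (b) in
/-- The trace of `(ad y)₊₋ (ad x)₋₊`. -/
def tr (x y : 𝔤) : ℂ := ∑ᶠ j, coefP b j ⁅y, qN s ⁅x, b.basis j⁆⁆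

/-- The operator `(ad y)₊₋ (ad x)₋₊` has finite rank. -/
theorem exists_support_mixed (x y : 𝔤) : ∃ A : Finset ι, ∀ z k, k ∉ A →
    b.basis.repr (qP s ⁅y, qN s ⁅x, qP s z⁆⁆) k = 0 := by
  classical
  obtain ⟨A, hA⟩ := exists_lie_support b x
  refine ⟨A.biUnion fun a => (b.basis.repr (qP s ⁅y, b.basis a⁆)).support, fun z k hk => ?_⟩
  have hk' : ∀ a ∈ A, b.basis.repr (qP s ⁅y, b.basis a⁆) k = 0 := by
    intro a ha
    by_contra hne
    exact hk (Finset.mem_biUnion.2 ⟨a, ha, Finsupp.mem_support_iff.2 hne⟩)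
  have h1 : b.basis.coord k ∘ₗ qP s ∘ₗ LieAlgebra.ad ℂ 𝔤 y ∘ₗ qN s ∘ₗ LieAlgebra.ad ℂ 𝔤 x ∘ₗ
      qP s = 0 := b.basis.ext fun j => by
    simp only [LinearMap.comp_apply, qP_basis, LieAlgebra.ad_apply, LinearMap.zero_apply]
    split_ifs with hj
    · simp
    rw [← b.basis.linearCombination_repr (qN s ⁅x, b.basis j⁆), Finsupp.linearCombination_apply,
      Finsupp.sum, lie_sum, map_sum, map_sum]
    refine Finset.sum_eq_zero fun a _ => ?_
    rw [repr_qN, coefN, lie_smul, map_smul, map_smul]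
    by_cases ha : b.deg a < 0
    · by_cases haA : a ∈ A
      · change _ • b.basis.repr (qP s ⁅y, b.basis a⁆) k = 0
        rw [hk' a haA, smul_zero]
      · rw [if_pos ha]
        change b.basis.repr ⁅x, b.basis j⁆ a • _ = (0 : ℂ)
        rw [hA j hj a ha haA, zero_smul]
    · rw [if_neg ha, LinearMap.zero_apply, zero_smul]
  exact LinearMap.congr_fun h1 z

theorem repr_mixed_basis (x y : 𝔤) (j : ι) :
    b.basis.repr (qP s ⁅y, qN s ⁅x, qP s (b.basis j)⁆⁆) j =
      coefP b j ⁅y, qN s ⁅x, b.basis j⁆⁆ := by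
  rw [repr_qP, qP_basis]
  split_ifs with hj
  · rw [coefP, if_pos hj]; rfl
  · rfl

variable (b) in
/-- The cochain `γ` in coordinates. -/
theorem gamma_lie (x y : 𝔤) : s.γ ⁅x, y⁆ = tr b y x - tr b x y := by
  classical
  obtain ⟨A, hA⟩ := exists_support_mixed (b := b) y x
  obtain ⟨A', hA'⟩ := exists_support_mixed (b := b) x y
  have h0 : ∀ z, mixedOperator s.isInternal x y z =
      qP s ⁅x, qN s ⁅y, qP s z⁆⁆ - qP s ⁅y, qN s ⁅x, qP s z⁆⁆ := fun z => rfl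
  have h1 : ∀ z k, k ∉ A ∪ A' → b.basis.repr (mixedOperator s.isInternal x y z) k = 0 := by
    intro z k hk
    rw [Finset.mem_union, not_or] at hk
    rw [h0, map_sub, Finsupp.sub_apply, hA z k hk.1, hA' z k hk.2, sub_zero]
  rw [s.γ_lie, finiteRankTrace_eq_sum h1]
  simp only [h0, map_sub, Finsupp.sub_apply, repr_mixed_basis, Finset.sum_sub_distrib]
  congr 1
  · rw [tr, finsum_eq_sum_of_support_subset]
    intro j hj
    by_contra hn
    simp only [Finset.coe_union, Set.mem_union, Finset.mem_coe, not_or] at hn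
    refine hj ?_
    change coefP b j ⁅x, qN s ⁅y, b.basis j⁆⁆ = 0
    rw [← repr_mixed_basis, hA _ _ hn.1]
  · rw [tr, finsum_eq_sum_of_support_subset]
    intro j hj
    by_contra hn
    simp only [Finset.coe_union, Set.mem_union, Finset.mem_coe, not_or] at hn
    refine hj ?_
    change coefP b j ⁅y, qN s ⁅x, b.basis j⁆⁆ = 0
    rw [← repr_mixed_basis, hA' _ _ hn.2]

theorem finsum_coefN (z : 𝔤) (f : 𝔤 →ₗ[ℂ] ℂ) :
    ∑ᶠ a, coefN b a z * f (b.basis a) = f (qN s z) := by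
  conv_rhs => rw [← b.basis.linearCombination_repr (qN s z), Finsupp.linearCombination_apply,
    Finsupp.sum, map_sum]
  rw [finsum_eq_sum_of_support_subset (s := (b.basis.repr (qN s z)).support)]
  · refine Finset.sum_congr rfl fun a _ => ?_
    rw [repr_qN, map_smul, smul_eq_mul]
  · intro a ha
    rw [Finset.mem_coe, Finsupp.mem_support_iff, repr_qN]
    exact left_ne_zero_of_mul ha

end Trace

/-! ### The differential squares to zero -/

section Square

variable {𝔤 : Type u} [LieRing 𝔤] [LieAlgebra ℂ 𝔤] {s : SemiInfiniteStructure 𝔤}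
  {ι : Type v} [LinearOrder ι] {b : HomogeneousBasis s ι}
  {Y : Type w} [AddCommGroup Y] [Module ℂ Y]

local notation "U" => UniversalEnvelopingAlgebra ℂ 𝔤

variable (b Y) in
/-- The tame formal sums without components over `∅ ⊆ 𝔤₋`. -/
def noStar : Submodule ℂ (Tame b Y) where
  carrier := {c | ∀ K, starPart b.opp K = ∅ → ∀ v, c.1 K v = 0}
  zero_mem' := fun _ _ _ => rfl
  add_mem' := fun {c c'} h h' K hK v => by
    change c.1 K v + c'.1 K v = 0
    rw [h K hK v, h' K hK v, add_zero]
  smul_mem' := fun a c h K hK v => by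
    change a • c.1 K v = 0
    rw [h K hK v, smul_zero]

variable (b Y) in
/-- The tame formal sums which only involve the `e_K` with `K ⊆ 𝔤₋`. -/
def onlyStar : Submodule ℂ (Tame b Y) := ⨅ j, LinearMap.ker (anP b Y j)

theorem mem_onlyStar {c : Tame b Y} : c ∈ onlyStar b Y ↔ ∀ j, anP b Y j c = 0 := by
  simp [onlyStar, Submodule.mem_iInf]

/-- Restriction of a formal sum to the `e_K` with `K` satisfying `p`. -/
def restrFormal (p : Finset ι → Prop) [DecidablePred p] : Formal 𝔤 ι Y →ₗ[ℂ] Formal 𝔤 ι Y where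
  toFun c K := if p K then c K else 0
  map_add' c c' := by funext K; by_cases h : p K <;> simp [h]
  map_smul' a c := by funext K; by_cases h : p K <;> simp [h]

variable (b) in
theorem restr_bdd (p : Finset ι → Prop) [DecidablePred p] :
    Bdd b (restrFormal p : Formal 𝔤 ι Y →ₗ[ℂ] _) := by
  intro I v
  refine ⟨{(I, v)}, fun c hc => ?_, fun c hc => ?_⟩
  · obtain ⟨𝒦, W, D, hW, h⟩ := hc _ (Finset.mem_singleton_self _)
    refine ⟨𝒦, W, D, hW, fun K hK n u hu => ?_⟩
    change (if p K then c K else 0) (v * u) ∈ W ∧ ((if p K then c K else 0) (v * u) ≠ 0 → _)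
    split_ifs
    · exact h K hK n u hu
    · exact ⟨zero_mem _, fun h => absurd rfl h⟩
  · intro K hK u hu
    change (if p K then c K else 0) (v * u) = 0
    split_ifs
    · exact hc _ (Finset.mem_singleton_self _) K hK u hu
    · rfl

variable (b Y) in
/-- Restriction of a tame formal sum to the `e_K` with `K` satisfying `p`. -/
def restr (p : Finset ι → Prop) [DecidablePred p] : Module.End ℂ (Tame b Y) :=
  (restr_bdd b p).lift

theorem restr_apply (p : Finset ι → Prop) [DecidablePred p] (c : Tame b Y) (K : Finset ι) (v : U) :
    (restr b Y p c).1 K v = if p K then c.1 K v else 0 := by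
  change (if p K then c.1 K else 0) v = _
  split_ifs <;> rfl

theorem crN_mem_noStar (a : ι) (c : Tame b Y) : crN b Y a c ∈ noStar b Y := by
  intro K hK v
  exact eq_zero_of_zeroAt (by rw [hK]; exact crN_zeroAt (Finset.notMem_empty a) v c)

/-- An operator which commutes up to sign with all `ψᵢ` vanishes if it has no matrix elements
between the `e_K` with `K ⊆ 𝔤₋` and the `e_K` with `K ⊆ 𝔤₊`. -/
theorem eq_zero_of_comm_ps {X : Module.End ℂ (Tame b Y)} (hX : Cont X) {ε : ℂ} (hε : ε * ε = 1)
    (hc : ∀ i, X * ps b Y i = ε • (ps b Y i * X))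
    (h0 : ∀ e ∈ onlyStar b Y, X e ∈ noStar b Y) : X = 0 := by
  classical
  have hc' : ∀ i c, X (ps b Y i c) = ε • ps b Y i (X c) := fun i c =>
    LinearMap.congr_fun (hc i) c
  -- the components over `∅`: by continuity only finitely many positive letters matter
  have step1 : ∀ c, X c ∈ noStar b Y := by
    intro c K hK v
    obtain ⟨σ, hσ⟩ := hX ∅ v
    have key : ∀ A : Finset ι, ∀ c : Tame b Y,
        (∀ p ∈ σ, ∀ K', starPart b.opp K' = p.1 → ∀ n, ∀ u ∈ UP b n, c.1 K' (p.2 * u) ≠ 0 →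
          ∀ k ∈ K', ¬ b.deg k < 0 → k ∈ A) →
        ∀ K, starPart b.opp K = ∅ → (X c).1 K v = 0 := by
      intro A
      induction A using Finset.induction_on with
      | empty =>
        intro c hcA K hK
        -- `c` and its restriction to the `K ⊆ 𝔤₋` cannot be distinguished by `(X c) K v`
        let p : Finset ι → Prop := fun K => ∀ k ∈ K, b.deg k < 0
        have e1 : restr b Y p c ∈ onlyStar b Y := mem_onlyStar.2 fun j => Tame.ext' fun K v => by
          unfold anP
          split_ifs with hj
          · rfl
          · rw [an_apply]
            split_ifs
            · rfl
            · rw [restr_apply, if_neg, smul_zero]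
              · rfl
              · exact fun h => hj (h j (Finset.mem_insert_self _ _))
        have e2 := hσ (c - restr b Y p c) fun q hq => mem_zeroAt_of fun K' hK' n u hu => by
          change c.1 K' (q.2 * u) - (restr b Y p c).1 K' (q.2 * u) = 0
          rw [restr_apply]
          split_ifs with hp
          · exact sub_self _
          · rw [sub_zero]
            by_contra hne
            exact hp fun k hk => by
              by_contra hkd
              exact absurd (hcA q hq K' hK' n u hu hne k hk hkd) (Finset.notMem_empty k)
        have e3 : X c = X (c - restr b Y p c) + X (restr b Y p c) := by
          rw [← map_add, sub_add_cancel]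
        rw [e3]
        change (X (c - restr b Y p c)).1 K v + (X (restr b Y p c)).1 K v = 0
        rw [h0 _ e1 K hK v, eq_zero_of_zeroAt (by rw [hK]; exact e2), add_zero]
      | insert j A hjA ih =>
        intro c hcA K hK
        by_cases hj : b.deg j < 0
        · refine ih c (fun p hp K' hK' n u hu hne k hk hkd => ?_) K hK
          refine (Finset.mem_insert.1 (hcA p hp K' hK' n u hu hne k hk hkd)).resolve_left ?_
          rintro rfl
          exact hkd hj
        have hpj : ps b Y j = cr b Y j := if_neg hj
        have h1 : ∀ K, starPart b.opp K = ∅ → (X (an b Y j c)).1 K v = 0 := by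
          refine ih _ fun p hp K' hK' n u hu hne k hk hkd => ?_
          rw [an_apply] at hne
          split_ifs at hne with hjK
          · exact absurd rfl hne
          refine (Finset.mem_insert.1 (hcA p hp (insert j K') ?_ n u hu
            (fun h => hne (by rw [h, smul_zero])) k (Finset.mem_insert_of_mem hk)
              hkd)).resolve_left ?_
          · rw [starPart_insert_eq, if_neg hj, hK']
          · rintro rfl
            exact hjK hk
        have h2 : (X (an b Y j (cr b Y j c))).1 K v = 0 := by
          refine ih _ (fun p hp K' hK' n u hu hne k hk hkd => ?_) K hK
          rw [an_apply] at hne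
          split_ifs at hne with hjK
          · exact absurd rfl hne
          rw [cr_apply, if_pos (Finset.mem_insert_self _ _), Finset.erase_insert hjK] at hne
          refine (Finset.mem_insert.1 (hcA p hp K' hK' n u hu
            (fun h => hne (by rw [h, smul_zero, smul_zero])) k hk hkd)).resolve_left ?_
          rintro rfl
          exact hjK hk
        -- `c = ψⱼ ψⱼ* c + ψⱼ* ψⱼ c`, and both `ψⱼ* c` and `ψⱼ* ψⱼ c` no longer involve `j`
        have h3 : X c = ε • cr b Y j (X (an b Y j c)) + X (an b Y j (cr b Y j c)) := by
          rw [← hpj, ← hc', hpj, ← map_add]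
          congr 1
          have := LinearMap.congr_fun (cr_an (b := b) (Y := Y) j j) c
          rw [if_pos rfl] at this
          exact this.symm
        rw [h3]
        change ε • (cr b Y j (X (an b Y j c))).1 K v + _ = 0
        rw [h2, add_zero, cr_apply]
        split_ifs
        · rw [h1 _ (by rw [starPart_erase, hK]; rfl), smul_zero, smul_zero]
        · rw [smul_zero]
    have hn : ∀ p ∈ σ, ∃ A : Finset ι, ∀ K', starPart b.opp K' = p.1 → ∀ n, ∀ u ∈ UP b n,
        c.1 K' (p.2 * u) ≠ 0 → ∀ k ∈ K', k ∈ A := by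
      intro p hp
      obtain ⟨𝒦, W, D, -, h⟩ := mem_tameY.1 c.2 p.1 p.2
      exact ⟨𝒦.biUnion id, fun K' hK' n u hu hne k hk =>
        Finset.mem_biUnion.2 ⟨K', ((h K' hK' n u hu).2 hne).1, hk⟩⟩
    choose! A hA using hn
    exact key (σ.biUnion A) c (fun p hp K' hK' n u hu hne k hk _ =>
      Finset.mem_biUnion.2 ⟨p, hp, hA p hp K' hK' n u hu hne k hk⟩) K hK
  -- the other components are reached from these by the annihilation operators `ψₐ`
  have step2 : ∀ m, ∀ K, (starPart b.opp K).card = m → ∀ c v, (X c).1 K v = 0 := by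
    intro m
    induction m with
    | zero => intro K hK c v; exact step1 c K (Finset.card_eq_zero.1 hK) v
    | succ m ih =>
      intro K hK c v
      obtain ⟨a, ha⟩ : (starPart b.opp K).Nonempty := Finset.card_pos.1 (by omega)
      obtain ⟨haK, had⟩ := mem_starPart.1 ha
      have hpa : ps b Y a = an b Y a := if_pos had
      have h1 : (X (an b Y a c)).1 (K.erase a) v = 0 := by
        refine ih _ ?_ _ _
        rw [starPart_erase, Finset.card_erase_of_mem ha, hK]
        rfl
      rw [← hpa, hc', hpa] at h1
      change ε • (an b Y a (X c)).1 (K.erase a) v = 0 at h1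
      rw [an_apply, if_neg (Finset.notMem_erase a K), Finset.insert_erase haK, smul_smul] at h1
      refine (smul_eq_zero.1 h1).resolve_left (mul_ne_zero ?_ ?_)
      · exact left_ne_zero_of_mul_eq_one hε
      · exact left_ne_zero_of_mul_eq_one (sgn_mul_self a _)
  exact LinearMap.ext fun c => Tame.ext' fun K v => step2 _ K rfl c v

theorem locSum_mem_noStar {κ : Type*} {T : κ → Module.End ℂ (Tame b Y)} (h : LF T) {c : Tame b Y}
    (hT : ∀ k, T k c ∈ noStar b Y) : locSum T h c ∈ noStar b Y := fun K hK v =>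
  (Submodule.mem_bot ℂ).1 (locSum_pointwise h fun k => (Submodule.mem_bot ℂ).2 (hT k K hK v))

theorem locSum_apply_eq_zero {κ : Type*} {T : κ → Module.End ℂ (Tame b Y)} (h : LF T)
    {c : Tame b Y} (hT : ∀ k, T k c = 0) : locSum T h c = 0 := Tame.ext' fun K v =>
  (Submodule.mem_bot ℂ).1 (locSum_pointwise h fun k => (Submodule.mem_bot ℂ).2 (by
    rw [hT k]; rfl))

theorem Kop_mem_noStar (x : 𝔤) (c : Tame b Y) : Kop b Y x c ∈ noStar b Y :=
  locSum_mem_noStar _ fun a => crN_mem_noStar a _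

theorem Qop_onlyStar (x : 𝔤) {e : Tame b Y} (he : e ∈ onlyStar b Y) : Qop b Y x e = 0 :=
  locSum_apply_eq_zero _ fun j => by
    change psi' b Y ⁅x, b.basis j⁆ (anP b Y j e) = 0
    rw [mem_onlyStar.1 he j, map_zero]

/-- The component over `∅ ⊆ 𝔤₋` of `ψ_z ψⱼ* K_y e`, for `e` supported on the `e_K` with `K ⊆ 𝔤₋`:
only the double contraction survives. -/
theorem psi'_anP_Kop_apply (z y : 𝔤) (j : ι) {e : Tame b Y} (he : e ∈ onlyStar b Y)
    {K : Finset ι} (hK : starPart b.opp K = ∅) (v : U) :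
    (psi' b Y z (anP b Y j (Kop b Y y e))).1 K v = coefP b j ⁅y, qN s z⁆ • e.1 K v := by
  have hcont : Cont (psi' b Y z * anP b Y j) := (cont_psi' z).mul (ec_anP.cont j)
  have h1 := mul_locSum (lf_crN fun a => -psi' b Y ⁅y, b.basis a⁆) hcont
  have h2 : psi' b Y z (anP b Y j (Kop b Y y e)) = locSum _ _ e := LinearMap.congr_fun h1 e
  rw [h2, locSum_apply]
  have h3 : ∀ a, ((psi' b Y z * anP b Y j * (crN b Y a * -psi' b Y ⁅y, b.basis a⁆)) e).1 K v =
      (coefN b a z * coefP b j ⁅y, b.basis a⁆) • e.1 K v := by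
    intro a
    have r1 := anP_crN (b := b) (Y := Y) j a
    have r2 := anP_psi' (b := b) (Y := Y) j ⁅y, b.basis a⁆
    have r3 := crN_psi' (b := b) (Y := Y) a z
    -- move `ψⱼ*` to the right, where it kills `e`, and `ψₐ*` to the left
    have r4 : psi' b Y z * anP b Y j * (crN b Y a * -psi' b Y ⁅y, b.basis a⁆) =
        -(psi' b Y z * (anP b Y j * crN b Y a + crN b Y a * anP b Y j) *
          psi' b Y ⁅y, b.basis a⁆) +
        psi' b Y z * crN b Y a * (anP b Y j * psi' b Y ⁅y, b.basis a⁆ +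
          psi' b Y ⁅y, b.basis a⁆ * anP b Y j) -
        psi' b Y z * crN b Y a * psi' b Y ⁅y, b.basis a⁆ * anP b Y j := by
      noncomm_ring
    have r5 : psi' b Y z * crN b Y a = coefN b a z • 1 - crN b Y a * psi' b Y z := by
      rw [← r3]; abel
    rw [r4, r1, r2]
    simp only [mul_zero, zero_mul, neg_zero, zero_add, LinearMap.sub_apply, Module.End.mul_apply,
      mem_onlyStar.1 he j, map_zero, sub_zero, LinearMap.smul_apply, Module.End.one_apply,
      map_smul]
    have r6 := LinearMap.congr_fun r5 e
    simp only [LinearMap.sub_apply, Module.End.mul_apply, LinearMap.smul_apply,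
      Module.End.one_apply] at r6
    rw [r6]
    change coefP b j ⁅y, b.basis a⁆ • (coefN b a z • e.1 K v -
      (crN b Y a (psi' b Y z e)).1 K v) = _
    rw [crN_mem_noStar a _ K hK v, sub_zero, smul_smul, mul_comm]
  rw [finsum_congr h3, ← finsum_smul]
  exact congrArg (· • e.1 K v)
    (finsum_coefN (b := b) z (coefP b j ∘ₗ (LieAlgebra.ad ℂ 𝔤 y : 𝔤 →ₗ[ℂ] 𝔤)))

/-- The component over `∅ ⊆ 𝔤₋` of `Q_x K_y e` is the trace of `(ad y)₊₋ (ad x)₋₊`. -/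
theorem Qop_Kop_apply (x y : 𝔤) {e : Tame b Y} (he : e ∈ onlyStar b Y)
    {K : Finset ι} (hK : starPart b.opp K = ∅) (v : U) :
    (Qop b Y x (Kop b Y y e)).1 K v = tr b x y • e.1 K v := by
  rw [Qop_eq, locSum_apply, tr, finsum_smul]
  exact finsum_congr fun j => psi'_anP_Kop_apply _ y j he hK v

variable [Module (UniversalEnvelopingAlgebra ℂ 𝔤) Y]
  [IsScalarTower ℂ (UniversalEnvelopingAlgebra ℂ 𝔤) Y]

theorem rhog_mem_noStar (x : 𝔤) {c : Tame b Y} (hc : c ∈ noStar b Y) :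
    rhog b Y x c ∈ noStar b Y := fun K hK v => by
  change c.1 K (v * toU x) + toU x • c.1 K v - s.γ x • c.1 K v = 0
  rw [hc K hK, hc K hK]
  simp

theorem rhog_mem_onlyStar (x : 𝔤) {e : Tame b Y} (he : e ∈ onlyStar b Y) :
    rhog b Y x e ∈ onlyStar b Y := mem_onlyStar.2 fun j => by
  have := LinearMap.congr_fun (rhog_comm (rho_anP (b := b) (Y := Y) x j)) e
  change rhog b Y x (anP b Y j e) = anP b Y j (rhog b Y x e) at this
  rw [← this, mem_onlyStar.1 he j, map_zero]

theorem Lop_onlyStar (x : 𝔤) {e : Tame b Y} (he : e ∈ onlyStar b Y) :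
    Lop b Y x e = rhog b Y x e + Kop b Y x e := by
  rw [Lop_apply, LinearMap.add_apply, LinearMap.add_apply, Qop_onlyStar x he, add_zero]

theorem Lop_Lop_apply (x y : 𝔤) {e : Tame b Y} (he : e ∈ onlyStar b Y)
    {K : Finset ι} (hK : starPart b.opp K = ∅) (v : U) :
    (Lop b Y x (Lop b Y y e)).1 K v = (rhog b Y x (rhog b Y y e)).1 K v +
      tr b x y • e.1 K v := by
  have h1 := Kop_mem_noStar y e
  have h2 := rhog_mem_noStar x h1 K hK v
  have h3 := Kop_mem_noStar x (Kop b Y y e) K hK v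
  have h4 := Kop_mem_noStar x (rhog b Y y e) K hK v
  have h5 := Qop_Kop_apply x y he hK v
  rw [Lop_onlyStar y he, map_add, Lop_onlyStar x (rhog_mem_onlyStar y he), Lop_apply]
  change (rhog b Y x (rhog b Y y e)).1 K v + (Kop b Y x (rhog b Y y e)).1 K v +
    ((rhog b Y x (Kop b Y y e)).1 K v + (Qop b Y x (Kop b Y y e)).1 K v +
      (Kop b Y x (Kop b Y y e)).1 K v) = _
  rw [h2, h3, h4, h5]
  abel

/-- The operators `L_x` form a representation: the vacuum anomaly of the spin action is cancelled
by `γ`. -/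
theorem Lop_lie (x y : 𝔤) :
    Lop b Y ⁅x, y⁆ = Lop b Y x * Lop b Y y - Lop b Y y * Lop b Y x := by
  have hX : Lop b Y x * Lop b Y y - Lop b Y y * Lop b Y x - Lop b Y ⁅x, y⁆ = 0 := by
    refine eq_zero_of_comm_ps (ε := 1) ((((cont_Lop x).mul (cont_Lop y)).sub
      ((cont_Lop y).mul (cont_Lop x))).sub (cont_Lop _)) (one_mul 1) (fun i => ?_) fun e he => ?_
    · have a1 := Lop_ps (b := b) (Y := Y) x i
      have a2 := Lop_ps (b := b) (Y := Y) y i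
      have a3 := Lop_psi' (b := b) (Y := Y) x ⁅y, b.basis i⁆
      have a4 := Lop_psi' (b := b) (Y := Y) y ⁅x, b.basis i⁆
      have a5 := Lop_ps (b := b) (Y := Y) ⁅x, y⁆ i
      rw [lie_lie, map_sub, ← a3, ← a4, ← a1, ← a2] at a5
      rw [one_smul, ← sub_eq_zero, ← sub_eq_zero.2 a5.symm]
      noncomm_ring
    · intro K hK v
      change (Lop b Y x (Lop b Y y e)).1 K v - (Lop b Y y (Lop b Y x e)).1 K v -
        (Lop b Y ⁅x, y⁆ e).1 K v = 0
      rw [Lop_Lop_apply x y he hK, Lop_Lop_apply y x he hK, Lop_onlyStar _ he]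
      change _ - (_ + _) - ((rhog b Y ⁅x, y⁆ e).1 K v + (Kop b Y ⁅x, y⁆ e).1 K v) = 0
      rw [Kop_mem_noStar _ e K hK v, add_zero]
      have h1 : rhog b Y x * rhog b Y y - rhog b Y y * rhog b Y x =
          rhog b Y ⁅x, y⁆ + s.γ ⁅x, y⁆ • 1 := by
        rw [rhog_apply, rhog_apply, rhog_apply, rho_lie]
        simp only [mul_sub, sub_mul, smul_one_mul, mul_smul_one]
        simp only [smul_sub, smul_smul, mul_comm (s.γ x) (s.γ y)]
        abel
      have h2 : (rhog b Y x (rhog b Y y e)).1 K v - (rhog b Y y (rhog b Y x e)).1 K v =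
          (rhog b Y ⁅x, y⁆ e).1 K v + s.γ ⁅x, y⁆ • e.1 K v :=
        congrArg (fun c : Tame b Y => c.1 K v) (LinearMap.congr_fun h1 e)
      rw [gamma_lie b, sub_smul] at h2
      rw [← sub_eq_zero.2 h2]
      abel
  exact (sub_eq_zero.1 hX).symm

theorem dAn_onlyStar {e : Tame b Y} (he : e ∈ onlyStar b Y) : dAn b Y e = 0 :=
  locSum_apply_eq_zero _ fun j => by
    change Bop b Y (b.basis j) (anP b Y j e) = 0
    rw [mem_onlyStar.1 he j, map_zero]

theorem dCr_mem_noStar (c : Tame b Y) : dCr b Y c ∈ noStar b Y :=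
  locSum_mem_noStar _ fun a => crN_mem_noStar a _

theorem anP_Kop_onlyStar (j : ι) {a : ι} (ha : b.deg a < 0) {e : Tame b Y}
    (he : e ∈ onlyStar b Y) : anP b Y j (Kop b Y (b.basis a) e) = 0 := by
  have h1 := mul_locSum (lf_crN fun c => -psi' b Y ⁅b.basis a, b.basis c⁆) (ec_anP.cont j)
  have h2 : anP b Y j (Kop b Y (b.basis a) e) = locSum _ _ e := LinearMap.congr_fun h1 e
  rw [h2]
  refine locSum_apply_eq_zero _ fun c => ?_
  have r1 := anP_crN (b := b) (Y := Y) j c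
  have r2 := anP_psi' (b := b) (Y := Y) j ⁅b.basis a, b.basis c⁆
  have r4 : anP b Y j * (crN b Y c * -psi' b Y ⁅b.basis a, b.basis c⁆) =
      -((anP b Y j * crN b Y c + crN b Y c * anP b Y j) * psi' b Y ⁅b.basis a, b.basis c⁆) +
      crN b Y c * (anP b Y j * psi' b Y ⁅b.basis a, b.basis c⁆ +
        psi' b Y ⁅b.basis a, b.basis c⁆ * anP b Y j) -
      crN b Y c * psi' b Y ⁅b.basis a, b.basis c⁆ * anP b Y j := by
    noncomm_ring
  rw [r4, r1, r2]
  simp only [zero_mul, neg_zero, zero_add, LinearMap.sub_apply, Module.End.mul_apply,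
    mem_onlyStar.1 he j, map_zero, sub_zero, LinearMap.smul_apply, Module.End.one_apply, map_smul]
  by_cases hc : b.deg c < 0
  · have : coefP b j ⁅b.basis a, b.basis c⁆ = 0 := by
      unfold coefP
      split_ifs with hj
      · rfl
      · exact repr_lie_eq_zero' ha hc hj
    rw [this, zero_smul]
  · simp [crN, hc]

/-- The differential preserves the formal sums of the `e_K` with `K ⊆ 𝔤₋`. -/
theorem dd_mem_onlyStar {e : Tame b Y} (he : e ∈ onlyStar b Y) : dd b Y e ∈ onlyStar b Y := by
  rw [dd, LinearMap.add_apply, dAn_onlyStar he, add_zero]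
  refine mem_onlyStar.2 fun j => ?_
  have h1 := mul_locSum (lf_crN fun a => Aop b Y (b.basis a)) (ec_anP.cont j)
  have h2 : anP b Y j (dCr b Y e) = locSum _ _ e := LinearMap.congr_fun h1 e
  rw [h2]
  refine locSum_apply_eq_zero _ fun a => ?_
  have r1 := LinearMap.congr_fun (anP_crN (b := b) (Y := Y) j a) (Aop b Y (b.basis a) e)
  change anP b Y j (crN b Y a (Aop b Y (b.basis a) e)) +
    crN b Y a (anP b Y j (Aop b Y (b.basis a) e)) = 0 at r1
  change anP b Y j (crN b Y a (Aop b Y (b.basis a) e)) = 0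
  rw [← r1, left_eq_add]
  by_cases ha : b.deg a < 0
  · have h3 : Aop b Y (b.basis a) e =
        rhog b Y (b.basis a) e + (1 / 2 : ℂ) • Kop b Y (b.basis a) e + Qop b Y (b.basis a) e := rfl
    rw [h3, Qop_onlyStar _ he, add_zero, map_add, map_smul, anP_Kop_onlyStar j ha he,
      mem_onlyStar.1 (rhog_mem_onlyStar _ he) j]
    simp
  · simp [crN, ha]

/-- The differential commutes with the operators `L_x`: the difference anticommutes with all `ψᵢ`,
by `dd_ps` and `Lop_lie`. -/
theorem Lop_dd (x : 𝔤) : Lop b Y x * dd b Y = dd b Y * Lop b Y x := by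
  have hX : dd b Y * Lop b Y x - Lop b Y x * dd b Y = 0 := by
    refine eq_zero_of_comm_ps (ε := -1) ((cont_dd.mul (cont_Lop x)).sub ((cont_Lop x).mul cont_dd))
      (by norm_num) (fun i => ?_) fun e he => ?_
    · have a1 := Lop_ps (b := b) (Y := Y) x i
      have a2 := dd_psi' (b := b) (Y := Y) ⁅x, b.basis i⁆
      have a3 := dd_ps (b := b) (Y := Y) i
      have a4 := Lop_lie (b := b) (Y := Y) x (b.basis i)
      rw [← a2, ← a3, ← a1] at a4
      rw [neg_one_smul, ← sub_eq_zero, ← sub_eq_zero.2 a4]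
      noncomm_ring
    · refine Submodule.sub_mem _ ?_ ?_
      · change dd b Y (Lop b Y x e) ∈ noStar b Y
        rw [Lop_onlyStar x he, map_add]
        refine Submodule.add_mem _ ?_ (Submodule.add_mem _ (dCr_mem_noStar _) ?_)
        · have := rhog_mem_onlyStar x he
          rw [dd, LinearMap.add_apply, dAn_onlyStar this, add_zero]
          exact dCr_mem_noStar _
        · -- the terms `(ρ_i + ½ Q_i) ψᵢ* ψₐ* ψ_{[x, a]} e` keep the factor `ψₐ*`
          refine locSum_mem_noStar _ fun i => ?_
          have h1 := mul_locSum (lf_crN fun a => -psi' b Y ⁅x, b.basis a⁆)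
            (R := Bop b Y (b.basis i) * anP b Y i) ((ec_anP_of ec_Bop).cont i)
          have h2 : (Bop b Y (b.basis i) * anP b Y i) (Kop b Y x e) = locSum _ _ e :=
            LinearMap.congr_fun h1 e
          rw [h2]
          refine locSum_mem_noStar _ fun a => ?_
          have r1 := anP_crN (b := b) (Y := Y) i a
          have r2 := anP_psi' (b := b) (Y := Y) i ⁅x, b.basis a⁆
          have r4 : Bop b Y (b.basis i) * anP b Y i *
              (crN b Y a * -psi' b Y ⁅x, b.basis a⁆) =
              -(Bop b Y (b.basis i) * (anP b Y i * crN b Y a + crN b Y a * anP b Y i) *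
                psi' b Y ⁅x, b.basis a⁆) +
              Bop b Y (b.basis i) * crN b Y a * (anP b Y i * psi' b Y ⁅x, b.basis a⁆ +
                psi' b Y ⁅x, b.basis a⁆ * anP b Y i) -
              Bop b Y (b.basis i) * crN b Y a * psi' b Y ⁅x, b.basis a⁆ * anP b Y i := by
            noncomm_ring
          rw [r4, r1, r2]
          simp only [mul_zero, zero_mul, neg_zero, zero_add, LinearMap.sub_apply,
            Module.End.mul_apply, mem_onlyStar.1 he i, map_zero, sub_zero, LinearMap.smul_apply,
            Module.End.one_apply, map_smul]
          refine Submodule.smul_mem _ _ ?_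
          have h3 : Qop b Y (b.basis i) (crN b Y a e) = 0 := Qop_onlyStar _ (mem_onlyStar.2
            fun j => by
              have := LinearMap.congr_fun (anP_crN (b := b) (Y := Y) j a) e
              change anP b Y j (crN b Y a e) + crN b Y a (anP b Y j e) = 0 at this
              rwa [mem_onlyStar.1 he j, map_zero, add_zero] at this)
          change rhog b Y (b.basis i) (crN b Y a e) +
            (1 / 2 : ℂ) • Qop b Y (b.basis i) (crN b Y a e) ∈ noStar b Y
          rw [h3, smul_zero, add_zero]
          exact rhog_mem_noStar _ (crN_mem_noStar a e)
      · change Lop b Y x (dd b Y e) ∈ noStar b Y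
        rw [Lop_onlyStar x (dd_mem_onlyStar he)]
        refine add_mem (rhog_mem_noStar x ?_) (Kop_mem_noStar _ _)
        rw [dd, LinearMap.add_apply, dAn_onlyStar he, add_zero]
        exact dCr_mem_noStar _
  exact (sub_eq_zero.1 hX).symm

variable (b Y) in
/-- The square of the differential commutes with all `ψᵢ`, by Cartan's formula and `Lop_dd`, and has
no matrix elements between the `e_K` with `K ⊆ 𝔤₋` and those with `K ⊆ 𝔤₊`. -/
theorem dd_dd : dd b Y * dd b Y = 0 := by
  refine eq_zero_of_comm_ps (ε := 1) (cont_dd.mul cont_dd) (one_mul 1) (fun i => ?_)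
    fun e he => ?_
  · have a1 := dd_ps (b := b) (Y := Y) i
    have a2 := Lop_dd (b := b) (Y := Y) (b.basis i)
    rw [← a1] at a2
    rw [one_smul, ← sub_eq_zero, ← sub_eq_zero.2 a2.symm]
    noncomm_ring
  · change dd b Y (dd b Y e) ∈ noStar b Y
    rw [dd, LinearMap.add_apply, ← dd, dAn_onlyStar (dd_mem_onlyStar he), add_zero]
    exact dCr_mem_noStar _

end Square

/-! ### Comparison with the differential given by coefficients -/

section Comparison

variable {𝔤 : Type u} [LieRing 𝔤] [LieAlgebra ℂ 𝔤] {s : SemiInfiniteStructure 𝔤}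
  {ι : Type v} [LinearOrder ι] {b : HomogeneousBasis s ι}

local notation "U" => UniversalEnvelopingAlgebra ℂ 𝔤

theorem psi_val (k : ι) (c : Tame b U) : psi b.opp k c.1 = (ps b U k c).1 := by
  unfold psi ps; split_ifs <;> rfl

theorem psiStar_val (k : ι) (c : Tame b U) :
    psiStar b.opp k c.1 = (crN b U k c + anP b U k c).1 := by
  unfold psiStar crN anP; split_ifs
  · rw [LinearMap.zero_apply, add_zero]; rfl
  · rw [LinearMap.zero_apply, zero_add]; rfl

variable (b) in
/-- The operator `:ψᵢ*(:ψⱼ*ψ_z:):` on tame formal sums. -/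
def cub (i j : ι) (z : 𝔤) : Module.End ℂ (Tame b U) :=
  if b.deg i < 0 then crN b U i * (crN b U j * psi' b U z - psi' b U z * anP b U j)
  else (crN b U j * psi' b U z - psi' b U z * anP b U j) * anP b U i

theorem normalCubic_val (i j k : ι) (c : Tame b U) :
    normalCubic b.opp i j k c.1 = (cub b i j (b.basis k) c).1 := by
  have h2 : ∀ c : Tame b U, normalQuadratic b.opp j k c.1 =
      ((crN b U j * ps b U k - ps b U k * anP b U j) c).1 := fun c => by
    unfold normalQuadratic
    split_ifs with h
    · rw [LinearMap.comp_apply, psi_val, psiStar_val]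
      simp [anP, h]
    · rw [LinearMap.neg_apply, LinearMap.comp_apply, psiStar_val, psi_val]
      simp [crN, h]
  unfold normalCubic cub
  rw [psi'_basis]
  split_ifs with h
  · rw [LinearMap.comp_apply, h2, psiStar_val]
    simp [anP, h]
  · rw [LinearMap.comp_apply, psiStar_val, h2]
    simp [crN, h]

theorem cub_add (i j : ι) (c : Tame b U) (K : Finset ι) (v : U) (z : 𝔤) :
    (cub b i j z c).1 K v =
      ∑ᶠ k, b.basis.repr z k • (cub b i j (b.basis k) c).1 K v := by
  have hl : ∃ f : 𝔤 →ₗ[ℂ] U, ∀ z, f z = (cub b i j z c).1 K v :=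
    ⟨{ toFun := fun z => (cub b i j z c).1 K v
       map_add' := fun x y => by
        unfold cub
        split_ifs
        · simp only [map_add, mul_add, add_mul, LinearMap.add_apply, LinearMap.sub_apply, mul_sub,
            Tame.val_add, Tame.val_sub, Pi.add_apply, Pi.sub_apply]
          abel
        · simp only [map_add, mul_add, add_mul, LinearMap.add_apply, LinearMap.sub_apply, sub_mul,
            Tame.val_add, Tame.val_sub, Pi.add_apply, Pi.sub_apply]
          abel
       map_smul' := fun a x => by
        unfold cub
        split_ifs
        · simp only [map_smul, mul_smul_comm, smul_mul_assoc, ← smul_sub]; rfl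
        · simp only [map_smul, mul_smul_comm, smul_mul_assoc, ← smul_sub]; rfl }, fun _ => rfl⟩
  obtain ⟨f, hf⟩ := hl
  rw [← hf, finsum_eq_sum_of_support_subset (s := (b.basis.repr z).support)]
  · conv_lhs => rw [← b.basis.linearCombination_repr z, Finsupp.linearCombination_apply,
      Finsupp.sum, map_sum]
    exact Finset.sum_congr rfl fun k _ => by rw [map_smul, hf]
  · intro k hk
    refine Finset.mem_coe.2 (Finsupp.mem_support_iff.2 fun h => hk ?_)
    change b.basis.repr z k • _ = _
    rw [h, zero_smul]

theorem finite_cub (c : Tame b U) (K : Finset ι) (v : U) :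
    (Function.support fun t : ι × ι =>
      (cub b t.1 t.2 ⁅b.basis t.1, b.basis t.2⁆ c).1 K v).Finite := by
  have h := finite_cubic b (mem_tame_iff.2 c.2) K v
  refine (h.image fun t => (t.1, t.2.1)).subset ?_
  rintro ⟨i, j⟩ ht
  rw [Function.mem_support, cub_add] at ht
  obtain ⟨k, hk⟩ : ∃ k, b.basis.repr ⁅b.basis i, b.basis j⁆ k •
      (cub b i j (b.basis k) c).1 K v ≠ 0 := by
    by_contra hn
    push Not at hn
    exact ht (finsum_eq_zero_of_forall_eq_zero hn)
  refine ⟨(i, j, k), ?_, rfl⟩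
  rw [Function.mem_support, normalCubic_val]
  exact hk

theorem finsum_cubic (c : Tame b U) (K : Finset ι) (v : U) :
    ∑ᶠ t : ι × ι × ι, b.sc t.1 t.2.1 t.2.2 • normalCubic b.opp t.1 t.2.1 t.2.2 c.1 K v =
      ∑ᶠ t : ι × ι, (cub b t.1 t.2 ⁅b.basis t.1, b.basis t.2⁆ c).1 K v := by
  rw [finsum_curry₃ _ (finite_cubic b (mem_tame_iff.2 c.2) K v), finsum_curry _ (finite_cub c K v)]
  refine finsum_congr fun i => finsum_congr fun j => ?_
  rw [cub_add]
  refine finsum_congr fun k => ?_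
  rw [normalCubic_val]
  rfl

theorem finsum_mul_crN (R : Module.End ℂ (Tame b U)) (hR : Cont R) (x : 𝔤) (c : Tame b U)
    (K : Finset ι) (v : U) :
    ∑ᶠ j, ((R * (crN b U j * psi' b U ⁅x, b.basis j⁆)) c).1 K v = -((R * Kop b U x) c).1 K v := by
  rw [Kop_eq, mul_locSum _ hR, locSum_apply, ← finsum_neg_distrib]
  refine finsum_congr fun j => ?_
  rw [mul_neg, mul_neg, LinearMap.neg_apply, Tame.val_neg, Pi.neg_apply, LinearMap.neg_apply,
    neg_neg]

theorem finsum_mul_anP (R : Module.End ℂ (Tame b U)) (hR : Cont R) (x : 𝔤) (c : Tame b U)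
    (K : Finset ι) (v : U) :
    ∑ᶠ j, ((R * (psi' b U ⁅x, b.basis j⁆ * anP b U j)) c).1 K v = ((R * Qop b U x) c).1 K v := by
  rw [Qop_eq, mul_locSum _ hR, locSum_apply]

/-- The cubic part of the differential, summed over the first two indices. The two sums in which
exactly one of these indices lies in `𝔤₋` are equal, by the antisymmetry of the bracket. -/
theorem finsum_cub (c : Tame b U) (K : Finset ι) (v : U) :
    ∑ᶠ t : ι × ι, (cub b t.1 t.2 ⁅b.basis t.1, b.basis t.2⁆ c).1 K v =
      -(∑ᶠ i, ((crN b U i * Kop b U (b.basis i)) c).1 K v) -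
      ∑ᶠ i, ((crN b U i * Qop b U (b.basis i)) c).1 K v -
      ∑ᶠ i, ((crN b U i * Qop b U (b.basis i)) c).1 K v -
      ∑ᶠ i, ((Qop b U (b.basis i) * anP b U i) c).1 K v := by
  classical
  let g : ι × ι → U := fun t => (cub b t.1 t.2 ⁅b.basis t.1, b.basis t.2⁆ c).1 K v
  have hg : (Function.support g).Finite := finite_cub c K v
  let r : (ι × ι → Prop) → ι × ι → U := fun p t => if p t then g t else 0
  have hr : ∀ p, (Function.support (r p)).Finite := fun p => hg.subset fun t ht h => ht (by
    change (if p t then g t else 0) = 0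
    rw [h, ite_self])
  -- separate the four possibilities for the signs of the degrees of the two indices
  have e : ∀ t, g t = r (fun t => b.deg t.1 < 0 ∧ b.deg t.2 < 0) t +
      r (fun t => b.deg t.1 < 0 ∧ ¬ b.deg t.2 < 0) t +
      r (fun t => ¬ b.deg t.1 < 0 ∧ b.deg t.2 < 0) t +
      r (fun t => ¬ b.deg t.1 < 0 ∧ ¬ b.deg t.2 < 0) t := fun t => by
    by_cases h1 : b.deg t.1 < 0 <;> by_cases h2 : b.deg t.2 < 0 <;>
      simp only [r, h1, h2, not_true_eq_false, not_false_eq_true, and_self, and_true, and_false,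
        if_true, if_false, add_zero, zero_add]
  have e1 : ∑ᶠ t, r (fun t => b.deg t.1 < 0 ∧ b.deg t.2 < 0) t =
      -(∑ᶠ i, ((crN b U i * Kop b U (b.basis i)) c).1 K v) := by
    rw [finsum_curry _ (hr _), ← finsum_neg_distrib]
    refine finsum_congr fun i => ?_
    rw [← finsum_mul_crN _ (cont_crN i)]
    refine finsum_congr fun j => ?_
    by_cases h1 : b.deg i < 0 <;> by_cases h2 : b.deg j < 0 <;> simp [r, g, h1, h2, cub, crN, anP]
  have e2 : ∑ᶠ t, r (fun t => b.deg t.1 < 0 ∧ ¬ b.deg t.2 < 0) t =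
      -(∑ᶠ i, ((crN b U i * Qop b U (b.basis i)) c).1 K v) := by
    rw [finsum_curry _ (hr _), ← finsum_neg_distrib]
    refine finsum_congr fun i => ?_
    rw [← finsum_mul_anP _ (cont_crN i), ← finsum_neg_distrib]
    refine finsum_congr fun j => ?_
    by_cases h1 : b.deg i < 0 <;> by_cases h2 : b.deg j < 0 <;> simp [r, g, h1, h2, cub, crN, anP]
  have e4 : ∑ᶠ t, r (fun t => ¬ b.deg t.1 < 0 ∧ ¬ b.deg t.2 < 0) t =
      -(∑ᶠ i, ((Qop b U (b.basis i) * anP b U i) c).1 K v) := by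
    rw [finsum_curry _ (hr _), ← finsum_neg_distrib]
    refine finsum_congr fun i => ?_
    have := finsum_mul_anP 1 Cont.one (b.basis i) (anP b U i c) K v
    rw [one_mul] at this
    rw [Module.End.mul_apply, ← this, ← finsum_neg_distrib]
    refine finsum_congr fun j => ?_
    by_cases h1 : b.deg i < 0 <;> by_cases h2 : b.deg j < 0 <;> simp [r, g, h1, h2, cub, crN, anP]
  -- exchanging the two indices reduces this case to the previous mixed one
  have e3 : ∑ᶠ t, r (fun t => ¬ b.deg t.1 < 0 ∧ b.deg t.2 < 0) t =
      -(∑ᶠ i, ((crN b U i * Qop b U (b.basis i)) c).1 K v) := by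
    have h0 : (Function.support fun t : ι × ι =>
        r (fun t => ¬ b.deg t.1 < 0 ∧ b.deg t.2 < 0) (Equiv.prodComm ι ι t)).Finite :=
      (hr fun t => ¬ b.deg t.1 < 0 ∧ b.deg t.2 < 0).preimage (Equiv.prodComm ι ι).injective.injOn
    rw [← finsum_comp_equiv (Equiv.prodComm ι ι)]
    rw [finsum_curry _ h0, ← finsum_neg_distrib]
    refine finsum_congr fun i => ?_
    rw [← finsum_mul_anP _ (cont_crN i), ← finsum_neg_distrib]
    refine finsum_congr fun j => ?_
    by_cases h1 : b.deg i < 0 <;> by_cases h2 : b.deg j < 0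
    · simp [r, g, h1, h2, crN, anP]
    · rw [← lie_skew (b.basis i)]
      simp [r, g, h1, h2, not_lt.1 h2, cub, crN, anP, mul_assoc, -lie_skew]
    · simp [r, g, h1, h2, crN, anP]
    · simp [r, g, h1, h2, crN, anP]
  change ∑ᶠ t, g t = _
  rw [finsum_congr e, finsum_add_distrib, finsum_add_distrib, finsum_add_distrib (hr _) (hr _),
    e1, e2, e3, e4]
  · abel
  · exact ((hr _).union (hr _)).subset (Function.support_add _ _)
  · exact hr _
  · exact (((hr _).union (hr _)).subset (Function.support_add _ _) |>.union (hr _)).subset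
      (Function.support_add _ _)
  · exact hr _

/-- The differential given by its coefficients is the operator `dd`. -/
theorem dCoeff_eq (c : Tame b U) (K : Finset ι) (v : U) :
    dCoeff b c.1 K v = (dd b U c).1 K v := by
  have hc := mem_tame_iff.2 c.2
  have l1 : LF fun i => crN b U i * rhog b U (b.basis i) := lf_crN _
  have l2 : LF fun i => crN b U i * Kop b U (b.basis i) := lf_crN _
  have l3 : LF fun i => crN b U i * Qop b U (b.basis i) := lf_crN _
  have l5 : LF fun i => Qop b U (b.basis i) * anP b U i := lf_anP_of ec_Qop
  have l6 : LF fun i => Bop b U (b.basis i) * anP b U i := lf_anP_of ec_Bop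
  have l4 : LF fun i => rhog b U (b.basis i) * anP b U i := by
    refine (l6.add (l5.smul fun _ => -(1 / 2))).congr fun i => ?_
    rw [Bop, add_mul, smul_mul_assoc]
    module
  have h1 : dCr b U = locSum _ l1 + (1 / 2 : ℂ) • locSum _ l2 + locSum _ l3 := by
    rw [← locSum_smul, ← locSum_add, ← locSum_add]
    refine locSum_eq _ _ fun i => ?_
    rw [Aop, mul_add, mul_add, mul_smul_comm]
  have h2 : dAn b U = locSum _ l4 + (1 / 2 : ℂ) • locSum _ l5 := by
    rw [← locSum_smul, ← locSum_add]
    refine locSum_eq _ _ fun i => ?_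
    rw [Bop, add_mul, smul_mul_assoc]
  have h3 : ∑ᶠ i, diagAct (b.basis i) (psiStar b.opp i c.1 K) v +
      ∑ᶠ i, (-s.γ) (b.basis i) • psiStar b.opp i c.1 K v =
      (locSum _ l1 c).1 K v + (locSum _ l4 c).1 K v := by
    rw [← finsum_add_distrib (finite_linear b hc K v) (finite_gamma b hc K v), locSum_apply,
      locSum_apply, ← finsum_add_distrib (l1.finite_support c K v) (l4.finite_support c K v)]
    refine finsum_congr fun i => ?_
    have h4 := rhog_comm (rho_crN (b := b) (Y := U) (b.basis i) i)
    rw [← h4, psiStar_val]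
    change ((crN b U i c).1 K (v * toU (b.basis i)) + (anP b U i c).1 K (v * toU (b.basis i)) +
      toU (b.basis i) * ((crN b U i c).1 K v + (anP b U i c).1 K v)) +
      (-s.γ (b.basis i)) • ((crN b U i c).1 K v + (anP b U i c).1 K v) =
      ((crN b U i c).1 K (v * toU (b.basis i)) + toU (b.basis i) * (crN b U i c).1 K v -
        s.γ (b.basis i) • (crN b U i c).1 K v) +
      ((anP b U i c).1 K (v * toU (b.basis i)) + toU (b.basis i) * (anP b U i c).1 K v -
        s.γ (b.basis i) • (anP b U i c).1 K v)
    rw [mul_add, neg_smul, smul_add]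
    abel
  have h4 : ∀ x y z : U, x - y + z = (x + z) - y := fun x y z => by abel
  rw [dCoeff, h4, h3, finsum_cubic, finsum_cub, dd, LinearMap.add_apply, h1, h2]
  simp only [LinearMap.add_apply, LinearMap.smul_apply, Tame.val_add, Tame.val_smul, Pi.add_apply,
    Pi.smul_apply]
  rw [locSum_apply l2, locSum_apply l3, locSum_apply l5]
  module

end Comparison

/-! ### The homotopy -/

section Homotopy

variable {𝔤 : Type u} [LieRing 𝔤] [LieAlgebra ℂ 𝔤] {s : SemiInfiniteStructure 𝔤}
  {ι : Type v} [LinearOrder ι] {b : HomogeneousBasis s ι}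
  {Y : Type w} [AddCommGroup Y] [Module ℂ Y]

local notation "U" => UniversalEnvelopingAlgebra ℂ 𝔤

theorem mul_wrd_mem_Fil {z : U} (hz : z ∈ Uplus s) (l : List ι) (hl : ∀ i ∈ l, i ∈ neg b) :
    z * wrd b l ∈ Fil b l.length := by
  induction l using List.reverseRecOn with
  | nil =>
    have h0 : omon b 0 = 1 := by
      have := @PBW.exists_word_eq_mon ι ℂ 𝔤 (keyOrder b) _ _ _ b.basis 0
      obtain ⟨l, hl, h⟩ := this
      rw [Multiset.coe_eq_zero] at hl
      subst hl
      exact h.symm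
    have := mul_omon_mem_Fil (b := b) hz (S := 0) (m := 0) (by simp) (by simp)
    rw [h0] at this
    simpa using this
  | append_singleton l a ih =>
    have h1 := ih fun i hi => hl i (by simp [hi])
    have h2 := mul_toU_mem_Fil (hl a (by simp)) h1
    have e : wrd b (l ++ [a]) = wrd b l * toU (b.basis a) := by simp [wrd]
    rw [e, ← mul_assoc]
    simpa using h2

theorem mul_wrd_mul_mem_Fil {z : U} (hz : z ∈ Uplus s) (l : List ι) (hl : ∀ i ∈ l, i ∈ neg b)
    {i : ι} (hi : ¬ b.deg i < 0) : z * wrd b l * toU (b.basis i) ∈ Fil b l.length := by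
  induction l using List.reverseRecOn generalizing i with
  | nil =>
    have h := mul_wrd_mem_Fil (mul_mem hz (toU_mem_Uplus b hi)) ([] : List ι) (b := b) (by simp)
    simpa using h
  | append_singleton l a ih =>
    have hl' : ∀ i ∈ l, i ∈ neg b := fun i hi => hl i (by simp [hi])
    have ha := hl a (by simp)
    have e : z * wrd b (l ++ [a]) * toU (b.basis i) =
        z * wrd b l * toU (b.basis i) * toU (b.basis a) +
          z * wrd b l * toU ⁅b.basis a, b.basis i⁆ := by
      have : wrd b (l ++ [a]) = wrd b l * toU (b.basis a) := by simp [wrd]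
      rw [this, ← mul_assoc z, mul_assoc _ (toU (b.basis a)), toU_mul_toU, mul_add, ← mul_assoc]
    rw [e, List.length_append, List.length_singleton, Nat.cast_add, Nat.cast_one]
    refine add_mem (mul_toU_mem_Fil ha (ih hl' hi)) (mul_lie_basis_mem fun k _ => ?_)
    by_cases hk : b.deg k < 0
    · exact mul_toU_mem_Fil hk (mul_wrd_mem_Fil hz l hl')
    · exact Fil_mono (by linarith) (ih hl' hk)

theorem mul_toU_nonneg_mem_Fil {i : ι} (hi : ¬ b.deg i < 0) {m : ℤ} {v : U} (hv : v ∈ Fil b m) :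
    v * toU (b.basis i) ∈ Fil b m :=
  Fil_le (F := (Fil b m).comap (LinearMap.mulRight ℂ (toU (b.basis i))))
    (fun z hz S hS hm => by
      change z * omon b S * toU (b.basis i) ∈ Fil b m
      obtain ⟨l, hl, hlw⟩ := @PBW.exists_word_eq_mon ι ℂ 𝔤 (keyOrder b) _ _ _ b.basis S
      have hlw' : wrd b l = omon b S := hlw
      have hlS : ∀ i ∈ l, i ∈ neg b := fun i hi => hS i (by rw [← hl]; exact hi)
      have hlen : l.length = Multiset.card S := by rw [← hl, Multiset.coe_card]
      rw [← hlw']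
      exact Fil_mono (by rw [hlen]; exact hm) (mul_wrd_mul_mem_Fil hz l hlS hi)) hv

theorem mul_mem_Fil_right {m : ℤ} {v : U} (hv : v ∈ Fil b m) {u : U} (hu : u ∈ Uplus s) :
    v * u ∈ Fil b m := by
  refine Uplus_le (b := b) (p := (Fil b m).comap (LinearMap.mulLeft ℂ v)) (fun n => ?_) hu
  refine Submodule.span_le.2 ?_
  rintro _ ⟨l, h, -, rfl⟩
  change v * wrd b l ∈ Fil b m
  induction l using List.reverseRecOn with
  | nil => simpa using hv
  | append_singleton l a ih =>
    have e : wrd b (l ++ [a]) = wrd b l * toU (b.basis a) := by simp [wrd]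
    rw [e, ← mul_assoc]
    exact mul_toU_nonneg_mem_Fil (h a (by simp)) (ih fun i hi => h i (by simp [hi]))

variable (b) in
/-- The partial derivative along `x_a` for `x_a ∈ 𝔤₋`, and zero for `x_a ∈ 𝔤₊`. -/
def pdN (a : ι) : U →ₗ[ℂ] U := if b.deg a < 0 then pd b a else 0

theorem pdN_mul (a : ι) {z : U} (hz : z ∈ Uplus s) (w : U) : pdN b a (z * w) = z * pdN b a w := by
  unfold pdN; split_ifs with h
  · exact pd_mul h hz w
  · simp

variable (b) in
theorem adm_pdN (a : ι) : Adm b (pdN b a) := by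
  intro v
  obtain ⟨W, hW, h⟩ := exists_mul_mem_RC (b := b) v
  choose X hX hX' using fun w : U => exists_mul_mem_LC b w
  refine ⟨⋃ p ∈ W, (fun q : U × ℤ => (q.1, p.2 + q.2)) '' X (pdN b a p.1),
    hW.biUnion fun p _ => (hX _).image _, fun n u hu => ?_⟩
  refine Submodule.span_le (p := (LC b _ n).comap (pdN b a)) |>.2 ?_ (h n u hu)
  rintro _ ⟨p, hp, u', hu', rfl⟩
  rw [SetLike.mem_coe, Submodule.mem_comap, pdN_mul a (UP_le_Uplus _ hu')]
  refine Submodule.span_le.2 ?_ (hX' (pdN b a p.1) _ _ hu')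
  rintro _ ⟨q, hq, u'', hu'', rfl⟩
  refine Submodule.subset_span ⟨(q.1, p.2 + q.2), Set.mem_biUnion hp ⟨q, hq, rfl⟩, u'', ?_, rfl⟩
  rwa [add_assoc] at hu''

variable (b Y) in
/-- Precomposition with the partial derivative along `x_a`. -/
def pp (a : ι) : Module.End ℂ (Tame b Y) := pre Y (adm_pdN b a)

theorem pp_apply (a : ι) (c : Tame b Y) (K : Finset ι) (v : U) :
    (pp b Y a c).1 K v = c.1 K (pdN b a v) := rfl

/-- The sum defining the homotopy is locally finite: only finitely many partial derivatives are
nonzero on each `v U₊`. -/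
theorem lf_an_pp : LF fun a => an b Y a * pp b Y a := fun c I v => by
  obtain ⟨W, hW, h⟩ := exists_mul_mem_RC (b := b) v
  choose A hA using fun w : U => exists_pd_eq_zero (b := b) w
  refine (hW.biUnion (t := fun p => (A p.1 : Set ι)) fun p _ => (A p.1).finite_toSet).subset
    fun a ha => ?_
  by_contra hn
  refine ha (mem_zeroAt_of fun K hK n u hu => ?_)
  have h0 : pdN b a (v * u) = 0 := by
    refine (Submodule.mem_bot ℂ).1 (Submodule.span_le (p := Submodule.comap (pdN b a) ⊥) |>.2 ?_
      (h n u hu))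
    rintro _ ⟨p, hp, u', hu', rfl⟩
    refine (Submodule.mem_bot ℂ).2 ?_
    unfold pdN; split_ifs with ha
    · exact hA p.1 u' (UP_le_Uplus _ hu') a ha fun h' => hn (Set.mem_biUnion hp h')
    · rfl
  change (an b Y a (pp b Y a c)).1 K (v * u) = 0
  rw [an_apply, pp_apply, h0]
  simp

variable (b Y) in
/-- The homotopy: `h = ∑_a ∂_a ⊗ ψ_a`, the sum over the basis of `𝔤₋`. -/
def hop : Module.End ℂ (Tame b Y) := locSum (fun a => an b Y a * pp b Y a) lf_an_pp

variable (b Y) in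
/-- The formal sums which vanish on the products of less than `n` elements of `𝔤₋`, multiplied by
elements of `U₊`. -/
def Van (n : ℤ) : Submodule ℂ (Tame b Y) where
  carrier := {c | ∀ K, ∀ v ∈ Fil b (n - 1), c.1 K v = 0}
  zero_mem' _ _ _ := rfl
  add_mem' := fun {c c'} h h' K v hv => by
    change c.1 K v + c'.1 K v = 0
    rw [h K v hv, h' K v hv, add_zero]
  smul_mem' := fun a c h K v hv => by
    change a • c.1 K v = 0
    rw [h K v hv, smul_zero]

theorem Van_mono {m n : ℤ} (h : m ≤ n) : Van b Y n ≤ Van b Y m := fun _ hc K v hv =>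
  hc K v (Fil_mono (by linarith) hv)

theorem Van_zero (c : Tame b Y) : c ∈ Van b Y 0 := fun K v hv => by
  rw [Fil_neg (by norm_num) hv, map_zero]

theorem mem_zeroAt_of_Van {c : Tame b Y} {n : ℤ} (hc : c ∈ Van b Y n) {v : U}
    (hv : v ∈ Fil b (n - 1)) (I : Finset ι) : c.1 ∈ zeroAt b I v := fun K _ _ hu =>
  hc K _ (mul_mem_Fil_right hv hu)

/-- The operators preserving the order of vanishing. -/
def VanP (T : Module.End ℂ (Tame b Y)) : Prop := ∀ n, ∀ c ∈ Van b Y n, T c ∈ Van b Y n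

theorem VanP.neg {T : Module.End ℂ (Tame b Y)} (h : VanP T) : VanP (-T) :=
  fun n c hc => Submodule.neg_mem _ (h n c hc)

theorem VanP.mul {T T' : Module.End ℂ (Tame b Y)} (h : VanP T) (h' : VanP T') : VanP (T * T') :=
  fun n c hc => h n _ (h' n c hc)

theorem vanP_zero : VanP (0 : Module.End ℂ (Tame b Y)) := fun _ _ _ => Submodule.zero_mem _

theorem locSum_mem_Van {κ : Type*} {T : κ → Module.End ℂ (Tame b Y)} (h : LF T) {c : Tame b Y}
    {n : ℤ} (hT : ∀ k, T k c ∈ Van b Y n) : locSum T h c ∈ Van b Y n := fun K v hv =>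
  (Submodule.mem_bot ℂ).1 (locSum_pointwise h fun k => (Submodule.mem_bot ℂ).2 (hT k K v hv))

theorem vanP_cr (i : ι) : VanP (cr b Y i) := fun n c hc K v hv => by
  rw [cr_apply]
  split_ifs
  · rw [hc _ v hv, smul_zero]
  · rfl

theorem vanP_an (i : ι) : VanP (an b Y i) := fun n c hc K v hv => by
  rw [an_apply]
  split_ifs
  · rfl
  · rw [hc _ v hv, smul_zero]

theorem vanP_anP (i : ι) : VanP (anP b Y i) := by
  unfold anP; split_ifs
  exacts [vanP_zero, vanP_an i]

theorem vanP_crN (i : ι) : VanP (crN b Y i) := by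
  unfold crN; split_ifs
  exacts [vanP_cr i, vanP_zero]

theorem vanP_psi' (x : 𝔤) : VanP (psi' b Y x) := by
  rw [psi'_eq_sum]
  refine fun n c hc => ?_
  rw [LinearMap.sum_apply]
  refine Submodule.sum_mem _ fun k _ => Submodule.smul_mem _ _ ?_
  unfold ps; split_ifs
  exacts [vanP_an k n c hc, vanP_cr k n c hc]

theorem vanP_Qop (x : 𝔤) : VanP (Qop b Y x) := fun n c hc =>
  locSum_mem_Van _ fun j => (vanP_psi' _).mul (vanP_anP j) n c hc

theorem vanP_Kop (x : 𝔤) : VanP (Kop b Y x) := fun n c hc =>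
  locSum_mem_Van _ fun j => (vanP_crN j).mul (vanP_psi' _).neg n c hc

theorem pp_mem_Van (a : ι) {n : ℤ} {c : Tame b Y} (hc : c ∈ Van b Y n) :
    pp b Y a c ∈ Van b Y (n + 1) := fun K v hv => by
  rw [pp_apply]
  unfold pdN; split_ifs with h
  · exact hc K _ (by simpa using pd_mem_Fil h hv)
  · rw [LinearMap.zero_apply, map_zero]

theorem hop_mem_Van {n : ℤ} {c : Tame b Y} (hc : c ∈ Van b Y n) : hop b Y c ∈ Van b Y (n + 1) :=
  locSum_mem_Van _ fun a => vanP_an a _ _ (pp_mem_Van a hc)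

theorem pp_cr (a i : ι) : pp b Y a * cr b Y i = cr b Y i * pp b Y a :=
  LinearMap.ext fun c => Tame.ext' fun K v => by
    change (pp b Y a (cr b Y i c)).1 K v = (cr b Y i (pp b Y a c)).1 K v
    simp only [pp_apply, cr_apply]

theorem pp_an (a i : ι) : pp b Y a * an b Y i = an b Y i * pp b Y a :=
  LinearMap.ext fun c => Tame.ext' fun K v => by
    change (pp b Y a (an b Y i c)).1 K v = (an b Y i (pp b Y a c)).1 K v
    simp only [pp_apply, an_apply]

theorem pp_crN (a i : ι) : pp b Y a * crN b Y i = crN b Y i * pp b Y a := by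
  unfold crN; split_ifs
  · exact pp_cr a i
  · simp

theorem pp_anP (a i : ι) : pp b Y a * anP b Y i = anP b Y i * pp b Y a := by
  unfold anP; split_ifs
  · simp
  · exact pp_an a i

theorem pp_psi' (a : ι) (x : 𝔤) : pp b Y a * psi' b Y x = psi' b Y x * pp b Y a := by
  rw [psi'_eq_sum, Finset.mul_sum, Finset.sum_mul]
  refine Finset.sum_congr rfl fun k _ => ?_
  rw [mul_smul_comm, smul_mul_assoc]
  congr 1
  unfold ps; split_ifs
  exacts [pp_an a k, pp_cr a k]

theorem cont_pp (a : ι) : Cont (pp b Y a) := cont_pre _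

theorem pp_Qop (a : ι) (x : 𝔤) : pp b Y a * Qop b Y x = Qop b Y x * pp b Y a := by
  rw [Qop_eq, mul_locSum _ (cont_pp a), locSum_mul]
  exact locSum_eq _ _ fun j => by
    rw [← mul_assoc, pp_psi', mul_assoc, pp_anP, mul_assoc]

theorem pp_Kop (a : ι) (x : 𝔤) : pp b Y a * Kop b Y x = Kop b Y x * pp b Y a := by
  rw [Kop_eq, mul_locSum _ (cont_pp a), locSum_mul]
  exact locSum_eq _ _ fun j => by
    rw [← mul_assoc, pp_crN, mul_assoc, mul_neg, pp_psi', mul_assoc, neg_mul]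

variable [Module (UniversalEnvelopingAlgebra ℂ 𝔤) Y]
  [IsScalarTower ℂ (UniversalEnvelopingAlgebra ℂ 𝔤) Y]

variable (b Y) in
/-- The commutator of the diagonal action of `x` with the partial derivative along `x_a`. -/
def comm (x : 𝔤) (a : ι) : Module.End ℂ (Tame b Y) := rho b Y x * pp b Y a - pp b Y a * rho b Y x

theorem comm_apply (x : 𝔤) (a : ι) (c : Tame b Y) (K : Finset ι) (v : U) :
    (comm b Y x a c).1 K v = c.1 K (pdN b a (v * toU x) - pdN b a v * toU x) := by
  change (c.1 K (pdN b a (v * toU x)) + toU x • c.1 K (pdN b a v)) -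
    (c.1 K (pdN b a v * toU x) + toU x • c.1 K (pdN b a v)) = _
  rw [map_sub]
  abel

theorem rhog_pp (x : 𝔤) (a : ι) :
    rhog b Y x * pp b Y a - pp b Y a * rhog b Y x = comm b Y x a := by
  rw [rhog_apply, comm, sub_mul, mul_sub, smul_one_mul, mul_smul_one]
  abel

theorem Aop_pp (x : 𝔤) (a : ι) :
    Aop b Y x * pp b Y a - pp b Y a * Aop b Y x = comm b Y x a := by
  rw [← rhog_pp, Aop, add_mul, add_mul, mul_add, mul_add, pp_Qop, smul_mul_assoc, mul_smul_comm,
    pp_Kop]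
  abel

theorem Bop_pp (x : 𝔤) (a : ι) :
    Bop b Y x * pp b Y a - pp b Y a * Bop b Y x = comm b Y x a := by
  rw [← rhog_pp, Bop, add_mul, mul_add, smul_mul_assoc, mul_smul_comm, pp_Qop]
  abel

theorem lf_comm (a : ι) : LF fun i => comm b Y (b.basis i) a * anP b Y i := by
  have l := lf_anP_of (b := b) (Y := Y) ec_Bop
  refine ((l.mul_right (pp b Y a)).add ((l.mul_left (cont_pp a)).smul fun _ => -1)).congr
    fun i => ?_
  rw [← Bop_pp, sub_mul, mul_assoc _ (pp b Y a), pp_anP]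
  simp only [mul_assoc]
  module

/-- Precomposition with `∂_a` commutes with the operators on forms, so that its commutator with the
differential only involves the diagonal action. -/
theorem dd_pp (a : ι) : dd b Y * pp b Y a - pp b Y a * dd b Y =
    locSum (fun i => crN b Y i * comm b Y (b.basis i) a) (lf_crN _) +
      locSum (fun i => comm b Y (b.basis i) a * anP b Y i) (lf_comm a) := by
  have l := lf_anP_of (b := b) (Y := Y) ec_Bop
  have h1 : dCr b Y * pp b Y a = pp b Y a * dCr b Y +
      locSum (fun i => crN b Y i * comm b Y (b.basis i) a) (lf_crN _) := by
    rw [dCr, locSum_mul, mul_locSum _ (cont_pp a), ← locSum_add]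
    refine locSum_eq _ _ fun i => ?_
    rw [← mul_assoc (pp b Y a), pp_crN, ← Aop_pp]
    noncomm_ring
  have h2 : dAn b Y * pp b Y a = pp b Y a * dAn b Y +
      locSum (fun i => comm b Y (b.basis i) a * anP b Y i) (lf_comm a) := by
    rw [dAn, locSum_mul, mul_locSum _ (cont_pp a), ← locSum_add]
    refine locSum_eq _ _ fun i => ?_
    rw [mul_assoc, ← pp_anP, ← Bop_pp]
    noncomm_ring
  rw [dd, add_mul, mul_add, h1, h2]
  abel

/-- The commutator of the action of `xⱼ` with `∂_a`, for `j ≠ a` or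
`xⱼ ∈ 𝔤₊`, raises the order of vanishing. -/
theorem comm_mem_Van {j a : ι} (h : j ≠ a ∨ ¬ b.deg j < 0) {n : ℤ} {c : Tame b Y}
    (hc : c ∈ Van b Y n) : comm b Y (b.basis j) a c ∈ Van b Y (n + 1) := fun K v hv => by
  rw [add_sub_cancel_right] at hv
  rw [comm_apply]
  refine hc K _ ?_
  unfold pdN; split_ifs with ha
  · by_cases hj : b.deg j < 0
    · have := pd_comm hj ha hv
      rw [if_neg fun e => (h.resolve_right (not_not.2 hj)) e.symm, sub_zero] at this
      exact this
    · exact sub_mem (pd_mem_Fil ha (mul_toU_nonneg_mem_Fil hj hv))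
        (mul_toU_nonneg_mem_Fil hj (pd_mem_Fil ha hv))
  · simp

theorem pd_mul_self {a : ι} (ha : b.deg a < 0) {n : ℤ} {c : Tame b Y} (hc : c ∈ Van b Y n)
    (K : Finset ι) {v : U} (hv : v ∈ Fil b n) :
    c.1 K (pd b a (v * toU (b.basis a))) = c.1 K (pd b a v * toU (b.basis a)) + c.1 K v := by
  have := hc K _ (pd_comm ha ha hv)
  rw [if_pos rfl, map_sub, map_sub, sub_sub, sub_eq_zero] at this
  exact this

/-- On leading terms, the commutator of the differential with `∂_a` is `ψₐ*`, since only the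
commutator of `∂_a` with the right multiplication by `xₐ` contributes. -/
theorem dd_pp_apply {a : ι} (ha : b.deg a < 0) {n : ℤ} {c : Tame b Y} (hc : c ∈ Van b Y n)
    (K : Finset ι) {v : U} (hv : v ∈ Fil b n) :
    ((dd b Y * pp b Y a - pp b Y a * dd b Y) c).1 K v = (cr b Y a c).1 K v := by
  have hv' : v ∈ Fil b (n + 1 - 1) := by rwa [add_sub_cancel_right]
  rw [dd_pp, LinearMap.add_apply, Tame.val_add, Pi.add_apply, LinearMap.add_apply]
  have h1 : locSum (fun i => comm b Y (b.basis i) a * anP b Y i) (lf_comm a) c ∈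
      Van b Y (n + 1) := by
    refine locSum_mem_Van _ fun i => ?_
    by_cases hi : b.deg i < 0
    · simp [anP, hi]
    · rw [Module.End.mul_apply]
      exact comm_mem_Van (Or.inr hi) (vanP_anP i _ _ hc)
  have h2 : (locSum (fun i => comm b Y (b.basis i) a * anP b Y i) (lf_comm a) c).1 K v = 0 :=
    h1 K v hv'
  -- among the terms `ψᵢ* [ρᵢ, ∂_a]` only `i = a` contributes to the leading term
  rw [h2, add_zero, locSum_apply, finsum_eq_single _ a]
  · change (crN b Y a (comm b Y (b.basis a) a c)).1 K v = _
    rw [crN, if_pos ha, cr_apply, cr_apply, comm_apply, pdN, if_pos ha, map_sub,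
      pd_mul_self ha hc _ hv, add_sub_cancel_left]
  · exact fun j hj => vanP_crN j _ _ (comm_mem_Van (Or.inl hj) hc) K v hv'

/-- The terms of the Laplacian of the homotopy, up to terms which vanish to a higher order. -/
theorem laplace_term {a : ι} (ha : b.deg a < 0) {n : ℤ} {c : Tame b Y} (hc : c ∈ Van b Y n)
    (K : Finset ι) {v : U} (hv : v ∈ Fil b n) :
    ((dd b Y * (an b Y a * pp b Y a) + an b Y a * pp b Y a * dd b Y) c).1 K v =
      c.1 K (pd b a v * toU (b.basis a)) + if a ∈ K then c.1 K v else 0 := by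
  have hv' : v ∈ Fil b (n + 1 - 1) := by rwa [add_sub_cancel_right]
  have hp := pp_mem_Van a hc
  have h1 := dd_ps (b := b) (Y := Y) a
  rw [ps, if_pos ha] at h1
  have e : dd b Y * (an b Y a * pp b Y a) + an b Y a * pp b Y a * dd b Y =
      (dd b Y * an b Y a + an b Y a * dd b Y) * pp b Y a -
        an b Y a * (dd b Y * pp b Y a - pp b Y a * dd b Y) := by noncomm_ring
  rw [e, h1]
  change ((rho b Y (b.basis a) (pp b Y a c)).1 K v - s.γ (b.basis a) • (pp b Y a c).1 K v +
      (Qop b Y (b.basis a) (pp b Y a c)).1 K v + (Kop b Y (b.basis a) (pp b Y a c)).1 K v) -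
    (an b Y a ((dd b Y * pp b Y a - pp b Y a * dd b Y) c)).1 K v = _
  rw [vanP_Qop _ _ _ hp K v hv', vanP_Kop _ _ _ hp K v hv', hp K v hv', rho_apply, hp K v hv',
    an_apply, dd_pp_apply ha hc _ hv, pp_apply, pdN, if_pos ha, pd_mul_self ha hc K hv]
  have h3 := LinearMap.congr_fun (cr_an (b := b) (Y := Y) a a) c
  have h4 : (an b Y a (cr b Y a c)).1 K v = if a ∈ K then 0 else c.1 K v := by
    rw [an_apply]
    split_ifs with h
    · rfl
    · rw [cr_apply, if_pos (Finset.mem_insert_self _ _), sgn_insert_self, smul_smul, sgn_mul_self,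
        one_smul, Finset.erase_insert h]
  rw [an_apply] at h4
  rw [h4]
  split_ifs <;> simp

/-- The Laplacian of the homotopy acts on the leading term of a formal sum as the operator counting
the elements of `𝔤₋`. -/
theorem laplace_apply {n : ℤ} {c : Tame b Y} (hc : c ∈ Van b Y n)
    (K : Finset ι) {v : U} (hv : v ∈ Fil b n) :
    (dd b Y (hop b Y c) + hop b Y (dd b Y c)).1 K v =
      ((n : ℂ) + (starPart b.opp K).card) • c.1 K v := by
  classical
  have h1 : dd b Y * hop b Y + hop b Y * dd b Y = locSum (fun a =>
      dd b Y * (an b Y a * pp b Y a) + an b Y a * pp b Y a * dd b Y)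
      ((lf_an_pp.mul_left cont_dd).add (lf_an_pp.mul_right _)) := by
    rw [hop, mul_locSum _ cont_dd, locSum_mul, ← locSum_add]
  have h2 : (dd b Y (hop b Y c) + hop b Y (dd b Y c)).1 K v =
      ((dd b Y * hop b Y + hop b Y * dd b Y) c).1 K v := rfl
  have h3 : ∀ a, ((dd b Y * (an b Y a * pp b Y a) + an b Y a * pp b Y a * dd b Y) c).1 K v =
      if b.deg a < 0 then c.1 K (pd b a v * toU (b.basis a)) + (if a ∈ K then c.1 K v else 0)
      else 0 := fun a => by
    split_ifs with ha hK
    · rw [laplace_term ha hc K hv, if_pos hK]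
    · rw [laplace_term ha hc K hv, if_neg hK]
    · have : pp b Y a = 0 := LinearMap.ext fun c => Tame.ext' fun K v => by
        rw [pp_apply, pdN, if_neg ha, LinearMap.zero_apply, map_zero]; rfl
      rw [this]
      simp
  obtain ⟨A, hA⟩ := euler_mem hv
  obtain ⟨A', hA'⟩ := exists_pd_eq_zero (b := b) v
  rw [h2, h1, locSum_apply, finsum_congr h3,
    finsum_eq_sum_of_support_subset (s := (A ∪ A') ∪ K)]
  · have h4 := hc K _ (hA (A ∪ A' ∪ K) (Finset.subset_union_left.trans Finset.subset_union_left))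
    rw [map_sub, sub_eq_zero, map_sum, map_smul] at h4
    rw [← Finset.sum_filter, Finset.sum_add_distrib, h4, Finset.sum_filter, ← Finset.sum_filter,
      Finset.sum_ite_mem, Finset.sum_const, add_smul]
    congr 1
    have : (Finset.filter (fun i => b.deg i < 0) (A ∪ A' ∪ K)) ∩ K = starPart b.opp K := by
      ext i
      simp [starPart]
      tauto
    rw [this, Nat.cast_smul_eq_nsmul]
  · intro a ha
    by_contra hn
    rw [Finset.mem_coe, Finset.mem_union, Finset.mem_union, not_or, not_or] at hn
    refine ha ?_
    change (if b.deg a < 0 then c.1 K (pd b a v * toU (b.basis a)) +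
      (if a ∈ K then c.1 K v else 0) else 0) = 0
    split_ifs with h
    · exact absurd ‹a ∈ K› hn.2
    · have := hA' 1 (one_mem _) a h hn.1.2
      rw [one_mul] at this
      rw [this]; simp
    · rfl

end Homotopy

/-! ### Degrees -/

section Degrees

variable {𝔤 : Type u} [LieRing 𝔤] [LieAlgebra ℂ 𝔤] {s : SemiInfiniteStructure 𝔤}
  {ι : Type v} [LinearOrder ι] {b : HomogeneousBasis s ι}
  {Y : Type w} [AddCommGroup Y] [Module ℂ Y] {grY : ℤ → Submodule ℂ Y}

local notation "U" => UniversalEnvelopingAlgebra ℂ 𝔤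

variable (b) in
/-- The internal degree of `e_K`, up to sign. -/
def wt (K : Finset ι) : ℤ := ∑ i ∈ starPart b.opp K, b.deg i - ∑ i ∈ psiPart b.opp K, b.deg i

variable (b) in
/-- The cohomological degree of `e_K`. -/
def cdeg (K : Finset ι) : ℤ := (starPart b.opp K).card - (psiPart b.opp K).card

variable (b grY) in
/-- The formal sums of cohomological degree `m` and internal degree `n` involving only the `e_K`
with at most `q` factors `ψ*`. -/
def HomY (m n q : ℤ) : Submodule ℂ (Tame b Y) where
  carrier := {c | ∀ K, (¬ (cdeg b K = m ∧ ((starPart b.opp K).card : ℤ) ≤ q) → c.1 K = 0) ∧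
    ∀ k, ∀ v ∈ grU s k, c.1 K v ∈ grY (n + k + wt b K)}
  zero_mem' := fun K => ⟨fun _ => rfl, fun _ _ _ => Submodule.zero_mem _⟩
  add_mem' := fun {c c'} h h' K => ⟨fun hK => by
      change c.1 K + c'.1 K = 0
      rw [(h K).1 hK, (h' K).1 hK, add_zero],
    fun k v hv => Submodule.add_mem _ ((h K).2 k v hv) ((h' K).2 k v hv)⟩
  smul_mem' := fun a c h K => ⟨fun hK => by
      change a • c.1 K = 0
      rw [(h K).1 hK, smul_zero],
    fun k v hv => Submodule.smul_mem _ a ((h K).2 k v hv)⟩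

theorem HomY_mono {m n q q' : ℤ} (h : q ≤ q') : HomY b grY m n q ≤ HomY b grY m n q' :=
  fun _ hc K => ⟨fun hK => (hc K).1 fun h' => hK ⟨h'.1, h'.2.trans h⟩, (hc K).2⟩

variable (b grY) in
/-- The operators which are homogeneous of given degrees. -/
def Gr (T : Module.End ℂ (Tame b Y)) (m₀ n₀ q₀ : ℤ) : Prop :=
  ∀ m n q, ∀ c ∈ HomY b grY m n q, T c ∈ HomY b grY (m + m₀) (n + n₀) (q + q₀)

theorem Gr.mono {T : Module.End ℂ (Tame b Y)} {m n q q' : ℤ} (h : Gr b grY T m n q) (hq : q ≤ q') :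
    Gr b grY T m n q' := fun m' n' q'' c hc => HomY_mono (by linarith) (h m' n' q'' c hc)

theorem Gr.add {T T' : Module.End ℂ (Tame b Y)} {m n q : ℤ} (h : Gr b grY T m n q)
    (h' : Gr b grY T' m n q) : Gr b grY (T + T') m n q := fun m' n' q' c hc =>
  Submodule.add_mem _ (h m' n' q' c hc) (h' m' n' q' c hc)

theorem Gr.sub {T T' : Module.End ℂ (Tame b Y)} {m n q : ℤ} (h : Gr b grY T m n q)
    (h' : Gr b grY T' m n q) : Gr b grY (T - T') m n q := fun m' n' q' c hc =>
  Submodule.sub_mem _ (h m' n' q' c hc) (h' m' n' q' c hc)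

theorem Gr.smul {T : Module.End ℂ (Tame b Y)} {m n q : ℤ} (h : Gr b grY T m n q) (a : ℂ) :
    Gr b grY (a • T) m n q := fun m' n' q' c hc => Submodule.smul_mem _ a (h m' n' q' c hc)

theorem Gr.neg {T : Module.End ℂ (Tame b Y)} {m n q : ℤ} (h : Gr b grY T m n q) :
    Gr b grY (-T) m n q := fun m' n' q' c hc => Submodule.neg_mem _ (h m' n' q' c hc)

theorem gr_zero {m n q : ℤ} : Gr b grY (0 : Module.End ℂ (Tame b Y)) m n q :=
  fun _ _ _ _ _ => Submodule.zero_mem _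

theorem gr_one : Gr b grY (1 : Module.End ℂ (Tame b Y)) 0 0 0 := fun m n q c hc => by
  rw [add_zero, add_zero, add_zero]; exact hc

theorem Gr.mul {T T' : Module.End ℂ (Tame b Y)} {m n q m' n' q' : ℤ} (h : Gr b grY T m n q)
    (h' : Gr b grY T' m' n' q') {m₀ n₀ q₀ : ℤ} (hm : m' + m = m₀) (hn : n' + n = n₀)
    (hq : q' + q = q₀) : Gr b grY (T * T') m₀ n₀ q₀ := fun m₁ n₁ q₁ c hc => by
  have := h _ _ _ _ (h' _ _ _ _ hc)
  rwa [add_assoc, add_assoc, add_assoc, hm, hn, hq] at this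

theorem gr_locSum {κ : Type*} {T : κ → Module.End ℂ (Tame b Y)} (h : LF T) {m n q : ℤ}
    (hT : ∀ k, Gr b grY (T k) m n q) : Gr b grY (locSum T h) m n q := fun m' n' q' c hc K =>
  ⟨fun hK => LinearMap.ext fun v => (Submodule.mem_bot ℂ).1
    (locSum_pointwise h fun k => (Submodule.mem_bot ℂ).2 (by
      rw [(hT k m' n' q' c hc K).1 hK]; rfl)),
   fun k' v hv => locSum_pointwise h fun k => (hT k m' n' q' c hc K).2 k' v hv⟩

theorem starPart_insert_neg {i : ι} (hi : b.deg i < 0) (K : Finset ι) :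
    starPart b.opp (insert i K) = insert i (starPart b.opp K) := by
  simp [starPart, Finset.filter_insert, hi]

theorem starPart_insert_nonneg {i : ι} (hi : ¬ b.deg i < 0) (K : Finset ι) :
    starPart b.opp (insert i K) = starPart b.opp K := by
  rw [starPart, Finset.filter_insert, if_neg hi, starPart]

theorem psiPart_insert_neg {i : ι} (hi : b.deg i < 0) (K : Finset ι) :
    psiPart b.opp (insert i K) = psiPart b.opp K := by
  rw [psiPart, Finset.filter_insert, if_neg (not_not.2 hi), psiPart]

theorem psiPart_insert_nonneg {i : ι} (hi : ¬ b.deg i < 0) (K : Finset ι) :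
    psiPart b.opp (insert i K) = insert i (psiPart b.opp K) := by
  rw [psiPart, Finset.filter_insert, if_pos hi, psiPart]

theorem notMem_psiPart {i : ι} {K : Finset ι} (hK : i ∉ K) : i ∉ psiPart b.opp K := fun h =>
  hK (Finset.mem_filter.1 h).1

theorem card_starPart_insert {i : ι} {K : Finset ι} (hK : i ∉ K) :
    ((starPart b.opp (insert i K)).card : ℤ) =
      (starPart b.opp K).card + if b.deg i < 0 then 1 else 0 := by
  split_ifs with hi
  · rw [starPart_insert_neg hi, Finset.card_insert_of_notMem (fun h => hK (mem_starPart.1 h).1)]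
    simp
  · rw [starPart_insert_nonneg hi, add_zero]

theorem cdeg_insert {i : ι} {K : Finset ι} (hK : i ∉ K) :
    cdeg b (insert i K) = cdeg b K + if b.deg i < 0 then 1 else -1 := by
  rw [cdeg, card_starPart_insert hK]
  split_ifs with hi
  · rw [psiPart_insert_neg hi, cdeg]; ring
  · rw [psiPart_insert_nonneg hi,
      Finset.card_insert_of_notMem (notMem_psiPart hK), cdeg]
    push_cast; ring

theorem wt_insert {i : ι} {K : Finset ι} (hK : i ∉ K) :
    wt b (insert i K) = wt b K + if b.deg i < 0 then b.deg i else -b.deg i := by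
  split_ifs with hi
  · rw [wt, psiPart_insert_neg hi, starPart_insert_neg hi,
      Finset.sum_insert (fun h => hK (mem_starPart.1 h).1), wt]; ring
  · rw [wt, psiPart_insert_nonneg hi, starPart_insert_nonneg hi,
      Finset.sum_insert (notMem_psiPart hK), wt]; ring

theorem gr_cr (i : ι) : Gr b grY (cr b Y i) (if b.deg i < 0 then 1 else -1)
    (-if b.deg i < 0 then b.deg i else -b.deg i) (if b.deg i < 0 then 1 else 0) := by
  intro m n q c hc K
  by_cases hi : i ∈ K
  · obtain ⟨L, hL, rfl⟩ : ∃ L, i ∉ L ∧ insert i L = K :=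
      ⟨K.erase i, Finset.notMem_erase i K, Finset.insert_erase hi⟩
    refine ⟨fun hK => ?_, fun k v hv => ?_⟩
    · refine LinearMap.ext fun v => ?_
      rw [cr_apply, if_pos hi, Finset.erase_insert hL, (hc L).1]
      · simp
      · rintro ⟨h1, h2⟩
        refine hK ⟨by rw [cdeg_insert hL, h1], ?_⟩
        rw [card_starPart_insert hL]
        linarith
    · rw [cr_apply, if_pos hi, Finset.erase_insert hL]
      have := (hc L).2 k v hv
      have e : n + k + wt b L = n + (-if b.deg i < 0 then b.deg i else -b.deg i) + k +
          wt b (insert i L) := by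
        rw [wt_insert hL]; ring
      rw [e] at this
      exact Submodule.smul_mem _ _ this
  · refine ⟨fun hK => LinearMap.ext fun v => ?_, fun k v hv => ?_⟩
    · rw [cr_apply, if_neg hi]; rfl
    · rw [cr_apply, if_neg hi]; exact Submodule.zero_mem _

theorem gr_an (i : ι) : Gr b grY (an b Y i) (-if b.deg i < 0 then 1 else -1)
    (if b.deg i < 0 then b.deg i else -b.deg i) (-if b.deg i < 0 then 1 else 0) := by
  intro m n q c hc K
  by_cases hi : i ∈ K
  · refine ⟨fun hK => LinearMap.ext fun v => ?_, fun k v hv => ?_⟩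
    · rw [an_apply, if_pos hi]; rfl
    · rw [an_apply, if_pos hi]; exact Submodule.zero_mem _
  · refine ⟨fun hK => ?_, fun k v hv => ?_⟩
    · refine LinearMap.ext fun v => ?_
      rw [an_apply, if_neg hi, (hc _).1]
      · simp
      · rintro ⟨h1, h2⟩
        rw [cdeg_insert hi] at h1
        rw [card_starPart_insert hi] at h2
        exact hK ⟨by linarith, by linarith⟩
    · rw [an_apply, if_neg hi]
      have := (hc (insert i K)).2 k v hv
      have e : n + k + wt b (insert i K) = n + (if b.deg i < 0 then b.deg i else -b.deg i) + k +
          wt b K := by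
        rw [wt_insert hi]; ring
      rw [e] at this
      exact Submodule.smul_mem _ _ this

theorem gr_crN (i : ι) : Gr b grY (crN b Y i) 1 (-b.deg i) 1 := by
  unfold crN; split_ifs with h
  · simpa [h] using gr_cr (b := b) (grY := grY) i
  · exact gr_zero

theorem gr_anP (i : ι) : Gr b grY (anP b Y i) 1 (-b.deg i) 0 := by
  unfold anP; split_ifs with h
  · exact gr_zero
  · have := gr_an (b := b) (grY := grY) i
    simp only [h, if_false] at this
    simpa using this

theorem gr_ps (i : ι) : Gr b grY (ps b Y i) (-1) (b.deg i) (if b.deg i < 0 then -1 else 0) := by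
  unfold ps; split_ifs with h
  · simpa [h] using gr_an (b := b) (grY := grY) i
  · have := gr_cr (b := b) (grY := grY) i
    simp only [h, if_false] at this
    simpa using this

theorem gr_psi' {e : ℤ} {z : 𝔤} (hz : z ∈ s.gr e) :
    Gr b grY (psi' b Y z) (-1) e (if e < 0 then -1 else 0) := by
  rw [psi'_eq_sum]
  intro m n q c hc
  rw [LinearMap.sum_apply]
  refine Submodule.sum_mem _ fun k hk => Submodule.smul_mem _ _ ?_
  have hk' : b.deg k = e := by
    by_contra h
    exact Finsupp.mem_support_iff.1 hk (b.coord_eq_zero hz h)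
  have := gr_ps (b := b) (grY := grY) k
  rw [hk'] at this
  exact this m n q c hc

theorem gr_Qop {e : ℤ} {x : 𝔤} (hx : x ∈ s.gr e) : Gr b grY (Qop b Y x) 0 e 0 :=
  gr_locSum _ fun j => ((gr_psi' (s.lie_mem hx (b.mem j))).mono (q' := 0) (by
    split_ifs <;> norm_num)).mul (gr_anP j) (by ring) (by ring) (by ring)

theorem gr_Kop {a : ι} (ha : b.deg a < 0) : Gr b grY (Kop b Y (b.basis a)) 0 (b.deg a) 0 :=
  gr_locSum _ fun j => by
    by_cases hj : b.deg j < 0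
    · have := gr_psi' (b := b) (grY := grY) (s.lie_mem (b.mem a) (b.mem j))
      rw [if_pos (by linarith)] at this
      exact (gr_crN j).mul this.neg (by ring) (by ring) (by ring)
    · have : crN b Y j = 0 := if_neg hj
      rw [this, zero_mul]
      exact gr_zero

theorem gr_pp (a : ι) : Gr b grY (pp b Y a) 0 (-b.deg a) 0 := fun m n q c hc K => by
  rw [add_zero, add_zero]
  refine ⟨fun hK => LinearMap.ext fun v => ?_, fun k v hv => ?_⟩
  · rw [pp_apply, (hc K).1 hK]; rfl
  · rw [pp_apply]
    unfold pdN; split_ifs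
    · have := (hc K).2 _ _ (pd_grU (b := b) a hv)
      have e : n + (k - b.deg a) + wt b K = n + -b.deg a + k + wt b K := by ring
      rwa [e] at this
    · rw [LinearMap.zero_apply, map_zero]; exact Submodule.zero_mem _

/-- The homotopy is homogeneous. -/
theorem gr_hop : Gr b grY (hop b Y) (-1) 0 (-1) := gr_locSum _ fun a => by
  by_cases ha : b.deg a < 0
  · have := gr_an (b := b) (grY := grY) a
    simp only [ha, if_true] at this
    exact this.mul (gr_pp a) (by ring) (by ring) (by ring)
  · have : pp b Y a = 0 := LinearMap.ext fun c => Tame.ext' fun K v => by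
      rw [pp_apply, pdN, if_neg ha, LinearMap.zero_apply, map_zero]; rfl
    rw [this, mul_zero]
    exact gr_zero

variable [Module (UniversalEnvelopingAlgebra ℂ 𝔤) Y]
  [IsScalarTower ℂ (UniversalEnvelopingAlgebra ℂ 𝔤) Y]

theorem gr_rho
    (hY : ∀ {i n : ℤ} {x : 𝔤} {y : Y}, x ∈ s.gr i → y ∈ grY n → toU x • y ∈ grY (i + n))
    {e : ℤ} {x : 𝔤} (hx : x ∈ s.gr e) : Gr b grY (rho b Y x) 0 e 0 :=
  fun m n q c hc K => by
    rw [add_zero, add_zero]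
    refine ⟨fun hK => LinearMap.ext fun v => ?_, fun k v hv => ?_⟩
    · rw [rho_apply, (hc K).1 hK]; simp
    · rw [rho_apply]
      have h1 := (hc K).2 _ _ (mul_toU_mem s hx hv)
      have h2 := hY hx ((hc K).2 _ _ hv)
      have e1 : n + (k + e) + wt b K = n + e + k + wt b K := by ring
      have e2 : e + (n + k + wt b K) = n + e + k + wt b K := by ring
      rw [e1] at h1
      rw [e2] at h2
      exact Submodule.add_mem _ h1 h2

theorem gr_rhog
    (hY : ∀ {i n : ℤ} {x : 𝔤} {y : Y}, x ∈ s.gr i → y ∈ grY n → toU x • y ∈ grY (i + n))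
    (hγ : ∀ n : ℤ, n ≠ 0 → ∀ x ∈ s.gr n, s.γ x = 0)
    {e : ℤ} {x : 𝔤} (hx : x ∈ s.gr e) : Gr b grY (rhog b Y x) 0 e 0 := by
  rw [rhog_apply]
  refine (gr_rho hY hx).sub ?_
  by_cases he : e = 0
  · subst he; exact gr_one.smul _
  · rw [hγ e he x hx, zero_smul]; exact gr_zero

/-- The differential is homogeneous. -/
theorem gr_dd
    (hY : ∀ {i n : ℤ} {x : 𝔤} {y : Y}, x ∈ s.gr i → y ∈ grY n → toU x • y ∈ grY (i + n))
    (hγ : ∀ n : ℤ, n ≠ 0 → ∀ x ∈ s.gr n, s.γ x = 0) :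
    Gr b grY (dd b Y) 1 0 1 := by
  refine Gr.add (gr_locSum _ fun a => ?_) ((gr_locSum _ fun i => ?_).mono zero_le_one)
  · by_cases ha : b.deg a < 0
    · have h : Gr b grY (Aop b Y (b.basis a)) 0 (b.deg a) 0 :=
        ((gr_rhog hY hγ (b.mem a)).add ((gr_Kop ha).smul _)).add (gr_Qop (b.mem a))
      exact (gr_crN a).mul h (by ring) (by ring) (by ring)
    · have : crN b Y a = 0 := if_neg ha
      rw [this, zero_mul]
      exact gr_zero
  · have h : Gr b grY (Bop b Y (b.basis i)) 0 (b.deg i) 0 :=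
      (gr_rhog hY hγ (b.mem i)).add ((gr_Qop (b.mem i)).smul _)
    exact h.mul (gr_anP i) (by ring) (by ring) (by ring)

/-! ### Exactness away from the lowest terms -/

/-- A cocycle vanishing to order `j` can be changed by a coboundary so that it vanishes to order
`j + 1`, provided that the eigenvalue `0` of the Laplacian `d h + h d` does not occur on its leading
term. -/
theorem exists_reduction
    (hY : ∀ {i n : ℤ} {x : 𝔤} {y : Y}, x ∈ s.gr i → y ∈ grY n → toU x • y ∈ grY (i + n))
    (hγ : ∀ n : ℤ, n ≠ 0 → ∀ x ∈ s.gr n, s.γ x = 0)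
    {m n q : ℤ} (j : ℕ) {c : Tame b Y} (hc : c ∈ HomY b grY m n q) (hd : dd b Y c = 0)
    (hV : c ∈ Van b Y j)
    (h0 : ∀ K, j + (starPart b.opp K).card = 0 → ∀ v ∈ Fil b 0, c.1 K v = 0) :
    ∃ g, g ∈ HomY b grY (m - 1) n q ∧ g ∈ Van b Y j ∧ c - dd b Y g ∈ HomY b grY m n q ∧
      dd b Y (c - dd b Y g) = 0 ∧ c - dd b Y g ∈ Van b Y (j + 1) := by
  have hdd : ∀ c : Tame b Y, dd b Y (dd b Y c) = 0 := LinearMap.congr_fun (dd_dd b Y)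
  -- on the leading term `d h` acts by `j + #(K ∩ 𝔤₋)`, which lies between `1` and `j + q`; so the
  -- operator `∏_{i < j + q} (1 - d h / (i + 1))`, which only adds coboundaries, annihilates it
  have key : ∀ J : ℕ, ∃ g, g ∈ HomY b grY (m - 1) n q ∧ g ∈ Van b Y j ∧
      c - dd b Y g ∈ HomY b grY m n q ∧ c - dd b Y g ∈ Van b Y j ∧
      ∀ K, ∀ v ∈ Fil b j, (c - dd b Y g).1 K v =
        (∏ i ∈ Finset.range J, (1 - ((j : ℂ) + (starPart b.opp K).card) / (i + 1))) • c.1 K v := by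
    intro J
    induction J with
    | zero => exact ⟨0, Submodule.zero_mem _, Submodule.zero_mem _, by simpa using hc,
        by simpa using hV, fun K v _ => by simp⟩
    | succ J ih =>
      obtain ⟨g, hg, hgV, h1, h2, h3⟩ := ih
      have hd' : dd b Y (c - dd b Y g) = 0 := by rw [map_sub, hd, hdd, sub_zero]
      have hE : ∀ {p : ℤ}, c - dd b Y g ∈ Van b Y p → ∀ K, ∀ v ∈ Fil b p,
          (dd b Y (hop b Y (c - dd b Y g))).1 K v =
            ((p : ℂ) + (starPart b.opp K).card) • (c - dd b Y g).1 K v := fun hp K v hv => by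
        rw [← laplace_apply hp K hv, hd', map_zero, add_zero]
      have e : c - dd b Y (g + ((J : ℂ) + 1)⁻¹ • hop b Y (c - dd b Y g)) =
          (c - dd b Y g) - ((J : ℂ) + 1)⁻¹ • dd b Y (hop b Y (c - dd b Y g)) := by
        rw [map_add, map_smul, sub_add_eq_sub_sub]
      have hh : hop b Y (c - dd b Y g) ∈ HomY b grY (m - 1) n q := by
        have h4 := gr_hop _ _ _ _ h1
        rw [add_zero, ← sub_eq_add_neg] at h4
        exact HomY_mono (by linarith) h4
      refine ⟨g + ((J : ℂ) + 1)⁻¹ • hop b Y (c - dd b Y g),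
        Submodule.add_mem _ hg (Submodule.smul_mem _ _ hh),
        Submodule.add_mem _ hgV (Submodule.smul_mem _ _ (Van_mono (by linarith) (hop_mem_Van h2))),
        ?_, ?_, ?_⟩
      · rw [e]
        have h4 := gr_dd hY hγ _ _ _ _ (gr_hop _ _ _ _ h1)
        simp only [add_zero, neg_add_cancel_right] at h4
        exact Submodule.sub_mem _ h1 (Submodule.smul_mem _ _ h4)
      · rw [e]
        refine Submodule.sub_mem _ h2 (Submodule.smul_mem _ _ fun K v hv => ?_)
        rw [hE (Van_mono (by linarith) h2) K v hv, h2 K v hv, smul_zero]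
      · intro K v hv
        rw [e, Finset.prod_range_succ, mul_comm, mul_smul, ← h3 K v hv]
        change (c - dd b Y g).1 K v - ((J : ℂ) + 1)⁻¹ • (dd b Y (hop b Y (c - dd b Y g))).1 K v = _
        rw [hE h2 K v hv, sub_smul, one_smul, smul_smul, Int.cast_natCast, div_eq_inv_mul]
  obtain ⟨g, hg, hgV, h1, h2, h3⟩ := key (j + q.toNat)
  refine ⟨g, hg, hgV, h1, by rw [map_sub, hd, hdd, sub_zero], fun K v hv => ?_⟩
  rw [add_sub_cancel_right] at hv
  rw [h3 K v hv]
  by_cases hK : ((starPart b.opp K).card : ℤ) ≤ q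
  · by_cases h4 : j + (starPart b.opp K).card = 0
    · have hj : j = 0 := by omega
      rw [h0 K h4 v (by rw [hj] at hv; exact_mod_cast hv), smul_zero]
    · rw [Finset.prod_eq_zero (i := j + (starPart b.opp K).card - 1), zero_smul]
      · rw [Finset.mem_range]; omega
      · have h5 : ((j + (starPart b.opp K).card - 1 : ℕ) : ℂ) + 1 =
            (j : ℂ) + (starPart b.opp K).card := by
          have : j + (starPart b.opp K).card - 1 + 1 = j + (starPart b.opp K).card := by omega
          exact_mod_cast this
        rw [h5, div_self, sub_self]
        exact_mod_cast h4
  · rw [(hc K).1 fun h => hK h.2]; simp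

/-- A cocycle is a coboundary if its terms without `ψ*` vanish on `U₊`. -/
theorem exists_primitive
    (hY : ∀ {i n : ℤ} {x : 𝔤} {y : Y}, x ∈ s.gr i → y ∈ grY n → toU x • y ∈ grY (i + n))
    (hγ : ∀ n : ℤ, n ≠ 0 → ∀ x ∈ s.gr n, s.γ x = 0)
    {m n q : ℤ} {c : Tame b Y} (hc : c ∈ HomY b grY m n q) (hd : dd b Y c = 0)
    (h0 : ∀ K, starPart b.opp K = ∅ → ∀ v ∈ Fil b 0, c.1 K v = 0) :
    ∃ g ∈ HomY b grY (m - 1) n q, dd b Y g = c := by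
  classical
  by_cases hc0 : c = 0
  · exact ⟨0, Submodule.zero_mem _, by rw [map_zero, hc0]⟩
  -- iterate the reduction; the corrections vanish to higher and higher order, so their sum makes
  -- sense
  let P : ℕ → Tame b Y → Prop := fun j c => c ∈ HomY b grY m n q ∧ dd b Y c = 0 ∧ c ∈ Van b Y j ∧
    ∀ K, j + (starPart b.opp K).card = 0 → ∀ v ∈ Fil b 0, c.1 K v = 0
  have step : ∀ (j : ℕ) (c : {c // P j c}), ∃ g, g ∈ HomY b grY (m - 1) n q ∧ g ∈ Van b Y j ∧
      P (j + 1) (c.1 - dd b Y g) := fun j ⟨c, h1, h2, h3, h4⟩ => by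
    obtain ⟨g, hg, hgV, k1, k2, k3⟩ := exists_reduction hY hγ j h1 h2 h3 h4
    exact ⟨g, hg, hgV, k1, k2, by exact_mod_cast k3, fun K hK => by omega⟩
  choose g hg hgV hg' using step
  let sq : ∀ j : ℕ, {c // P j c} := fun j => Nat.rec (motive := fun j => {c // P j c})
    ⟨c, hc, hd, Van_zero c, fun K hK => h0 K (Finset.card_eq_zero.1 (by omega))⟩
    (fun j c => ⟨c.1 - dd b Y (g j c), hg' j c⟩) j
  have hsq : ∀ j, dd b Y (g j (sq j)) = (sq j).1 - (sq (j + 1)).1 := fun j => by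
    change _ = (sq j).1 - ((sq j).1 - dd b Y (g j (sq j)))
    rw [sub_sub_cancel]
  have hz : ∀ v : U, ∃ J : ℕ, ∀ j, J ≤ j → v ∈ Fil b ((j : ℤ) - 1) := fun v => by
    obtain ⟨M, hM⟩ := exists_mem_Fil (b := b) v
    exact ⟨M + 1, fun j hj => Fil_mono (by
      have : ((M + 1 : ℕ) : ℤ) ≤ j := by exact_mod_cast hj
      push_cast at this
      linarith) hM⟩
  -- a functional turns the elements `g j (sq j)` into operators, whose sum is locally finite
  obtain ⟨φ, hφ⟩ : ∃ φ : Module.Dual ℂ (Tame b Y), φ c ≠ 0 := by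
    by_contra hn
    push Not at hn
    exact hc0 ((Module.forall_dual_apply_eq_zero_iff ℂ c).1 hn)
  have hlf : LF fun j : ℕ => (φ.smulRight (g j (sq j)) : Module.End ℂ (Tame b Y)) :=
    fun c I v => by
      obtain ⟨J, hJ⟩ := hz v
      refine (Finset.range J).finite_toSet.subset fun j hj => ?_
      by_contra hn
      refine hj (Submodule.smul_mem _ _ (mem_zeroAt_of_Van (hgV j (sq j)) (hJ j ?_) I))
      simpa using hn
  refine ⟨(φ c)⁻¹ • locSum _ hlf c, Submodule.smul_mem _ _ fun K => ⟨fun hK => ?_, fun k v hv => ?_⟩,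
    ?_⟩
  · refine LinearMap.ext fun v => (Submodule.mem_bot ℂ).1
      (locSum_pointwise hlf fun j => (Submodule.mem_bot ℂ).2 ?_)
    change φ c • (g j (sq j)).1 K v = 0
    rw [(hg j (sq j) K).1 hK]; simp
  · exact locSum_pointwise hlf fun j => Submodule.smul_mem _ _ ((hg j (sq j) K).2 k v hv)
  · refine Tame.ext' fun K v => ?_
    have h1 : dd b Y (locSum _ hlf c) = locSum _ (hlf.mul_left cont_dd) c :=
      LinearMap.congr_fun (mul_locSum hlf cont_dd) c
    obtain ⟨J, hJ⟩ := hz v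
    rw [map_smul, h1]
    change (φ c)⁻¹ • (locSum _ (hlf.mul_left cont_dd) c).1 K v = _
    rw [locSum_apply, finsum_eq_sum_of_support_subset (s := Finset.range J)]
    · have h2 : ∀ j, ((dd b Y * (φ.smulRight (g j (sq j)) : Module.End ℂ (Tame b Y))) c).1 K v =
          φ c • ((sq j).1.1 K v - (sq (j + 1)).1.1 K v) := fun j => by
        change (dd b Y (φ c • g j (sq j))).1 K v = _
        rw [map_smul, hsq]
        rfl
      rw [Finset.sum_congr rfl fun j _ => h2 j, ← Finset.smul_sum, Finset.sum_range_sub',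
        smul_smul, inv_mul_cancel₀ hφ, one_smul, (sq J).2.2.2.1 K v (hJ J le_rfl), sub_zero]
      rfl
    · intro j hj
      by_contra hn
      have hn : J ≤ j := by simpa using hn
      refine hj ?_
      change (dd b Y (φ c • g j (sq j))).1 K v = 0
      rw [map_smul, hsq]
      change φ c • ((sq j).1.1 K v - (sq (j + 1)).1.1 K v) = 0
      rw [(sq j).2.2.2.1 K v (hJ j hn),
        (sq (j + 1)).2.2.2.1 K v (hJ (j + 1) (by omega)), sub_zero, smul_zero]

end Degrees

/-! ### Functoriality of the cohomology in the coefficients -/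

section Functoriality

variable {𝔤 : Type u} [LieRing 𝔤] [LieAlgebra ℂ 𝔤] {s : SemiInfiniteStructure 𝔤}
  {ι : Type v} [LinearOrder ι] {b : HomogeneousBasis s ι}
  {Y : Type w} [AddCommGroup Y] [Module ℂ Y]
  [Module (UniversalEnvelopingAlgebra ℂ 𝔤) Y] [IsScalarTower ℂ (UniversalEnvelopingAlgebra ℂ 𝔤) Y]
  {Y' : Type w'} [AddCommGroup Y'] [Module ℂ Y']
  [Module (UniversalEnvelopingAlgebra ℂ 𝔤) Y']
  [IsScalarTower ℂ (UniversalEnvelopingAlgebra ℂ 𝔤) Y']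

local notation "U" => UniversalEnvelopingAlgebra ℂ 𝔤

/-- The continuous maps which act on the coefficients and commute with the diagonal action. -/
structure IsCoeffMap (Θ : Tame b Y →ₗ[ℂ] Tame b Y') : Prop where
  cont : Cont Θ
  cr : ∀ i c, Θ (cr b Y i c) = cr b Y' i (Θ c)
  an : ∀ i c, Θ (an b Y i c) = an b Y' i (Θ c)
  rho : ∀ x c, Θ (rho b Y x c) = rho b Y' x (Θ c)

namespace IsCoeffMap

variable {Θ Θ' : Tame b Y →ₗ[ℂ] Tame b Y'}

theorem smul (h : IsCoeffMap Θ) (a : ℂ) : IsCoeffMap (a • Θ) where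
  cont := h.cont.smul a
  cr i c := by rw [LinearMap.smul_apply, LinearMap.smul_apply, h.cr, map_smul]
  an i c := by rw [LinearMap.smul_apply, LinearMap.smul_apply, h.an, map_smul]
  rho i c := by rw [LinearMap.smul_apply, LinearMap.smul_apply, h.rho, map_smul]

theorem neg (h : IsCoeffMap Θ) : IsCoeffMap (-Θ) := by
  rw [← neg_one_smul ℂ]; exact h.smul _

theorem crN (h : IsCoeffMap Θ) (i : ι) (c : Tame b Y) : Θ (crN b Y i c) = crN b Y' i (Θ c) := by
  unfold SemiInfinite.crN; split_ifs
  · exact h.cr i c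
  · rw [LinearMap.zero_apply, LinearMap.zero_apply, map_zero]

theorem anP (h : IsCoeffMap Θ) (i : ι) (c : Tame b Y) : Θ (anP b Y i c) = anP b Y' i (Θ c) := by
  unfold SemiInfinite.anP; split_ifs
  · rw [LinearMap.zero_apply, LinearMap.zero_apply, map_zero]
  · exact h.an i c

theorem psi' (h : IsCoeffMap Θ) (x : 𝔤) (c : Tame b Y) : Θ (psi' b Y x c) = psi' b Y' x (Θ c) := by
  rw [psi'_eq_sum, psi'_eq_sum, LinearMap.sum_apply, LinearMap.sum_apply, map_sum]
  refine Finset.sum_congr rfl fun k _ => ?_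
  rw [LinearMap.smul_apply, LinearMap.smul_apply, map_smul]
  congr 1
  unfold ps; split_ifs
  exacts [h.an k c, h.cr k c]

theorem locSum {κ : Type*} {T : κ → Module.End ℂ (Tame b Y)} {T' : κ → Module.End ℂ (Tame b Y')}
    (h : IsCoeffMap Θ) (hT : LF T) (hT' : LF T') (e : ∀ k c, Θ (T k c) = T' k (Θ c))
    (c : Tame b Y) : Θ (locSum T hT c) = locSum T' hT' (Θ c) := by
  have h1 := LinearMap.congr_fun (comp_locSum hT h.cont) c
  refine h1.trans (Tame.ext' fun K v => ?_)
  rw [locSum_apply, locSum_apply]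
  exact finsum_congr fun k => congrArg (fun c : Tame b Y' => c.1 K v) (e k c)

theorem Qop (h : IsCoeffMap Θ) (x : 𝔤) (c : Tame b Y) : Θ (Qop b Y x c) = Qop b Y' x (Θ c) :=
  h.locSum _ _ (fun j c => by rw [Module.End.mul_apply, Module.End.mul_apply, h.psi', h.anP]) c

theorem Kop (h : IsCoeffMap Θ) (x : 𝔤) (c : Tame b Y) : Θ (Kop b Y x c) = Kop b Y' x (Θ c) :=
  h.locSum _ _ (fun j c => by
    rw [Module.End.mul_apply, Module.End.mul_apply, h.crN, LinearMap.neg_apply,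
      LinearMap.neg_apply, map_neg, h.psi']) c

theorem rhog (h : IsCoeffMap Θ) (x : 𝔤) (c : Tame b Y) : Θ (rhog b Y x c) = rhog b Y' x (Θ c) := by
  rw [rhog_apply, rhog_apply, LinearMap.sub_apply, LinearMap.sub_apply, map_sub, h.rho,
    LinearMap.smul_apply, LinearMap.smul_apply, map_smul]
  rfl

theorem dd (h : IsCoeffMap Θ) (c : Tame b Y) : Θ (dd b Y c) = dd b Y' (Θ c) := by
  rw [SemiInfinite.dd, SemiInfinite.dd, LinearMap.add_apply, LinearMap.add_apply, map_add]
  refine congrArg₂ _ (h.locSum _ _ (fun j c => ?_) c) (h.locSum _ _ (fun j c => ?_) c)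
  · rw [Module.End.mul_apply, Module.End.mul_apply, h.crN, Aop, Aop]
    simp only [LinearMap.add_apply, LinearMap.smul_apply, map_add, map_smul, h.rhog, h.Kop, h.Qop]
  · rw [Module.End.mul_apply, Module.End.mul_apply, ← h.anP, Bop, Bop]
    simp only [LinearMap.add_apply, LinearMap.smul_apply, map_add, map_smul, h.rhog, h.Qop]

end IsCoeffMap

/-- Homomorphisms of coefficient modules induce morphisms of complexes. -/
theorem isCoeffMap_post {g : Y →ₗ[ℂ] Y'} (hg : ∀ (x : 𝔤) y, g (toU x • y) = toU x • g y) :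
    IsCoeffMap (post b g) where
  cont := cont_post g
  cr i c := Tame.ext' fun K v => by
    rw [post_apply, cr_apply, cr_apply]
    split_ifs
    · rw [map_smul, post_apply]
    · rw [map_zero]
  an i c := Tame.ext' fun K v => by
    rw [post_apply, an_apply, an_apply]
    split_ifs
    · rw [map_zero]
    · rw [map_smul, post_apply]
  rho x c := Tame.ext' fun K v => by
    rw [post_apply, rho_apply, rho_apply, map_add, hg, post_apply, post_apply]

theorem isCoeffMap_pre (w : U) : IsCoeffMap (pre Y (adm_mulLeft b w)) where
  cont := cont_pre _
  cr i c := Tame.ext' fun K v => by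
    simp only [pre_apply, cr_apply]
  an i c := Tame.ext' fun K v => by
    simp only [pre_apply, an_apply]
  rho x c := Tame.ext' fun K v => by
    simp only [pre_apply, rho_apply, LinearMap.mulLeft_apply, mul_assoc]

variable {grY : ℤ → Submodule ℂ Y} {grY' : ℤ → Submodule ℂ Y'}

variable (b grY) in
/-- The cochains of cohomological degree `m` with coefficients in `Y`. -/
def CY (m : ℤ) : Submodule ℂ (Tame b Y) := ⨆ (n : ℤ) (q : ℤ), HomY b grY m n q

theorem HomY_le_CY (m n q : ℤ) : HomY b grY m n q ≤ CY b grY m :=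
  le_iSup_of_le n (le_iSup_of_le q le_rfl)

theorem CY_induction {m : ℤ} {p : Submodule ℂ (Tame b Y)} (h : ∀ n q, HomY b grY m n q ≤ p) :
    CY b grY m ≤ p := iSup_le fun n => iSup_le fun q => h n q

variable (b grY) in
/-- The cocycles of degree `0`. -/
def ZY : Submodule ℂ (Tame b Y) := CY b grY 0 ⊓ LinearMap.ker (dd b Y)

variable (b grY) in
/-- The coboundaries of degree `0`. -/
def BY : Submodule ℂ (Tame b Y) := (CY b grY (0 - 1)).map (dd b Y)

variable (b grY) in
/-- The cohomology in degree `0`. -/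
abbrev HY : Type _ := ZY b grY ⧸ (BY b grY).comap (ZY b grY).subtype

variable (grY grY') in
/-- The maps of coefficients which preserve the cochains. -/
structure IsMor (Θ : Tame b Y →ₗ[ℂ] Tame b Y') : Prop extends IsCoeffMap Θ where
  mem : ∀ m, ∀ c ∈ CY b grY m, Θ c ∈ CY b grY' m

theorem IsMor.map_ZY {Θ : Tame b Y →ₗ[ℂ] Tame b Y'} (h : IsMor grY grY' Θ) :
    ∀ c ∈ ZY b grY, Θ c ∈ ZY b grY' := fun c hc => ⟨h.mem 0 c hc.1, by
  have hd : dd b Y c = 0 := hc.2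
  change dd b Y' (Θ c) = 0
  rw [← h.dd, hd, map_zero]⟩

theorem IsCoeffMap.isMor {Θ : Tame b Y →ₗ[ℂ] Tame b Y'} (h : IsCoeffMap Θ)
    (hΘ : ∀ m n q, ∃ n', ∀ c ∈ HomY b grY m n q, Θ c ∈ HomY b grY' m n' q) :
    IsMor grY grY' Θ :=
  ⟨h, fun m c hc => CY_induction (p := (CY b grY' m).comap Θ) (fun n q c hc => by
    obtain ⟨n', h'⟩ := hΘ m n q
    exact HomY_le_CY m n' q (h' c hc)) hc⟩

/-- The map induced on the cohomology. -/
def IsMor.map {Θ : Tame b Y →ₗ[ℂ] Tame b Y'} (h : IsMor grY grY' Θ) : HY b grY →ₗ[ℂ] HY b grY' :=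
  Submodule.mapQ _ _ (Θ.restrict h.map_ZY) (by
    rintro ⟨c, hc⟩ ⟨a, ha, e⟩
    exact ⟨Θ a, h.mem _ a ha, (h.dd a).symm.trans (congrArg Θ e)⟩)

theorem IsMor.map_mk {Θ : Tame b Y →ₗ[ℂ] Tame b Y'} (h : IsMor grY grY' Θ) (z : ZY b grY) :
    h.map (Submodule.Quotient.mk z) = Submodule.Quotient.mk ⟨Θ z.1, h.map_ZY z.1 z.2⟩ := rfl

variable (grY) in
/-- An automorphism of the coefficients induces an automorphism of the cohomology. -/
def IsMor.equiv {Θ : Tame b Y ≃ₗ[ℂ] Tame b Y} (h : IsMor grY grY Θ.toLinearMap)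
    (h' : IsMor grY grY Θ.symm.toLinearMap) : HY b grY ≃ₗ[ℂ] HY b grY :=
  LinearEquiv.ofLinearMap h.map h'.map
    (LinearMap.ext fun t => by
      obtain ⟨z, rfl⟩ := Submodule.Quotient.mk_surjective _ t
      rw [LinearMap.comp_apply, h'.map_mk, h.map_mk]
      exact congrArg _ (Subtype.ext (Θ.apply_symm_apply z.1)))
    (LinearMap.ext fun t => by
      obtain ⟨z, rfl⟩ := Submodule.Quotient.mk_surjective _ t
      rw [LinearMap.comp_apply, h.map_mk, h'.map_mk]
      exact congrArg _ (Subtype.ext (Θ.symm_apply_apply z.1)))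

end Functoriality

/-! ### The semi-regular bimodule as a cohomology space -/

section Comparison

variable {𝔤 : Type u} [LieRing 𝔤] [LieAlgebra ℂ 𝔤] {s : SemiInfiniteStructure 𝔤}
  {ι : Type v} [LinearOrder ι] {b : HomogeneousBasis s ι}

local notation "U" => UniversalEnvelopingAlgebra ℂ 𝔤

variable (b) in
/-- The underlying formal sum, as a linear function. -/
def valLin : Tame b U →ₗ[ℂ] FormalCochain 𝔤 ι where
  toFun := Tame.val
  map_add' _ _ := rfl
  map_smul' _ _ := rfl

/-- The cochains with coefficients in `U* ⊗ U` in the two descriptions, where one bounds the number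
`q` of elements of `𝔤₋` and the other one fixes it. -/
theorem mem_CY_iff {m : ℤ} {c : Tame b U} : c ∈ CY b (grU s) m ↔ c.1 ∈ cochains b m := by
  classical
  constructor
  · refine fun hc => CY_induction (p := (cochains b m).comap (valLin b)) (fun n q c hc => ?_) hc
    change c.1 ∈ cochains b m
    -- split `c` according to the number of elements of `𝔤₋`
    have h1 : c = ∑ j ∈ Finset.range (q.toNat + 1),
        restr b U (fun K => (starPart b.opp K).card = j) c := by
      refine Tame.ext' fun K v => ?_
      rw [Tame.val_sum, Finset.sum_apply, LinearMap.sum_apply]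
      simp only [restr_apply]
      rw [Finset.sum_ite_eq]
      split_ifs with h
      · rfl
      · rw [(hc K).1 fun h' => h (by rw [Finset.mem_range]; omega)]
        rfl
    rw [h1, Tame.val_sum]
    refine Submodule.sum_mem _ fun j _ => Submodule.mem_iSup_of_mem n (Submodule.mem_iSup_of_mem j
      ⟨mem_tame_iff.2 (restr b U _ c).2, fun K => ⟨fun hK => LinearMap.ext fun v => ?_,
        fun k v hv => ?_⟩⟩)
    · rw [restr_apply]
      split_ifs with h
      · rw [(hc K).1 fun h' => hK ⟨h, by rw [← h]; exact h'.1⟩]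
      · rfl
    · rw [restr_apply]
      split_ifs
      · have := (hc K).2 k v hv
        rwa [wt, ← add_sub_assoc] at this
      · exact Submodule.zero_mem _
  · intro hc
    have h : cochains b m ≤ (CY b (grU s) m).map (valLin b) :=
      iSup_le fun n => iSup_le fun q => fun c hc => by
        refine ⟨⟨c, mem_tame_iff.1 hc.1⟩, HomY_le_CY m n q fun K => ⟨fun hK => ?_,
          fun k v hv => ?_⟩, rfl⟩
        · exact (hc.2 K).1 fun h => hK ⟨by rw [cdeg, h.1]; exact h.2, by rw [h.1]⟩
        · have := (hc.2 K).2 k v hv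
          rwa [add_sub_assoc] at this
    obtain ⟨c', h', e⟩ := h hc
    rwa [← Tame.val_injective e]

variable (b) in
/-- The cocycles with coefficients in `U* ⊗ U`, as tame formal sums. -/
def cocyclesEquiv : cocycles b 0 ≃ₗ[ℂ] ZY b (grU s) where
  toFun c := ⟨⟨c.1, mem_tame_iff.1 (cochains_le_tame b 0 c.2.1)⟩, mem_CY_iff.2 c.2.1,
    Tame.ext' fun K v => by rw [← dCoeff_eq]; exact c.2.2 K v⟩
  map_add' _ _ := rfl
  map_smul' _ _ := rfl
  invFun z := ⟨z.1.1, mem_CY_iff.1 z.2.1, fun K v => by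
    have h : dd b U z.1 = 0 := z.2.2
    rw [dCoeff_eq, h]
    rfl⟩
  left_inv _ := rfl
  right_inv _ := rfl

variable (b) in
/-- The semi-regular bimodule is the cohomology of the complex of tame formal sums. -/
def semiRegularEquiv : SemiRegular b ≃ₗ[ℂ] HY b (grU s) :=
  Submodule.Quotient.equiv _ _ (cocyclesEquiv b) (by
    ext z
    constructor
    · rintro ⟨c, ⟨a, ha, h⟩, rfl⟩
      refine ⟨⟨a, mem_tame_iff.1 (cochains_le_tame b _ ha)⟩, mem_CY_iff.2 ha,
        Tame.ext' fun K v => ?_⟩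
      rw [← dCoeff_eq]
      exact (h K v).symm
    · rintro ⟨a, ha, h⟩
      refine ⟨(cocyclesEquiv b).symm z, ⟨a.1, mem_CY_iff.1 ha, fun K v => ?_⟩,
        (cocyclesEquiv b).apply_symm_apply z⟩
      rw [dCoeff_eq, h]
      rfl)

end Comparison

/-! ### Tensor products with a graded vector space -/

section Coordinates

/-- A basis of a graded vector space consisting of homogeneous elements. -/
structure AdaptedBasis {M : Type w} [AddCommGroup M] [Module ℂ M] (grM : ℤ → Submodule ℂ M)
    (κ : Type w') where
  basis : Module.Basis κ ℂ M
  deg : κ → ℤ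
  mem : ∀ a, basis a ∈ grM (deg a)
  coord_eq_zero : ∀ {n : ℤ} {m : M}, m ∈ grM n → ∀ a, deg a ≠ n → basis.coord a m = 0

theorem exists_adaptedBasis {M : Type w} [AddCommGroup M] [Module ℂ M] {grM : ℤ → Submodule ℂ M}
    (h : DirectSum.IsInternal grM) : ∃ κ : Type w, Nonempty (AdaptedBasis grM κ) := by
  classical
  let v := fun n => Module.Basis.ofVectorSpace ℂ (grM n)
  refine ⟨_, ⟨{
    basis := h.collectedBasis v
    deg := fun a => a.1
    mem := fun a => ?_
    coord_eq_zero := fun {n m} hm a ha => ?_ }⟩⟩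
  · exact h.collectedBasis_mem v _
  · rw [Module.Basis.coord_apply]
    obtain ⟨j, a⟩ := a
    exact h.collectedBasis_repr_of_mem_ne v (fun e => ha e.symm) hm

variable {V : Type*} [AddCommGroup V] [Module ℂ V] {M : Type w} [AddCommGroup M] [Module ℂ M]
  {κ : Type w'} (B : Module.Basis κ ℂ M)

variable (V) in
/-- The coordinates on `V ⊗ M` with values in `V`. -/
def co (a : κ) : V ⊗[ℂ] M →ₗ[ℂ] V := TensorProduct.rid ℂ V ∘ₗ (B.coord a).lTensor V

@[simp] theorem co_tmul (a : κ) (v : V) (m : M) : co V B a (v ⊗ₜ m) = B.coord a m • v := rfl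

theorem exists_eq_sum_co (t : V ⊗[ℂ] M) : ∃ A : Finset κ, ∀ A', A ⊆ A' →
    ∑ a ∈ A', co V B a t ⊗ₜ[ℂ] B a = t := by
  classical
  induction t with
  | zero => exact ⟨∅, fun A' _ => Finset.sum_eq_zero fun a _ => by
      rw [map_zero, TensorProduct.zero_tmul]⟩
  | tmul v m =>
    refine ⟨(B.repr m).support, fun A' h => ?_⟩
    simp only [co_tmul, Module.Basis.coord_apply, TensorProduct.smul_tmul]
    rw [← TensorProduct.tmul_sum]
    congr 1
    rw [← Finset.sum_subset h fun a _ ha => by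
      rw [Finsupp.notMem_support_iff.1 ha, zero_smul]]
    exact B.linearCombination_repr m
  | add t t' h h' =>
    obtain ⟨A, h⟩ := h
    obtain ⟨A', h'⟩ := h'
    refine ⟨A ∪ A', fun C hC => ?_⟩
    simp only [map_add, TensorProduct.add_tmul, Finset.sum_add_distrib]
    rw [h C (Finset.union_subset_left hC), h' C (Finset.union_subset_right hC)]

theorem eq_zero_of_co {t : V ⊗[ℂ] M} (h : ∀ a, co V B a t = 0) : t = 0 := by
  obtain ⟨A, hA⟩ := exists_eq_sum_co B t
  rw [← hA A le_rfl]
  exact Finset.sum_eq_zero fun a _ => by rw [h, TensorProduct.zero_tmul]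

theorem exists_eq_sum_co_of_finiteDimensional (W : Submodule ℂ (V ⊗[ℂ] M))
    [FiniteDimensional ℂ W] : ∃ A : Finset κ, ∀ t ∈ W, ∑ a ∈ A, co V B a t ⊗ₜ[ℂ] B a = t := by
  classical
  obtain ⟨S, hS⟩ := (Submodule.fg_iff_finiteDimensional W).2 inferInstance
  choose A hA using exists_eq_sum_co (V := V) B
  refine ⟨S.biUnion A, fun t ht => ?_⟩
  rw [← hS] at ht
  induction ht using Submodule.span_induction with
  | mem t ht => exact hA t _ (Finset.subset_biUnion_of_mem A ht)
  | zero => exact Finset.sum_eq_zero fun a _ => by rw [map_zero, TensorProduct.zero_tmul]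
  | add t t' _ _ h h' =>
    simp only [map_add, TensorProduct.add_tmul, Finset.sum_add_distrib]
    rw [h, h']
  | smul z t _ h =>
    simp only [map_smul, ← TensorProduct.smul_tmul', ← Finset.smul_sum]
    rw [h]

end Coordinates

section Enveloping

variable {𝔤 : Type u} [LieRing 𝔤] [LieAlgebra ℂ 𝔤] {s : SemiInfiniteStructure 𝔤}
  {ι : Type v} [LinearOrder ι] {b : HomogeneousBasis s ι}
  {M : Type w} [AddCommGroup M] [Module ℂ M] {grM : ℤ → Submodule ℂ M}

local notation "U" => UniversalEnvelopingAlgebra ℂ 𝔤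

theorem iSup_grU (b : HomogeneousBasis s ι) : ⨆ n, grU s n = ⊤ := by
  refine eq_top_iff.2 fun u _ => ?_
  rw [← (pbw b).linearCombination_repr u]
  refine Submodule.sum_mem _ fun S _ => Submodule.smul_mem _ _ ?_
  refine Submodule.mem_iSup_of_mem (S.map b.deg).sum ?_
  rw [grU_eq_omon (b := b), pbw_apply]
  exact Submodule.subset_span ⟨S, rfl, rfl⟩

/-- Elements of pairwise distinct degrees of `U` whose sum vanishes are zero. -/
theorem grU_sum_eq_zero (b : HomogeneousBasis s ι) {A : Finset ℤ} {d : ℤ} {t : ℤ → U}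
    (ht : ∀ n, t n ∈ grU s (n + d)) (h : ∑ n ∈ A, t n = 0) {n : ℤ} (hn : n ∈ A) : t n = 0 := by
  refine (pbw b).repr.map_eq_zero_iff.1 (Finsupp.ext fun S => ?_)
  have key : ∀ n', (pbw b).repr (t n') S ≠ 0 → n' + d = (S.map b.deg).sum := fun n' h' => by
    have := ht n'
    rw [grU_eq_omon (b := b), mem_span_omon] at this
    exact (this S (Finsupp.mem_support_iff.2 h')).symm
  by_contra hne
  have h1 : (pbw b).repr (∑ n ∈ A, t n) S = (pbw b).repr (t n) S := by
    rw [map_sum, Finsupp.finsetSum_apply]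
    refine Finset.sum_eq_single n (fun n' _ h' => ?_) fun h' => absurd hn h'
    by_contra h''
    exact h' (by have := key n' h''; have := key n hne; omega)
  rw [h, map_zero] at h1
  exact hne h1.symm

theorem mem_Uplus_of_mem_Fil {v : U} (hv : v ∈ Fil b 0) : v ∈ Uplus s := by
  have h : Fil b 0 ≤ Subalgebra.toSubmodule (Uplus s) := by
    rw [Uplus_eq_omon (b := b)]
    refine Submodule.span_mono (Set.image_mono fun S hS i hi => ?_)
    have h1 : S.filter (fun i => b.deg i < 0) = 0 := Multiset.card_eq_zero.1 (by
      have : (Multiset.card (S.filter fun i => b.deg i < 0) : ℤ) ≤ 0 := hS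
      omega)
    exact Multiset.filter_eq_nil.1 h1 i hi
  exact h hv

variable (s grM) in
/-- The grading of `U ⊗ M`. -/
def grT (n : ℤ) : Submodule ℂ (U ⊗[ℂ] M) :=
  Submodule.span ℂ {t | ∃ i j, i + j = n ∧ ∃ u ∈ grU s i, ∃ m ∈ grM j, u ⊗ₜ[ℂ] m = t}

theorem tmul_mem_grT {i j n : ℤ} (h : i + j = n) {u : U} (hu : u ∈ grU s i) {m : M}
    (hm : m ∈ grM j) : u ⊗ₜ[ℂ] m ∈ grT s grM n :=
  Submodule.subset_span ⟨i, j, h, u, hu, m, hm, rfl⟩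

theorem grT_le {n : ℤ} {p : Submodule ℂ (U ⊗[ℂ] M)}
    (h : ∀ i j, i + j = n → ∀ u ∈ grU s i, ∀ m ∈ grM j, u ⊗ₜ[ℂ] m ∈ p) : grT s grM n ≤ p := by
  refine Submodule.span_le.2 ?_
  rintro _ ⟨i, j, e, u, hu, m, hm, rfl⟩
  exact h i j e u hu m hm

theorem toU_smul_mem_grT {i n : ℤ} {x : 𝔤} {t : U ⊗[ℂ] M} (hx : x ∈ s.gr i)
    (ht : t ∈ grT s grM n) : toU x • t ∈ grT s grM (i + n) := by
  have h : grT s grM n ≤ (grT s grM (i + n)).comap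
      ((LinearMap.mulLeft ℂ (toU x : U)).rTensor M) := grT_le fun j k e u hu m hm =>
    tmul_mem_grT (by omega) (toU_mul_mem s hx hu) hm
  have e : toU x • t = (LinearMap.mulLeft ℂ (toU x : U)).rTensor M t := by
    clear ht
    induction t with
    | zero => rw [smul_zero, map_zero]
    | tmul u m => rw [TensorProduct.smul_tmul']; rfl
    | add t t' h h' => rw [smul_add, map_add, h, h']
  rw [e]
  exact h ht

theorem co_toU_smul {κ : Type*} (B : Module.Basis κ ℂ M) (a : κ) (x : 𝔤) (t : U ⊗[ℂ] M) :
    co U B a (toU x • t) = toU x • co U B a t := by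
  induction t with
  | zero => rw [smul_zero, map_zero, smul_zero]
  | tmul u m => rw [TensorProduct.smul_tmul', co_tmul, co_tmul, smul_comm]
  | add t t' h h' => rw [smul_add, map_add, map_add, smul_add, h, h']

theorem co_mem_grU {κ : Type*} (B : AdaptedBasis grM κ) (a : κ) {n : ℤ} {t : U ⊗[ℂ] M}
    (ht : t ∈ grT s grM n) : co U B.basis a t ∈ grU s (n - B.deg a) := by
  refine grT_le (p := (grU s (n - B.deg a)).comap (co U B.basis a)) (fun i j e u hu m hm => ?_) ht
  rw [Submodule.mem_comap, co_tmul]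
  by_cases h : B.deg a = j
  · rw [h, ← e, add_sub_cancel_right]
    exact Submodule.smul_mem _ _ hu
  · rw [B.coord_eq_zero hm a h, zero_smul]
    exact Submodule.zero_mem _

end Enveloping

/-! ### Cohomology with coefficients in a tensor product -/

section TensorCoefficients

variable {𝔤 : Type u} [LieRing 𝔤] [LieAlgebra ℂ 𝔤] {s : SemiInfiniteStructure 𝔤}
  {ι : Type v} [LinearOrder ι] {b : HomogeneousBasis s ι}
  {Y : Type w} [AddCommGroup Y] [Module ℂ Y] {Y' : Type w'} [AddCommGroup Y'] [Module ℂ Y']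
  {grY : ℤ → Submodule ℂ Y} {grY' : ℤ → Submodule ℂ Y'}

local notation "U" => UniversalEnvelopingAlgebra ℂ 𝔤

theorem mem_CY_of_graded [Module U Y] [IsScalarTower ℂ U Y] [Module U Y']
    [IsScalarTower ℂ U Y'] {V : Type*} [AddCommGroup V] [Module ℂ V] {gr : ℤ → Submodule ℂ V}
    (hgr : ⨆ i, gr i = ⊤) {Θ : V → Tame b Y →ₗ[ℂ] Tame b Y'} (h0 : Θ 0 = 0)
    (hadd : ∀ v w, Θ (v + w) = Θ v + Θ w)
    (h : ∀ i, ∀ v ∈ gr i, ∀ m n q, ∀ c ∈ HomY b grY m n q, Θ v c ∈ HomY b grY' m (n + i) q)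
    (v : V) (m : ℤ) (c : Tame b Y) (hc : c ∈ CY b grY m) : Θ v c ∈ CY b grY' m := by
  have hv : v ∈ ⨆ i, gr i := hgr ▸ Submodule.mem_top
  induction hv using Submodule.iSup_induction' with
  | mem i v hv =>
    exact CY_induction (p := (CY b grY' m).comap (Θ v)) (fun n q c hc =>
      HomY_le_CY m (n + i) q (h i v hv m n q c hc)) hc
  | zero => rw [h0]; exact Submodule.zero_mem _
  | add v w _ _ h h' => rw [hadd]; exact Submodule.add_mem _ h h'

theorem post_mem_HomY {g : Y →ₗ[ℂ] Y'} {i : ℤ} (hg : ∀ n, ∀ y ∈ grY n, g y ∈ grY' (n + i))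
    {m n q : ℤ} {c : Tame b Y} (hc : c ∈ HomY b grY m n q) :
    post b g c ∈ HomY b grY' m (n + i) q := fun K =>
  ⟨fun hK => LinearMap.ext fun v => by
      rw [post_apply, (hc K).1 hK, LinearMap.zero_apply, LinearMap.zero_apply, map_zero],
    fun k v hv => by
      have := hg _ _ ((hc K).2 k v hv)
      rw [post_apply]
      rwa [show n + i + k + wt b K = n + k + wt b K + i by ring]⟩

theorem pre_mem_HomY {i : ℤ} {w : U} (hw : ∀ n, ∀ v ∈ grU s n, w * v ∈ grU s (i + n))
    {m n q : ℤ} {c : Tame b Y} (hc : c ∈ HomY b grY m n q) :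
    pre Y (adm_mulLeft b w) c ∈ HomY b grY m (n + i) q := fun K =>
  ⟨fun hK => LinearMap.ext fun v => by
      rw [pre_apply, (hc K).1 hK]; rfl,
    fun k v hv => by
      have := (hc K).2 _ _ (hw k v hv)
      rw [pre_apply]
      rwa [show n + i + k + wt b K = n + (i + k) + wt b K by ring]⟩

variable {M : Type w} [AddCommGroup M] [Module ℂ M] {grM : ℤ → Submodule ℂ M}

variable (b) in
/-- The map `c ↦ c ⊗ m` on cochains. -/
def em (m : M) : Tame b U →ₗ[ℂ] Tame b (U ⊗[ℂ] M) := post b ((TensorProduct.mk ℂ U M).flip m)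

theorem em_add (m m' : M) : em b (m + m') = em b m + em b m' :=
  LinearMap.ext fun c => Tame.ext' fun K v => TensorProduct.tmul_add _ _ _

theorem em_smul (z : ℂ) (m : M) : em b (z • m) = z • em b m :=
  LinearMap.ext fun c => Tame.ext' fun K v => TensorProduct.tmul_smul _ _ _

theorem em_mem_HomY {j : ℤ} {x : M} (hx : x ∈ grM j) {m n q : ℤ} {c : Tame b U}
    (hc : c ∈ HomY b (grU s) m n q) : em b x c ∈ HomY b (grT s grM) m (n + j) q :=
  post_mem_HomY (fun _ _ hy => tmul_mem_grT rfl hy hx) hc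

theorem isCoeffMap_em (m : M) : IsCoeffMap (em b m) := isCoeffMap_post fun _ _ => rfl

theorem isMor_em (hM : ⨆ n, grM n = ⊤) (m : M) : IsMor (grU s) (grT s grM) (em b m) :=
  ⟨isCoeffMap_em m,
    fun m' c => mem_CY_of_graded hM (Θ := em b)
      (LinearMap.ext fun c => Tame.ext' fun K v => TensorProduct.tmul_zero _ _) em_add
      (fun _ _ hv _ _ _ _ hc => em_mem_HomY hv hc) m m' c⟩

theorem isMor_co {κ : Type*} (B : AdaptedBasis grM κ) (a : κ) :
    IsMor (grT s grM) (grU s) (post b (co U B.basis a)) :=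
  (isCoeffMap_post (co_toU_smul B.basis a)).isMor fun m n q => ⟨n + -B.deg a, fun c hc =>
    post_mem_HomY (fun n y hy => co_mem_grU B a hy) hc⟩

/-- The comparison map from cohomology tensored with `M` to cohomology with coefficients tensored
with `M`. -/
def tensorHY (hM : ⨆ n, grM n = ⊤) : HY b (grU s) ⊗[ℂ] M →ₗ[ℂ] HY b (grT s grM) :=
  TensorProduct.lift (LinearMap.mk₂ ℂ (fun h m => (isMor_em hM m).map h)
    (fun h h' m => map_add _ _ _)
    (fun z h m => map_smul _ _ _)
    (fun h m m' => by
      obtain ⟨c, rfl⟩ := Submodule.Quotient.mk_surjective _ h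
      rw [IsMor.map_mk, IsMor.map_mk, IsMor.map_mk, ← Submodule.Quotient.mk_add]
      exact congrArg _ (Subtype.ext (LinearMap.congr_fun (em_add m m') c.1)))
    (fun z h m => by
      obtain ⟨c, rfl⟩ := Submodule.Quotient.mk_surjective _ h
      rw [IsMor.map_mk, IsMor.map_mk, ← Submodule.Quotient.mk_smul]
      exact congrArg _ (Subtype.ext (LinearMap.congr_fun (em_smul z m) c.1))))

theorem tensorHY_tmul (hM : ⨆ n, grM n = ⊤) (h : HY b (grU s)) (m : M) :
    tensorHY hM (h ⊗ₜ m) = (isMor_em hM m).map h := rfl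

/-- The coordinates with respect to a homogeneous basis of `M` come from morphisms of complexes, and
they separate the elements of the tensor product. -/
theorem tensorHY_injective (hM : DirectSum.IsInternal grM) :
    Function.Injective (tensorHY (b := b) (s := s) hM.submodule_iSup_eq_top) := by
  obtain ⟨κ, ⟨B⟩⟩ := exists_adaptedBasis hM
  refine (injective_iff_map_eq_zero _).2 fun t ht => eq_zero_of_co B.basis fun a => ?_
  have h : (isMor_co B a).map ∘ₗ tensorHY (b := b) (s := s) hM.submodule_iSup_eq_top =
      co _ B.basis a := TensorProduct.ext' fun h m => by
    obtain ⟨c, rfl⟩ := Submodule.Quotient.mk_surjective _ h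
    rw [LinearMap.comp_apply, tensorHY_tmul, IsMor.map_mk, IsMor.map_mk, co_tmul,
      ← Submodule.Quotient.mk_smul]
    exact congrArg _ (Subtype.ext (Tame.ext' fun K v => rfl))
  rw [← h, LinearMap.comp_apply, ht, map_zero]

theorem gr_dd_tensor (hγ : ∀ n : ℤ, n ≠ 0 → ∀ x ∈ s.gr n, s.γ x = 0) :
    Gr b (grT s grM) (dd b (U ⊗[ℂ] M)) 1 0 1 :=
  gr_dd (Y := U ⊗[ℂ] M) (grY := grT s grM) (fun hx hy => toU_smul_mem_grT hx hy) hγ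

theorem sum_val_apply {Y : Type*} [AddCommGroup Y] [Module ℂ Y] {V : Type*} [AddCommGroup V]
    [Module ℂ V] {κ : Type*} (g : Y →ₗ[ℂ] V) (A : Finset κ) (c : κ → Tame b Y) (K : Finset ι) (v : U) :
    ∑ n ∈ A, g ((c n).1 K v) = g ((∑ n ∈ A, c n).1 K v) := by
  rw [Tame.val_sum, Finset.sum_apply, LinearMap.sum_apply, map_sum]

/-- The homogeneous components of a cocycle are cocycles. -/
theorem dd_eq_zero_of_sum {κ : Type*} (B : AdaptedBasis grM κ)
    (hγ : ∀ n : ℤ, n ≠ 0 → ∀ x ∈ s.gr n, s.γ x = 0) {m : ℤ} {A : Finset ℤ}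
    {c : ℤ → Tame b (U ⊗[ℂ] M)} {q : ℤ → ℤ} (hc : ∀ n, c n ∈ HomY b (grT s grM) m n (q n))
    (h : dd b (U ⊗[ℂ] M) (∑ n ∈ A, c n) = 0) {n : ℤ} (hn : n ∈ A) :
    dd b (U ⊗[ℂ] M) (c n) = 0 := by
  -- compare the coordinates, which are homogeneous elements of `U` of distinct degrees
  refine Tame.ext' fun K v => eq_zero_of_co B.basis fun a => ?_
  have hv : v ∈ ⨆ k, grU s k := iSup_grU b ▸ Submodule.mem_top
  induction hv using Submodule.iSup_induction' with
  | mem k v hv =>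
    refine grU_sum_eq_zero b (A := A) (d := k + wt b K - B.deg a)
      (t := fun n => co U B.basis a ((dd b (U ⊗[ℂ] M) (c n)).1 K v)) (fun n => ?_) ?_ hn
    · have h1 := (gr_dd_tensor hγ m n (q n) (c n) (hc n) K).2 k v hv
      have h2 := co_mem_grU B a h1
      rwa [show n + (k + wt b K - B.deg a) = n + 0 + k + wt b K - B.deg a by ring]
    · rw [sum_val_apply (co U B.basis a) A (fun n => dd b (U ⊗[ℂ] M) (c n)), ← map_sum, h,
        Tame.val_zero, Pi.zero_apply, LinearMap.zero_apply, map_zero]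
  | zero => rw [LinearMap.map_zero, LinearMap.map_zero]
  | add v w _ _ h h' => rw [LinearMap.map_add, LinearMap.map_add, h, h', add_zero]

/-- Every homogeneous cocycle `c` with coefficients in `U ⊗ M` is cohomologous to a finite sum of
cocycles `cₐ ⊗ mₐ`. As the values of `c` on `U₊` over `∅ ⊆ 𝔤₋` lie in a finite-dimensional subspace,
finitely many coordinates of `c` suffice to produce them; the difference is a coboundary by
`exists_primitive`. -/
theorem exists_sum_em {κ : Type*} (B : AdaptedBasis grM κ)
    (hγ : ∀ n : ℤ, n ≠ 0 → ∀ x ∈ s.gr n, s.γ x = 0) {n q : ℤ} {c : Tame b (U ⊗[ℂ] M)}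
    (hc : c ∈ HomY b (grT s grM) 0 n q) (hd : dd b (U ⊗[ℂ] M) c = 0) :
    ∃ A : Finset κ, ∃ g ∈ HomY b (grT s grM) (0 - 1) n q, dd b (U ⊗[ℂ] M) g =
      c - ∑ a ∈ A, em b (B.basis a) (post b (co U B.basis a) c) := by
  -- `W` contains the values of `c` on `U₊` over `∅ ⊆ 𝔤₋`
  obtain ⟨𝒦, W, D, hW, h⟩ := mem_tameY.1 c.2 ∅ 1
  obtain ⟨A, hA⟩ := exists_eq_sum_co_of_finiteDimensional B.basis W
  refine ⟨A, exists_primitive (Y := U ⊗[ℂ] M) (grY := grT s grM)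
    (fun hx hy => toU_smul_mem_grT hx hy) hγ ?_ ?_ fun K hK v hv => ?_⟩
  · refine Submodule.sub_mem _ hc (Submodule.sum_mem _ fun a _ => ?_)
    have := em_mem_HomY (b := b) (B.mem a)
      (post_mem_HomY (i := -B.deg a) (fun n y hy => co_mem_grU B a hy) hc)
    rwa [neg_add_cancel_right] at this
  · rw [LinearMap.map_sub, hd, map_sum, zero_sub, neg_eq_zero]
    refine Finset.sum_eq_zero fun a _ => ?_
    rw [← (isCoeffMap_em (B.basis a)).dd, ← (isMor_co (s := s) (b := b) B a).dd, hd,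
      LinearMap.map_zero, LinearMap.map_zero]
  · have h1 : c.1 K v ∈ W := by
      refine Uplus_le (b := b) (p := W.comap (c.1 K)) (fun n u hu => ?_) (mem_Uplus_of_mem_Fil hv)
      have := (h K hK n u hu).1
      rwa [one_mul] at this
    rw [Tame.val_sub, Tame.val_sum, Pi.sub_apply, Finset.sum_apply, LinearMap.sub_apply,
      LinearMap.sum_apply, sub_eq_zero]
    exact (hA _ h1).symm

/-- A cocycle is the sum of its finitely many homogeneous components, to which `exists_sum_em`
applies. -/
theorem tensorHY_surjective (hM : DirectSum.IsInternal grM)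
    (hγ : ∀ n : ℤ, n ≠ 0 → ∀ x ∈ s.gr n, s.γ x = 0) :
    Function.Surjective (tensorHY (b := b) (s := s) hM.submodule_iSup_eq_top) := by
  classical
  obtain ⟨κ, ⟨B⟩⟩ := exists_adaptedBasis hM
  intro h
  obtain ⟨⟨z, hz, hd⟩, rfl⟩ := Submodule.Quotient.mk_surjective _ h
  obtain ⟨f, hf, rfl⟩ := (Submodule.mem_iSup_iff_exists_finsupp _ _).1 hz
  have hq : ∀ n, ∃ q, f n ∈ HomY b (grT s grM) 0 n q := fun n =>
    (Submodule.mem_iSup_of_directed _ (Monotone.directed_le fun q q' h => HomY_mono h)).1 (hf n)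
  choose q hq using hq
  have hd' : ∀ n, dd b (U ⊗[ℂ] M) (f n) = 0 := fun n => by
    by_cases hn : n ∈ f.support
    · exact dd_eq_zero_of_sum B hγ hq hd hn
    · rw [Finsupp.notMem_support_iff.1 hn, map_zero]
  have hZ : ∀ n, f n ∈ ZY b (grT s grM) := fun n => ⟨HomY_le_CY 0 n (q n) (hq n), hd' n⟩
  have key : ∀ n, (Submodule.Quotient.mk ⟨f n, hZ n⟩ : HY b (grT s grM)) ∈
      LinearMap.range (tensorHY (b := b) (s := s) hM.submodule_iSup_eq_top) := fun n => by
    obtain ⟨A, g, hg, e⟩ := exists_sum_em B hγ (hq n) (hd' n)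
    refine ⟨∑ a ∈ A, Submodule.Quotient.mk
      ⟨post b (co U B.basis a) (f n), (isMor_co B a).map_ZY _ (hZ n)⟩ ⊗ₜ B.basis a, ?_⟩
    rw [map_sum]
    simp only [tensorHY_tmul, IsMor.map_mk]
    rw [← Submodule.mkQ_apply, ← sub_eq_zero, ← neg_eq_zero, neg_sub]
    simp only [← Submodule.mkQ_apply]
    rw [← map_sum, ← map_sub, Submodule.mkQ_apply, Submodule.Quotient.mk_eq_zero]
    refine ⟨g, HomY_le_CY _ _ _ hg, e.trans ?_⟩
    simp
  have hs : (Submodule.Quotient.mk ⟨f.sum fun _ x => x, hz, hd⟩ : HY b (grT s grM)) =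
      ∑ n ∈ f.support, Submodule.Quotient.mk ⟨f n, hZ n⟩ := by
    simp only [← Submodule.mkQ_apply]
    rw [← map_sum]
    congr 1
    refine Subtype.ext ?_
    simp [Finsupp.sum]
  rw [hs]
  exact Submodule.sum_mem _ fun n _ => key n

end TensorCoefficients

/-! ### The actions of the Lie algebra -/

section Actions

variable {𝔤 : Type u} [LieRing 𝔤] [LieAlgebra ℂ 𝔤] {s : SemiInfiniteStructure 𝔤}
  {ι : Type v} [LinearOrder ι] {b : HomogeneousBasis s ι}
  {M : Type w} [AddCommGroup M] [Module ℂ M] [LieRingModule 𝔤 M] [LieModule ℂ 𝔤 M]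
  {grM : ℤ → Submodule ℂ M}

local notation "U" => UniversalEnvelopingAlgebra ℂ 𝔤

variable (M) in
/-- Right multiplication on the factor `U` of `U ⊗ M`. -/
def rT (x : 𝔤) : Module.End ℂ (U ⊗[ℂ] M) := (LinearMap.mulRight ℂ (toU x : U)).rTensor M

variable (M) in
/-- Left multiplication on the factor `U` of `U ⊗ M`. -/
def lT (x : 𝔤) : Module.End ℂ (U ⊗[ℂ] M) := (LinearMap.mulLeft ℂ (toU x : U)).rTensor M

variable (M) in
/-- The action on the factor `M` of `U ⊗ M`. -/
def mT (x : 𝔤) : Module.End ℂ (U ⊗[ℂ] M) := (LieModule.toEnd ℂ 𝔤 M x).lTensor U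

@[simp] theorem rT_tmul (x : 𝔤) (u : U) (m : M) : rT M x (u ⊗ₜ m) = (u * toU x) ⊗ₜ m := rfl

@[simp] theorem lT_tmul (x : 𝔤) (u : U) (m : M) : lT M x (u ⊗ₜ m) = (toU x * u) ⊗ₜ m := rfl

@[simp] theorem mT_tmul (x : 𝔤) (u : U) (m : M) : mT M x (u ⊗ₜ m) = u ⊗ₜ ⁅x, m⁆ := rfl

theorem lT_apply (x : 𝔤) (t : U ⊗[ℂ] M) : lT M x t = toU x • t := by
  induction t with
  | zero => rw [LinearMap.map_zero, smul_zero]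
  | tmul u m => rw [TensorProduct.smul_tmul']; rfl
  | add t t' h h' => rw [LinearMap.map_add, smul_add, h, h']

theorem rT_add (x y : 𝔤) : rT M (x + y) = rT M x + rT M y :=
  TensorProduct.ext' fun u m => by
    rw [LinearMap.add_apply, rT_tmul, rT_tmul, rT_tmul, toU_add, mul_add, TensorProduct.add_tmul]

theorem rT_zero : rT M (0 : 𝔤) = 0 := TensorProduct.ext' fun u m => by
  rw [rT_tmul, toU, map_zero, mul_zero, TensorProduct.zero_tmul, LinearMap.zero_apply]

theorem mT_add (x y : 𝔤) : mT M (x + y) = mT M x + mT M y :=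
  TensorProduct.ext' fun u m => by
    rw [LinearMap.add_apply, mT_tmul, mT_tmul, mT_tmul, add_lie, TensorProduct.tmul_add]

theorem mT_zero : mT M (0 : 𝔤) = 0 := TensorProduct.ext' fun u m => by
  rw [mT_tmul, zero_lie, TensorProduct.tmul_zero, LinearMap.zero_apply]

theorem rT_smul (x y : 𝔤) (t : U ⊗[ℂ] M) : rT M x (toU y • t) = toU y • rT M x t := by
  induction t with
  | zero => rw [smul_zero, LinearMap.map_zero, smul_zero]
  | tmul u m => rw [TensorProduct.smul_tmul', rT_tmul, rT_tmul, TensorProduct.smul_tmul',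
      smul_eq_mul, smul_eq_mul, mul_assoc]
  | add t t' h h' => rw [smul_add, LinearMap.map_add, LinearMap.map_add, smul_add, h, h']

theorem mT_smul (x y : 𝔤) (t : U ⊗[ℂ] M) : mT M x (toU y • t) = toU y • mT M x t := by
  induction t with
  | zero => rw [smul_zero, LinearMap.map_zero, smul_zero]
  | tmul u m => rw [TensorProduct.smul_tmul', mT_tmul, mT_tmul, TensorProduct.smul_tmul']
  | add t t' h h' => rw [smul_add, LinearMap.map_add, LinearMap.map_add, smul_add, h, h']

theorem rT_mem_grT {i : ℤ} {x : 𝔤} (hx : x ∈ s.gr i) (n : ℤ) (t : U ⊗[ℂ] M)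
    (ht : t ∈ grT s grM n) : rT M x t ∈ grT s grM (n + i) :=
  grT_le (p := (grT s grM (n + i)).comap (rT M x)) (fun j k e u hu m hm =>
    tmul_mem_grT (i := j + i) (by omega) (mul_toU_mem s hx hu) hm) ht

theorem mT_mem_grT (hM : IsCategoryO s grM) {i : ℤ} {x : 𝔤} (hx : x ∈ s.gr i) (n : ℤ)
    (t : U ⊗[ℂ] M) (ht : t ∈ grT s grM n) : mT M x t ∈ grT s grM (n + i) :=
  grT_le (p := (grT s grM (n + i)).comap (mT M x)) (fun j k e u hu m hm =>
    tmul_mem_grT (j := i + k) (by omega) hu (hM.lie_mem hx hm)) ht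

variable (b M) in
/-- The right action on the coefficients. -/
def rgt (x : 𝔤) : Module.End ℂ (Tame b (U ⊗[ℂ] M)) := post b (rT M x)

variable (b M) in
/-- The action on `M`. -/
def actM (x : 𝔤) : Module.End ℂ (Tame b (U ⊗[ℂ] M)) := post b (mT M x)

variable (b M) in
/-- The left action, which comes from the arguments. -/
def lam (x : 𝔤) : Module.End ℂ (Tame b (U ⊗[ℂ] M)) :=
  -pre (U ⊗[ℂ] M) (adm_mulLeft b (toU x))

theorem isMor_rgt (x : 𝔤) : IsMor (grT s grM) (grT s grM) (rgt b M x) :=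
  ⟨isCoeffMap_post fun y t => rT_smul x y t, fun m c => mem_CY_of_graded
    s.isInternal.submodule_iSup_eq_top (Θ := rgt b M)
    (LinearMap.ext fun c => Tame.ext' fun K v => by rw [rgt, post_apply, rT_zero]; rfl)
    (fun x y => LinearMap.ext fun c => Tame.ext' fun K v => by rw [rgt, post_apply, rT_add]; rfl)
    (fun i x hx m n q c hc => post_mem_HomY (rT_mem_grT hx) hc) x m c⟩

theorem isMor_actM (hM : IsCategoryO s grM) (x : 𝔤) :
    IsMor (grT s grM) (grT s grM) (actM b M x) :=
  ⟨isCoeffMap_post fun y t => mT_smul x y t, fun m c => mem_CY_of_graded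
    s.isInternal.submodule_iSup_eq_top (Θ := actM b M)
    (LinearMap.ext fun c => Tame.ext' fun K v => by rw [actM, post_apply, mT_zero]; rfl)
    (fun x y => LinearMap.ext fun c => Tame.ext' fun K v => by rw [actM, post_apply, mT_add]; rfl)
    (fun i x hx m n q c hc => post_mem_HomY (mT_mem_grT hM hx) hc) x m c⟩

theorem lam_apply (x : 𝔤) (c : Tame b (U ⊗[ℂ] M)) (K : Finset ι) (v : U) :
    (lam b M x c).1 K v = -c.1 K (toU x * v) := rfl

theorem isMor_lam (x : 𝔤) : IsMor (grT s grM) (grT s grM) (lam b M x) :=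
  ⟨(isCoeffMap_pre (toU x)).neg, fun m c => mem_CY_of_graded
    s.isInternal.submodule_iSup_eq_top (Θ := lam b M)
    (LinearMap.ext fun c => Tame.ext' fun K v => by
      rw [lam_apply, toU, map_zero, zero_mul, LinearMap.map_zero, neg_zero]; rfl)
    (fun x y => LinearMap.ext fun c => Tame.ext' fun K v => by
      rw [lam_apply, toU_add, add_mul, LinearMap.map_add, neg_add]; rfl)
    (fun i x hx m n q c hc => Submodule.neg_mem _
      (pre_mem_HomY (fun n v hv => toU_mul_mem s hx hv) hc)) x m c⟩

variable (b) in
/-- The tensor product of the semi-regular bimodule with a module of the category, as a cohomology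
space. -/
def semiRegularTensor (hM : IsCategoryO s grM)
    (hγ : ∀ n : ℤ, n ≠ 0 → ∀ x ∈ s.gr n, s.γ x = 0) :
    SemiRegular b ⊗[ℂ] M ≃ₗ[ℂ] HY b (grT s grM) :=
  (semiRegularEquiv b).rTensor M ≪≫ₗ
    LinearEquiv.ofBijective (tensorHY hM.isInternal.submodule_iSup_eq_top)
      ⟨tensorHY_injective hM.isInternal, tensorHY_surjective hM.isInternal hγ⟩

variable (hM : IsCategoryO s grM) (hγ : ∀ n : ℤ, n ≠ 0 → ∀ x ∈ s.gr n, s.γ x = 0)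

theorem semiRegularTensor_tmul (c : cocycles b 0) (m : M) :
    semiRegularTensor b hM hγ (Submodule.Quotient.mk c ⊗ₜ m) = Submodule.Quotient.mk
      ⟨em b m (cocyclesEquiv b c).1, (isMor_em hM.isInternal.submodule_iSup_eq_top m).map_ZY _
        (cocyclesEquiv b c).2⟩ := rfl

theorem semiRegularTensor_rightAct (x : 𝔤) (t : SemiRegular b ⊗[ℂ] M) :
    semiRegularTensor b hM hγ ((rightAct b x).rTensor M t) =
      (isMor_rgt x).map (semiRegularTensor b hM hγ t) := by
  induction t with
  | zero => simp only [LinearMap.map_zero, LinearEquiv.map_zero]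
  | tmul c m =>
    obtain ⟨c, rfl⟩ := Submodule.Quotient.mk_surjective _ c
    rw [LinearMap.rTensor_tmul, semiRegularTensor_tmul, IsMor.map_mk]
    rfl
  | add t t' h h' => simp only [LinearMap.map_add, LinearEquiv.map_add, h, h']

theorem semiRegularTensor_leftAct (x : 𝔤) (t : SemiRegular b ⊗[ℂ] M) :
    semiRegularTensor b hM hγ ((leftAct b x).rTensor M t) =
      (isMor_lam x).map (semiRegularTensor b hM hγ t) := by
  induction t with
  | zero => simp only [LinearMap.map_zero, LinearEquiv.map_zero]
  | tmul c m =>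
    obtain ⟨c, rfl⟩ := Submodule.Quotient.mk_surjective _ c
    rw [LinearMap.rTensor_tmul, semiRegularTensor_tmul, IsMor.map_mk]
    refine congrArg _ (Subtype.ext (Tame.ext' fun K v => ?_))
    exact TensorProduct.neg_tmul _ _
  | add t t' h h' => simp only [LinearMap.map_add, LinearEquiv.map_add, h, h']

theorem semiRegularTensor_actM (x : 𝔤) (t : SemiRegular b ⊗[ℂ] M) :
    semiRegularTensor b hM hγ ((LieModule.toEnd ℂ 𝔤 M x).lTensor (SemiRegular b) t) =
      (isMor_actM hM x).map (semiRegularTensor b hM hγ t) := by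
  induction t with
  | zero => simp only [LinearMap.map_zero, LinearEquiv.map_zero]
  | tmul c m =>
    obtain ⟨c, rfl⟩ := Submodule.Quotient.mk_surjective _ c
    rw [LinearMap.lTensor_tmul, semiRegularTensor_tmul, semiRegularTensor_tmul, IsMor.map_mk]
    rfl
  | add t t' h h' => simp only [LinearMap.map_add, LinearEquiv.map_add, h, h']

/-- It suffices to construct the equivalence on the level of cochains. -/
theorem exists_equiv_of_cochains (hM : IsCategoryO s grM)
    (hγ : ∀ n : ℤ, n ≠ 0 → ∀ x ∈ s.gr n, s.γ x = 0)
    {Θ : Tame b (U ⊗[ℂ] M) ≃ₗ[ℂ] Tame b (U ⊗[ℂ] M)}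
    (h : IsMor (grT s grM) (grT s grM) Θ.toLinearMap)
    (h' : IsMor (grT s grM) (grT s grM) Θ.symm.toLinearMap)
    (h₁ : ∀ x c, Θ (-rgt b M x c) = -rgt b M x (Θ c) + actM b M x (Θ c))
    (h₂ : ∀ x c, Θ (lam b M x c + actM b M x c) = lam b M x (Θ c)) :
    ∃ Φ : SemiRegular b ⊗[ℂ] M ≃ₗ[ℂ] SemiRegular b ⊗[ℂ] M, ∀ x : 𝔤,
        Φ.toLinearMap ∘ₗ pi₁' b M x = pi₁ b M x ∘ₗ Φ.toLinearMap ∧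
        Φ.toLinearMap ∘ₗ pi₂' b M x = pi₂ b M x ∘ₗ Φ.toLinearMap := by
  let J := semiRegularTensor b hM hγ
  let Ψ := IsMor.equiv (grT s grM) h h'
  have hJ : ∀ t, J ((J ≪≫ₗ Ψ ≪≫ₗ J.symm) t) = h.map (J t) := fun t => J.apply_symm_apply _
  have k₁ : ∀ x : 𝔤, ∀ t, h.map (-(isMor_rgt x).map t) =
      -(isMor_rgt x).map (h.map t) + (isMor_actM hM x).map (h.map t) := fun x t => by
    obtain ⟨c, rfl⟩ := Submodule.Quotient.mk_surjective _ t
    exact congrArg _ (Subtype.ext (h₁ x c.1))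
  have k₂ : ∀ x : 𝔤, ∀ t, h.map ((isMor_lam x).map t + (isMor_actM hM x).map t) =
      (isMor_lam x).map (h.map t) := fun x t => by
    obtain ⟨c, rfl⟩ := Submodule.Quotient.mk_surjective _ t
    exact congrArg _ (Subtype.ext (h₂ x c.1))
  have e₁' : ∀ x t, J (pi₁' b M x t) = -(isMor_rgt x).map (J t) := fun x t =>
    (map_neg J _).trans (congrArg Neg.neg (semiRegularTensor_rightAct hM hγ x t))
  have e₁ : ∀ x t, J (pi₁ b M x t) = -(isMor_rgt x).map (J t) + (isMor_actM hM x).map (J t) :=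
    fun x t => (map_add J _ _).trans (congrArg₂ _
      ((map_neg J _).trans (congrArg Neg.neg (semiRegularTensor_rightAct hM hγ x t)))
      (semiRegularTensor_actM hM hγ x t))
  have e₂' : ∀ x t, J (pi₂' b M x t) = (isMor_lam x).map (J t) + (isMor_actM hM x).map (J t) :=
    fun x t => (map_add J _ _).trans (congrArg₂ _ (semiRegularTensor_leftAct hM hγ x t)
      (semiRegularTensor_actM hM hγ x t))
  have e₂ : ∀ x t, J (pi₂ b M x t) = (isMor_lam x).map (J t) := fun x t =>
    semiRegularTensor_leftAct hM hγ x t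
  let Φ := J ≪≫ₗ Ψ ≪≫ₗ J.symm
  refine ⟨Φ, fun x => ⟨LinearMap.ext fun t => J.injective ?_,
    LinearMap.ext fun t => J.injective ?_⟩⟩
  · change J (Φ (pi₁' b M x t)) = J (pi₁ b M x (Φ t))
    rw [e₁, hJ, hJ, e₁', k₁]
  · change J (Φ (pi₂' b M x t)) = J (pi₂ b M x (Φ t))
    rw [e₂, hJ, hJ, e₂', k₂]

end Actions

/-! ### Representations and anti-representations of the enveloping algebra -/

section Lift

attribute [local instance 100] LieRing.ofAssociativeRing

variable {𝔤 : Type u} [LieRing 𝔤] [LieAlgebra ℂ 𝔤] {s : SemiInfiniteStructure 𝔤}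
  {ι : Type v} [LinearOrder ι]
  {E : Type*} [AddCommGroup E] [Module ℂ E]

local notation "U" => UniversalEnvelopingAlgebra ℂ 𝔤

/-- The extension of a representation of `𝔤` to the enveloping algebra. -/
def repLift (f : 𝔤 →ₗ[ℂ] Module.End ℂ E) (hf : ∀ x y, f ⁅x, y⁆ = f x * f y - f y * f x) :
    U →ₐ[ℂ] Module.End ℂ E :=
  UniversalEnvelopingAlgebra.lift ℂ
    { f with map_lie' := fun {x y} => (hf x y).trans (Ring.lie_def (f x) (f y)).symm }

theorem repLift_toU (f : 𝔤 →ₗ[ℂ] Module.End ℂ E) (hf : ∀ x y, f ⁅x, y⁆ = f x * f y - f y * f x)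
    (x : 𝔤) : repLift f hf (toU x) = f x := UniversalEnvelopingAlgebra.lift_ι_apply ℂ _ x

/-- The extension of an anti-representation of `𝔤` to the enveloping algebra. -/
def antiLift (f : 𝔤 →ₗ[ℂ] Module.End ℂ E) (hf : ∀ x y, f ⁅x, y⁆ = f y * f x - f x * f y) :
    U →ₐ[ℂ] (Module.End ℂ E)ᵐᵒᵖ :=
  UniversalEnvelopingAlgebra.lift ℂ
    { (MulOpposite.opLinearEquiv ℂ).toLinearMap ∘ₗ f with
      map_lie' := fun {x y} => (congrArg MulOpposite.op (hf x y)).trans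
        (Ring.lie_def (MulOpposite.op (f x)) (MulOpposite.op (f y))).symm }

/-- The operators of an anti-representation. -/
def antiRep (f : 𝔤 →ₗ[ℂ] Module.End ℂ E) (hf : ∀ x y, f ⁅x, y⁆ = f y * f x - f x * f y) :
    U →ₗ[ℂ] Module.End ℂ E :=
  (MulOpposite.opLinearEquiv ℂ).symm.toLinearMap ∘ₗ (antiLift f hf).toLinearMap

variable {f : 𝔤 →ₗ[ℂ] Module.End ℂ E} {hf : ∀ x y, f ⁅x, y⁆ = f y * f x - f x * f y}

theorem antiRep_toU (x : 𝔤) : antiRep f hf (toU x) = f x :=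
  congrArg MulOpposite.unop (UniversalEnvelopingAlgebra.lift_ι_apply ℂ _ x)

theorem antiRep_one : antiRep f hf 1 = 1 := congrArg MulOpposite.unop (map_one (antiLift f hf))

theorem antiRep_mul (v w : U) : antiRep f hf (v * w) = antiRep f hf w * antiRep f hf v :=
  congrArg MulOpposite.unop (map_mul (antiLift f hf) v w)

theorem antiRep_toU_mul (x : 𝔤) (v : U) (e : E) :
    antiRep f hf (toU x * v) e = antiRep f hf v (f x e) := by
  rw [antiRep_mul, antiRep_toU]; rfl

theorem antiRep_mul_toU (x : 𝔤) (v : U) (e : E) :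
    antiRep f hf (v * toU x) e = f x (antiRep f hf v e) := by
  rw [antiRep_mul, antiRep_toU]; rfl

/-- Induction on the number of letters, which are added on the left. -/
theorem U_induction (b : HomogeneousBasis s ι) {p : U → Prop} (h1 : p 1) (h0 : p 0) (hadd : ∀ v w, p v → p w → p (v + w))
    (hsmul : ∀ (a : ℂ) v, p v → p (a • v)) (h : ∀ (x : 𝔤) v, p v → p (toU x * v)) (v : U) : p v :=
  mem_of_left_closed (b := b) (F := ⟨⟨⟨{v | p v}, fun {v w} => hadd v w⟩, h0⟩, hsmul⟩) h1
    (fun _ v hv => h _ v hv) v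

/-- The extension to the enveloping algebra is natural in the anti-representation. -/
theorem antiRep_comm (b : HomogeneousBasis s ι) {E' : Type*} [AddCommGroup E'] [Module ℂ E'] {f' : 𝔤 →ₗ[ℂ] Module.End ℂ E'}
    {hf' : ∀ x y, f' ⁅x, y⁆ = f' y * f' x - f' x * f' y} {g : E →ₗ[ℂ] E'}
    (hg : ∀ x e, g (f x e) = f' x (g e)) (v : U) :
    ∀ e, g (antiRep f hf v e) = antiRep f' hf' v (g e) := by
  refine U_induction b (p := fun v => ∀ e, g (antiRep f hf v e) = antiRep f' hf' v (g e))
    ?_ ?_ ?_ ?_ ?_ v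
  · intro e; rw [antiRep_one, antiRep_one]; rfl
  · intro e; simp only [LinearMap.map_zero, LinearMap.zero_apply]
  · intro v w hv hw e; simp only [LinearMap.map_add, LinearMap.add_apply, hv, hw]
  · intro a v hv e; simp only [LinearMap.map_smul, LinearMap.smul_apply, hv]
  · intro x v hv e; rw [antiRep_toU_mul, antiRep_toU_mul, hv, hg]

/-- The extension to the enveloping algebra is natural in the representation. -/
theorem repLift_comm (b : HomogeneousBasis s ι)
    {f : 𝔤 →ₗ[ℂ] Module.End ℂ E} {hf : ∀ x y, f ⁅x, y⁆ = f x * f y - f y * f x}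
    {E' : Type*} [AddCommGroup E'] [Module ℂ E'] {f' : 𝔤 →ₗ[ℂ] Module.End ℂ E'}
    {hf' : ∀ x y, f' ⁅x, y⁆ = f' x * f' y - f' y * f' x} {g : E →ₗ[ℂ] E'}
    (hg : ∀ x e, g (f x e) = f' x (g e)) (v : U) :
    ∀ e, g (repLift f hf v e) = repLift f' hf' v (g e) := by
  refine U_induction b (p := fun v => ∀ e, g (repLift f hf v e) = repLift f' hf' v (g e))
    ?_ ?_ ?_ ?_ ?_ v
  · intro e; rw [map_one, map_one]; rfl
  · intro e; simp only [map_zero, LinearMap.zero_apply]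
  · intro v w hv hw e; simp only [map_add, LinearMap.add_apply, hv, hw]
  · intro a v hv e; simp only [map_smul, LinearMap.smul_apply, hv]
  · intro x v hv e
    rw [map_mul, map_mul, repLift_toU, repLift_toU, Module.End.mul_apply, Module.End.mul_apply,
      hg, hv]

end Lift

/-! ### Twisting linear maps on the enveloping algebra by a representation -/

section Twist

variable {𝔤 : Type u} [LieRing 𝔤] [LieAlgebra ℂ 𝔤] {s : SemiInfiniteStructure 𝔤}
  {ι : Type v} [LinearOrder ι] {b : HomogeneousBasis s ι}
  {Y : Type w} [AddCommGroup Y] [Module ℂ Y]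

local notation "U" => UniversalEnvelopingAlgebra ℂ 𝔤

/-- `F ↦ F(x ·) - x F`. -/
def twL (a : 𝔤 →ₗ[ℂ] Module.End ℂ Y) : 𝔤 →ₗ[ℂ] Module.End ℂ (U →ₗ[ℂ] Y) where
  toFun x :=
    { toFun := fun F => F ∘ₗ LinearMap.mulLeft ℂ (toU x) - a x ∘ₗ F
      map_add' := fun F G => LinearMap.ext fun v => by
        simp only [LinearMap.sub_apply, LinearMap.comp_apply, LinearMap.add_apply, map_add]; abel
      map_smul' := fun z F => LinearMap.ext fun v => by
        simp only [LinearMap.sub_apply, LinearMap.comp_apply, LinearMap.smul_apply, map_smul,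
          RingHom.id_apply, smul_sub] }
  map_add' x y := LinearMap.ext fun F => LinearMap.ext fun v => by
    simp only [LinearMap.coe_mk, AddHom.coe_mk, LinearMap.sub_apply, LinearMap.comp_apply,
      LinearMap.add_apply, map_add, LinearMap.mulLeft_apply, add_mul]; abel
  map_smul' z x := LinearMap.ext fun F => LinearMap.ext fun v => by
    simp only [LinearMap.coe_mk, AddHom.coe_mk, LinearMap.sub_apply, LinearMap.comp_apply,
      LinearMap.smul_apply, map_smul, LinearMap.mulLeft_apply, toU, smul_mul_assoc,
      RingHom.id_apply, smul_sub]

/-- `F ↦ x F + F(· x)`. -/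
def twR (a : 𝔤 →ₗ[ℂ] Module.End ℂ Y) : 𝔤 →ₗ[ℂ] Module.End ℂ (U →ₗ[ℂ] Y) where
  toFun x :=
    { toFun := fun F => a x ∘ₗ F + F ∘ₗ LinearMap.mulRight ℂ (toU x)
      map_add' := fun F G => LinearMap.ext fun v => by
        simp only [LinearMap.comp_apply, LinearMap.add_apply, map_add]; abel
      map_smul' := fun z F => LinearMap.ext fun v => by
        simp only [LinearMap.add_apply, LinearMap.comp_apply, LinearMap.smul_apply, map_smul,
          RingHom.id_apply, smul_add] }
  map_add' x y := LinearMap.ext fun F => LinearMap.ext fun v => by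
    simp only [LinearMap.coe_mk, AddHom.coe_mk, LinearMap.comp_apply,
      LinearMap.add_apply, map_add, LinearMap.mulRight_apply, mul_add]; abel
  map_smul' z x := LinearMap.ext fun F => LinearMap.ext fun v => by
    simp only [LinearMap.coe_mk, AddHom.coe_mk, LinearMap.add_apply, LinearMap.comp_apply,
      LinearMap.smul_apply, map_smul, LinearMap.mulRight_apply, toU, mul_smul_comm,
      RingHom.id_apply, smul_add]

variable {a : 𝔤 →ₗ[ℂ] Module.End ℂ Y}

theorem twL_apply (x : 𝔤) (F : U →ₗ[ℂ] Y) (v : U) : twL a x F v = F (toU x * v) - a x (F v) := rfl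

theorem twR_apply (x : 𝔤) (F : U →ₗ[ℂ] Y) (v : U) : twR a x F v = a x (F v) + F (v * toU x) := rfl

theorem twL_lie (ha : ∀ x y, a ⁅x, y⁆ = a x * a y - a y * a x) (x y : 𝔤) :
    twL a ⁅x, y⁆ = twL a y * twL a x - twL a x * twL a y :=
  LinearMap.ext fun F => LinearMap.ext fun v => by
    rw [LinearMap.sub_apply, LinearMap.sub_apply, Module.End.mul_apply, Module.End.mul_apply]
    simp only [twL_apply, ha, toU_lie, sub_mul, map_sub, LinearMap.sub_apply,
      Module.End.mul_apply, mul_assoc]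
    abel

theorem twR_lie (ha : ∀ x y, a ⁅x, y⁆ = a x * a y - a y * a x) (x y : 𝔤) :
    twR a ⁅x, y⁆ = twR a x * twR a y - twR a y * twR a x :=
  LinearMap.ext fun F => LinearMap.ext fun v => by
    rw [LinearMap.sub_apply, LinearMap.sub_apply, Module.End.mul_apply, Module.End.mul_apply]
    simp only [twR_apply, ha, toU_lie, mul_sub, map_sub, map_add, LinearMap.sub_apply,
      Module.End.mul_apply, mul_assoc]
    abel

variable (ha : ∀ x y, a ⁅x, y⁆ = a x * a y - a y * a x)

/-- The twist `F ↦ (v ↦ ∑ S(v₁) F(v₂))`, where `S` is the antipode and `∑ v₁ ⊗ v₂` the coproduct. -/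
def twist : Module.End ℂ (U →ₗ[ℂ] Y) where
  toFun F :=
    { toFun := fun v => antiRep (twL a) (twL_lie ha) v F 1
      map_add' := fun v w => by rw [map_add]; rfl
      map_smul' := fun z v => by rw [map_smul]; rfl }
  map_add' F G := LinearMap.ext fun v => by
    simp only [LinearMap.coe_mk, AddHom.coe_mk, LinearMap.add_apply, map_add]
  map_smul' z F := LinearMap.ext fun v => by
    simp only [LinearMap.coe_mk, AddHom.coe_mk, LinearMap.smul_apply, map_smul, RingHom.id_apply]

/-- The twist `F ↦ (v ↦ ∑ v₁ F(v₂))`, where `∑ v₁ ⊗ v₂` is the coproduct. -/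
def untwist : Module.End ℂ (U →ₗ[ℂ] Y) where
  toFun F :=
    { toFun := fun v => repLift (twR a) (twR_lie ha) v F 1
      map_add' := fun v w => by rw [map_add]; rfl
      map_smul' := fun z v => by rw [map_smul]; rfl }
  map_add' F G := LinearMap.ext fun v => by
    simp only [LinearMap.coe_mk, AddHom.coe_mk, LinearMap.add_apply, map_add]
  map_smul' z F := LinearMap.ext fun v => by
    simp only [LinearMap.coe_mk, AddHom.coe_mk, LinearMap.smul_apply, map_smul, RingHom.id_apply]

theorem twist_apply (F : U →ₗ[ℂ] Y) (v : U) :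
    twist ha F v = antiRep (twL a) (twL_lie ha) v F 1 := rfl

theorem untwist_apply (F : U →ₗ[ℂ] Y) (v : U) :
    untwist ha F v = repLift (twR a) (twR_lie ha) v F 1 := rfl

theorem twist_one (F : U →ₗ[ℂ] Y) : twist ha F 1 = F 1 := by rw [twist_apply, antiRep_one]; rfl

theorem untwist_one (F : U →ₗ[ℂ] Y) : untwist ha F 1 = F 1 := by rw [untwist_apply, map_one (repLift _ _)]; rfl

theorem twist_toU_mul (F : U →ₗ[ℂ] Y) (x : 𝔤) (v : U) :
    twist ha F (toU x * v) = twist ha (twL a x F) v := by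
  rw [twist_apply, antiRep_toU_mul, twist_apply]

theorem twist_eq_neg {F G : U →ₗ[ℂ] Y} {x : 𝔤} (h : ∀ w, G w = -(F (toU x * w) - a x (F w)))
    (v : U) : twist ha G v = -twist ha F (toU x * v) := by
  have : G = -twL a x F := LinearMap.ext h
  rw [twist_toU_mul, this, LinearMap.map_neg, LinearMap.neg_apply]

/-- The twist turns the regular representation `F ↦ F(· x)` into its tensor product with the
representation `a`. -/
theorem twist_mul_toU (b : HomogeneousBasis s ι) (F : U →ₗ[ℂ] Y) (x : 𝔤) (v : U) :
    twist ha F (v * toU x) =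
      twist ha (F ∘ₗ LinearMap.mulRight ℂ (toU x)) v - a x (twist ha F v) := by
  rw [twist_apply, antiRep_mul_toU, twL_apply, ← twist_apply ha, mul_one, twist_apply ha (F ∘ₗ _)]
  congr 1
  have := antiRep_comm b (f := twL a) (hf := twL_lie ha) (f' := twL a) (hf' := twL_lie ha)
    (g := (LinearMap.mulRight ℂ (toU x : U)).lcomp ℂ Y)
    (fun y F => LinearMap.ext fun w => by
      simp only [LinearMap.lcomp_apply, twL_apply, LinearMap.mulRight_apply, mul_assoc]) v F
  refine Eq.trans ?_ (LinearMap.congr_fun this 1)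
  rw [LinearMap.lcomp_apply, LinearMap.mulRight_apply, one_mul]

theorem untwist_toU_mul (b : HomogeneousBasis s ι) (F : U →ₗ[ℂ] Y) (x : 𝔤) (v : U) :
    untwist ha F (toU x * v) =
      a x (untwist ha F v) + untwist ha (F ∘ₗ LinearMap.mulLeft ℂ (toU x)) v := by
  rw [untwist_apply, map_mul, repLift_toU, Module.End.mul_apply, twR_apply, ← untwist_apply ha,
    one_mul, untwist_apply ha (F ∘ₗ _)]
  congr 1
  have := repLift_comm b (f := twR a) (hf := twR_lie ha) (f' := twR a) (hf' := twR_lie ha)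
    (g := (LinearMap.mulLeft ℂ (toU x : U)).lcomp ℂ Y)
    (fun y F => LinearMap.ext fun w => by
      simp only [LinearMap.lcomp_apply, twR_apply, LinearMap.mulLeft_apply, mul_assoc]) v F
  refine Eq.trans ?_ (LinearMap.congr_fun this 1)
  rw [LinearMap.lcomp_apply, LinearMap.mulLeft_apply, mul_one]

/-- The twist commutes with the endomorphisms of the representation. -/
theorem twist_comp (b : HomogeneousBasis s ι) {g : Module.End ℂ Y}
    (hg : ∀ x y, g (a x y) = a x (g y)) (F : U →ₗ[ℂ] Y) (v : U) :
    twist ha (g ∘ₗ F) v = g (twist ha F v) := by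
  have := antiRep_comm b (f := twL a) (hf := twL_lie ha) (f' := twL a) (hf' := twL_lie ha)
    (g := LinearMap.compRight ℂ g)
    (fun y F => LinearMap.ext fun w => by
      simp only [LinearMap.compRight_apply, twL_apply, LinearMap.comp_apply, map_sub, hg]) v F
  exact (LinearMap.congr_fun this 1).symm

/-- The map `untwist` is a right inverse of `twist`. -/
theorem twist_untwist (b : HomogeneousBasis s ι) (v : U) :
    ∀ F : U →ₗ[ℂ] Y, twist ha (untwist ha F) v = F v := by
  refine U_induction b (p := fun v => ∀ F : U →ₗ[ℂ] Y, twist ha (untwist ha F) v = F v)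
    ?_ ?_ ?_ ?_ ?_ v
  · intro F; rw [twist_one, untwist_one]
  · intro F; rw [LinearMap.map_zero, LinearMap.map_zero]
  · intro v w hv hw F; rw [LinearMap.map_add, LinearMap.map_add, hv, hw]
  · intro z v hv F; rw [LinearMap.map_smul, LinearMap.map_smul, hv]
  · intro x v hv F
    have : twL a x (untwist ha F) = untwist ha (F ∘ₗ LinearMap.mulLeft ℂ (toU x)) :=
      LinearMap.ext fun w => by rw [twL_apply, untwist_toU_mul ha b, add_sub_cancel_left]
    rw [twist_toU_mul, this, hv]; rfl

/-- The map `untwist` is a left inverse of `twist`. -/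
theorem untwist_twist (b : HomogeneousBasis s ι) (v : U) :
    ∀ F : U →ₗ[ℂ] Y, untwist ha (twist ha F) v = F v := by
  refine U_induction b (p := fun v => ∀ F : U →ₗ[ℂ] Y, untwist ha (twist ha F) v = F v)
    ?_ ?_ ?_ ?_ ?_ v
  · intro F; rw [untwist_one, twist_one]
  · intro F; rw [LinearMap.map_zero, LinearMap.map_zero]
  · intro v w hv hw F; rw [LinearMap.map_add, LinearMap.map_add, hv, hw]
  · intro z v hv F; rw [LinearMap.map_smul, LinearMap.map_smul, hv]
  · intro x v hv F
    have : twist ha F ∘ₗ LinearMap.mulLeft ℂ (toU x) = twist ha (twL a x F) :=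
      LinearMap.ext fun w => twist_toU_mul ha F x w
    rw [untwist_toU_mul ha b, this, hv, hv, twL_apply, add_sub_cancel]

end Twist

/-! ### Boundedness of the twist -/

section TwistBounded

variable {𝔤 : Type u} [LieRing 𝔤] [LieAlgebra ℂ 𝔤] {s : SemiInfiniteStructure 𝔤}
  {ι : Type v} [LinearOrder ι] {b : HomogeneousBasis s ι}
  {Y : Type w} [AddCommGroup Y] [Module ℂ Y] {a : 𝔤 →ₗ[ℂ] Module.End ℂ Y}
  (ha : ∀ x y, a ⁅x, y⁆ = a x * a y - a y * a x)

local notation "U" => UniversalEnvelopingAlgebra ℂ 𝔤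

theorem toU_mul_mem_wrdSpan {p : Set ι} {i : ι} (hi : i ∈ p) {n : ℤ} {u : U}
    (hu : u ∈ wrdSpan b p n) : toU (b.basis i) * u ∈ wrdSpan b p (b.deg i + n) := by
  have h : toU (b.basis i) ∈ wrdSpan b p (b.deg i) := by
    have := wrd_mem (b := b) (p := p) (l := [i]) (by simpa using hi)
    simpa [wrd] using this
  exact mul_mem_wrdSpan h hu

variable {p : Set ι} {W : ℤ → Submodule ℂ Y}

/-- The twist preserves the maps of degree `k` into a family `W` of subspaces which the letters in
`p` shift by their degrees. -/
theorem twist_wrd (hW : ∀ i ∈ p, ∀ j, ∀ y ∈ W j, a (b.basis i) y ∈ W (j + b.deg i)) (l : List ι)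
    (hl : ∀ i ∈ l, i ∈ p) : ∀ (k : ℤ) (F : U →ₗ[ℂ] Y),
      (∀ n, ∀ u ∈ wrdSpan b p n, F u ∈ W (n + k)) →
        twist ha F (wrd b l) ∈ W ((l.map b.deg).sum + k) := by
  induction l with
  | nil =>
    intro k F hF
    rw [wrd_nil, twist_one]
    exact hF 0 1 (one_mem_wrdSpan p)
  | cons i l ih =>
    intro k F hF
    have hi := hl i List.mem_cons_self
    rw [wrd_cons, twist_toU_mul, List.map_cons, List.sum_cons,
      show b.deg i + (l.map b.deg).sum + k = (l.map b.deg).sum + (b.deg i + k) by ring]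
    refine ih (fun j hj => hl j (List.mem_cons_of_mem i hj)) _ _ fun n u hu => ?_
    rw [twL_apply]
    refine Submodule.sub_mem _ ?_ ?_
    · have := hF _ _ (toU_mul_mem_wrdSpan hi hu)
      rwa [show n + (b.deg i + k) = b.deg i + n + k by ring]
    · have := hW i hi _ _ (hF n u hu)
      rwa [show n + (b.deg i + k) = n + k + b.deg i by ring]

theorem untwist_wrd (hW : ∀ i ∈ p, ∀ j, ∀ y ∈ W j, a (b.basis i) y ∈ W (j + b.deg i)) (l : List ι)
    (hl : ∀ i ∈ l, i ∈ p) : ∀ (k : ℤ) (F : U →ₗ[ℂ] Y),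
      (∀ n, ∀ u ∈ wrdSpan b p n, F u ∈ W (n + k)) →
        untwist ha F (wrd b l) ∈ W ((l.map b.deg).sum + k) := by
  induction l with
  | nil =>
    intro k F hF
    rw [wrd_nil, untwist_one]
    exact hF 0 1 (one_mem_wrdSpan p)
  | cons i l ih =>
    intro k F hF
    have hi := hl i List.mem_cons_self
    have hl' : ∀ j ∈ l, j ∈ p := fun j hj => hl j (List.mem_cons_of_mem i hj)
    rw [wrd_cons, untwist_toU_mul ha b, List.map_cons, List.sum_cons,
      show b.deg i + (l.map b.deg).sum + k = (l.map b.deg).sum + (k + b.deg i) by ring]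
    refine Submodule.add_mem _ ?_ (ih hl' _ _ fun n u hu => ?_)
    · have := hW i hi _ _ (ih hl' k F hF)
      rwa [← add_assoc]
    · have := hF _ _ (toU_mul_mem_wrdSpan hi hu)
      rw [LinearMap.comp_apply, LinearMap.mulLeft_apply]
      rwa [show n + (k + b.deg i) = b.deg i + n + k by ring]

theorem mem_of_wrd {R : U →ₗ[ℂ] Y} {n : ℤ} {S : Submodule ℂ Y}
    (h : ∀ l : List ι, (∀ i ∈ l, i ∈ p) → (l.map b.deg).sum = n → R (wrd b l) ∈ S) {u : U}
    (hu : u ∈ wrdSpan b p n) : R u ∈ S := by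
  have : wrdSpan b p n ≤ S.comap R := Submodule.span_le.2 (by
    rintro _ ⟨l, hl, e, rfl⟩
    exact h l hl e)
  exact this hu

theorem twist_mem (hW : ∀ i ∈ p, ∀ j, ∀ y ∈ W j, a (b.basis i) y ∈ W (j + b.deg i)) {k : ℤ}
    {F : U →ₗ[ℂ] Y} (hF : ∀ n, ∀ u ∈ wrdSpan b p n, F u ∈ W (n + k)) (n : ℤ) (u : U)
    (hu : u ∈ wrdSpan b p n) : twist ha F u ∈ W (n + k) :=
  mem_of_wrd (fun l hl e => e ▸ twist_wrd ha hW l hl k F hF) hu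

theorem untwist_mem (hW : ∀ i ∈ p, ∀ j, ∀ y ∈ W j, a (b.basis i) y ∈ W (j + b.deg i)) {k : ℤ}
    {F : U →ₗ[ℂ] Y} (hF : ∀ n, ∀ u ∈ wrdSpan b p n, F u ∈ W (n + k)) (n : ℤ) (u : U)
    (hu : u ∈ wrdSpan b p n) : untwist ha F u ∈ W (n + k) :=
  mem_of_wrd (fun l hl e => e ▸ untwist_wrd ha hW l hl k F hF) hu

variable (s) in
/-- Every finite-dimensional subspace lies in a term of a finite decreasing filtration by
finite-dimensional subspaces which is compatible with the action of `𝔤₊`. -/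
def LocFilt (a : 𝔤 →ₗ[ℂ] Module.End ℂ Y) : Prop :=
  ∀ X : Submodule ℂ Y, FiniteDimensional ℂ X → ∃ (W : ℤ → Submodule ℂ Y) (e N : ℤ), Antitone W ∧
    (∀ i, FiniteDimensional ℂ (W i)) ∧ X ≤ W e ∧ W N = ⊥ ∧
    ∀ d, 0 ≤ d → ∀ x ∈ s.gr d, ∀ i, ∀ y ∈ W i, a x y ∈ W (i + d)

/-- An operator on `Hom(U, Y)` which preserves the maps of each degree on `U₊`, for all filtrations
stable under `𝔤₊`, preserves the finiteness conditions on `U₊`: the filtration supplied by `LocFilt`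
bounds both the values and the degrees. -/
theorem niceAt_one_of_locFilt (hs : LocFilt s a) {R : (U →ₗ[ℂ] Y) → (U →ₗ[ℂ] Y)}
    (hR : ∀ W : ℤ → Submodule ℂ Y, (∀ i ∈ nonneg b, ∀ j, ∀ y ∈ W j,
      a (b.basis i) y ∈ W (j + b.deg i)) → ∀ (k : ℤ) (F : U →ₗ[ℂ] Y),
        (∀ n, ∀ u ∈ UP b n, F u ∈ W (n + k)) → ∀ n, ∀ u ∈ UP b n, R F u ∈ W (n + k))
    {I : Finset ι} {c : Formal 𝔤 ι Y} (hc : c ∈ niceAt b I 1) :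
    (fun K => R (c K)) ∈ niceAt b I 1 := by
  obtain ⟨𝒦, X, D, hX, h⟩ := hc
  obtain ⟨W, e, N, hWa, hWf, hXW, hWN, hWx⟩ := hs X hX
  -- `c K` maps the degree `n ≤ D` part of `U₊` to `W e ⊆ W (n + (e - D))`, and vanishes above `D`
  have key : ∀ K, starPart b.opp K = I → ∀ n, ∀ u ∈ UP b n, R (c K) u ∈ W (n + (e - D)) :=
    fun K hK => hR W (fun i hi j y hy => hWx _ (not_lt.1 hi) _ (b.mem i) j y hy) _ _
      fun n u hu => by
        have h1 := h K hK n u hu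
        rw [one_mul] at h1
        by_cases hn : n ≤ D
        · exact hWa (by omega) (hXW h1.1)
        · have h0 : c K u = 0 := by
            by_contra h0
            exact hn (h1.2 h0).2
          rw [h0]
          exact Submodule.zero_mem _
  -- in degrees `n > D + N - e` the values lie in `W N = ⊥`
  refine ⟨𝒦, W (e - D), D + N - e, hWf _, fun K hK n u hu => ?_⟩
  change R (c K) (1 * u) ∈ _ ∧ (R (c K) (1 * u) ≠ 0 → _)
  rw [one_mul]
  by_cases hn : n < 0
  · rw [UP_neg hn hu, map_zero]
    exact ⟨Submodule.zero_mem _, fun h => absurd rfl h⟩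
  · refine ⟨hWa (by omega) (key K hK n u hu), fun hne => ⟨?_, ?_⟩⟩
    -- the zero filtration shows that `R (c K)` vanishes on `U₊` if `c K` does
    · by_contra hK'
      refine hne ((Submodule.mem_bot ℂ).1 (hR (fun _ => ⊥) (fun i _ _ y hy => by
        rw [(Submodule.mem_bot ℂ).1 hy, map_zero]; exact Submodule.zero_mem _) 0 (c K)
        (fun n u hu => (Submodule.mem_bot ℂ).2 ?_) n u hu))
      have h1 := (h K hK n u hu).2
      rw [one_mul] at h1
      by_contra h0
      exact hK' (h1 h0).1
    · by_contra hn'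
      have := hWa (show N ≤ n + (e - D) by omega) (key K hK n u hu)
      rw [hWN] at this
      exact hne ((Submodule.mem_bot ℂ).1 this)

theorem zeroAt_one_of_locFilt {R : (U →ₗ[ℂ] Y) → (U →ₗ[ℂ] Y)}
    (hR : ∀ W : ℤ → Submodule ℂ Y, (∀ i ∈ nonneg b, ∀ j, ∀ y ∈ W j,
      a (b.basis i) y ∈ W (j + b.deg i)) → ∀ (k : ℤ) (F : U →ₗ[ℂ] Y),
        (∀ n, ∀ u ∈ UP b n, F u ∈ W (n + k)) → ∀ n, ∀ u ∈ UP b n, R F u ∈ W (n + k))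
    {I : Finset ι} {c : Formal 𝔤 ι Y} (hc : c ∈ zeroAt b I 1) :
    (fun K => R (c K)) ∈ zeroAt b I 1 := by
  refine mem_zeroAt_of fun K hK n u hu => ?_
  rw [one_mul]
  refine (Submodule.mem_bot ℂ).1 (hR (fun _ => ⊥) (fun i _ _ y hy => by
    rw [(Submodule.mem_bot ℂ).1 hy, map_zero]; exact Submodule.zero_mem _) 0 (c K)
    (fun n u hu => (Submodule.mem_bot ℂ).2 ?_) n u hu)
  have := hc K hK u (UP_le_Uplus n hu)
  rwa [one_mul] at this

/-- A linear operator on `Hom(U, Y)`, applied to the coefficients of formal sums. -/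
def coeffFormal (R : Module.End ℂ (U →ₗ[ℂ] Y)) : Formal 𝔤 ι Y →ₗ[ℂ] Formal 𝔤 ι Y where
  toFun c K := R (c K)
  map_add' _ _ := funext fun _ => R.map_add _ _
  map_smul' _ _ := funext fun _ => R.map_smul _ _

/-- The restriction of formal sums to `w U`. -/
abbrev preL (w : U) : Formal 𝔤 ι Y →ₗ[ℂ] Formal 𝔤 ι Y := preFormal (LinearMap.mulLeft ℂ w)

theorem preL_mul (v w : U) (c : Formal 𝔤 ι Y) : preL (v * w) c = preL w (preL v c) :=
  funext fun K => LinearMap.ext fun u => congrArg (c K) (mul_assoc v w u)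

/-- A finiteness condition `S` on `U₊` which is preserved by `R` is preserved on all `v U₊`, if `R`
satisfies a commutation rule with the left multiplications by elements of `𝔤`. -/
theorem coeffFormal_local (b : HomogeneousBasis s ι) {S : Submodule ℂ (Formal 𝔤 ι Y)}
    {R : Module.End ℂ (U →ₗ[ℂ] Y)} (h1 : ∀ c ∈ S, coeffFormal R c ∈ S)
    (h : ∀ (x : 𝔤) (v : U), (∃ A : Finset U, ∀ c : Formal 𝔤 ι Y, (∀ w ∈ A, preL w c ∈ S) →
        preL v (coeffFormal R c) ∈ S) → ∃ A : Finset U, ∀ c : Formal 𝔤 ι Y,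
          (∀ w ∈ A, preL w c ∈ S) → preL (toU x * v) (coeffFormal R c) ∈ S) (v : U) :
    ∃ A : Finset U, ∀ c : Formal 𝔤 ι Y, (∀ w ∈ A, preL w c ∈ S) →
      preL v (coeffFormal R c) ∈ S := by
  classical
  refine U_induction b (p := fun v => ∃ A : Finset U, ∀ c : Formal 𝔤 ι Y,
    (∀ w ∈ A, preL w c ∈ S) → preL v (coeffFormal R c) ∈ S) ?_ ?_ ?_ ?_ h v
  · have e : ∀ c : Formal 𝔤 ι Y, preL 1 c = c := fun c =>
      funext fun K => LinearMap.ext fun u => congrArg (c K) (one_mul u)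
    refine ⟨{1}, fun c hc => ?_⟩
    have := hc 1 (Finset.mem_singleton_self _)
    rw [e] at this ⊢
    exact h1 c this
  · refine ⟨∅, fun c _ => ?_⟩
    have : preL 0 (coeffFormal R c) = 0 := funext fun K => LinearMap.ext fun u =>
      (congrArg (R (c K)) (zero_mul u)).trans (map_zero _)
    rw [this]; exact Submodule.zero_mem _
  · rintro v w ⟨A, hA⟩ ⟨A', hA'⟩
    refine ⟨A ∪ A', fun c hc => ?_⟩
    have : preL (v + w) (coeffFormal R c) = preL v (coeffFormal R c) + preL w (coeffFormal R c) :=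
      funext fun K => LinearMap.ext fun u =>
        (congrArg (R (c K)) (add_mul v w u)).trans (map_add _ _ _)
    rw [this]
    exact Submodule.add_mem _ (hA c fun w hw => hc w (Finset.mem_union_left _ hw))
      (hA' c fun w hw => hc w (Finset.mem_union_right _ hw))
  · rintro z v ⟨A, hA⟩
    refine ⟨A, fun c hc => ?_⟩
    have : preL (z • v) (coeffFormal R c) = z • preL v (coeffFormal R c) :=
      funext fun K => LinearMap.ext fun u =>
        (congrArg (R (c K)) (smul_mul_assoc z v u)).trans (map_smul _ _ _)
    rw [this]
    exact Submodule.smul_mem _ z (hA c hc)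

variable {S : Submodule ℂ (Formal 𝔤 ι Y)}

theorem twist_local (b : HomogeneousBasis s ι) (h1 : ∀ c ∈ S, coeffFormal (twist ha) c ∈ S)
    (hS : ∀ x, ∀ c ∈ S, postFormal (a x) c ∈ S) (v : U) :
    ∃ A : Finset U, ∀ c : Formal 𝔤 ι Y, (∀ w ∈ A, preL w c ∈ S) →
      preL v (coeffFormal (twist ha) c) ∈ S := by
  classical
  refine coeffFormal_local b h1 (fun x v => ?_) v
  rintro ⟨A, hA⟩
  refine ⟨A ∪ A.image fun w => toU x * w, fun c hc => ?_⟩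
  have e : preL (toU x * v) (coeffFormal (twist ha) c) =
      preL v (coeffFormal (twist ha) (preL (toU x) c - postFormal (a x) c)) :=
    funext fun K => LinearMap.ext fun u =>
      (congrArg (twist ha (c K)) (mul_assoc (toU x) v u)).trans (twist_toU_mul ha (c K) x (v * u))
  rw [e]
  refine hA _ fun w hw => ?_
  have e' : preL w (preL (toU x) c - postFormal (a x) c) =
      preL (toU x * w) c - postFormal (a x) (preL w c) := by
    rw [preL_mul, map_sub]; rfl
  rw [e']
  exact Submodule.sub_mem _
    (hc _ (Finset.mem_union_right _ (Finset.mem_image.2 ⟨w, hw, rfl⟩)))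
    (hS x _ (hc w (Finset.mem_union_left _ hw)))

theorem untwist_local (b : HomogeneousBasis s ι) (h1 : ∀ c ∈ S, coeffFormal (untwist ha) c ∈ S)
    (hS : ∀ x, ∀ c ∈ S, postFormal (a x) c ∈ S) (v : U) :
    ∃ A : Finset U, ∀ c : Formal 𝔤 ι Y, (∀ w ∈ A, preL w c ∈ S) →
      preL v (coeffFormal (untwist ha) c) ∈ S := by
  classical
  refine coeffFormal_local b h1 (fun x v => ?_) v
  rintro ⟨A, hA⟩
  refine ⟨A ∪ A.image fun w => toU x * w, fun c hc => ?_⟩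
  have e : preL (toU x * v) (coeffFormal (untwist ha) c) =
      postFormal (a x) (preL v (coeffFormal (untwist ha) c)) +
        preL v (coeffFormal (untwist ha) (preL (toU x) c)) :=
    funext fun K => LinearMap.ext fun u => (congrArg (untwist ha (c K))
      (mul_assoc (toU x) v u)).trans (untwist_toU_mul ha b (c K) x (v * u))
  rw [e]
  refine Submodule.add_mem _ (hS x _ (hA c fun w hw => hc w (Finset.mem_union_left _ hw)))
    (hA _ fun w hw => ?_)
  rw [← preL_mul]
  exact hc _ (Finset.mem_union_right _ (Finset.mem_image.2 ⟨w, hw, rfl⟩))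

theorem preL_mem_niceAt {I : Finset ι} {v : U} {c : Formal 𝔤 ι Y} :
    preL v c ∈ niceAt b I 1 ↔ c ∈ niceAt b I v := by
  simp only [niceAt, Submodule.mem_mk, preFormal, LinearMap.coe_mk, AddHom.coe_mk,
    LinearMap.comp_apply, LinearMap.mulLeft_apply, one_mul, AddSubmonoid.mem_mk,
    AddSubsemigroup.mem_mk, Set.mem_ofPred_eq]

theorem preL_mem_zeroAt {I : Finset ι} {v : U} {c : Formal 𝔤 ι Y} :
    preL v c ∈ zeroAt b I 1 ↔ c ∈ zeroAt b I v := by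
  simp only [zeroAt, Submodule.mem_mk, preFormal, LinearMap.coe_mk, AddHom.coe_mk,
    LinearMap.comp_apply, LinearMap.mulLeft_apply, one_mul, AddSubmonoid.mem_mk,
    AddSubsemigroup.mem_mk, Set.mem_ofPred_eq]

/-- Boundedness only has to be checked on `U₊`, for the restrictions to the `v U`. -/
theorem bdd_of_local {T : Formal 𝔤 ι Y →ₗ[ℂ] Formal 𝔤 ι Y}
    (h : ∀ I v, ∃ A : Finset U, ∀ c : Formal 𝔤 ι Y, (∀ w ∈ A, preL w c ∈ niceAt b I 1) →
      preL v (T c) ∈ niceAt b I 1)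
    (h' : ∀ I v, ∃ A : Finset U, ∀ c : Formal 𝔤 ι Y, (∀ w ∈ A, preL w c ∈ zeroAt b I 1) →
      preL v (T c) ∈ zeroAt b I 1) : Bdd b T := by
  classical
  intro I v
  obtain ⟨A, hA⟩ := h I v
  obtain ⟨A', hA'⟩ := h' I v
  refine ⟨(A ∪ A').image fun w => (I, w), fun c hc => preL_mem_niceAt.1 (hA c fun w hw =>
    preL_mem_niceAt.2 (hc (I, w) (Finset.mem_image.2 ⟨w, Finset.mem_union_left _ hw, rfl⟩))),
    fun c hc => preL_mem_zeroAt.1 (hA' c fun w hw =>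
    preL_mem_zeroAt.2 (hc (I, w) (Finset.mem_image.2 ⟨w, Finset.mem_union_right _ hw, rfl⟩)))⟩

theorem twist_bdd (b : HomogeneousBasis s ι) (hs : LocFilt s a) :
    Bdd b (coeffFormal (twist ha) : Formal 𝔤 ι Y →ₗ[ℂ] _) :=
  bdd_of_local
    (fun I v => twist_local ha b (fun c hc => niceAt_one_of_locFilt hs
      (fun W hW k F hF => twist_mem ha hW hF) hc) (fun x c hc => postFormal_niceAt _ hc) v)
    (fun I v => twist_local ha b (fun c hc => zeroAt_one_of_locFilt (a := a)
      (fun W hW k F hF => twist_mem ha hW hF) hc) (fun x c hc => postFormal_zeroAt _ hc) v)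

theorem untwist_bdd (b : HomogeneousBasis s ι) (hs : LocFilt s a) :
    Bdd b (coeffFormal (untwist ha) : Formal 𝔤 ι Y →ₗ[ℂ] _) :=
  bdd_of_local
    (fun I v => untwist_local ha b (fun c hc => niceAt_one_of_locFilt hs
      (fun W hW k F hF => untwist_mem ha hW hF) hc) (fun x c hc => postFormal_niceAt _ hc) v)
    (fun I v => untwist_local ha b (fun c hc => zeroAt_one_of_locFilt (a := a)
      (fun W hW k F hF => untwist_mem ha hW hF) hc) (fun x c hc => postFormal_zeroAt _ hc) v)

end TwistBounded

/-! ### Filtrations of the modules of the category -/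

section Filtration

variable {𝔤 : Type u} [LieRing 𝔤] [LieAlgebra ℂ 𝔤] {s : SemiInfiniteStructure 𝔤}
  {M : Type w} [AddCommGroup M] [Module ℂ M] [LieRingModule 𝔤 M] [LieModule ℂ 𝔤 M]
  {grM : ℤ → Submodule ℂ M}

local notation "U" => UniversalEnvelopingAlgebra ℂ 𝔤

variable (M) in
/-- The action of a word on a module, as a linear map. -/
def actWord (l : List (ℤ × 𝔤)) : Module.End ℂ M :=
  (l.map fun p => LieModule.toEnd ℂ 𝔤 M p.2).prod

theorem actWord_apply (l : List (ℤ × 𝔤)) (m : M) :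
    actWord M l m = l.foldr (fun p m' => ⁅p.2, m'⁆) m := by
  induction l with
  | nil => rfl
  | cons p l ih =>
    rw [List.foldr_cons, ← ih, actWord, List.map_cons, List.prod_cons]; rfl

variable (s M) in
/-- The vectors killed by all products of homogeneous elements of positive degrees whose total
degree is at least `t`. -/
def killed (t : ℤ) : Submodule ℂ M where
  carrier := {m | ∀ l : List (ℤ × 𝔤), (∀ p ∈ l, 0 < p.1 ∧ p.2 ∈ s.gr p.1) →
    t ≤ (l.map Prod.fst).sum → actWord M l m = 0}
  zero_mem' _ _ _ := map_zero _
  add_mem' h h' l hl ht := by rw [map_add, h l hl ht, h' l hl ht, add_zero]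
  smul_mem' z m h l hl ht := by rw [map_smul, h l hl ht, smul_zero]

theorem killed_mono {t t' : ℤ} (h : t ≤ t') : killed s M t ≤ killed s M t' :=
  fun _ hm l hl ht => hm l hl (h.trans ht)

theorem killed_of_nonpos {t : ℤ} (ht : t ≤ 0) : killed s M t = ⊥ :=
  eq_bot_iff.2 fun _ hm => hm [] (fun _ h => absurd h List.not_mem_nil) ht

theorem lie_mem_killed_of_pos {t d : ℤ} (hd : 0 < d) {x : 𝔤} (hx : x ∈ s.gr d) {m : M}
    (hm : m ∈ killed s M t) : ⁅x, m⁆ ∈ killed s M (t - d) := fun l hl ht => by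
  have := hm (l ++ [(d, x)]) (fun p hp => by
    rcases List.mem_append.1 hp with hp | hp
    · exact hl p hp
    · rw [List.mem_singleton.1 hp]; exact ⟨hd, hx⟩) (by
    rw [List.map_append, List.sum_append]
    simp only [List.map_cons, List.map_nil, List.sum_cons, List.sum_nil]
    omega)
  rw [actWord_apply, List.foldr_append] at this
  rw [actWord_apply]
  exact this

/-- The recursive characterization of `killed`. -/
theorem mem_killed_of_lie {t : ℤ} (ht : 0 < t) {m : M}
    (h : ∀ d, 0 < d → ∀ x ∈ s.gr d, ⁅x, m⁆ ∈ killed s M (t - d)) : m ∈ killed s M t := by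
  intro l hl hlt
  rcases List.eq_nil_or_concat' l with rfl | ⟨l, ⟨d, x⟩, rfl⟩
  · rw [List.map_nil, List.sum_nil] at hlt; omega
  · have hp := hl (d, x) (List.mem_append_right _ (List.mem_singleton_self _))
    have := h d hp.1 x hp.2 l (fun p hp => hl p (List.mem_append_left _ hp)) (by
      rw [List.map_append, List.sum_append] at hlt
      simp only [List.map_cons, List.map_nil, List.sum_cons, List.sum_nil] at hlt
      omega)
    rw [actWord_apply] at this
    rw [actWord_apply, List.foldr_append]
    exact this

/-- The subspaces `killed` are stable under `𝔤₀`, by induction on `t`. -/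
theorem lie_mem_killed {x : 𝔤} (hx : x ∈ s.gr 0) (n : ℕ) : ∀ t : ℤ, t ≤ n → ∀ m ∈ killed s M t,
    ⁅x, m⁆ ∈ killed s M t := by
  induction n with
  | zero =>
    intro t ht m hm
    rw [killed_of_nonpos (by simpa using ht), Submodule.mem_bot] at hm
    rw [hm, lie_zero]
    exact Submodule.zero_mem _
  | succ n ih =>
    intro t ht m hm
    by_cases h0 : t ≤ 0
    · rw [killed_of_nonpos h0, Submodule.mem_bot] at hm
      rw [hm, lie_zero]
      exact Submodule.zero_mem _
    · refine mem_killed_of_lie (not_le.1 h0) fun d hd y hy => ?_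
      rw [leibniz_lie]
      refine Submodule.add_mem _ ?_ (ih _ (by push_cast at ht; omega) _
        (lie_mem_killed_of_pos hd hy hm))
      have := s.lie_mem hy hx
      rw [add_zero] at this
      exact lie_mem_killed_of_pos hd this hm

theorem lie_mem_killed_of_nonneg {t d : ℤ} (hd : 0 ≤ d) {x : 𝔤} (hx : x ∈ s.gr d) {m : M}
    (hm : m ∈ killed s M t) : ⁅x, m⁆ ∈ killed s M (t - d) := by
  rcases hd.eq_or_lt with rfl | hd
  · rw [sub_zero]
    exact lie_mem_killed hx t.toNat t (Int.self_le_toNat t) m hm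
  · exact lie_mem_killed_of_pos hd hx hm

variable (s grM) in
/-- The span of the homogeneous vectors of degree `≥ i` from which degree `D` cannot be reached. -/
def filM (D i : ℤ) : Submodule ℂ M := ⨆ (k : ℤ) (_ : i ≤ k), killed s M (D - k) ⊓ grM k

theorem filM_le {D i : ℤ} {p : Submodule ℂ M}
    (h : ∀ k, i ≤ k → ∀ m ∈ killed s M (D - k), m ∈ grM k → m ∈ p) : filM s grM D i ≤ p :=
  iSup_le fun k => iSup_le fun hk => fun m hm => h k hk m hm.1 hm.2

theorem mem_filM {D i k : ℤ} (hk : i ≤ k) {m : M} (hm : m ∈ killed s M (D - k))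
    (hm' : m ∈ grM k) : m ∈ filM s grM D i :=
  Submodule.mem_iSup_of_mem k (Submodule.mem_iSup_of_mem hk ⟨hm, hm'⟩)

theorem filM_mono {D D' i i' : ℤ} (hD : D ≤ D') (hi : i' ≤ i) :
    filM s grM D i ≤ filM s grM D' i' :=
  filM_le fun _ hk _ hm hm' => mem_filM (hi.trans hk) (killed_mono (by omega) hm) hm'

theorem filM_self (D : ℤ) : filM s grM D D = ⊥ :=
  eq_bot_iff.2 (filM_le fun k hk m hm _ => by
    rwa [killed_of_nonpos (by omega)] at hm)

theorem finiteDimensional_filM (hM : IsCategoryO s grM) (D i : ℤ) :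
    FiniteDimensional ℂ (filM s grM D i) := by
  have := hM.finiteDimensional
  have h : filM s grM D i ≤ ⨆ k : Finset.Icc i D, grM k := filM_le fun k hk m hm hm' => by
    by_cases hkD : k ≤ D
    · exact Submodule.mem_iSup_of_mem ⟨k, Finset.mem_Icc.2 ⟨hk, hkD⟩⟩ hm'
    · rw [killed_of_nonpos (by omega), Submodule.mem_bot] at hm
      rw [hm]; exact Submodule.zero_mem _
  exact Submodule.finiteDimensional_of_le h

theorem lie_mem_filM (hM : IsCategoryO s grM) {d : ℤ} (hd : 0 ≤ d) {x : 𝔤} (hx : x ∈ s.gr d)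
    {D i : ℤ} {m : M} (hm : m ∈ filM s grM D i) : ⁅x, m⁆ ∈ filM s grM D (i + d) := by
  have h : filM s grM D i ≤ (filM s grM D (i + d)).comap (LieModule.toEnd ℂ 𝔤 M x) :=
    filM_le fun k hk m hm hm' => mem_filM (k := d + k) (by omega) (by
      have := lie_mem_killed_of_nonneg hd hx hm
      rwa [show D - k - d = D - (d + k) by ring] at this) (hM.lie_mem hx hm')
  exact h hm

/-- The filtrations exhaust `M`, since `⨁_{j>0} 𝔤ⱼ` acts locally nilpotently. -/
theorem exists_mem_filM (hM : IsCategoryO s grM) (m : M) : ∃ D i, m ∈ filM s grM D i := by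
  have hm : m ∈ ⨆ k, grM k := hM.isInternal.submodule_iSup_eq_top ▸ Submodule.mem_top
  induction hm using Submodule.iSup_induction' with
  | mem k m hm =>
    obtain ⟨N, hN⟩ := hM.locally_nilpotent m
    refine ⟨N + k, k, mem_filM le_rfl (fun l hl ht => ?_) hm⟩
    rw [actWord_apply]
    exact hN l hl (by omega)
  | zero => exact ⟨0, 0, Submodule.zero_mem _⟩
  | add m m' _ _ h h' =>
    obtain ⟨D, i, h⟩ := h
    obtain ⟨D', i', h'⟩ := h'
    exact ⟨max D D', min i i', Submodule.add_mem _
      (filM_mono (le_max_left _ _) (min_le_left _ _) h)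
      (filM_mono (le_max_right _ _) (min_le_right _ _) h')⟩

variable (s grM) in
/-- The subspace `X ⊗ W` of `U ⊗ M`, where `W` runs through the filtration of `M`. -/
def filT (X : Submodule ℂ U) (D i : ℤ) : Submodule ℂ (U ⊗[ℂ] M) :=
  Submodule.map₂ (TensorProduct.mk ℂ U M) X (filM s grM D i)

theorem filT_mono {X X' : Submodule ℂ U} (hX : X ≤ X') {D D' i i' : ℤ} (hD : D ≤ D')
    (hi : i' ≤ i) : filT s grM X D i ≤ filT s grM X' D' i' :=
  Submodule.map₂_le_map₂ hX (filM_mono hD hi)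

theorem exists_le_filT (hM : IsCategoryO s grM) (W : Submodule ℂ (U ⊗[ℂ] M)) (hW : W.FG) :
    ∃ (X : Submodule ℂ U) (D i : ℤ), X.FG ∧ W ≤ filT s grM X D i := by
  have hsup : ∀ W W' : Submodule ℂ (U ⊗[ℂ] M),
      (∃ (X : Submodule ℂ U) (D i : ℤ), X.FG ∧ W ≤ filT s grM X D i) →
      (∃ (X : Submodule ℂ U) (D i : ℤ), X.FG ∧ W' ≤ filT s grM X D i) →
      ∃ (X : Submodule ℂ U) (D i : ℤ), X.FG ∧ W ⊔ W' ≤ filT s grM X D i := by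
    rintro W W' ⟨X, D, i, hX, h⟩ ⟨X', D', i', hX', h'⟩
    exact ⟨X ⊔ X', max D D', min i i', hX.sup hX', sup_le
      (h.trans (filT_mono le_sup_left (le_max_left _ _) (min_le_left _ _)))
      (h'.trans (filT_mono le_sup_right (le_max_right _ _) (min_le_right _ _)))⟩
  refine Submodule.fg_induction
    (motive := fun W _ => ∃ (X : Submodule ℂ U) (D i : ℤ), X.FG ∧ W ≤ filT s grM X D i)
    (fun t => ?_) (fun W W' _ _ => hsup W W') W hW
  induction t with
  | zero => exact ⟨⊥, 0, 0, Submodule.fg_bot, by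
      rw [Submodule.span_zero_singleton]; exact bot_le⟩
  | tmul u m =>
    obtain ⟨D, i, hm⟩ := exists_mem_filM hM m
    refine ⟨Submodule.span ℂ {u}, D, i, Submodule.fg_span_singleton u, ?_⟩
    rw [Submodule.span_singleton_le_iff_mem]
    exact Submodule.apply_mem_map₂ _ (Submodule.mem_span_singleton_self u) hm
  | add t t' h h' =>
    obtain ⟨X, D, i, hX, h⟩ := hsup _ _ h h'
    refine ⟨X, D, i, hX, le_trans ?_ h⟩
    rw [Submodule.span_singleton_le_iff_mem]
    exact Submodule.add_mem_sup (Submodule.mem_span_singleton_self t)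
      (Submodule.mem_span_singleton_self t')

variable (𝔤 M) in
/-- The action on the factor `M` of `U ⊗ M`, as a linear function of the element of `𝔤`. -/
def mTL : 𝔤 →ₗ[ℂ] Module.End ℂ (U ⊗[ℂ] M) :=
  LinearMap.lTensorHom U ∘ₗ (LieModule.toEnd ℂ 𝔤 M : 𝔤 →ₗ[ℂ] Module.End ℂ M)

theorem mTL_apply (x : 𝔤) : mTL 𝔤 M x = mT M x := rfl

theorem mTL_lie (x y : 𝔤) :
    mTL 𝔤 M ⁅x, y⁆ = mTL 𝔤 M x * mTL 𝔤 M y - mTL 𝔤 M y * mTL 𝔤 M x :=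
  TensorProduct.ext' fun u m => by
    rw [LinearMap.sub_apply, Module.End.mul_apply, Module.End.mul_apply, mTL_apply, mTL_apply,
      mTL_apply, mT_tmul, mT_tmul, mT_tmul, mT_tmul, mT_tmul, ← TensorProduct.tmul_sub, lie_lie]

/-- The filtration of `U ⊗ M` for which the twist by the action on `M` preserves tameness. It is
here that the local nilpotency of the action and the finite-dimensionality of the graded components
are used. -/
theorem locFilt_mTL (hM : IsCategoryO s grM) : LocFilt s (mTL 𝔤 M) := by
  intro W hW
  obtain ⟨X, D, i, hX, h⟩ := exists_le_filT hM W ((Submodule.fg_iff_finiteDimensional W).2 hW)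
  -- `filM D k` is contained in the sum of the components of degrees in `[k, D]`; it vanishes for
  -- `k = D`
  refine ⟨filT s grM X D, i, D, fun i j hij => filT_mono le_rfl le_rfl hij, fun j => ?_, h, ?_,
    fun d hd x hx j t ht => ?_⟩
  · refine (Submodule.fg_iff_finiteDimensional _).1 (hX.map₂ _
      ((Submodule.fg_iff_finiteDimensional _).2 (finiteDimensional_filM hM D j)))
  · rw [filT, filM_self, Submodule.map₂_bot_right]
  · have h1 : filT s grM X D j ≤ (filT s grM X D (j + d)).comap (mT M x) :=
      Submodule.map₂_le.2 fun u hu m hm => by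
        rw [Submodule.mem_comap, TensorProduct.mk_apply, mT_tmul]
        exact Submodule.apply_mem_map₂ (TensorProduct.mk ℂ U M) hu (lie_mem_filM hM hd hx hm)
    exact h1 ht

end Filtration

/-! ### The equivalence on the level of cochains -/

section Equivalence

variable {𝔤 : Type u} [LieRing 𝔤] [LieAlgebra ℂ 𝔤] {s : SemiInfiniteStructure 𝔤}
  {ι : Type v} [LinearOrder ι] {b : HomogeneousBasis s ι}
  {M : Type w} [AddCommGroup M] [Module ℂ M] [LieRingModule 𝔤 M] [LieModule ℂ 𝔤 M]
  {grM : ℤ → Submodule ℂ M}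

local notation "U" => UniversalEnvelopingAlgebra ℂ 𝔤

theorem lT_mT (x y : 𝔤) (t : U ⊗[ℂ] M) : lT M x (mT M y t) = mT M y (lT M x t) := by
  induction t with
  | zero => simp only [LinearMap.map_zero]
  | tmul u m => rfl
  | add t t' h h' => simp only [LinearMap.map_add, h, h']

theorem rT_mT (x y : 𝔤) (t : U ⊗[ℂ] M) : rT M x (mT M y t) = mT M y (rT M x t) := by
  induction t with
  | zero => simp only [LinearMap.map_zero]
  | tmul u m => rfl
  | add t t' h h' => simp only [LinearMap.map_add, h, h']

theorem lT_rT (x y : 𝔤) (t : U ⊗[ℂ] M) : lT M x (rT M y t) = rT M y (lT M x t) := by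
  rw [lT_apply, lT_apply, rT_smul]

variable (𝔤 M) in
/-- The anti-representation `x ↦ (u ⊗ m ↦ u x ⊗ m - u ⊗ x m)`. -/
def tauT : 𝔤 →ₗ[ℂ] Module.End ℂ (U ⊗[ℂ] M) where
  toFun x := rT M x - mT M x
  map_add' x y := by rw [rT_add, mT_add]; abel
  map_smul' z x := TensorProduct.ext' fun u m => by
    simp only [LinearMap.sub_apply, LinearMap.smul_apply, rT_tmul, mT_tmul, toU, map_smul,
      mul_smul_comm, smul_lie, TensorProduct.tmul_smul, TensorProduct.smul_tmul', smul_sub,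
      RingHom.id_apply]

variable (𝔤 M) in
/-- The representation `x ↦ (u ⊗ m ↦ x u ⊗ m + u ⊗ x m)`. -/
def deltaT : 𝔤 →ₗ[ℂ] Module.End ℂ (U ⊗[ℂ] M) where
  toFun x := lT M x + mT M x
  map_add' x y := TensorProduct.ext' fun u m => by
    simp only [LinearMap.add_apply, lT_tmul, mT_tmul, toU_add, add_mul, add_lie,
      TensorProduct.tmul_add, TensorProduct.add_tmul]
    abel
  map_smul' z x := TensorProduct.ext' fun u m => by
    simp only [LinearMap.add_apply, LinearMap.smul_apply, lT_tmul, mT_tmul, toU, map_smul,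
      smul_mul_assoc, smul_lie, TensorProduct.tmul_smul, TensorProduct.smul_tmul', smul_add,
      RingHom.id_apply]

theorem tauT_apply (x : 𝔤) (t : U ⊗[ℂ] M) : tauT 𝔤 M x t = rT M x t - mT M x t := rfl

theorem deltaT_apply (x : 𝔤) (t : U ⊗[ℂ] M) : deltaT 𝔤 M x t = lT M x t + mT M x t := rfl

theorem tauT_lie (x y : 𝔤) :
    tauT 𝔤 M ⁅x, y⁆ = tauT 𝔤 M y * tauT 𝔤 M x - tauT 𝔤 M x * tauT 𝔤 M y :=
  TensorProduct.ext' fun u m => by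
    simp only [LinearMap.sub_apply, Module.End.mul_apply, tauT_apply, LinearMap.map_sub, rT_tmul,
      mT_tmul, toU_lie, mul_sub, TensorProduct.sub_tmul, lie_lie, TensorProduct.tmul_sub, mul_assoc]
    abel

theorem deltaT_lie (x y : 𝔤) :
    deltaT 𝔤 M ⁅x, y⁆ = deltaT 𝔤 M x * deltaT 𝔤 M y - deltaT 𝔤 M y * deltaT 𝔤 M x :=
  TensorProduct.ext' fun u m => by
    simp only [LinearMap.sub_apply, Module.End.mul_apply, deltaT_apply, LinearMap.map_add, lT_tmul,
      mT_tmul, toU_lie, sub_mul, TensorProduct.sub_tmul, lie_lie, TensorProduct.tmul_sub, mul_assoc]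
    abel

variable (𝔤 M) in
/-- The linear automorphism `u ⊗ m ↦ ∑ u₁ ⊗ S(u₂) m` of `U ⊗ M`, where `S` is the antipode and
`∑ u₁ ⊗ u₂` the coproduct. -/
def shear : Module.End ℂ (U ⊗[ℂ] M) :=
  TensorProduct.lift ((TensorProduct.mk ℂ U M 1).lcomp ℂ (U ⊗[ℂ] M) ∘ₗ
    antiRep (tauT 𝔤 M) tauT_lie)

variable (𝔤 M) in
/-- The linear automorphism `u ⊗ m ↦ ∑ u₁ ⊗ u₂ m` of `U ⊗ M`, where `∑ u₁ ⊗ u₂` is the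
coproduct. -/
def unshear : Module.End ℂ (U ⊗[ℂ] M) :=
  TensorProduct.lift ((TensorProduct.mk ℂ U M 1).lcomp ℂ (U ⊗[ℂ] M) ∘ₗ
    (repLift (deltaT 𝔤 M) deltaT_lie).toLinearMap)

theorem shear_tmul (u : U) (m : M) :
    shear 𝔤 M (u ⊗ₜ m) = antiRep (tauT 𝔤 M) tauT_lie u (1 ⊗ₜ m) := rfl

theorem unshear_tmul (u : U) (m : M) :
    unshear 𝔤 M (u ⊗ₜ m) = repLift (deltaT 𝔤 M) deltaT_lie u (1 ⊗ₜ m) := rfl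

theorem shear_one (m : M) : shear 𝔤 M (1 ⊗ₜ m) = 1 ⊗ₜ m := by rw [shear_tmul, antiRep_one]; rfl

theorem unshear_one (m : M) : unshear 𝔤 M (1 ⊗ₜ m) = 1 ⊗ₜ m := by
  rw [unshear_tmul, map_one (repLift _ _)]; rfl

/-- The shear turns the right multiplication of `𝔤` on `U ⊗ M` into the diagonal right action. -/
theorem shear_rT (x : 𝔤) (t : U ⊗[ℂ] M) :
    shear 𝔤 M (rT M x t) = rT M x (shear 𝔤 M t) - mT M x (shear 𝔤 M t) := by
  induction t with
  | zero => simp only [LinearMap.map_zero, sub_zero]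
  | tmul u m => rw [rT_tmul, shear_tmul, antiRep_mul_toU, ← shear_tmul, tauT_apply]
  | add t t' h h' => simp only [LinearMap.map_add, h, h']; abel

/-- The shear turns the diagonal left action of `𝔤` on `U ⊗ M` into the left multiplication. -/
theorem shear_lT (b : HomogeneousBasis s ι) (x : 𝔤) (t : U ⊗[ℂ] M) :
    shear 𝔤 M (lT M x t) = lT M x (shear 𝔤 M t) - shear 𝔤 M (mT M x t) := by
  induction t with
  | zero => simp only [LinearMap.map_zero, sub_zero]
  | tmul u m =>
    have h : tauT 𝔤 M x (1 ⊗ₜ m) = lT M x (1 ⊗ₜ m) - 1 ⊗ₜ ⁅x, m⁆ := by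
      rw [tauT_apply, rT_tmul, lT_tmul, mT_tmul, one_mul, mul_one]
    rw [lT_tmul, mT_tmul, shear_tmul, antiRep_toU_mul, h, map_sub,
      ← antiRep_comm b (f := tauT 𝔤 M) (hf := tauT_lie) (fun y t => by
        rw [tauT_apply, tauT_apply, LinearMap.map_sub, lT_rT, lT_mT]) u]
    rfl
  | add t t' h h' => simp only [LinearMap.map_add, h, h']; abel

theorem unshear_lT (x : 𝔤) (t : U ⊗[ℂ] M) :
    unshear 𝔤 M (lT M x t) = lT M x (unshear 𝔤 M t) + mT M x (unshear 𝔤 M t) := by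
  induction t with
  | zero => simp only [LinearMap.map_zero, add_zero]
  | tmul u m =>
    rw [lT_tmul, unshear_tmul, map_mul, repLift_toU, Module.End.mul_apply, deltaT_apply,
      unshear_tmul]
  | add t t' h h' => simp only [LinearMap.map_add, h, h']; abel

theorem shear_unshear (b : HomogeneousBasis s ι) (t : U ⊗[ℂ] M) :
    shear 𝔤 M (unshear 𝔤 M t) = t := by
  induction t with
  | zero => simp only [LinearMap.map_zero]
  | tmul u m =>
    refine U_induction b (p := fun u => shear 𝔤 M (unshear 𝔤 M (u ⊗ₜ m)) = u ⊗ₜ m)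
      ?_ ?_ ?_ ?_ ?_ u
    · rw [unshear_one, shear_one]
    · rw [TensorProduct.zero_tmul, LinearMap.map_zero, LinearMap.map_zero]
    · intro v w hv hw
      rw [TensorProduct.add_tmul, LinearMap.map_add, LinearMap.map_add, hv, hw]
    · intro z v hv
      rw [← TensorProduct.smul_tmul', LinearMap.map_smul, LinearMap.map_smul, hv]
    · intro x v hv
      rw [← lT_tmul, unshear_lT, LinearMap.map_add, shear_lT b, hv, sub_add_cancel]
  | add t t' h h' => simp only [LinearMap.map_add, h, h']

theorem unshear_shear (b : HomogeneousBasis s ι) (t : U ⊗[ℂ] M) :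
    unshear 𝔤 M (shear 𝔤 M t) = t := by
  induction t with
  | zero => simp only [LinearMap.map_zero]
  | tmul u m =>
    revert m
    refine U_induction b (p := fun u => ∀ m : M, unshear 𝔤 M (shear 𝔤 M (u ⊗ₜ m)) = u ⊗ₜ m)
      ?_ ?_ ?_ ?_ ?_ u
    · intro m
      rw [shear_one, unshear_one]
    · intro m
      rw [TensorProduct.zero_tmul, LinearMap.map_zero, LinearMap.map_zero]
    · intro v w hv hw m
      rw [TensorProduct.add_tmul, LinearMap.map_add, LinearMap.map_add, hv, hw]
    · intro z v hv m
      rw [← TensorProduct.smul_tmul', LinearMap.map_smul, LinearMap.map_smul, hv]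
    · intro x v hv m
      rw [← lT_tmul, shear_lT b, LinearMap.map_sub, unshear_lT, hv, mT_tmul, hv,
        add_sub_cancel_right]
  | add t t' h h' => simp only [LinearMap.map_add, h, h']

theorem lT_mem_grT {i : ℤ} {x : 𝔤} (hx : x ∈ s.gr i) {n : ℤ} {t : U ⊗[ℂ] M}
    (ht : t ∈ grT s grM n) : lT M x t ∈ grT s grM (i + n) := by
  rw [lT_apply]; exact toU_smul_mem_grT hx ht

theorem mem_grT_of_wrd (b : HomogeneousBasis s ι) {T : Module.End ℂ (U ⊗[ℂ] M)}
    (h : ∀ (l : List ι) (j : ℤ), ∀ m ∈ grM j, T (wrd b l ⊗ₜ m) ∈ grT s grM ((l.map b.deg).sum + j))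
    (n : ℤ) (t : U ⊗[ℂ] M) (ht : t ∈ grT s grM n) : T t ∈ grT s grM n := by
  refine grT_le (p := (grT s grM n).comap T) (fun i j e u hu m hm => ?_) ht
  rw [← wrdSpan_univ (b := b)] at hu
  exact mem_of_wrd (S := grT s grM n) (R := T ∘ₗ (TensorProduct.mk ℂ U M).flip m) (fun l _ hl => by
    rw [← e, ← hl]
    exact h l j m hm) hu

theorem one_tmul_mem_grT (b : HomogeneousBasis s ι) {j : ℤ} {m : M} (hm : m ∈ grM j) :
    (1 : U) ⊗ₜ[ℂ] m ∈ grT s grM (0 + j) := by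
  refine tmul_mem_grT rfl ?_ hm
  rw [← wrdSpan_univ (b := b)]
  exact one_mem_wrdSpan _

theorem shear_mem_grT (b : HomogeneousBasis s ι) (hM : IsCategoryO s grM) (n : ℤ)
    (t : U ⊗[ℂ] M) (ht : t ∈ grT s grM n) : shear 𝔤 M t ∈ grT s grM n := by
  refine mem_grT_of_wrd b (fun l => ?_) n t ht
  induction l with
  | nil =>
    intro j m hm
    rw [wrd_nil, shear_one]
    exact one_tmul_mem_grT b hm
  | cons i l ih =>
    intro j m hm
    rw [wrd_cons, ← lT_tmul, shear_lT b, mT_tmul, List.map_cons, List.sum_cons]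
    refine Submodule.sub_mem _ ?_ ?_
    · have := lT_mem_grT (b.mem i) (ih j m hm)
      rwa [← add_assoc] at this
    · have := ih _ _ (hM.lie_mem (b.mem i) hm)
      rwa [← add_assoc, add_comm _ (b.deg i)] at this

theorem unshear_mem_grT (b : HomogeneousBasis s ι) (hM : IsCategoryO s grM) (n : ℤ)
    (t : U ⊗[ℂ] M) (ht : t ∈ grT s grM n) : unshear 𝔤 M t ∈ grT s grM n := by
  refine mem_grT_of_wrd b (fun l => ?_) n t ht
  induction l with
  | nil =>
    intro j m hm
    rw [wrd_nil, unshear_one]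
    exact one_tmul_mem_grT b hm
  | cons i l ih =>
    intro j m hm
    rw [wrd_cons, ← lT_tmul, unshear_lT, List.map_cons, List.sum_cons]
    refine Submodule.add_mem _ ?_ ?_
    · have := lT_mem_grT (b.mem i) (ih j m hm)
      rwa [← add_assoc] at this
    · have := mT_mem_grT hM (b.mem i) _ _ (ih j m hm)
      rwa [add_comm _ (b.deg i), ← add_assoc] at this

variable (b) in
/-- The automorphism of the tame formal sums which exchanges the two bimodule structures. -/
def exchange (hs : LocFilt s (mTL 𝔤 M)) : Tame b (U ⊗[ℂ] M) ≃ₗ[ℂ] Tame b (U ⊗[ℂ] M) :=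
  LinearEquiv.ofLinearMap (post b (shear 𝔤 M) ∘ₗ (twist_bdd mTL_lie b hs).lift)
    ((untwist_bdd mTL_lie b hs).lift ∘ₗ post b (unshear 𝔤 M))
    (LinearMap.ext fun c => Tame.ext' fun K v => by
      change shear 𝔤 M (twist mTL_lie (untwist mTL_lie (unshear 𝔤 M ∘ₗ c.1 K)) v) = c.1 K v
      rw [twist_untwist mTL_lie b]
      exact shear_unshear b _)
    (LinearMap.ext fun c => Tame.ext' fun K v => by
      change untwist mTL_lie (unshear 𝔤 M ∘ₗ (shear 𝔤 M ∘ₗ twist mTL_lie (c.1 K))) v = c.1 K v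
      have h : unshear 𝔤 M ∘ₗ (shear 𝔤 M ∘ₗ twist mTL_lie (c.1 K)) = twist mTL_lie (c.1 K) :=
        LinearMap.ext fun v => unshear_shear b _
      rw [h, untwist_twist mTL_lie b])

theorem exchange_apply (hs : LocFilt s (mTL 𝔤 M)) (c : Tame b (U ⊗[ℂ] M)) (K : Finset ι) (v : U) :
    (exchange b hs c).1 K v = shear 𝔤 M (twist mTL_lie (c.1 K) v) := rfl

/-- The automorphism commutes with the diagonal action: the twist produces an additional action of
`x` on the factor `M`, and the shear absorbs it into the left multiplication on `U`. -/
theorem isCoeffMap_exchange (hs : LocFilt s (mTL 𝔤 M)) :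
    IsCoeffMap (exchange b hs).toLinearMap where
  cont := (cont_post _).comp (twist_bdd mTL_lie b hs).cont
  cr i c := Tame.ext' fun K v => by
    have e : (cr b (U ⊗[ℂ] M) i c).1 K =
        if i ∈ K then sgn i K • c.1 (K.erase i) else 0 :=
      LinearMap.ext fun v => by rw [cr_apply]; split_ifs <;> rfl
    change (exchange b hs (cr b _ i c)).1 K v = (cr b _ i (exchange b hs c)).1 K v
    rw [exchange_apply, cr_apply, exchange_apply, e]
    split_ifs
    · rw [map_smul, LinearMap.smul_apply, map_smul]
    · rw [map_zero, LinearMap.zero_apply, map_zero]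
  an i c := Tame.ext' fun K v => by
    have e : (an b (U ⊗[ℂ] M) i c).1 K = if i ∈ K then 0 else sgn i K • c.1 (insert i K) :=
      LinearMap.ext fun v => by rw [an_apply]; split_ifs <;> rfl
    change (exchange b hs (an b _ i c)).1 K v = (an b _ i (exchange b hs c)).1 K v
    rw [exchange_apply, an_apply, exchange_apply, e]
    split_ifs
    · rw [map_zero, LinearMap.zero_apply, map_zero]
    · rw [map_smul, LinearMap.smul_apply, map_smul]
  rho x c := Tame.ext' fun K v => by
    have e : (rho b (U ⊗[ℂ] M) x c).1 K =
        c.1 K ∘ₗ LinearMap.mulRight ℂ (toU x) + lT M x ∘ₗ c.1 K :=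
      LinearMap.ext fun v => by
        rw [rho_apply, LinearMap.add_apply, LinearMap.comp_apply, LinearMap.comp_apply, lT_apply]
        rfl
    change (exchange b hs (rho b _ x c)).1 K v = (rho b _ x (exchange b hs c)).1 K v
    rw [exchange_apply, rho_apply, exchange_apply, exchange_apply, e, map_add,
      LinearMap.add_apply, twist_comp mTL_lie b fun y t => lT_mT x y t,
      twist_mul_toU mTL_lie b, map_add, map_sub, shear_lT b, lT_apply, mTL_apply]
    abel

/-- An operator on `Hom(U, U ⊗ M)` which preserves the homogeneous maps of each degree preserves the
homogeneous cochains. -/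
theorem coeff_mem_HomY {m n q : ℤ} {c c' : Tame b (U ⊗[ℂ] M)}
    (hc : c ∈ HomY b (grT s grM) m n q) {R : Module.End ℂ (U →ₗ[ℂ] U ⊗[ℂ] M)}
    (hc' : ∀ K, c'.1 K = R (c.1 K))
    (hR : ∀ (k : ℤ) (F : U →ₗ[ℂ] U ⊗[ℂ] M), (∀ n, ∀ u ∈ wrdSpan b Set.univ n,
      F u ∈ grT s grM (n + k)) → ∀ n, ∀ u ∈ wrdSpan b Set.univ n, R F u ∈ grT s grM (n + k)) :
    c' ∈ HomY b (grT s grM) m n q := fun K =>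
  ⟨fun hK => by rw [hc', (hc K).1 hK, map_zero], fun k v hv => by
    have := hR (n + wt b K) (c.1 K) (fun k u hu => by
      rw [wrdSpan_univ] at hu
      have := (hc K).2 k u hu
      rwa [show k + (n + wt b K) = n + k + wt b K by ring]) k v (by rwa [wrdSpan_univ])
    rw [hc']
    rwa [show n + k + wt b K = k + (n + wt b K) by ring]⟩

theorem isMor_exchange (hM : IsCategoryO s grM) (hs : LocFilt s (mTL 𝔤 M)) :
    IsMor (grT s grM) (grT s grM) (exchange b hs).toLinearMap :=
  (isCoeffMap_exchange hs).isMor fun m n q => ⟨n, fun c hc => by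
    have h := coeff_mem_HomY hc (c' := (twist_bdd mTL_lie b hs).lift c) (fun _ => rfl)
      fun k F hF => twist_mem mTL_lie (fun i _ j y hy => mT_mem_grT hM (b.mem i) j y hy) hF
    have := post_mem_HomY (g := shear 𝔤 M) (i := 0) (grY' := grT s grM)
      (fun n t ht => by rw [add_zero]; exact shear_mem_grT b hM n t ht) h
    rw [add_zero] at this
    exact this⟩

theorem isMor_exchange_symm (hM : IsCategoryO s grM) (hs : LocFilt s (mTL 𝔤 M)) :
    IsMor (grT s grM) (grT s grM) (exchange b hs).symm.toLinearMap := by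
  have h := isCoeffMap_exchange (b := b) hs
  have h' : IsCoeffMap (exchange b hs).symm.toLinearMap :=
    { cont := (untwist_bdd mTL_lie b hs).cont.comp (cont_post _)
      cr := fun i c => (exchange b hs).symm_apply_eq.2 (by
        refine Eq.trans ?_ (h.cr i _).symm
        exact congrArg _ ((exchange b hs).apply_symm_apply c).symm)
      an := fun i c => (exchange b hs).symm_apply_eq.2 (by
        refine Eq.trans ?_ (h.an i _).symm
        exact congrArg _ ((exchange b hs).apply_symm_apply c).symm)
      rho := fun x c => (exchange b hs).symm_apply_eq.2 (by
        refine Eq.trans ?_ (h.rho x _).symm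
        exact congrArg _ ((exchange b hs).apply_symm_apply c).symm) }
  refine h'.isMor fun m n q => ⟨n, fun c hc => ?_⟩
  have h1 := post_mem_HomY (g := unshear 𝔤 M) (i := 0) (grY' := grT s grM)
    (fun n t ht => by rw [add_zero]; exact unshear_mem_grT b hM n t ht) hc
  rw [add_zero] at h1
  exact coeff_mem_HomY h1 (fun _ => rfl)
    fun k F hF => untwist_mem mTL_lie (fun i _ j y hy => mT_mem_grT hM (b.mem i) j y hy) hF

/-- The automorphism intertwines `π₁'` with `π₁`. -/
theorem exchange_rgt (hs : LocFilt s (mTL 𝔤 M)) (x : 𝔤) (c : Tame b (U ⊗[ℂ] M)) :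
    exchange b hs (-rgt b M x c) = -rgt b M x (exchange b hs c) + actM b M x (exchange b hs c) := by
  rw [map_neg]
  refine Tame.ext' fun K v => ?_
  change -(exchange b hs (rgt b M x c)).1 K v =
    -rT M x ((exchange b hs c).1 K v) + mT M x ((exchange b hs c).1 K v)
  have e : (rgt b M x c).1 K = rT M x ∘ₗ c.1 K := rfl
  rw [exchange_apply, exchange_apply, e, twist_comp mTL_lie b fun y t => rT_mT x y t, shear_rT]
  abel

/-- The automorphism intertwines `π₂'` with `π₂`. -/
theorem exchange_lam (hs : LocFilt s (mTL 𝔤 M)) (x : 𝔤) (c : Tame b (U ⊗[ℂ] M)) :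
    exchange b hs (lam b M x c + actM b M x c) = lam b M x (exchange b hs c) := by
  refine Tame.ext' fun K v => ?_
  rw [exchange_apply, lam_apply, exchange_apply,
    twist_eq_neg mTL_lie (F := c.1 K) (x := x) (fun w => ?_), map_neg]
  change -c.1 K (toU x * w) + mT M x (c.1 K w) = -(c.1 K (toU x * w) - mT M x (c.1 K w))
  abel

end Equivalence

end SemiInfinite

theorem mainTheorem11
    {𝔤 : Type*} [LieRing 𝔤] [LieAlgebra ℂ 𝔤]
    (s : SemiInfinite.SemiInfiniteStructure 𝔤)
    (hγ : ∀ n : ℤ, n ≠ 0 → ∀ x ∈ s.gr n, s.γ x = 0)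
    {ι : Type*} [LinearOrder ι] (b : SemiInfinite.HomogeneousBasis s ι)
    {M : Type*} [AddCommGroup M] [Module ℂ M] [LieRingModule 𝔤 M] [LieModule ℂ 𝔤 M]
    (grM : ℤ → Submodule ℂ M) (hM : SemiInfinite.IsCategoryO s grM) :
    ∃ Φ : TensorProduct ℂ (SemiInfinite.SemiRegular b) M ≃ₗ[ℂ]
        TensorProduct ℂ (SemiInfinite.SemiRegular b) M,
      ∀ x : 𝔤,
        Φ.toLinearMap ∘ₗ SemiInfinite.pi₁' b M x = SemiInfinite.pi₁ b M x ∘ₗ Φ.toLinearMap ∧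
        Φ.toLinearMap ∘ₗ SemiInfinite.pi₂' b M x = SemiInfinite.pi₂ b M x ∘ₗ Φ.toLinearMap :=
  SemiInfinite.exists_equiv_of_cochains hM hγ
    (SemiInfinite.isMor_exchange hM (SemiInfinite.locFilt_mTL hM))
    (SemiInfinite.isMor_exchange_symm hM (SemiInfinite.locFilt_mTL hM))
    (SemiInfinite.exchange_rgt (SemiInfinite.locFilt_mTL hM))
    (SemiInfinite.exchange_lam (SemiInfinite.locFilt_mTL hM))
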